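/- Let $\mathbb D\subset\mathbb C$ be the open unit disk and let $\Omega\subset\mathbb C$ be the domain enclosed by a Weil-Petersson curve $\Gamma=\partial\Omega$: $\Omega=F(\mathbb D)$ for some quasiconformal homeomorphism $F:\mathbb C\to\mathbb C$, and some biholomorphic map $h:\mathbb D\to\Omega$ satisfies $\int_{\mathbb D}|h''/h'|^2<\infty$. Let $\nu$ be the outward unit normal of $\Omega$ on $\Gamma$ (defined almost everywhere) and $\tau=i\nu$ the unit tangent field such that $(\nu,\tau)$ is a direct frame. A uniformization of $\Omega$ is a biholomorphic map $\mathbb D\to\Omega$; it extends continuously to $\overline{\mathbb D}$. For $g:\Gamma\to\mathbb S^1$, we write $g\in H^{1/2}(\Gamma,\mathbb S^1)$, and $\deg(g,\Gamma)=n$, if for a uniformization $h$ the map $g\circ h$ lies in $H^{1/2}(\mathbb S^1,\mathbb S^1)$, respectively is of the form $z^ne^{i\varphi}$ with a real-valued $\varphi\in H^{1/2}(\mathbb S^1)$. Let $a\in\Omega$, $g\in H^{1/2}(\Gamma,\mathbb S^1)$ and $\deg(g,\Gamma)=1$. The canonical harmonic map of degree $1$ associated to $(g,a)$ is the unique (up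 to null sets) map $w:\Omega\setminus\{a\}\to\mathbb S^1$ such that 1. $w\in H^1_{loc}(\overline\Omega\setminus\{a\})$; 2. $\deg(w,a)=1$ (degree on small circles around $a$); 3. $w=g$ on $\Gamma$ in the sense of traces, that is, the trace of $w\circ h$ on $\mathbb S^1$ is $g\circ h$ for a uniformization $h$ with $h(0)=a$; 4. $\star\langle dw,-iw\rangle=d\Phi$ in $\Omega\setminus\{a\}$, where $\star dx=dy$, $\star dy=-dx$, and $\Phi=\tilde\Phi\circ h^{-1}$ for a uniformization $h$ with $h(0)=a$ and a weak solution $\tilde\Phi$ (unique up to a constant) of $\Delta\tilde\Phi=2\pi\delta_0$ in $\mathbb D$, $\partial_r\tilde\Phi=\langle\partial_\theta(g\circ h),i\,(g\circ h)\rangle$ on $\mathbb S^1$. **Proposition.** Let $f:\mathbb D\to\Omega$ be a uniformization with $f(0)=a$, let $f_r=\frac{xf_x+yf_y}{r}$ and $f_\theta=-yf_x+xf_y$ be its radial and angular derivatives, and set $$u=\frac{f_\theta}{|f_\theta|}\circ f^{-1},\qquad v=\frac{f_r}{|f_r|}\circ f^{-1}\qquad\text{on }\Omega\setminus\{a\}.$$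 Then $u$ is the canonical harmonic map of degree $1$ associated to $(\tau,a)$ and $v$ is the canonical harmonic map of degree $1$ associated to $(\nu,a)$; in particular $\tau,\nu\in H^{1/2}(\Gamma,\mathbb S^1)$ have degree $1$. Both $u$ and $v$ are smooth harmonic maps $\Omega\setminus\{a\}\to\mathbb S^1$, that is, $-\Delta u=|\nabla u|^2u$ and $-\Delta v=|\nabla v|^2v$. Moreover, the Dirichlet Green function $G$ of $\Omega$ at $a$ ($\Delta G=2\pi\delta_a$ in $\Omega$, $G=0$ on $\Gamma$) exists and, with $\omega=\langle du,v\rangle$ and $\mu=\ln|f'|\circ f^{-1}$, $$\star\,\omega=d(\mu+G),$$ pointwise in $\Omega\setminus\{a\}$ and in the sense of distributions in $\Omega$. -/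

import Mathlib

open Set Filter Topology MeasureTheory Complex
open scoped ContDiff ComplexConjugate

noncomputable section

/-- Polar coordinates on the unit circle: the point `e^{iθ}`. -/
abbrev circlePt (θ : ℝ) : ℂ := circleMap 0 1 θ

/-- Lebesgue measure on one period of the angle. -/
abbrev angleMeasure : Measure ℝ := volume.restrict (Ioc 0 (2 * Real.pi))

/-- The open unit disk. -/
abbrev unitDisk : Set ℂ := Metric.ball 0 1

/-! ### Weak derivatives and one-forms -/

/-- `Du` is the weak (distributional) derivative of `u` on the open set `U`. -/
def HasWeakDeriv {E : Type*} [NormedAddCommGroup E] [NormedSpace ℝ E]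
    (U : Set ℂ) (u : ℂ → E) (Du : ℂ → ℂ →L[ℝ] E) : Prop :=
  LocallyIntegrableOn u U ∧ LocallyIntegrableOn Du U ∧
    ∀ φ : ℂ → ℝ, ContDiff ℝ ∞ φ → HasCompactSupport φ → tsupport φ ⊆ U →
      ∀ e : ℂ, ∫ z in U, (fderiv ℝ φ z e) • u z = - ∫ z in U, φ z • Du z e

/-- The Hodge star on one-forms of the plane: `⋆dx = dy`, `⋆dy = -dx`. -/
def hodgeStar (α : ℂ → ℂ →L[ℝ] ℝ) : ℂ → ℂ →L[ℝ] ℝ :=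
  fun z => -(α z).comp (ContinuousLinearMap.mul ℝ ℂ I)

/-- The one-form `⟨A, b⟩ : e ↦ ⟨A(e), b⟩`, for a vector-valued one-form `A` and a vector field `b`. -/
def pairForm (A : ℂ → ℂ →L[ℝ] ℂ) (b : ℂ → ℂ) : ℂ → ℂ →L[ℝ] ℝ :=
  fun z => (innerSL ℝ (b z)).comp (A z)

/-- The Euclidean inner product of two covectors. -/
def covectorInner (ξ η : ℂ →L[ℝ] ℝ) : ℝ := ξ 1 * η 1 + ξ I * η I

/-! ### Uniformizations, quasidisks, Weil-Petersson domains -/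

/-- `f` is a uniformization of `Ω`: a biholomorphic map from the unit disk onto `Ω`. -/
def IsUniformization (f : ℂ → ℂ) (Ω : Set ℂ) : Prop :=
  DifferentiableOn ℂ f unitDisk ∧ BijOn f unitDisk Ω

/-- The inverse of a uniformization. -/
def discInv (f : ℂ → ℂ) : ℂ → ℂ := Function.invFunOn f unitDisk

/-- The continuous extension of a uniformization to the closed disk. -/
def boundaryMap (f : ℂ → ℂ) : ℂ → ℂ := extendFrom unitDisk f

/-- A quasiconformal homeomorphism of the plane. -/
def IsQuasiconformal (F : ℂ ≃ₜ ℂ) : Prop :=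
  ∃ K : ℝ, 1 ≤ K ∧ ∃ DF : ℂ → ℂ →L[ℝ] ℂ, HasWeakDeriv univ F DF ∧
    (∀ C : Set ℂ, IsCompact C → MemLp DF 2 (volume.restrict C)) ∧
    ∀ᵐ z, ‖(DF z 1 + I * DF z I) / 2‖ ≤ (K - 1) / (K + 1) * ‖(DF z 1 - I * DF z I) / 2‖

/-- A quasidisk. -/
def IsQuasidisk (Ω : Set ℂ) : Prop :=
  ∃ F : ℂ ≃ₜ ℂ, IsQuasiconformal F ∧ Ω = F '' unitDisk

/-- `Ω` is the domain enclosed by a Weil-Petersson curve. -/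
def IsWeilPeterssonDomain (Ω : Set ℂ) : Prop :=
  IsQuasidisk Ω ∧ ∃ f : ℂ → ℂ, IsUniformization f Ω ∧
    IntegrableOn (fun z => ‖deriv (deriv f) z / deriv f z‖ ^ 2) unitDisk

/-! ### Normal and tangent vectors -/

/-- `n` is the outward unit normal of `Ω` at `p`: near `p`, every open cone around `-n` (of
half-opening less than a right angle) lies in `Ω`, and every such cone around `n` lies outside
the closure of `Ω`. -/
def IsOutwardUnitNormal (Ω : Set ℂ) (p n : ℂ) : Prop :=
  ‖n‖ = 1 ∧ ∀ ε > 0, ∀ᶠ q in 𝓝 p,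
    (inner ℝ (q - p) n < -(ε * ‖q - p‖) → q ∈ Ω) ∧
    (ε * ‖q - p‖ < inner ℝ (q - p) n → q ∉ closure Ω)

open Classical in
/-- The outward unit normal vector field (`0` at the points where there is no normal). -/
def outwardNormal (Ω : Set ℂ) (p : ℂ) : ℂ :=
  if h : ∃ n, IsOutwardUnitNormal Ω p n then h.choose else 0

/-- The unit tangent vector field such that (normal, tangent) is a direct frame. -/
def unitTangent (Ω : Set ℂ) (p : ℂ) : ℂ := I * outwardNormal Ω p

/-! ### `H^{1/2}` on the circle, degree, and `H^{-1/2}`-`H^{1/2}` duality.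
A function on the circle is represented by a function on the plane, of which only the values on
the unit circle matter. -/

/-- `g ∈ H^{1/2}(𝕊¹)`: `g ∈ L²` and the double integral of `|g(x)-g(y)|²/|x-y|²` is finite. -/
def MemHHalfCircle {E : Type*} [NormedAddCommGroup E] (g : ℂ → E) : Prop :=
  MemLp (fun θ => g (circlePt θ)) 2 angleMeasure ∧
    ∫⁻ s, ∫⁻ t, (‖g (circlePt s) - g (circlePt t)‖ₑ / ‖circlePt s - circlePt t‖ₑ) ^ 2
      ∂angleMeasure ∂angleMeasure < ⊤

/-- `g ∈ H^{1/2}(𝕊¹, 𝕊¹)`. -/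
def MemHHalfCircleCircle (g : ℂ → ℂ) : Prop :=
  MemHHalfCircle g ∧ ∀ᵐ θ ∂angleMeasure, ‖g (circlePt θ)‖ = 1

/-- `g : 𝕊¹ → 𝕊¹` has degree `n`: `g = z^n e^{iφ}` with a real-valued `φ ∈ H^{1/2}(𝕊¹)`. -/
def HasCircleDegree (g : ℂ → ℂ) (n : ℤ) : Prop :=
  ∃ φ : ℂ → ℝ, MemHHalfCircle φ ∧
    ∀ᵐ θ ∂angleMeasure, g (circlePt θ) = circlePt θ ^ n * exp (I * φ (circlePt θ))

/-- The Fourier coefficients of a function on the circle. -/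
def circleFourier (g : ℂ → ℂ) (n : ℤ) : ℂ :=
  fourierCoeffOn Real.two_pi_pos (fun θ => g (circlePt θ)) n

/-- The duality bracket `∫_{𝕊¹} ⟨∂_θ g, ψ⟩ dθ` of `∂_θ g ∈ H^{-1/2}` with `ψ ∈ H^{1/2}` (real inner
product of `ℂ = ℝ²`) exists and equals `L`. It is computed on the Fourier side. -/
def HasTangentialPairing (g ψ : ℂ → ℂ) (L : ℝ) : Prop :=
  HasSum (fun n : ℤ => 2 * Real.pi * (I * n * circleFourier g n * conj (circleFourier ψ n)).re) L

/-- `g ∈ H^{1/2}(∂Ω, 𝕊¹)`, for a quasidisk `Ω`. -/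
def MemHHalfBoundary (Ω : Set ℂ) (g : ℂ → ℂ) : Prop :=
  ∃ f, IsUniformization f Ω ∧ MemHHalfCircleCircle (g ∘ boundaryMap f)

/-- `deg(g, ∂Ω) = n`, for a quasidisk `Ω`. -/
def HasBoundaryDegree (Ω : Set ℂ) (g : ℂ → ℂ) (n : ℤ) : Prop :=
  ∃ f, IsUniformization f Ω ∧ HasCircleDegree (g ∘ boundaryMap f) n

/-! ### Canonical harmonic maps -/

/-- `u ∈ H¹_loc(closure Ω ∖ {a})`, with weak derivative `Du`. -/
def HasH1LocDeriv (Ω : Set ℂ) (a : ℂ) (u : ℂ → ℂ) (Du : ℂ → ℂ →L[ℝ] ℂ) : Prop :=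
  HasWeakDeriv (Ω \ {a}) u Du ∧
    ∀ C : Set ℂ, IsCompact C → C ⊆ closure Ω \ {a} →
      MemLp u 2 (volume.restrict (C ∩ Ω)) ∧ MemLp Du 2 (volume.restrict (C ∩ Ω))

/-- `deg(u, a) = n`: the restriction of `u` to almost every small circle around `a` has degree `n`. -/
def HasDegreeAt (u : ℂ → ℂ) (a : ℂ) (n : ℤ) : Prop :=
  ∃ r₀ > 0, ∀ᵐ r : ℝ ∂(volume.restrict (Ioo 0 r₀)), HasCircleDegree (fun ζ => u (a + r * ζ)) n

/-- `U` is of class `H¹` on the unit disk away from the origin and its trace on the unit circle is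
`g`, that is, the Gauss-Green formula holds with boundary values `g`. -/
def HasCircleTrace (U g : ℂ → ℂ) : Prop :=
  Integrable (fun θ => g (circlePt θ)) angleMeasure ∧
  ∃ DU : ℂ → ℂ →L[ℝ] ℂ,
    (∀ δ > 0, MemLp U 2 (volume.restrict (unitDisk \ Metric.closedBall 0 δ)) ∧
      MemLp DU 2 (volume.restrict (unitDisk \ Metric.closedBall 0 δ))) ∧
    ∀ φ : ℂ → ℝ, ContDiff ℝ ∞ φ → HasCompactSupport φ → (0 : ℂ) ∉ tsupport φ → ∀ e : ℂ,
      ∫ z in unitDisk, ((fderiv ℝ φ z e) • U z + φ z • DU z e) =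
        ∫ θ, (inner ℝ e (circlePt θ) * φ (circlePt θ)) • g (circlePt θ) ∂angleMeasure

/-- `Φ` is a solution of `ΔΦ = 2πδ₀` in the unit disk with `∂_r Φ = ⟨∂_θ g, i g⟩` on the unit circle,
in the weak sense: `Φ` is of class `W^{1,1}`, of class `H¹` away from `0`, and
`∫ ⟨∇Φ, ∇φ⟩ + 2π φ(0) = ∫_{𝕊¹} ⟨∂_θ g, i g⟩ φ` for all smooth `φ`. -/
def IsNeumannPotential (g : ℂ → ℂ) (Φ : ℂ → ℝ) : Prop :=
  ∃ DΦ : ℂ → ℂ →L[ℝ] ℝ, HasWeakDeriv unitDisk Φ DΦ ∧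
    IntegrableOn Φ unitDisk ∧ IntegrableOn DΦ unitDisk ∧
    (∀ δ > 0, MemLp Φ 2 (volume.restrict (unitDisk \ Metric.closedBall 0 δ)) ∧
      MemLp DΦ 2 (volume.restrict (unitDisk \ Metric.closedBall 0 δ))) ∧
    ∀ φ : ℂ → ℝ, ContDiff ℝ ∞ φ →
      HasTangentialPairing g (fun ζ => φ ζ * (I * g ζ))
        ((∫ z in unitDisk, covectorInner (DΦ z) (fderiv ℝ φ z)) + 2 * Real.pi * φ 0)

/-- The defining properties of a canonical harmonic map of degree `1` associated to the data
`(g, a)`. The Cartan form is `ω = ⟨du, -iu⟩`. -/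
structure HasCanonicalProperties (Ω : Set ℂ) (g : ℂ → ℂ) (a : ℂ) (u : ℂ → ℂ) : Prop where
  data_mem : MemHHalfBoundary Ω g
  data_degree : HasBoundaryDegree Ω g 1
  norm_eq_one : ∀ᵐ z ∂(volume.restrict (Ω \ {a})), ‖u z‖ = 1
  degree_at : HasDegreeAt u a 1
  trace_eq : ∃ f, IsUniformization f Ω ∧ f 0 = a ∧ HasCircleTrace (u ∘ f) (g ∘ boundaryMap f)
  star_cartan : ∃ Du, HasH1LocDeriv Ω a u Du ∧
    ∃ f, IsUniformization f Ω ∧ f 0 = a ∧ ∃ Φ, IsNeumannPotential (g ∘ boundaryMap f) Φ ∧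
      HasWeakDeriv (Ω \ {a}) (Φ ∘ discInv f) (hodgeStar (pairForm Du (fun z => -(I * u z))))

/-- `u` is the canonical harmonic map of degree `1` associated to the data `(g, a)`: it has the
defining properties, and it is (almost everywhere) the only one. -/
def IsCanonicalHarmonicMap (Ω : Set ℂ) (g : ℂ → ℂ) (a : ℂ) (u : ℂ → ℂ) : Prop :=
  HasCanonicalProperties Ω g a u ∧
    ∀ w, HasCanonicalProperties Ω g a w → w =ᵐ[volume.restrict (Ω \ {a})] u

/-- `u` is a (smooth) harmonic map from the open set `U` to the unit circle:
`-Δu = |∇u|² u`. -/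
def IsHarmonicMapToCircle (U : Set ℂ) (u : ℂ → ℂ) : Prop :=
  ContDiffOn ℝ ∞ u U ∧ (∀ z ∈ U, ‖u z‖ = 1) ∧
    ∀ z ∈ U, -(Laplacian.laplacian u z) =
      (‖fderiv ℝ u z 1‖ ^ 2 + ‖fderiv ℝ u z I‖ ^ 2) • u z

/-! ### The Dirichlet Green function -/

/-- `G` is the Dirichlet Green function of `Ω` at `a`: `ΔG = 2πδ_a` in `Ω` in the sense of
distributions, and `G = 0` on `∂Ω`. It is represented by a function continuous off `a`. -/
structure IsDirichletGreenFunction (Ω : Set ℂ) (a : ℂ) (G : ℂ → ℝ) : Prop where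
  continuousOn : ContinuousOn G (Ω \ {a})
  locallyIntegrableOn : LocallyIntegrableOn G Ω
  laplacian_eq : ∀ φ : ℂ → ℝ, ContDiff ℝ ∞ φ → HasCompactSupport φ → tsupport φ ⊆ Ω →
    ∫ z in Ω, G z * Laplacian.laplacian φ z = 2 * Real.pi * φ a
  boundary : ∀ p ∈ frontier Ω, Tendsto G (𝓝[Ω] p) (𝓝 0)

/-! ### The polar frame of a uniformization -/

/-- `f_r = (x f_x + y f_y) / r`. -/
def radialDeriv (f : ℂ → ℂ) (z : ℂ) : ℂ :=
  (z.re * fderiv ℝ f z 1 + z.im * fderiv ℝ f z I) / ‖z‖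

/-- `f_θ = -y f_x + x f_y`. -/
def angularDeriv (f : ℂ → ℂ) (z : ℂ) : ℂ :=
  -z.im * fderiv ℝ f z 1 + z.re * fderiv ℝ f z I

/-- `u = (f_θ / |f_θ|) ∘ f⁻¹`. -/
def frameU (f : ℂ → ℂ) : ℂ → ℂ :=
  (fun z => angularDeriv f z / ‖angularDeriv f z‖) ∘ discInv f

/-- `v = (f_r / |f_r|) ∘ f⁻¹`. -/
def frameV (f : ℂ → ℂ) : ℂ → ℂ :=
  (fun z => radialDeriv f z / ‖radialDeriv f z‖) ∘ discInv f

/-- The Cartan form `ω = ⟨du, v⟩` of the frame `(v, u)`. -/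
def cartanForm (f : ℂ → ℂ) : ℂ → ℂ →L[ℝ] ℝ :=
  pairForm (fderiv ℝ (frameU f)) (frameV f)

/-- `μ = ln |f'| ∘ f⁻¹`. -/
def logConformalFactor (f : ℂ → ℂ) : ℂ → ℝ :=
  (fun z => Real.log ‖deriv f z‖) ∘ discInv f

end

/-! Let `ψ` be a holomorphic logarithm of `f'` on the disk. Since `f_r` is a positive multiple of `z
f'(z)` and `f_θ = i z f'(z)`, both frame fields have the form `(z/|z|) e^{i(Im ψ + c)}` in the
coordinate of the disk, with `c = 0` for `v` and `c = π/2` for `u` (`phaseMap`). Their phase is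
locally the imaginary part of the holomorphic function `log z + ψ`. Hence both are harmonic maps
(`laplacian_of_fderiv_eq`), and the star of their Cartan form is the differential of the real part
`log |z| + log |f'|` (`pairForm_smulRight`). In the coordinate of `Ω` the first summand is the Green
function `log |f⁻¹|` and the second is `μ`.

The Weil-Petersson condition says that `ψ' = f''/f'` is square integrable. It does not depend on the
uniformization (`HasFiniteEnergy.of_isUniformization`), and it controls the boundary in two ways. A
function of finite Dirichlet integral has radial limits almost everywhere, and these form a function
in `H^{1/2}` (`memHHalfCircle_radialLimit`). It also has the little Bloch property
(`exists_mul_norm_le_of_integrable`), so that at small scales `f` is almost affine up to the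
boundary (`BlochLog.norm_sub_sub_le`). Consequently `f` extends continuously to the closed disk. The
extension is injective because `Ω` is the image of a disk under a homeomorphism of the plane. At a
point `ζ` where `ψ` has a radial limit `L`, the extension has derivative `e^L`, and `Ω` has the
outward normal `ζ e^{i Im L}` (`IsLogDeriv.isOutwardUnitNormal`). Thus `ν ∘ f = z e^{i Im ψ}` almost
everywhere on the circle: normal and tangent lie in `H^{1/2}`, have degree `1`, and are the traces
of the frame fields.

It remains to see that `log |z| + Re ψ` solves the Neumann problem with data `⟨∂_θ g, i g⟩`. For `g
= z e^{iφ}` the duality bracket is computed from difference quotients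
(`hasTangentialPairing_of_lift`). The Dirichlet pairing of the potential with a test function is
computed by the Gauss-Green formula, where the Cauchy-Riemann equations trade `∇ Re ψ` for the
boundary values of `Im ψ` (`integral_covectorInner_inv`, `integral_covectorInner_deriv`).

For uniqueness, the Neumann potential is unique up to a constant
(`IsNeumannPotential.ae_eq_add_const`), so a competitor has the same Cartan form as the frame field
and equals it up to a constant factor (`ae_eq_const_mul_of_pairForm_eq`); the trace shows that the
factor is `1` (`eq_one_of_hasCircleTrace`). Uniformizations with the same value at the origin differ
by a rotation, which leaves the frame fields unchanged. The Green function is unique by Weyl's lemma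
(`exists_harmonicOnNhd_of_weaklyHarmonic`) and the maximum principle
(`HarmonicOnNhd.le_zero_of_tendsto_frontier`). -/

/-! ### Polar coordinates on the unit disk. -/

/-- The measure `r dr dθ` on the rectangle `(0, 1) × (0, 2π]`. -/
noncomputable def polarMeasure : Measure (ℝ × ℝ) :=
  ((volume.restrict (Ioo (0 : ℝ) 1)).prod angleMeasure).withDensity (fun p => ENNReal.ofReal p.1)

theorem continuous_circleMap_prod : Continuous (fun p : ℝ × ℝ => circleMap 0 p.1 p.2) := by
  unfold circleMap; fun_prop

theorem lintegral_angleMeasure_add (F : ℝ → ENNReal) (hF : Function.Periodic F (2 * Real.pi))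
    (a : ℝ) : ∫⁻ θ in Ioc a (a + 2 * Real.pi), F θ = ∫⁻ θ, F θ ∂angleMeasure := by
  have h := (isAddFundamentalDomain_Ioc Real.two_pi_pos a).setLIntegral_eq
    (isAddFundamentalDomain_Ioc Real.two_pi_pos 0) F (by
      rintro ⟨g, n, rfl⟩ x
      have := hF.int_mul n x
      simpa [AddSubgroup.vadd_def, add_comm] using this)
  simpa [angleMeasure] using h

/-- The usual polar coordinates have radii in `(0, ∞)` and angles in `(-π, π)`. Radii at least `1`
contribute nothing to the disk, and periodicity moves the angles to `(0, 2π]`. -/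
theorem measurePreserving_polar : MeasurePreserving (fun p : ℝ × ℝ => circleMap 0 p.1 p.2)
    polarMeasure (volume.restrict unitDisk) := by
  refine ⟨continuous_circleMap_prod.measurable, ?_⟩
  refine Measure.ext fun s hs => ?_
  rw [Measure.map_apply continuous_circleMap_prod.measurable hs, Measure.restrict_apply hs,
    ← lintegral_indicator_one (hs.inter Metric.isOpen_ball.measurableSet),
    ← Complex.lintegral_comp_polarCoord_symm,
    ← lintegral_indicator_one (continuous_circleMap_prod.measurable hs), polarMeasure,
    lintegral_withDensity_eq_lintegral_mul _ (by exact ENNReal.measurable_ofReal.comp measurable_fst)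
      (measurable_one.indicator (continuous_circleMap_prod.measurable hs)),
    lintegral_prod _ (by
      refine AEMeasurable.mul (ENNReal.measurable_ofReal.comp measurable_fst).aemeasurable ?_
      exact (measurable_one.indicator (continuous_circleMap_prod.measurable hs)).aemeasurable)]
  have hm : Measurable (fun p : ℝ × ℝ => ENNReal.ofReal p.1 •
      (s ∩ unitDisk).indicator (1 : ℂ → ENNReal) (circleMap 0 p.1 p.2)) := by
    refine Measurable.smul (ENNReal.measurable_ofReal.comp measurable_fst) ?_
    exact (measurable_one.indicator (hs.inter Metric.isOpen_ball.measurableSet)).comp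
      continuous_circleMap_prod.measurable
  have hsymm : ∀ p : ℝ × ℝ, Complex.polarCoord.symm p = circleMap 0 p.1 p.2 := fun p => by
    simp [circleMap, Complex.polarCoord_symm_apply, Complex.exp_mul_I]
  simp_rw [hsymm]
  rw [polarCoord_target, Measure.volume_eq_prod, ← Measure.prod_restrict,
    lintegral_prod _ hm.aemeasurable]
  have h1 : ∀ r : ℝ, ∫⁻ θ in Ioo (-Real.pi) Real.pi, ENNReal.ofReal r •
        (s ∩ unitDisk).indicator (1 : ℂ → ENNReal) (circleMap 0 r θ) =
      ∫⁻ θ, ENNReal.ofReal r *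
        (s ∩ unitDisk).indicator (1 : ℂ → ENNReal) (circleMap 0 r θ) ∂angleMeasure := by
    intro r
    rw [← lintegral_angleMeasure_add _ _ (-Real.pi), show -Real.pi + 2 * Real.pi = Real.pi by ring,
      setLIntegral_congr (Ioo_ae_eq_Ioc)]
    · rfl
    · intro θ
      simp only [periodic_circleMap 0 r θ]
  simp_rw [h1]
  rw [← Ioo_union_Ici_eq_Ioi (zero_lt_one (α := ℝ)), lintegral_union measurableSet_Ici
    (by
      rw [Set.disjoint_left]; rintro x ⟨_, h⟩ (h' : (1:ℝ) ≤ x); linarith)]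
  have h2 : ∫⁻ r in Ici (1 : ℝ), ∫⁻ θ, ENNReal.ofReal r *
        (s ∩ unitDisk).indicator (1 : ℂ → ENNReal) (circleMap 0 r θ) ∂angleMeasure = 0 := by
    rw [setLIntegral_congr_fun (g := fun _ => 0) measurableSet_Ici]
    · simp
    · intro r hr
      have hr' : (1 : ℝ) ≤ r := hr
      have : ∀ θ, circleMap 0 r θ ∉ s ∩ unitDisk := by
        rintro θ ⟨-, h⟩
        simp only [mem_ball_zero_iff, norm_circleMap_zero] at h
        exact absurd (h.trans_le hr') (not_lt.2 (le_abs_self r))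
      simp [this]
  rw [h2, add_zero]
  refine setLIntegral_congr_fun measurableSet_Ioo fun r hr => ?_
  refine lintegral_congr fun θ => ?_
  have : circleMap 0 r θ ∈ unitDisk := by
    simp [abs_of_pos hr.1, hr.2]
  simp only [Pi.mul_apply]
  congr 1
  by_cases h : circleMap 0 r θ ∈ s
  · have h' : circleMap 0 r θ ∈ s ∩ unitDisk := ⟨h, this⟩
    rw [indicator_of_mem h', indicator_of_mem (by exact h)]; rfl
  · have h' : circleMap 0 r θ ∉ s ∩ unitDisk := fun h' => h h'.1
    rw [indicator_of_notMem h', indicator_of_notMem (by exact h)]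

section polar_integrals

variable {E : Type*} [NormedAddCommGroup E] [NormedSpace ℝ E]

/-- The measure `dr dθ` on the rectangle `(0, 1) × (0, 2π]`. -/
noncomputable abbrev rectMeasure : Measure (ℝ × ℝ) :=
  (volume.restrict (Ioo (0 : ℝ) 1)).prod angleMeasure

theorem ae_rectMeasure_mem : ∀ᵐ p ∂rectMeasure, p.1 ∈ Ioo (0 : ℝ) 1 := by
  have : ∀ᵐ r ∂(volume.restrict (Ioo (0 : ℝ) 1)), r ∈ Ioo (0 : ℝ) 1 :=
    ae_restrict_mem measurableSet_Ioo
  exact Measure.quasiMeasurePreserving_fst.ae this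

theorem integrable_polarMeasure_iff {F : ℝ × ℝ → E} :
    Integrable F polarMeasure ↔ Integrable (fun p => p.1 • F p) rectMeasure := by
  rw [polarMeasure, integrable_withDensity_iff_integrable_smul' (by fun_prop) (by simp)]
  refine integrable_congr ?_
  filter_upwards [ae_rectMeasure_mem] with p hp
  simp [ENNReal.toReal_ofReal hp.1.le]

theorem integral_polarMeasure {F : ℝ × ℝ → E} :
    ∫ p, F p ∂polarMeasure = ∫ p, p.1 • F p ∂rectMeasure := by
  rw [polarMeasure, integral_withDensity_eq_integral_toReal_smul (by fun_prop) (by simp)]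
  refine integral_congr_ae ?_
  filter_upwards [ae_rectMeasure_mem] with p hp
  simp [ENNReal.toReal_ofReal hp.1.le]

theorem integrable_rectMeasure_of_integrableOn {F : ℂ → E} (hF : IntegrableOn F unitDisk) :
    Integrable (fun p : ℝ × ℝ => p.1 • F (circleMap 0 p.1 p.2)) rectMeasure :=
  integrable_polarMeasure_iff.1 (measurePreserving_polar.integrable_comp_of_integrable hF)

theorem setIntegral_unitDisk_eq {F : ℂ → E} (hF : IntegrableOn F unitDisk) :
    ∫ z in unitDisk, F z = ∫ p, p.1 • F (circleMap 0 p.1 p.2) ∂rectMeasure := by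
  rw [← integral_polarMeasure, ← measurePreserving_polar.map_eq,
    integral_map continuous_circleMap_prod.aemeasurable
      (by rw [measurePreserving_polar.map_eq]; exact hF.aestronglyMeasurable)]

theorem setLIntegral_unitDisk_eq {F : ℂ → ENNReal} (hF : AEMeasurable F (volume.restrict unitDisk)) :
    ∫⁻ z in unitDisk, F z = ∫⁻ p, ENNReal.ofReal p.1 * F (circleMap 0 p.1 p.2) ∂rectMeasure := by
  rw [← measurePreserving_polar.map_eq] at hF ⊢
  rw [lintegral_map' hF continuous_circleMap_prod.aemeasurable, polarMeasure,
    lintegral_withDensity_eq_lintegral_mul_non_measurable₀ _ (by fun_prop) (by simp)]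
  rfl

end polar_integrals

theorem hasDerivAt_circleMap_radius (θ r : ℝ) :
    HasDerivAt (fun r : ℝ => circleMap 0 r θ) (circlePt θ) r := by
  have : (fun r : ℝ => circleMap 0 r θ) = fun r : ℝ => (r : ℂ) * circlePt θ := by
    ext r; simp [circlePt, circleMap]
  rw [this]
  simpa using (Complex.ofRealCLM.hasDerivAt (x := r)).mul_const (circlePt θ)

theorem circleMap_eq_mul (r θ : ℝ) : circleMap 0 r θ = r * circlePt θ := by
  simp [circlePt, circleMap]

theorem norm_circlePt (θ : ℝ) : ‖circlePt θ‖ = 1 := by simp [circlePt]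

/-- Expansion in the orthonormal basis `ζ`, `I * ζ`: it splits a constant direction into its radial
and angular components. -/
theorem normSq_eq_inner (e ζ : ℂ) (h : ‖ζ‖ = 1) :
    e = (inner ℝ e ζ : ℝ) • ζ + (inner ℝ e (I * ζ) : ℝ) • (I * ζ) := by
  have h1 : ζ.re ^ 2 + ζ.im ^ 2 = 1 := by
    have := Complex.sq_norm ζ
    rw [h, Complex.normSq_apply] at this; nlinarith
  apply Complex.ext
  · simp [Complex.inner]; linear_combination (-e.re) * h1
  · simp [Complex.inner]; linear_combination (-e.im) * h1

/-! ### The Gauss-Green formula on the punctured disk. -/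

section gauss_green

variable {E : Type*} [NormedAddCommGroup E] [NormedSpace ℝ E]

/-- Evaluation at a moving vector is reduced to evaluations at the fixed vectors `1` and `I` with
bounded continuous coefficients. -/
theorem integrable_rectMeasure_clm_circlePt {L : ℝ × ℝ → ℂ →L[ℝ] E} (hL : Integrable L rectMeasure)
    {c : ℝ → ℝ} (hc : Continuous c) (hcb : ∀ θ, ‖c θ‖ ≤ 1) {ζ : ℝ → ℂ} (hζ : Continuous ζ)
    (hζb : ∀ θ, ‖ζ θ‖ ≤ 1) :
    Integrable (fun p : ℝ × ℝ => c p.2 • L p (ζ p.2)) rectMeasure := by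
  have h1 : ∀ e : ℂ, Integrable (fun p => L p e) rectMeasure := fun e =>
    (ContinuousLinearMap.apply ℝ E e).integrable_comp hL
  have h2 : ∀ (g : ℝ → ℝ) (_ : Continuous g) (_ : ∀ θ, ‖g θ‖ ≤ 1) (e : ℂ),
      Integrable (fun p : ℝ × ℝ => g p.2 • L p e) rectMeasure := fun g hg hgb e =>
    (h1 e).bdd_smul 1 (hg.comp continuous_snd).aestronglyMeasurable (ae_of_all _ fun p => hgb p.2)
  have h3 := (h2 (fun θ => c θ * (ζ θ).re) (by fun_prop) (fun θ => by
    rw [norm_mul]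
    exact mul_le_one₀ (hcb θ) (norm_nonneg _) ((Complex.abs_re_le_norm _).trans (hζb θ))) 1).add
    (h2 (fun θ => c θ * (ζ θ).im) (by fun_prop) (fun θ => by
    rw [norm_mul]
    exact mul_le_one₀ (hcb θ) (norm_nonneg _) ((Complex.abs_im_le_norm _).trans (hζb θ))) I)
  refine h3.congr (ae_of_all _ fun p => ?_)
  have : ζ p.2 = (ζ p.2).re • (1 : ℂ) + (ζ p.2).im • I := by
    apply Complex.ext <;> simp
  show _ = c p.2 • L p (ζ p.2)
  conv_rhs => rw [this]
  simp only [Pi.add_apply, map_add, map_smul, smul_add, mul_smul]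

/-- The Gauss-Green formula on the punctured unit disk, for a function with radial boundary
values. -/
theorem integral_unitDisk_fderiv_eq_boundary [CompleteSpace E] {V : ℂ → E} {DV : ℂ → ℂ →L[ℝ] E}
    (hV : ∀ z ∈ unitDisk \ {0}, HasFDerivAt V (DV z) z) (hc : ContinuousOn DV (unitDisk \ {0}))
    (hVi : IntegrableOn (fun z => ‖z‖⁻¹ • V z) unitDisk) (hDVi : IntegrableOn DV unitDisk)
    (h0 : ∀ᵐ θ ∂angleMeasure, Tendsto (fun r : ℝ => r • V (circleMap 0 r θ)) (𝓝[>] 0) (𝓝 0))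
    {Vb : ℝ → E} (h1 : ∀ᵐ θ ∂angleMeasure,
      Tendsto (fun r : ℝ => V (circleMap 0 r θ)) (𝓝[<] 1) (𝓝 (Vb θ))) (e : ℂ) :
    ∫ z in unitDisk, DV z e = ∫ θ, (inner ℝ e (circlePt θ) : ℝ) • Vb θ ∂angleMeasure := by
  -- Both sides are linear in `e`; the normalization makes the angular weights bounded by `1`.
  wlog he : ‖e‖ ≤ 1 generalizing e with H
  · have hne : ‖e‖ ≠ 0 := by intro h; rw [h] at he; exact he zero_le_one
    have h := H (‖e‖⁻¹ • e) (by rw [norm_smul, norm_inv, norm_norm, inv_mul_cancel₀ hne])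
    simp only [map_smul, integral_smul, real_inner_smul_left, mul_smul] at h
    exact smul_right_injective E (inv_ne_zero hne) h
  have hmem : ∀ r ∈ Ioo (0 : ℝ) 1, ∀ θ, circleMap 0 r θ ∈ unitDisk \ {0} := fun r hr θ =>
    ⟨by simpa [abs_of_pos hr.1] using hr.2, by simp [hr.1.ne']⟩
  have hcp : Continuous circlePt := by unfold circlePt; exact continuous_circleMap 0 1
  have hin1 : ∀ θ, ‖(inner ℝ e (circlePt θ) : ℝ)‖ ≤ 1 := fun θ =>
    (norm_inner_le_norm _ _).trans (by rw [norm_circlePt, mul_one]; exact he)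
  have hin2 : ∀ θ, ‖(inner ℝ e (I * circlePt θ) : ℝ)‖ ≤ 1 := fun θ =>
    (norm_inner_le_norm _ _).trans (by rw [norm_mul, norm_I, norm_circlePt]; simpa using he)
  have hVr : Integrable (fun p : ℝ × ℝ => V (circleMap 0 p.1 p.2)) rectMeasure := by
    refine (integrable_rectMeasure_of_integrableOn hVi).congr ?_
    filter_upwards [ae_rectMeasure_mem] with p hp
    simp only [norm_circleMap_zero, abs_of_pos hp.1, smul_smul]
    rw [mul_inv_cancel₀ hp.1.ne', one_smul]
  have hVr' : Integrable (fun p : ℝ × ℝ => (inner ℝ e (circlePt p.2) : ℝ) •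
      V (circleMap 0 p.1 p.2)) rectMeasure :=
    hVr.bdd_smul 1 (by
      refine Continuous.aestronglyMeasurable ?_
      fun_prop) (ae_of_all _ fun p => hin1 p.2)
  have hDr := integrable_rectMeasure_of_integrableOn hDVi
  -- `A` and `B` split `r ∂_e V` into exact derivatives, `A = ∂_r (⟨e, ζ⟩ r V)` and `B = ∂_θ (⟨e,
  -- iζ⟩ V)`; the extra terms `±⟨e, ζ⟩ V` cancel. By periodicity `B` integrates to zero, and `A`
  -- produces the boundary term.
  let A : ℝ × ℝ → E := fun p => (inner ℝ e (circlePt p.2) : ℝ) • V (circleMap 0 p.1 p.2) +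
    (inner ℝ e (circlePt p.2) : ℝ) • (p.1 • DV (circleMap 0 p.1 p.2)) (circlePt p.2)
  let B : ℝ × ℝ → E := fun p => -((inner ℝ e (circlePt p.2) : ℝ) • V (circleMap 0 p.1 p.2)) +
    (inner ℝ e (I * circlePt p.2) : ℝ) • (p.1 • DV (circleMap 0 p.1 p.2)) (I * circlePt p.2)
  have hA : Integrable A rectMeasure := hVr'.add
    (integrable_rectMeasure_clm_circlePt hDr (by fun_prop) hin1 hcp (fun θ => (norm_circlePt θ).le))
  have hB : Integrable B rectMeasure := hVr'.neg.add
    (integrable_rectMeasure_clm_circlePt hDr (c := fun θ => inner ℝ e (I * circlePt θ))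
      (ζ := fun θ => I * circlePt θ) (by fun_prop) hin2 (by fun_prop)
      (fun θ => by simp))
  have hAB : ∀ p : ℝ × ℝ, p.1 • (DV (circleMap 0 p.1 p.2) e) = A p + B p := by
    intro p
    conv_lhs => rw [normSq_eq_inner e (circlePt p.2) (norm_circlePt _)]
    simp only [A, B, map_add, map_smul, smul_add, _root_.smul_apply]
    rw [smul_comm p.1, smul_comm p.1 (inner ℝ e (I * circlePt p.2) : ℝ)]
    abel
  have hBz : ∫ p, B p ∂rectMeasure = 0 := by
    rw [integral_prod _ hB, setIntegral_congr_fun (g := fun _ => 0) measurableSet_Ioo]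
    · simp
    intro r hr
    have hd : ∀ θ : ℝ, HasDerivAt (fun θ : ℝ => (inner ℝ e (I * circlePt θ) : ℝ) •
        V (circleMap 0 r θ)) (B (r, θ)) θ := by
      intro θ
      have h1 : HasDerivAt (fun θ : ℝ => circleMap 0 r θ) (circleMap 0 r θ * I) θ :=
        hasDerivAt_circleMap 0 r θ
      have h2 : HasDerivAt (fun θ : ℝ => circlePt θ) (circlePt θ * I) θ :=
        hasDerivAt_circleMap 0 1 θ
      have h3 := (hV _ (hmem r hr θ)).comp_hasDerivAt θ h1
      have h4 : HasDerivAt (fun θ : ℝ => (inner ℝ e (I * circlePt θ) : ℝ))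
          (inner ℝ e (I * (circlePt θ * I))) θ := by
        have := (hasDerivAt_const θ e).inner ℝ (h2.const_mul I)
        simpa using this
      refine (h4.smul h3).congr_deriv ?_
      simp only [B]
      rw [add_comm]
      congr 1
      · rw [show I * (circlePt θ * I) = -circlePt θ by
          rw [mul_comm (circlePt θ), ← mul_assoc, I_mul_I]; ring, inner_neg_right, neg_smul]
        rfl
      · congr 1
        rw [_root_.smul_apply, ← map_smul]
        congr 1
        rw [circleMap_eq_mul, real_smul]; ring
    have hBc : Continuous fun θ => B (r, θ) := by
      have hc1 : Continuous fun θ => V (circleMap 0 r θ) := by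
        refine continuous_iff_continuousAt.2 fun θ => ?_
        exact (hV _ (hmem r hr θ)).continuousAt.comp (continuous_circleMap 0 r).continuousAt
      have hc2 : Continuous fun θ => DV (circleMap 0 r θ) :=
        hc.comp_continuous (continuous_circleMap 0 r) (hmem r hr)
      exact ((continuous_const.inner hcp).smul hc1).neg.add
        ((continuous_const.inner (continuous_const.mul hcp)).smul
          ((hc2.const_smul r).clm_apply (continuous_const.mul hcp)))
    have := intervalIntegral.integral_eq_sub_of_hasDerivAt (fun θ _ => hd θ)
      (hBc.intervalIntegrable 0 (2 * Real.pi))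
    rw [intervalIntegral.integral_of_le Real.two_pi_pos.le] at this
    simp only [angleMeasure]
    rw [this]
    have e1 : circleMap 0 r (2 * Real.pi) = circleMap 0 r 0 := by
      simpa using periodic_circleMap 0 r 0
    have e2 : circlePt (2 * Real.pi) = circlePt 0 := by
      simpa [circlePt] using periodic_circleMap 0 1 0
    rw [e1, e2, sub_self]
  have hDe : IntegrableOn (fun z => DV z e) unitDisk :=
    (ContinuousLinearMap.apply ℝ E e).integrable_comp hDVi
  rw [setIntegral_unitDisk_eq hDe, integral_congr_ae (ae_of_all _ hAB), integral_add hA hB, hBz,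
    add_zero, integral_prod_symm _ hA]
  refine integral_congr_ae ?_
  filter_upwards [h0, h1, hA.prod_left_ae] with θ hθ0 hθ1 hθi
  have hd : ∀ r ∈ Ioo (0 : ℝ) 1, HasDerivAt (fun r : ℝ => (inner ℝ e (circlePt θ) : ℝ) •
      (r • V (circleMap 0 r θ))) (A (r, θ)) r := by
    intro r hr
    have h3 := (hV _ (hmem r hr θ)).comp_hasDerivAt r (hasDerivAt_circleMap_radius θ r)
    refine (((hasDerivAt_id r).smul h3).const_smul (inner ℝ e (circlePt θ) : ℝ)).congr_deriv ?_
    simp only [A, Function.comp_apply, one_smul, id, smul_add, _root_.smul_apply]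
    rw [add_comm]
  -- The fundamental theorem is applied on the open interval with one-sided limits at its ends, so
  -- radial boundary values are enough.
  have h := intervalIntegral.integral_eq_sub_of_hasDerivAt_of_tendsto zero_lt_one hd
    (by rw [intervalIntegrable_iff_integrableOn_Ioo_of_le zero_le_one]; exact hθi)
    (by simpa using hθ0.const_smul (inner ℝ e (circlePt θ) : ℝ))
    (by simpa using ((tendsto_nhdsWithin_of_tendsto_nhds tendsto_id).smul hθ1).const_smul
          (inner ℝ e (circlePt θ) : ℝ))
  rw [intervalIntegral.integral_of_le zero_le_one, integral_Ioc_eq_integral_Ioo] at h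
  simpa using h

end gauss_green

/-! ### Weak derivatives on open sets. -/

section weak_derivatives

variable {E : Type*} [NormedAddCommGroup E] [NormedSpace ℝ E] {U V : Set ℂ} {u u' : ℂ → E}
  {Du Du' : ℂ → ℂ →L[ℝ] E}

theorem setIntegral_eq_integral_of_tsupport_subset {φ : ℂ → ℝ} (hφ : tsupport φ ⊆ U) (F : ℂ → E) :
    ∫ z in U, φ z • F z = ∫ z, φ z • F z := by
  refine setIntegral_eq_integral_of_forall_compl_eq_zero fun z hz => ?_
  rw [image_eq_zero_of_notMem_tsupport fun h => hz (hφ h), zero_smul]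

theorem integrable_smul_of_tsupport_subset (hu : LocallyIntegrableOn u U) {φ : ℂ → ℝ}
    (hφ : Continuous φ) (hc : HasCompactSupport φ) (hs : tsupport φ ⊆ U) :
    Integrable (fun z => φ z • u z) := by
  have h1 : IntegrableOn u (tsupport φ) := hu.integrableOn_compact_subset hs hc
  obtain ⟨C, hC⟩ := hφ.bounded_above_of_compact_support hc
  have h2 : IntegrableOn (fun z => φ z • u z) (tsupport φ) :=
    Integrable.bdd_smul h1 C hφ.aestronglyMeasurable (ae_of_all _ hC)
  refine (integrableOn_iff_integrable_of_support_subset fun z hz => ?_).1 h2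
  exact subset_tsupport _ fun h => hz (by simp [h])

theorem HasWeakDeriv.integral_eq (h : HasWeakDeriv U u Du) {φ : ℂ → ℝ} (hφ : ContDiff ℝ ∞ φ)
    (hc : HasCompactSupport φ) (hs : tsupport φ ⊆ U) (e : ℂ) :
    ∫ z, (fderiv ℝ φ z e) • u z = - ∫ z, φ z • Du z e := by
  have := h.2.2 φ hφ hc hs e
  rwa [setIntegral_eq_integral_of_tsupport_subset hs,
    setIntegral_eq_integral_of_tsupport_subset ((tsupport_fderiv_apply_subset ℝ e).trans hs)] at this

/-- Test functions vanish off `U`, so all integrals may be taken over the whole plane, where the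
later arguments take place. -/
theorem hasWeakDeriv_iff : HasWeakDeriv U u Du ↔ LocallyIntegrableOn u U ∧
    LocallyIntegrableOn Du U ∧ ∀ φ : ℂ → ℝ, ContDiff ℝ ∞ φ → HasCompactSupport φ →
      tsupport φ ⊆ U → ∀ e : ℂ, ∫ z, (fderiv ℝ φ z e) • u z = - ∫ z, φ z • Du z e := by
  refine ⟨fun h => ⟨h.1, h.2.1, fun φ hφ hc hs e => h.integral_eq hφ hc hs e⟩,
    fun h => ⟨h.1, h.2.1, fun φ hφ hc hs e => ?_⟩⟩
  rw [setIntegral_eq_integral_of_tsupport_subset hs,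
    setIntegral_eq_integral_of_tsupport_subset ((tsupport_fderiv_apply_subset ℝ e).trans hs)]
  exact h.2.2 φ hφ hc hs e

theorem locallyIntegrableOn_congr_ae {F : Type*} [NormedAddCommGroup F] {u u' : ℂ → F}
    (hu : LocallyIntegrableOn u U) (h : u =ᵐ[volume.restrict U] u') : LocallyIntegrableOn u' U := by
  intro x hx
  obtain ⟨s, hs, hi⟩ := hu x hx
  refine ⟨s ∩ U, inter_mem hs self_mem_nhdsWithin, ?_⟩
  exact (hi.mono_set inter_subset_left).congr (ae_restrict_of_ae_restrict_of_subset
    inter_subset_right h)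

theorem HasWeakDeriv.congr (h : HasWeakDeriv U u Du) (hu : u =ᵐ[volume.restrict U] u')
    (hD : Du =ᵐ[volume.restrict U] Du') : HasWeakDeriv U u' Du' := by
  refine ⟨locallyIntegrableOn_congr_ae h.1 hu, locallyIntegrableOn_congr_ae h.2.1 hD, fun φ hφ hc hs e => ?_⟩
  have := h.2.2 φ hφ hc hs e
  rw [integral_congr_ae (f := fun z => (fderiv ℝ φ z e) • u z)
      (g := fun z => (fderiv ℝ φ z e) • u' z)
    (by filter_upwards [hu] with z hz; rw [hz]),
    integral_congr_ae (f := fun z => φ z • Du z e) (g := fun z => φ z • Du' z e)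
    (by filter_upwards [hD] with z hz; rw [hz])] at this
  exact this

theorem locallyIntegrableOn_clm_apply {Du : ℂ → ℂ →L[ℝ] E} (h : LocallyIntegrableOn Du U) (e : ℂ) :
    LocallyIntegrableOn (fun z => Du z e) U := fun x hx => by
  obtain ⟨s, hs, hi⟩ := h x hx
  exact ⟨s, hs, (ContinuousLinearMap.apply ℝ E e).integrable_comp hi⟩

theorem clm_ext_one_I {L M : ℂ →L[ℝ] E} (h1 : L 1 = M 1) (hI : L I = M I) : L = M := by
  ext e
  have : e = e.re • (1 : ℂ) + e.im • I := by apply Complex.ext <;> simp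
  rw [this, map_add, map_add, map_smul, map_smul, map_smul, map_smul, h1, hI]

theorem HasWeakDeriv.sub (h : HasWeakDeriv U u Du) (h' : HasWeakDeriv U u' Du') :
    HasWeakDeriv U (fun z => u z - u' z) (fun z => Du z - Du' z) := by
  refine hasWeakDeriv_iff.2 ⟨h.1.sub h'.1, h.2.1.sub h'.2.1, fun φ hφ hc hs e => ?_⟩
  have hφe : Continuous (fun z => fderiv ℝ φ z e) := (hφ.continuous_fderiv (by simp)).clm_apply
    continuous_const
  have hce : HasCompactSupport (fun z => fderiv ℝ φ z e) :=
    hc.mono' ((subset_tsupport _).trans (tsupport_fderiv_apply_subset ℝ e))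
  have hse := (tsupport_fderiv_apply_subset ℝ e).trans hs
  simp only [smul_sub, _root_.sub_apply]
  rw [integral_sub (integrable_smul_of_tsupport_subset h.1 hφe hce hse)
    (integrable_smul_of_tsupport_subset h'.1 hφe hce hse),
    integral_sub (integrable_smul_of_tsupport_subset (locallyIntegrableOn_clm_apply h.2.1 e) hφ.continuous hc hs)
    (integrable_smul_of_tsupport_subset (locallyIntegrableOn_clm_apply h'.2.1 e) hφ.continuous hc hs),
    h.integral_eq hφ hc hs, h'.integral_eq hφ hc hs]
  abel

theorem HasWeakDeriv.ae_unique [CompleteSpace E] (hU : IsOpen U) (h : HasWeakDeriv U u Du)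
    (h' : HasWeakDeriv U u Du') : Du =ᵐ[volume.restrict U] Du' := by
  have key : ∀ e : ℂ, ∀ᵐ z, z ∈ U → Du z e - Du' z e = 0 := fun e =>
    hU.ae_eq_zero_of_integral_contDiff_smul_eq_zero
      ((locallyIntegrableOn_clm_apply h.2.1 e).sub (locallyIntegrableOn_clm_apply h'.2.1 e)) fun φ hφ hc hs => by
        have := (h.sub h').integral_eq hφ hc hs e
        simp only [sub_self, smul_zero, integral_zero, _root_.sub_apply] at this
        exact neg_eq_zero.1 this.symm
  rw [Filter.EventuallyEq, ae_restrict_iff' hU.measurableSet]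
  filter_upwards [key 1, key I] with z h1 hI hz
  exact clm_ext_one_I (sub_eq_zero.1 (h1 hz)) (sub_eq_zero.1 (hI hz))

theorem hasWeakDeriv_of_hasFDerivAt (hU : IsOpen U) (hu : ∀ z ∈ U, HasFDerivAt u (Du z) z)
    (hDu : ContinuousOn Du U) : HasWeakDeriv U u Du := by
  have hcu : ContinuousOn u U := fun z hz => (hu z hz).continuousAt.continuousWithinAt
  refine hasWeakDeriv_iff.2 ⟨hcu.locallyIntegrableOn hU.measurableSet,
    hDu.locallyIntegrableOn hU.measurableSet, fun φ hφ hc hs e => ?_⟩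
  have hφe : Continuous (fun z => fderiv ℝ φ z e) := (hφ.continuous_fderiv (by simp)).clm_apply
    continuous_const
  have hce : HasCompactSupport (fun z => fderiv ℝ φ z e) :=
    hc.mono' ((subset_tsupport _).trans (tsupport_fderiv_apply_subset ℝ e))
  have hse := (tsupport_fderiv_apply_subset ℝ e).trans hs
  have h1 := integrable_smul_of_tsupport_subset (hcu.locallyIntegrableOn hU.measurableSet) hφe hce hse
  have h2 := integrable_smul_of_tsupport_subset
    (locallyIntegrableOn_clm_apply (hDu.locallyIntegrableOn hU.measurableSet) e) hφ.continuous hc hs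
  have h3 := integrable_smul_of_tsupport_subset (hcu.locallyIntegrableOn hU.measurableSet)
    hφ.continuous hc hs
  have := integral_bilinear_hasFDerivAt_right_eq_neg_left_of_integrable (μ := volume)
    (B := ContinuousLinearMap.lsmul ℝ ℝ) (f := φ) (f' := fderiv ℝ φ) (g := u) (g' := Du) (v := e)
    h1 h2 h3 (fun x _ => (hφ.differentiable (by simp) x).hasFDerivAt) (fun x hx => hu x (hs hx))
  simp only [ContinuousLinearMap.lsmul_apply] at this
  rw [this, neg_neg]

end weak_derivatives

/-! ### The Laplacian in terms of first derivatives. -/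

section laplacian

variable {E : Type*} [NormedAddCommGroup E] [NormedSpace ℝ E]

theorem laplacian_eq_fderiv_fderiv {u : ℂ → E} {z : ℂ} (hu : DifferentiableAt ℝ (fderiv ℝ u) z) :
    Laplacian.laplacian u z = fderiv ℝ (fun w => fderiv ℝ u w 1) z 1 +
      fderiv ℝ (fun w => fderiv ℝ u w I) z I := by
  have h : ∀ e : ℂ, fderiv ℝ (fun w => fderiv ℝ u w e) z e = fderiv ℝ (fderiv ℝ u) z e e := by
    intro e
    rw [fderiv_clm_apply hu (differentiableAt_const e)]
    simp
  rw [congrFun (InnerProductSpace.laplacian_eq_iteratedFDeriv_complexPlane u) z, h, h]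
  simp [iteratedFDeriv_two_apply]

theorem laplacian_comp_affine {u : ℂ → E} (hu : ContDiff ℝ 2 u) (c : ℝ) (w z : ℂ) :
    Laplacian.laplacian (fun z => u (c • (w - z))) z = c ^ 2 • Laplacian.laplacian u (c • (w - z)) := by
  have hd1 : Differentiable ℝ u := hu.differentiable (by norm_num)
  have hd2 : ContDiff ℝ 1 (fderiv ℝ u) := hu.fderiv_right (by norm_num)
  have hd2' : Differentiable ℝ (fderiv ℝ u) := hd2.differentiable (by norm_num)
  have hA : ∀ z, HasFDerivAt (fun z : ℂ => c • (w - z)) (c • (-(ContinuousLinearMap.id ℝ ℂ))) z :=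
    fun z => ((hasFDerivAt_id z).const_sub w).const_smul c
  have h1 : ∀ z, fderiv ℝ (fun z => u (c • (w - z))) z = -c • fderiv ℝ u (c • (w - z)) := by
    intro z
    have h : HasFDerivAt (fun z => u (c • (w - z))) _ z := (hd1 _).hasFDerivAt.comp z (hA z)
    rw [h.fderiv]
    ext e; simp
  have h2 : ∀ z e, fderiv ℝ (fun z => fderiv ℝ (fun z => u (c • (w - z))) z e) z e =
      c ^ 2 • fderiv ℝ (fun w => fderiv ℝ u w e) (c • (w - z)) e := by
    intro z e
    have h3 : HasFDerivAt (fun w => fderiv ℝ u w e) _ (c • (w - z)) :=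
      ((hd2' _).clm_apply (differentiableAt_const e)).hasFDerivAt
    have h4 := (h3.comp z (hA z)).const_smul (-c)
    have : (fun z => fderiv ℝ (fun z => u (c • (w - z))) z e) =
      fun z => (-c) • ((fun w => fderiv ℝ u w e) ∘ fun z => c • (w - z)) z := by
      ext z; rw [h1]; rfl
    rw [this]
    erw [h4.fderiv]
    simp [smul_smul, sq]
  rw [laplacian_eq_fderiv_fderiv, laplacian_eq_fderiv_fderiv (hd2' _), h2, h2, smul_add]
  have : fderiv ℝ (fun z => u (c • (w - z))) = fun z => -c • fderiv ℝ u (c • (w - z)) := funext h1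
  rw [this]
  exact (((hd2' _).hasFDerivAt.comp z (hA z)).const_smul (-c)).differentiableAt

theorem contDiff_laplacian {u : ℂ → E} (hu : ContDiff ℝ ∞ u) :
    ContDiff ℝ ∞ (Laplacian.laplacian u) := by
  have h1 : ContDiff ℝ ∞ (fderiv ℝ u) := hu.fderiv_right (by simp)
  have h2 : ∀ e : ℂ, ContDiff ℝ ∞ (fun z => fderiv ℝ (fun w => fderiv ℝ u w e) z e) := fun e =>
    (ContDiff.fderiv_right (m := ∞) (h1.clm_apply contDiff_const) (by simp)).clm_apply contDiff_const
  have : Laplacian.laplacian u = fun z => fderiv ℝ (fun w => fderiv ℝ u w 1) z 1 +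
      fderiv ℝ (fun w => fderiv ℝ u w I) z I :=
    funext fun z => laplacian_eq_fderiv_fderiv (h1.differentiable (by simp) z)
  rw [this]
  exact (h2 1).add (h2 I)

theorem tsupport_laplacian_subset (u : ℂ → E) : tsupport (Laplacian.laplacian u) ⊆ tsupport u := by
  refine closure_minimal (fun z hz => ?_) (isClosed_tsupport u)
  by_contra h
  have h0 : u =ᶠ[𝓝 z] fun _ => 0 := notMem_tsupport_iff_eventuallyEq.1 h
  apply hz
  rw [(InnerProductSpace.laplacian_congr_nhds h0).eq_of_nhds]
  simp

end laplacian

/-! ### A smooth truncation of the logarithm and its Laplacian. -/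

section smooth_log

/-- A smooth function on the plane which agrees with `log |z|²` outside a disk. -/
noncomputable def smoothLog (z : ℂ) : ℝ :=
  -- The cutoff vanishes for `|z|² ≤ 1/2` and equals `1` for `|z|² ≥ 3/4`.
  Real.smoothTransition (4 * ‖z‖ ^ 2 - 2) * Real.log (‖z‖ ^ 2)

theorem smoothLog_of_le {z : ℂ} (h : 3 / 4 ≤ ‖z‖ ^ 2) : smoothLog z = Real.log (‖z‖ ^ 2) := by
  rw [smoothLog, Real.smoothTransition.one_of_one_le (by linarith), one_mul]

theorem contDiff_smoothLog : ContDiff ℝ ∞ smoothLog := by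
  rw [contDiff_iff_contDiffAt]
  intro z
  have hn : ContDiff ℝ ∞ (fun z : ℂ => ‖z‖ ^ 2) := contDiff_norm_sq ℝ
  by_cases h : ‖z‖ ^ 2 < 1 / 2
  · have : smoothLog =ᶠ[𝓝 z] fun _ => 0 := by
      filter_upwards [(hn.continuous.isOpen_preimage _ isOpen_Iio).mem_nhds h] with w hw
      have hw' : ‖w‖ ^ 2 < 1 / 2 := hw
      rw [smoothLog, Real.smoothTransition.zero_of_nonpos (by linarith), zero_mul]
    exact contDiffAt_const.congr_of_eventuallyEq this
  · have h0 : ‖z‖ ^ 2 ≠ 0 := by intro h'; rw [h'] at h; norm_num at h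
    have h1 : ContDiffAt ℝ ∞ (fun z : ℂ => Real.smoothTransition (4 * ‖z‖ ^ 2 - 2)) z :=
      (Real.smoothTransition.contDiff.comp
        ((contDiff_const.mul hn).sub contDiff_const)).contDiffAt
    exact h1.mul (hn.contDiffAt.log h0)

theorem laplacian_smoothLog_eq_zero {z : ℂ} (h : 1 ≤ ‖z‖) :
    Laplacian.laplacian smoothLog z = 0 := by
  have hn : Continuous (fun z : ℂ => ‖z‖ ^ 2) := by fun_prop
  have h1 : smoothLog =ᶠ[𝓝 z] fun w => (2 : ℝ) • Real.log ‖w‖ := by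
    filter_upwards [(hn.isOpen_preimage _ isOpen_Ioi).mem_nhds
      (show 3 / 4 < ‖z‖ ^ 2 by nlinarith)] with w hw
    rw [smoothLog_of_le (le_of_lt hw), Real.log_pow]
    simp
  have h0 : z ≠ 0 := by rintro rfl; norm_num at h
  have h2 : InnerProductSpace.HarmonicAt (fun w : ℂ => (2 : ℝ) • Real.log ‖w‖) z :=
    (AnalyticAt.harmonicAt_log_norm analyticAt_id h0).const_smul
  rw [(InnerProductSpace.laplacian_congr_nhds h1).eq_of_nhds]
  exact h2.2.eq_of_nhds

/-- The Laplacian of `smoothLog`, a mollifying kernel supported in the unit disk. -/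
noncomputable abbrev logKernel : ℂ → ℝ := Laplacian.laplacian smoothLog

theorem contDiff_logKernel : ContDiff ℝ ∞ logKernel := contDiff_laplacian contDiff_smoothLog

theorem support_logKernel_subset : Function.support logKernel ⊆ Metric.ball 0 1 := by
  intro z hz
  by_contra h
  exact hz (laplacian_smoothLog_eq_zero (by simpa using h))

theorem hasCompactSupport_logKernel : HasCompactSupport logKernel :=
  HasCompactSupport.intro (isCompact_closedBall (0 : ℂ) 1) fun z hz =>
    laplacian_smoothLog_eq_zero (by
      simp only [Metric.mem_closedBall, dist_zero_right, not_le] at hz; exact hz.le)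

theorem inner_mul_I_sq_add (ζ : ℂ) :
    (inner ℝ (1 : ℂ) ζ : ℝ) * inner ℝ (1 : ℂ) ζ + (inner ℝ I ζ : ℝ) * inner ℝ I ζ = ‖ζ‖ ^ 2 := by
  rw [Complex.sq_norm, Complex.normSq_apply]
  simp [Complex.inner]

theorem fderiv_smoothLog_circlePt (θ : ℝ) (e : ℂ) :
    fderiv ℝ smoothLog (circlePt θ) e = 2 * inner ℝ e (circlePt θ) := by
  have hn : Continuous (fun z : ℂ => ‖z‖ ^ 2) := by fun_prop
  have h1 : smoothLog =ᶠ[𝓝 (circlePt θ)] fun w => Real.log (‖w‖ ^ 2) := by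
    filter_upwards [(hn.isOpen_preimage _ isOpen_Ioi).mem_nhds
      (show 3 / 4 < ‖circlePt θ‖ ^ 2 by rw [norm_circlePt]; norm_num)] with w hw
    rw [smoothLog_of_le (le_of_lt hw)]
  have h2 : HasFDerivAt (fun w : ℂ => ‖w‖ ^ 2) (2 • innerSL ℝ (circlePt θ)) (circlePt θ) :=
    (hasStrictFDerivAt_norm_sq (circlePt θ)).hasFDerivAt
  rw [h1.fderiv_eq, (h2.log (by rw [norm_circlePt]; norm_num)).fderiv]
  simp only [norm_circlePt, _root_.smul_apply, innerSL_apply_apply, real_inner_comm]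
  norm_num
  ring

/-- By the divergence theorem this is the flux of `∇ log |z|² = 2ζ` through the unit circle. -/
theorem integral_logKernel : ∫ z, logKernel z = 4 * Real.pi := by
  have hS := contDiff_smoothLog
  have hS1 : ContDiff ℝ ∞ (fderiv ℝ smoothLog) := hS.fderiv_right (by simp)
  have key : ∀ e : ℂ, ∫ z in unitDisk, fderiv ℝ (fun w => fderiv ℝ smoothLog w e) z e =
      ∫ θ, (inner ℝ e (circlePt θ) : ℝ) * (2 * inner ℝ e (circlePt θ)) ∂angleMeasure := by
    intro e
    have hV : ContDiff ℝ ∞ (fun w => fderiv ℝ smoothLog w e) := hS1.clm_apply contDiff_const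
    have hV1 : Continuous (fderiv ℝ fun w => fderiv ℝ smoothLog w e) :=
      hV.continuous_fderiv (by simp)
    have hint : ∀ {F : Type} [NormedAddCommGroup F] (g : ℂ → F), Continuous g →
        IntegrableOn g unitDisk := fun g hg =>
      (hg.continuousOn.integrableOn_compact (isCompact_closedBall 0 1)).mono_set
        Metric.ball_subset_closedBall
    have h0 : ∀ z : ℂ, ‖z‖ ^ 2 < 1 / 2 → fderiv ℝ smoothLog z e = 0 := by
      intro z hz
      have hn : Continuous (fun z : ℂ => ‖z‖ ^ 2) := by fun_prop
      have : smoothLog =ᶠ[𝓝 z] fun _ => 0 := by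
        filter_upwards [(hn.isOpen_preimage _ isOpen_Iio).mem_nhds hz] with w hw
        have hw' : ‖w‖ ^ 2 < 1 / 2 := hw
        rw [smoothLog, Real.smoothTransition.zero_of_nonpos (by linarith), zero_mul]
      rw [this.fderiv_eq]; simp
    have := integral_unitDisk_fderiv_eq_boundary (V := fun w => fderiv ℝ smoothLog w e)
      (DV := fderiv ℝ (fun w => fderiv ℝ smoothLog w e))
      (Vb := fun θ => fderiv ℝ smoothLog (circlePt θ) e)
      (fun z _ => (hV.differentiable (by simp) z).hasFDerivAt) hV1.continuousOn
      (by
        -- The weight `1/|z|` is harmless: the derivative vanishes where `|z|² < 1/2`, and elsewhere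
        -- `1/|z| ≤ 2`.
        refine Integrable.mono' (g := fun z => 2 * ‖fderiv ℝ smoothLog z e‖)
          ((hint _ hV.continuous.norm).const_mul 2)
          (measurable_norm.inv.aestronglyMeasurable.smul hV.continuous.aestronglyMeasurable)
          (ae_of_all _ fun z => ?_)
        by_cases hz : ‖z‖ ^ 2 < 1 / 2
        · rw [h0 z hz]; simp
        · rw [norm_smul, norm_inv, norm_norm]
          refine mul_le_mul_of_nonneg_right ?_ (norm_nonneg _)
          rw [inv_le_comm₀ (by by_contra h; nlinarith [norm_nonneg z]) (by norm_num)]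
          nlinarith [norm_nonneg z])
      (hint _ hV1)
      (ae_of_all _ fun θ => by
        have : Continuous fun r : ℝ => r • fderiv ℝ smoothLog (circleMap 0 r θ) e := by
          refine continuous_id.smul (hV.continuous.comp ?_)
          unfold circleMap; fun_prop
        have h := this.tendsto 0
        rw [zero_smul] at h
        exact tendsto_nhdsWithin_of_tendsto_nhds h)
      (ae_of_all _ fun θ => by
        have : Continuous fun r : ℝ => fderiv ℝ smoothLog (circleMap 0 r θ) e := by
          refine hV.continuous.comp ?_
          unfold circleMap; fun_prop
        exact tendsto_nhdsWithin_of_tendsto_nhds (this.tendsto 1)) e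
    rw [this]
    simp only [fderiv_smoothLog_circlePt, smul_eq_mul]
  have hcirc : ∀ e : ℂ, Integrable (fun θ => (inner ℝ e (circlePt θ) : ℝ) *
      (2 * inner ℝ e (circlePt θ))) angleMeasure := fun e => by
    have : Continuous fun θ => (inner ℝ e (circlePt θ) : ℝ) * (2 * inner ℝ e (circlePt θ)) := by
      have hcp : Continuous circlePt := continuous_circleMap 0 1
      exact (continuous_const.inner hcp).mul (continuous_const.mul (continuous_const.inner hcp))
    exact (this.integrableOn_Icc (a := 0) (b := 2 * Real.pi)).mono_set Ioc_subset_Icc_self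
  have hdisk : ∀ e : ℂ, IntegrableOn (fun z => fderiv ℝ (fun w => fderiv ℝ smoothLog w e) z e)
      unitDisk := fun e => by
    have hV : ContDiff ℝ ∞ (fun w => fderiv ℝ smoothLog w e) := hS1.clm_apply contDiff_const
    have hV1 : Continuous (fun z => fderiv ℝ (fun w => fderiv ℝ smoothLog w e) z e) :=
      (hV.continuous_fderiv (by simp)).clm_apply continuous_const
    exact (hV1.continuousOn.integrableOn_compact (isCompact_closedBall 0 1)).mono_set
        Metric.ball_subset_closedBall
  rw [← setIntegral_eq_integral_of_forall_compl_eq_zero (s := unitDisk) fun z hz => by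
    by_contra h; exact hz (support_logKernel_subset h)]
  have : ∀ z, logKernel z = fderiv ℝ (fun w => fderiv ℝ smoothLog w 1) z 1 +
      fderiv ℝ (fun w => fderiv ℝ smoothLog w I) z I := fun z =>
    laplacian_eq_fderiv_fderiv (hS1.differentiable (by simp) z)
  simp_rw [this]
  rw [integral_add (hdisk 1) (hdisk I), key, key, ← integral_add (hcirc 1) (hcirc I)]
  have : ∀ θ, (inner ℝ (1 : ℂ) (circlePt θ) : ℝ) * (2 * inner ℝ (1 : ℂ) (circlePt θ)) +
      (inner ℝ I (circlePt θ) : ℝ) * (2 * inner ℝ I (circlePt θ)) = 2 := fun θ => by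
    have := inner_mul_I_sq_add (circlePt θ)
    rw [norm_circlePt] at this
    linarith
  simp_rw [this]
  simp [angleMeasure]
  rw [max_eq_left (by positivity)]
  ring

end smooth_log

theorem two_le_infty : (2 : WithTop ℕ∞) ≤ ∞ := ENat.LEInfty.out

/-! ### Weyl's lemma. -/

section weyl

/-- The mean of `u` near `w` with respect to the kernel `logKernel` at scale `ε`. -/
noncomputable def logMean (u : ℂ → ℝ) (ε : ℝ) (w : ℂ) : ℝ :=
  ∫ z, u z * ((ε⁻¹) ^ 2 * logKernel (ε⁻¹ • (w - z)))

variable {U : Set ℂ} {u : ℂ → ℝ}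

theorem logKernel_scaled_eq_zero {ε : ℝ} (hε : 0 < ε) {w z : ℂ} (h : z ∉ Metric.ball w ε) :
    logKernel (ε⁻¹ • (w - z)) = 0 := by
  apply laplacian_smoothLog_eq_zero
  rw [norm_smul, norm_inv, Real.norm_of_nonneg hε.le, ← dist_eq_norm, dist_comm]
  rw [Metric.mem_ball, not_lt] at h
  rw [le_inv_mul_iff₀ hε, mul_one]; exact h

theorem contDiff_scaled {n : WithTop ℕ∞} {F : ℂ → ℝ} (hF : ContDiff ℝ n F) (c : ℝ) (w : ℂ) :
    ContDiff ℝ n (fun z => F (c • (w - z))) :=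
  hF.comp ((contDiff_const.sub contDiff_id).const_smul c)

theorem hasCompactSupport_scaled {F : ℂ → ℝ} (hF : HasCompactSupport F) {c : ℝ} (hc : c ≠ 0)
    (w : ℂ) : HasCompactSupport (fun z => F (c • (w - z))) := by
  have := hF.comp_homeomorph ((Homeomorph.subLeft w).trans (Homeomorph.smulOfNeZero c hc))
  exact this

/-- The two means differ by the integral of `u` against the Laplacian of the difference of the
truncated logarithms at scales `ε` and `δ`. Outside the larger disk these are `log |w - z|²` minus
`2 log ε` and `2 log δ`; once that constant discrepancy is subtracted, the difference has compact
support and is an admissible test function. -/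
theorem logMean_eq_of_weaklyHarmonic
    (hu : LocallyIntegrableOn u U)
    (H : ∀ φ : ℂ → ℝ, ContDiff ℝ ∞ φ → HasCompactSupport φ → tsupport φ ⊆ U →
      ∫ z, u z * Laplacian.laplacian φ z = 0) {w : ℂ} {ε δ : ℝ} (hε : 0 < ε) (hδ : 0 < δ)
    (hεU : Metric.closedBall w ε ⊆ U) (hδU : Metric.closedBall w δ ⊆ U) :
    logMean u ε w = logMean u δ w := by
  wlog h : ε ≤ δ generalizing ε δ with Hw
  · exact (Hw hδ hε hδU hεU (le_of_not_ge h)).symm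
  set S : ℝ → ℂ → ℝ := fun ε z => smoothLog (ε⁻¹ • (w - z)) with hS
  let φ : ℂ → ℝ := fun z => S ε z - S δ z - (2 * Real.log δ - 2 * Real.log ε)
  have hSc : ∀ ε, ContDiff ℝ ∞ (S ε) := fun ε => contDiff_scaled contDiff_smoothLog _ _
  have hφ0 : ∀ z, z ∉ Metric.closedBall w δ → φ z = 0 := by
    intro z hz
    rw [Metric.mem_closedBall, not_le, dist_comm, dist_eq_norm] at hz
    have hv : ∀ η, 0 < η → η ≤ δ → S η z = 2 * Real.log ‖w - z‖ - 2 * Real.log η := by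
      intro η hη hηδ
      have h1 : 1 ≤ ‖η⁻¹ • (w - z)‖ := by
        rw [norm_smul, norm_inv, Real.norm_of_nonneg hη.le, le_inv_mul_iff₀ hη, mul_one]
        exact hηδ.trans hz.le
      simp only [hS]
      rw [smoothLog_of_le (by nlinarith), Real.log_pow, norm_smul, norm_inv,
        Real.norm_of_nonneg hη.le, Real.log_mul (inv_ne_zero hη.ne') (hδ.trans hz).ne', Real.log_inv]
      push_cast; ring
    simp only [φ, hv ε hε h, hv δ hδ le_rfl]; ring
  have hts : tsupport φ ⊆ Metric.closedBall w δ :=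
    closure_minimal (fun z hz => by by_contra h; exact hz (hφ0 z h)) Metric.isClosed_closedBall
  have hφc : HasCompactSupport φ :=
    HasCompactSupport.intro (isCompact_closedBall w δ) hφ0
  have hφ : ContDiff ℝ ∞ φ := ((hSc ε).sub (hSc δ)).sub contDiff_const
  have h0 := H φ hφ hφc (hts.trans hδU)
  have hlap : ∀ z, Laplacian.laplacian φ z = (ε⁻¹) ^ 2 * logKernel (ε⁻¹ • (w - z)) -
      (δ⁻¹) ^ 2 * logKernel (δ⁻¹ • (w - z)) := by
    intro z
    have hl : ∀ η, Laplacian.laplacian (S η) z = (η⁻¹) ^ 2 * logKernel (η⁻¹ • (w - z)) := fun η =>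
      laplacian_comp_affine (contDiff_smoothLog.of_le two_le_infty) _ _ _
    have c2 : ∀ η, ContDiffAt ℝ 2 (S η) z := fun η =>
      ((hSc η).of_le two_le_infty).contDiffAt
    have e1 : φ = (S ε - S δ) - fun _ => (2 * Real.log δ - 2 * Real.log ε) := rfl
    rw [e1, ContDiffAt.laplacian_sub (f₁ := S ε - S δ) ((c2 ε).sub (c2 δ)) contDiffAt_const,
      ContDiffAt.laplacian_sub (c2 ε) (c2 δ), hl, hl]
    simp
  have hint : ∀ η, 0 < η → Metric.closedBall w η ⊆ U →
      Integrable (fun z => u z * ((η⁻¹) ^ 2 * logKernel (η⁻¹ • (w - z)))) := by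
    intro η hη hηU
    have hk : Continuous fun z => (η⁻¹) ^ 2 * logKernel (η⁻¹ • (w - z)) :=
      continuous_const.mul (contDiff_scaled contDiff_logKernel _ _).continuous
    have hz : ∀ z ∉ Metric.closedBall w η, (η⁻¹) ^ 2 * logKernel (η⁻¹ • (w - z)) = 0 :=
      fun z hz => by
        rw [logKernel_scaled_eq_zero hη fun h => hz (Metric.ball_subset_closedBall h), mul_zero]
    have := integrable_smul_of_tsupport_subset hu hk
      (HasCompactSupport.intro (isCompact_closedBall w η) hz)
      ((closure_minimal (fun z hz' => by by_contra h; exact hz' (hz z h))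
        Metric.isClosed_closedBall).trans hηU)
    simpa only [smul_eq_mul, mul_comm] using this
  simp_rw [hlap, mul_sub] at h0
  rw [integral_sub (hint ε hε hεU) (hint δ hδ hδU), sub_eq_zero] at h0
  exact h0

theorem laplacian_convolution {g k : ℂ → ℝ} (hg : LocallyIntegrable g) (hk : ContDiff ℝ ∞ k)
    (hkc : HasCompactSupport k) (w : ℂ) :
    Laplacian.laplacian (convolution g k (ContinuousLinearMap.mul ℝ ℝ) volume) w =
      ∫ z, g z * Laplacian.laplacian k (w - z) := by
  have hf : ∀ (k : ℂ → ℝ) (_ : ContDiff ℝ ∞ k) (_ : HasCompactSupport k) (e : ℂ),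
      (fun w => fderiv ℝ (convolution g k (ContinuousLinearMap.mul ℝ ℝ) volume) w e) =
      convolution g (fun z => fderiv ℝ k z e) (ContinuousLinearMap.mul ℝ ℝ) volume := by
    intro k hk hkc e
    ext w
    rw [(hkc.hasFDerivAt_convolution_right _ hg (hk.of_le (by exact_mod_cast le_top)) w).fderiv,
      convolution_precompR_apply _ hg (hkc.fderiv ℝ) (hk.continuous_fderiv (by simp))]
  have hke : ∀ e : ℂ, ContDiff ℝ ∞ (fun z => fderiv ℝ k z e) := fun e =>
    (ContDiff.fderiv_right (m := ∞) hk (by simp)).clm_apply contDiff_const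
  have hkce : ∀ e : ℂ, HasCompactSupport (fun z => fderiv ℝ k z e) := fun e =>
    hkc.fderiv_apply ℝ e
  have hC : ContDiff ℝ ∞ (convolution g k (ContinuousLinearMap.mul ℝ ℝ) volume) :=
    hkc.contDiff_convolution_right _ hg hk
  have hC1 : ContDiff ℝ ∞ (fderiv ℝ (convolution g k (ContinuousLinearMap.mul ℝ ℝ) volume)) :=
    hC.fderiv_right (by simp)
  have hk1 : ContDiff ℝ ∞ (fderiv ℝ k) := hk.fderiv_right (by simp)
  rw [laplacian_eq_fderiv_fderiv (hC1.differentiable (by simp) w), hf k hk hkc 1, hf k hk hkc I]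
  rw [congrFun (hf _ (hke 1) (hkce 1) 1) w, congrFun (hf _ (hke I) (hkce I) I) w]
  simp only [convolution_def, ContinuousLinearMap.mul_apply']
  have hint : ∀ e : ℂ, Integrable fun z =>
      g z * fderiv ℝ (fun z => fderiv ℝ k z e) (w - z) e := fun e => by
    have hcs : HasCompactSupport (fun z => fderiv ℝ (fun z => fderiv ℝ k z e) z e) :=
      (hkce e).fderiv_apply ℝ e
    exact hcs.convolutionExists_right (ContinuousLinearMap.mul ℝ ℝ) hg
      (((hke e).continuous_fderiv (by simp)).clm_apply continuous_const) w
  rw [← integral_add (hint 1) (hint I)]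
  refine integral_congr_ae (ae_of_all _ fun z => ?_)
  simp only
  rw [laplacian_eq_fderiv_fderiv (hk1.differentiable (by simp) _), mul_add]

/-- The kernel is not assumed positive. Its normalized mass is `1`, its support lies in the disk of
radius `ε`, and it is bounded by a multiple of the inverse area of that disk; this suffices for
Lebesgue differentiation. -/
theorem ae_tendsto_logMean {g : ℂ → ℝ} (hg : LocallyIntegrable g) :
    ∀ᵐ w, Tendsto (fun ε => (4 * Real.pi)⁻¹ * logMean g ε w) (𝓝[>] 0) (𝓝 (g w)) := by
  obtain ⟨M, hM⟩ := contDiff_logKernel.continuous.bounded_above_of_compact_support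
    hasCompactSupport_logKernel
  filter_upwards [(Besicovitch.vitaliFamily (volume : Measure ℂ)).ae_tendsto_average_norm_sub hg]
    with w hw
  have hw' := hw.comp (Besicovitch.tendsto_filterAt volume w)
  have := tendsto_integral_smul_of_tendsto_average_norm_sub (μ := volume) (f := g) (c := g w)
    (a := fun ε => Metric.closedBall w ε) (l := 𝓝[>] 0)
    (g := fun (ε : ℝ) z => (4 * Real.pi)⁻¹ * ((ε⁻¹) ^ 2 * logKernel (ε⁻¹ • (w - z)))) (M / 4) hw'
    (Eventually.of_forall fun ε => hg.integrableOn_isCompact (isCompact_closedBall _ _))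
    (by
      refine tendsto_const_nhds.congr' ?_
      filter_upwards [self_mem_nhdsWithin] with ε hε
      have hε' : 0 < ε := hε
      rw [integral_const_mul, integral_const_mul,
        integral_sub_left_eq_self (fun z => logKernel (ε⁻¹ • z)) volume w,
        Measure.integral_comp_smul, integral_logKernel, Complex.finrank_real_complex,
        abs_of_nonneg (by positivity)]
      have := Real.pi_pos
      simp only [smul_eq_mul]
      field_simp)
    (by
      filter_upwards [self_mem_nhdsWithin] with ε hε z hz
      by_contra h
      refine hz ?_
      simp only
      rw [logKernel_scaled_eq_zero hε fun h' => h (Metric.ball_subset_closedBall h')]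
      simp)
    (by
      filter_upwards [self_mem_nhdsWithin] with ε hε z
      have hε' : 0 < ε := hε
      have hπ := Real.pi_pos
      have hv : (volume : Measure ℂ).real (Metric.closedBall w ε) = ε ^ 2 * Real.pi := by
        rw [Measure.real, Complex.volume_closedBall]
        simp [hε'.le]
      rw [hv, abs_mul, abs_mul, abs_of_pos (by positivity : 0 < (4 * Real.pi)⁻¹),
        abs_of_nonneg (by positivity : 0 ≤ (ε⁻¹) ^ 2)]
      have := hM (ε⁻¹ • (w - z))
      rw [Real.norm_eq_abs] at this
      calc (4 * Real.pi)⁻¹ * ((ε⁻¹) ^ 2 * |logKernel (ε⁻¹ • (w - z))|)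
          ≤ (4 * Real.pi)⁻¹ * ((ε⁻¹) ^ 2 * M) := by gcongr
        _ = M / 4 / (ε ^ 2 * Real.pi) := by field_simp)
  refine this.congr fun ε => ?_
  rw [logMean, ← integral_const_mul]
  refine integral_congr_ae (ae_of_all _ fun z => ?_)
  simp only [smul_eq_mul]; ring

/-- **Weyl's lemma**: a weakly harmonic function agrees almost everywhere with a harmonic one. -/
theorem exists_harmonicOnNhd_of_weaklyHarmonic (hU : IsOpen U) (hu : LocallyIntegrableOn u U)
    (H : ∀ φ : ℂ → ℝ, ContDiff ℝ ∞ φ → HasCompactSupport φ → tsupport φ ⊆ U →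
      ∫ z, u z * Laplacian.laplacian φ z = 0) :
    ∃ p : ℂ → ℝ, InnerProductSpace.HarmonicOnNhd p U ∧ ContDiffOn ℝ ∞ p U ∧
      u =ᵐ[volume.restrict U] p := by
  have hex : ∀ w : ℂ, ∃ δ : ℝ, 0 < δ ∧ (w ∈ U → Metric.closedBall w δ ⊆ U) := fun w => by
    by_cases hw : w ∈ U
    · obtain ⟨δ, hδ, h⟩ := Metric.nhds_basis_closedBall.mem_iff.1 (hU.mem_nhds hw)
      exact ⟨δ, hδ, fun _ => h⟩
    · exact ⟨1, one_pos, fun h => absurd h hw⟩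
  choose δ hδ hδU using hex
  -- The scale `δ w` is an arbitrary admissible choice, since the mean does not depend on it.
  let p : ℂ → ℝ := fun w => (4 * Real.pi)⁻¹ * logMean u (δ w) w
  have hp : ∀ w ε, 0 < ε → Metric.closedBall w ε ⊆ U → p w = (4 * Real.pi)⁻¹ * logMean u ε w := by
    intro w ε hε hεU
    have hw : w ∈ U := hεU (Metric.mem_closedBall_self hε.le)
    simp only [p]
    rw [logMean_eq_of_weaklyHarmonic hu H (hδ w) hε (hδU w hw) hεU]
  -- Near a given point one scale serves all nearby points, and `u` may be replaced by an integrable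
  -- truncation `g`; there `p` becomes a convolution with a smooth kernel.
  have hloc : ∀ w₀ ∈ U, ∃ ε > 0, ∃ g : ℂ → ℝ, Integrable g ∧ Metric.closedBall w₀ (2 * ε) ⊆ U ∧
      (∀ z ∈ Metric.closedBall w₀ (2 * ε), g z = u z) ∧
      ∀ η > 0, η ≤ ε → ∀ w ∈ Metric.ball w₀ ε, p w = (4 * Real.pi)⁻¹ * logMean g η w := by
    intro w₀ hw₀
    obtain ⟨r, hr, h⟩ := Metric.nhds_basis_closedBall.mem_iff.1 (hU.mem_nhds hw₀)
    have h2 : Metric.closedBall w₀ (2 * (r / 2)) ⊆ U := by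
      rw [mul_div_cancel₀ _ (two_ne_zero)]; exact h
    refine ⟨r / 2, by positivity, (Metric.closedBall w₀ (2 * (r / 2))).indicator u, ?_, h2,
      fun z hz => indicator_of_mem hz _, ?_⟩
    · rw [integrable_indicator_iff Metric.isClosed_closedBall.measurableSet]
      exact hu.integrableOn_compact_subset h2 (isCompact_closedBall _ _)
    · intro η hη hηr w hw
      have hsub : Metric.closedBall w η ⊆ Metric.closedBall w₀ (2 * (r / 2)) :=
        Metric.closedBall_subset_closedBall' (by
          have := Metric.mem_ball.1 hw; linarith)
      rw [hp w η hη (hsub.trans h2), logMean, logMean]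
      congr 1
      refine integral_congr_ae (ae_of_all _ fun z => ?_)
      simp only
      by_cases hz : z ∈ Metric.ball w η
      · rw [indicator_of_mem (hsub (Metric.ball_subset_closedBall hz))]
      · rw [logKernel_scaled_eq_zero hη hz]; simp
  have hsm : ∀ w₀ ∈ U, ContDiffAt ℝ ∞ p w₀ ∧ Laplacian.laplacian p w₀ = 0 := by
    intro w₀ hw₀
    obtain ⟨ε, hε, g, hg, hsub, hgu, hpg⟩ := hloc w₀ hw₀
    let k : ℂ → ℝ := fun x => (4 * Real.pi)⁻¹ * ((ε⁻¹) ^ 2 * logKernel (ε⁻¹ • (x - 0)))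
    have hk1 : ContDiff ℝ ∞ k := by
      refine contDiff_const.mul (contDiff_const.mul (contDiff_logKernel.comp ?_))
      exact (contDiff_id.sub contDiff_const).const_smul _
    have hks : ∀ x ∉ Metric.closedBall (0 : ℂ) ε, k x = 0 := fun x hx => by
      have := logKernel_scaled_eq_zero hε (w := x) (z := 0) (fun h => hx (by
        rw [Metric.mem_ball, dist_comm] at h
        exact h.le))
      simp only [k, this, mul_zero]
    have hk2 : HasCompactSupport k := HasCompactSupport.intro (isCompact_closedBall 0 ε) hks
    have hpe : p =ᶠ[𝓝 w₀] convolution g k (ContinuousLinearMap.mul ℝ ℝ) volume := by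
      filter_upwards [Metric.ball_mem_nhds w₀ hε] with w hw
      rw [hpg ε hε le_rfl w hw, convolution_def, logMean, ← integral_const_mul]
      refine integral_congr_ae (ae_of_all _ fun z => ?_)
      simp only [ContinuousLinearMap.mul_apply', k, sub_zero]
      ring
    refine ⟨(hk2.contDiff_convolution_right _ hg.locallyIntegrable hk1).contDiffAt.congr_of_eventuallyEq
      hpe, ?_⟩
    rw [(InnerProductSpace.laplacian_congr_nhds hpe).eq_of_nhds,
      laplacian_convolution hg.locallyIntegrable hk1 hk2]
    have hq : ContDiff ℝ ∞ fun z => k ((1 : ℝ) • (w₀ - z)) := contDiff_scaled hk1 1 w₀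
    have hlap : ∀ z, Laplacian.laplacian (fun z => k ((1 : ℝ) • (w₀ - z))) z =
        Laplacian.laplacian k (w₀ - z) := fun z => by
      rw [laplacian_comp_affine (hk1.of_le two_le_infty)]
      simp
    have hsup : tsupport (fun z => k ((1 : ℝ) • (w₀ - z))) ⊆ Metric.closedBall w₀ ε := by
      refine closure_minimal (fun z hz => ?_) Metric.isClosed_closedBall
      by_contra h
      refine hz (hks _ fun h' => h ?_)
      rw [one_smul, mem_closedBall_zero_iff, ← dist_eq_norm, dist_comm] at h'
      exact h'
    have hball : Metric.closedBall w₀ ε ⊆ Metric.closedBall w₀ (2 * ε) :=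
      Metric.closedBall_subset_closedBall (by linarith)
    -- The Laplacian of the convolution at `w₀` is the integral of `u` against the Laplacian of `z ↦
    -- k (w₀ - z)`, an admissible test function.
    have := H _ hq (hasCompactSupport_scaled hk2 one_ne_zero w₀) (hsup.trans (hball.trans hsub))
    simp_rw [hlap] at this
    rw [← this]
    refine integral_congr_ae (ae_of_all _ fun z => ?_)
    simp only
    by_cases hz : z ∈ Metric.closedBall w₀ ε
    · rw [hgu z (hball hz)]
    · rw [← hlap, image_eq_zero_of_notMem_tsupport
        fun h => hz (hsup (tsupport_laplacian_subset _ h)), mul_zero, mul_zero]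
  refine ⟨p, fun w hw => ⟨(hsm w hw).1.of_le two_le_infty, ?_⟩,
    fun w hw => (hsm w hw).1.contDiffWithinAt, ?_⟩
  · filter_upwards [hU.mem_nhds hw] with z hz using (hsm z hz).2
  rw [Filter.EventuallyEq, ae_restrict_iff' hU.measurableSet, ae_iff]
  refine measure_null_of_locally_null _ fun w₀ hw₀ => ?_
  simp only [mem_ofPred_eq, Classical.not_imp] at hw₀
  obtain ⟨ε, hε, g, hg, hsub, hgu, hpg⟩ := hloc w₀ hw₀.1
  refine ⟨_, inter_mem_nhdsWithin _ (Metric.ball_mem_nhds w₀ hε), ?_⟩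
  have := ae_tendsto_logMean hg.locallyIntegrable
  rw [ae_iff] at this
  refine measure_mono_null (fun w hw => ?_) this
  intro hlim
  have hwp := hw.1
  simp only [mem_ofPred_eq, Classical.not_imp] at hwp
  apply hwp.2
  rw [← hgu w (Metric.ball_subset_closedBall (Metric.ball_subset_ball (by linarith) hw.2))]
  -- The means converge to `g w` at almost every `w`, while at small scales they are all equal to `p
  -- w`.
  refine tendsto_nhds_unique hlim (tendsto_const_nhds.congr' ?_)
  filter_upwards [Ioc_mem_nhdsGT hε] with η hη using hpg η hη.1 hη.2 w hw.2

end weyl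

/-! ### Regularity, removable points and a chain rule for weak derivatives. -/

section weak_derivative_consequences

variable {U : Set ℂ}

theorem contDiff_fderiv_apply {F : Type*} [NormedAddCommGroup F] [NormedSpace ℝ F] {φ : ℂ → F}
    (hφ : ContDiff ℝ ∞ φ) (e : ℂ) : ContDiff ℝ ∞ (fun z => fderiv ℝ φ z e) :=
  (ContDiff.fderiv_right (m := ∞) hφ (by simp)).clm_apply contDiff_const

theorem exists_smooth_cutoff {K : Set ℂ} (hK : IsCompact K) (hU : IsOpen U) (hKU : K ⊆ U) :
    ∃ χ : ℂ → ℝ, ContDiff ℝ ∞ χ ∧ HasCompactSupport χ ∧ tsupport χ ⊆ U ∧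
      (∀ᶠ z in 𝓝ˢ K, χ z = 1) ∧ ∀ z, χ z ∈ Icc (0 : ℝ) 1 := by
  obtain ⟨L, hL, hKL, hLU⟩ := exists_compact_between hK hU hKU
  obtain ⟨χ, h1, h0, h01⟩ := exists_contMDiffMap_one_nhds_of_subset_interior (n := ⊤)
    (modelWithCornersSelf ℝ ℂ) hK.isClosed hKL
  refine ⟨χ, χ.contMDiff.contDiff, HasCompactSupport.intro hL h0, ?_, h1, h01⟩
  exact (closure_minimal (fun z hz => by by_contra h; exact hz (h0 z h)) hL.isClosed).trans hLU

theorem HasWeakDeriv.integral_mul_laplacian {u : ℂ → ℝ} {Du : ℂ → ℂ →L[ℝ] ℝ}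
    (h : HasWeakDeriv U u Du) {φ : ℂ → ℝ} (hφ : ContDiff ℝ ∞ φ)
    (hc : HasCompactSupport φ) (hs : tsupport φ ⊆ U) :
    ∫ z, u z * Laplacian.laplacian φ z = - ∫ z, covectorInner (Du z) (fderiv ℝ φ z) := by
  have hce : ∀ e : ℂ, HasCompactSupport (fun z => fderiv ℝ φ z e) := fun e => hc.fderiv_apply ℝ e
  have hse : ∀ e : ℂ, tsupport (fun z => fderiv ℝ φ z e) ⊆ U := fun e =>
    (tsupport_fderiv_apply_subset ℝ e).trans hs
  have key := fun e : ℂ => h.integral_eq (contDiff_fderiv_apply hφ e) (hce e) (hse e) e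
  have hi1 : ∀ e : ℂ, Integrable fun z => fderiv ℝ (fun z => fderiv ℝ φ z e) z e • u z := fun e =>
    integrable_smul_of_tsupport_subset h.1
      (contDiff_fderiv_apply (contDiff_fderiv_apply hφ e) e).continuous ((hce e).fderiv_apply ℝ e)
      ((tsupport_fderiv_apply_subset ℝ e).trans (hse e))
  have hi2 : ∀ e : ℂ, Integrable fun z => fderiv ℝ φ z e • Du z e := fun e =>
    integrable_smul_of_tsupport_subset (locallyIntegrableOn_clm_apply h.2.1 e)
      (contDiff_fderiv_apply hφ e).continuous (hce e) (hse e)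
  have e1 : ∀ z, u z * Laplacian.laplacian φ z =
      fderiv ℝ (fun z => fderiv ℝ φ z 1) z 1 • u z + fderiv ℝ (fun z => fderiv ℝ φ z I) z I • u z := by
    intro z
    rw [laplacian_eq_fderiv_fderiv ((ContDiff.fderiv_right (m := ∞) hφ (by simp)).differentiable
      (by simp) z)]
    simp only [smul_eq_mul]; ring
  have e2 : ∀ z, covectorInner (Du z) (fderiv ℝ φ z) =
      fderiv ℝ φ z 1 • Du z 1 + fderiv ℝ φ z I • Du z I := fun z => by
    simp only [covectorInner, smul_eq_mul]; ring
  simp_rw [e1, e2]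
  rw [integral_add (hi1 1) (hi1 I), integral_add (hi2 1) (hi2 I), key, key]
  ring

theorem HasWeakDeriv.exists_harmonic (hU : IsOpen U) {u : ℂ → ℝ} {Du : ℂ → ℂ →L[ℝ] ℝ}
    (h : HasWeakDeriv U u Du)
    (H : ∀ φ : ℂ → ℝ, ContDiff ℝ ∞ φ → HasCompactSupport φ → tsupport φ ⊆ U →
      ∫ z, covectorInner (Du z) (fderiv ℝ φ z) = 0) :
    ∃ p : ℂ → ℝ, InnerProductSpace.HarmonicOnNhd p U ∧ ContDiffOn ℝ ∞ p U ∧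
      u =ᵐ[volume.restrict U] p ∧ Du =ᵐ[volume.restrict U] fderiv ℝ p := by
  obtain ⟨p, hp, hps, hup⟩ := exists_harmonicOnNhd_of_weaklyHarmonic hU h.1
    fun φ hφ hc hs => by rw [h.integral_mul_laplacian hφ hc hs, H φ hφ hc hs, neg_zero]
  refine ⟨p, hp, hps, hup, ?_⟩
  have hpd : HasWeakDeriv U p (fderiv ℝ p) := hasWeakDeriv_of_hasFDerivAt hU
    (fun z hz => ((hps.contDiffAt (hU.mem_nhds hz)).differentiableAt (by simp)).hasFDerivAt)
    (hps.continuousOn_fderiv_of_isOpen hU (by simp))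
  exact (h.congr hup (Filter.EventuallyEq.refl _ _)).ae_unique hU hpd

/-- A zero derivative is divergence free, so Weyl's lemma supplies a smooth representative, to which
the classical statement applies. -/
theorem HasWeakDeriv.ae_const (hU : IsOpen U) (hc : IsPreconnected U) {u : ℂ → ℝ}
    (h : HasWeakDeriv U u 0) : ∃ c, ∀ᵐ z ∂volume.restrict U, u z = c := by
  obtain ⟨p, -, hps, hup, hD⟩ := h.exists_harmonic hU fun φ _ _ _ => by simp [covectorInner]
  have h0 : EqOn (fderiv ℝ p) 0 U :=
    (Measure.eqOn_open_of_ae_eq hD hU continuousOn_const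
      (hps.continuousOn_fderiv_of_isOpen hU (by simp))).symm
  obtain ⟨c, hcc⟩ := hU.exists_is_const_of_fderiv_eq_zero hc (hps.differentiableOn (by simp)) h0
  refine ⟨c, ?_⟩
  filter_upwards [hup, ae_restrict_mem hU.measurableSet] with z hz hzU
  rw [hz, hcc z hzU]

theorem HasWeakDeriv.clm_comp {E F : Type*} [NormedAddCommGroup E] [NormedSpace ℝ E]
    [NormedAddCommGroup F] [NormedSpace ℝ F] [CompleteSpace E] [CompleteSpace F]
    {u : ℂ → E} {Du : ℂ → ℂ →L[ℝ] E}
    (h : HasWeakDeriv U u Du) (L : E →L[ℝ] F) :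
    HasWeakDeriv U (fun z => L (u z)) (fun z => L.comp (Du z)) := by
  refine hasWeakDeriv_iff.2 ⟨fun x hx => ?_, fun x hx => ?_, fun φ hφ hc hs e => ?_⟩
  · obtain ⟨s, hs, hi⟩ := h.1 x hx
    exact ⟨s, hs, L.integrable_comp hi⟩
  · obtain ⟨s, hs, hi⟩ := h.2.1 x hx
    exact ⟨s, hs, (ContinuousLinearMap.compL ℝ ℂ E F L).integrable_comp hi⟩
  · have h1 := integrable_smul_of_tsupport_subset h.1 (contDiff_fderiv_apply hφ e).continuous
      (hc.fderiv_apply ℝ e) ((tsupport_fderiv_apply_subset ℝ e).trans hs)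
    have h2 := integrable_smul_of_tsupport_subset (locallyIntegrableOn_clm_apply h.2.1 e)
      hφ.continuous hc hs
    have := congrArg L (h.integral_eq hφ hc hs e)
    rw [map_neg, ← L.integral_comp_comm h1, ← L.integral_comp_comm h2] at this
    simpa using this

/-- Test functions vanishing near a point of `U` suffice, if `u` is not too singular there. -/
theorem HasWeakDeriv.of_punctured {E : Type*} [NormedAddCommGroup E] [NormedSpace ℝ E]
    {u : ℂ → E} {Du : ℂ → ℂ →L[ℝ] E} {a : ℂ} (h : HasWeakDeriv (U \ {a}) u Du)
    (hu : LocallyIntegrableOn u U) (hD : LocallyIntegrableOn Du U)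
    (hr : LocallyIntegrableOn (fun z => ‖z - a‖⁻¹ • u z) U) : HasWeakDeriv U u Du := by
  refine hasWeakDeriv_iff.2 ⟨hu, hD, fun φ hφ hc hs e => ?_⟩
  -- A cutoff that vanishes on the unit disk and equals `1` for `|x|² ≥ 2`; its dilations about `a`
  -- remove smaller and smaller neighbourhoods of `a`.
  let η : ℂ → ℝ := fun x => Real.smoothTransition (‖x‖ ^ 2 - 1)
  have hη : ContDiff ℝ ∞ η := Real.smoothTransition.contDiff.comp
    ((contDiff_norm_sq ℝ).sub contDiff_const)
  have hn : Continuous fun x : ℂ => ‖x‖ ^ 2 := by fun_prop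
  have hη0 : ∀ x, ‖x‖ ^ 2 ≤ 1 → η x = 0 := fun x hx =>
    Real.smoothTransition.zero_of_nonpos (by linarith)
  have hη1 : ∀ x, 2 ≤ ‖x‖ ^ 2 → η x = 1 := fun x hx =>
    Real.smoothTransition.one_of_one_le (by linarith)
  have hηb : ∀ x, ‖η x‖ ≤ 1 := fun x => by
    rw [Real.norm_of_nonneg (Real.smoothTransition.nonneg _)]
    exact Real.smoothTransition.le_one _
  have hDη : ∀ x, 2 < ‖x‖ ^ 2 → fderiv ℝ η x = 0 := by
    intro x hx
    have : η =ᶠ[𝓝 x] fun _ => 1 := by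
      filter_upwards [(hn.isOpen_preimage _ isOpen_Ioi).mem_nhds hx] with y hy
      exact hη1 y (le_of_lt hy)
    rw [this.fderiv_eq]; simp
  -- The product `|∇η| |x|` is invariant under dilation, so all rescaled cutoffs have gradient at
  -- most `M / |z - a|`. This is why the integrability of `u / |z - a|` dominates the error term.
  obtain ⟨M, hM⟩ : ∃ M, ∀ x, ‖fderiv ℝ η x‖ * ‖x‖ ≤ M := by
    have hcs : HasCompactSupport fun x => ‖fderiv ℝ η x‖ * ‖x‖ :=
      HasCompactSupport.intro (isCompact_closedBall 0 2) fun x hx => by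
        simp only [Metric.mem_closedBall, dist_zero_right, not_le] at hx
        rw [hDη x (by nlinarith), norm_zero, zero_mul]
    obtain ⟨M, hM⟩ := ((hη.continuous_fderiv (by simp)).norm.mul
      continuous_norm).bounded_above_of_compact_support hcs
    exact ⟨M, fun x => (le_abs_self _).trans (hM x)⟩
  let ηn : ℕ → ℂ → ℝ := fun n z => η ((n : ℝ) • (z - a))
  have hηn : ∀ n, ContDiff ℝ ∞ (ηn n) := fun n =>
    hη.comp ((contDiff_id.sub contDiff_const).const_smul _)
  have hDηn : ∀ n z, fderiv ℝ (ηn n) z e = n * fderiv ℝ η ((n : ℝ) • (z - a)) e := by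
    intro n z
    have h1 : HasFDerivAt (fun z : ℂ => (n : ℝ) • (z - a))
        ((n : ℝ) • ContinuousLinearMap.id ℝ ℂ) z := ((hasFDerivAt_id z).sub_const a).const_smul (n : ℝ)
    have h2 : HasFDerivAt (ηn n) _ z :=
      ((hη.differentiable (by simp) _).hasFDerivAt).comp z h1
    rw [h2.fderiv]; simp
  have hprod : ∀ n z, fderiv ℝ (fun z => φ z * ηn n z) z e =
      ηn n z * fderiv ℝ φ z e + φ z * fderiv ℝ (ηn n) z e := by
    intro n z
    rw [fderiv_fun_mul (hφ.differentiable (by simp) z) ((hηn n).differentiable (by simp) z)]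
    simp; ring
  have hformula : ∀ n : ℕ, 1 ≤ n → ∫ z, (ηn n z * fderiv ℝ φ z e + φ z * fderiv ℝ (ηn n) z e) • u z =
      -∫ z, (φ z * ηn n z) • Du z e := by
    intro n hn1
    have hn0 : (0 : ℝ) < n := by exact_mod_cast hn1
    rw [← h.integral_eq (hφ.mul (hηn n)) hc.mul_right ?_ e]
    · simp_rw [hprod]
    · refine subset_sdiff_singleton ((closure_mono (fun z hz => left_ne_zero_of_mul hz)).trans hs) ?_
      rw [notMem_tsupport_iff_eventuallyEq]
      filter_upwards [Metric.ball_mem_nhds a (show (0 : ℝ) < 1 / n by positivity)] with z hz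
      have : ηn n z = 0 := hη0 _ (by
        rw [norm_smul, Real.norm_of_nonneg hn0.le]
        rw [Metric.mem_ball, dist_eq_norm, lt_div_iff₀ hn0, mul_comm] at hz
        exact pow_le_one₀ (by positivity) hz.le)
      simp [this]
  have hae : ∀ᵐ z : ℂ, z ≠ a := by simp [ae_iff, measure_singleton]
  have hev : ∀ z ≠ a, ∀ᶠ n : ℕ in atTop, 2 < ‖(n : ℝ) • (z - a)‖ ^ 2 := by
    intro z hz
    have hz' : 0 < ‖z - a‖ := norm_pos_iff.2 (sub_ne_zero.2 hz)
    have : Tendsto (fun n : ℕ => (n : ℝ) * ‖z - a‖) atTop atTop :=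
      tendsto_natCast_atTop_atTop.atTop_mul_const hz'
    filter_upwards [this.eventually_gt_atTop 2] with n hn
    rw [norm_smul, Real.norm_of_nonneg (Nat.cast_nonneg n)]
    nlinarith
  have hφe := contDiff_fderiv_apply hφ e
  have hi1 := integrable_smul_of_tsupport_subset hu hφe.continuous
      (hc.fderiv_apply ℝ e) ((tsupport_fderiv_apply_subset ℝ e).trans hs)
  have hi2 := integrable_smul_of_tsupport_subset (locallyIntegrableOn_clm_apply hD e)
      hφ.continuous hc hs
  have hi3 := integrable_smul_of_tsupport_subset hr hφ.continuous hc hs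
  have hsu : ∀ c : ℕ → ℂ → ℝ, (∀ n, Continuous (c n)) → ∀ n,
      tsupport φ ⊆ U → AEStronglyMeasurable (fun z => (c n z) • (tsupport φ).indicator u z) := by
    intro c hcc n hs
    refine (hcc n).aestronglyMeasurable.smul ?_
    rw [aestronglyMeasurable_indicator_iff (isClosed_tsupport φ).measurableSet]
    exact (hu.integrableOn_compact_subset hs hc).aestronglyMeasurable
  have hlim1 : Tendsto (fun n : ℕ => ∫ z, (ηn n z * fderiv ℝ φ z e + φ z * fderiv ℝ (ηn n) z e) • u z)
      atTop (𝓝 (∫ z, fderiv ℝ φ z e • u z)) := by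
    refine tendsto_integral_of_dominated_convergence
      (fun z => ‖fderiv ℝ φ z e • u z‖ + (M * ‖e‖) * ‖φ z • (‖z - a‖⁻¹ • u z)‖) (fun n => ?_)
      (hi1.norm.add (hi3.norm.const_mul _)) (fun n => ?_) ?_
    · refine (hsu (fun n z => ηn n z * fderiv ℝ φ z e + φ z * fderiv ℝ (ηn n) z e) (fun n =>
        ((hηn n).continuous.mul hφe.continuous).add
          (hφ.continuous.mul (contDiff_fderiv_apply (hηn n) e).continuous)) n hs).congr
        (ae_of_all _ fun z => ?_)
      by_cases hz : z ∈ tsupport φ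
      · simp only [indicator_of_mem hz]
      · simp only [indicator_of_notMem hz, image_eq_zero_of_notMem_tsupport hz,
          image_eq_zero_of_notMem_tsupport fun h => hz (tsupport_fderiv_apply_subset ℝ e h)]
        simp
    · filter_upwards [hae] with z hz
      have hz' : 0 < ‖z - a‖ := norm_pos_iff.2 (sub_ne_zero.2 hz)
      rw [add_smul]
      refine (norm_add_le _ _).trans (add_le_add ?_ ?_)
      · rw [mul_smul, norm_smul]
        exact mul_le_of_le_one_left (norm_nonneg _) (hηb _)
      · rw [norm_smul, norm_smul, norm_smul, norm_mul, norm_inv, norm_norm, hDηn]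
        have h1 : ‖(n : ℝ) * fderiv ℝ η ((n : ℝ) • (z - a)) e‖ ≤ M * ‖e‖ * ‖z - a‖⁻¹ := by
          rw [← div_eq_mul_inv, le_div_iff₀ hz', norm_mul, Real.norm_of_nonneg (Nat.cast_nonneg n)]
          have h2 := hM ((n : ℝ) • (z - a))
          rw [norm_smul (n : ℝ) (z - a), Real.norm_of_nonneg (Nat.cast_nonneg n)] at h2
          calc n * ‖fderiv ℝ η ((n : ℝ) • (z - a)) e‖ * ‖z - a‖
              ≤ n * (‖fderiv ℝ η ((n : ℝ) • (z - a))‖ * ‖e‖) * ‖z - a‖ := by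
                gcongr; exact ContinuousLinearMap.le_opNorm _ _
            _ = ‖fderiv ℝ η ((n : ℝ) • (z - a))‖ * (n * ‖z - a‖) * ‖e‖ := by ring
            _ ≤ M * ‖e‖ := by gcongr
        calc _ ≤ ‖φ z‖ * (M * ‖e‖ * ‖z - a‖⁻¹) * ‖u z‖ := by gcongr
          _ = _ := by ring
    · filter_upwards [hae] with z hz
      refine tendsto_const_nhds.congr' ?_
      filter_upwards [hev z hz] with n hn
      rw [hDηn, hDη _ hn]
      have : ηn n z = 1 := hη1 _ hn.le
      simp [this]
  have hlim2 : Tendsto (fun n : ℕ => -∫ z, (φ z * ηn n z) • Du z e) atTop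
      (𝓝 (-∫ z, φ z • Du z e)) := by
    refine (tendsto_integral_of_dominated_convergence
      (fun z => ‖φ z • Du z e‖) (fun n => ?_) hi2.norm (fun n => ae_of_all _ fun z => ?_) ?_).neg
    · refine ((hηn n).continuous.aestronglyMeasurable.smul hi2.aestronglyMeasurable).congr
        (ae_of_all _ fun z => ?_)
      simp only [Pi.smul_apply', smul_smul, mul_comm]
    · rw [mul_comm, mul_smul, norm_smul]
      exact mul_le_of_le_one_left (norm_nonneg _) (hηb _)
    · filter_upwards [hae] with z hz
      refine tendsto_const_nhds.congr' ?_
      filter_upwards [hev z hz] with n hn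
      have : ηn n z = 1 := hη1 _ hn.le
      simp [this]
  refine tendsto_nhds_unique hlim1 (hlim2.congr' ?_)
  filter_upwards [eventually_ge_atTop 1] with n hn using (hformula n hn).symm

/-- The chain rule for the square of a bounded weakly differentiable function. -/
theorem HasWeakDeriv.integral_sq {a : ℂ → ℝ} {Da : ℂ → ℂ →L[ℝ] ℝ} (h : HasWeakDeriv U a Da)
    (hb : ∀ᵐ z ∂volume.restrict U, ‖a z‖ ≤ 1) {χ : ℂ → ℝ} (hχ : ContDiff ℝ ∞ χ)
    (hc : HasCompactSupport χ) (hs : tsupport χ ⊆ U) (hU : IsOpen U) (e : ℂ) :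
    ∫ z, χ z * fderiv ℝ χ z e * a z ^ 2 = - ∫ z, χ z ^ 2 * (a z * Da z e) := by
  let g : ℂ → ℝ := fun z => χ z * a z
  have hgi : Integrable g := integrable_smul_of_tsupport_subset h.1 hχ.continuous hc hs
  have hgb : ∀ᵐ z, ‖g z‖ ≤ ‖χ z‖ := by
    rw [ae_restrict_iff' hU.measurableSet] at hb
    filter_upwards [hb] with z hz
    by_cases hzU : z ∈ U
    · rw [norm_mul]; exact mul_le_of_le_one_right (norm_nonneg _) (hz hzU)
    · simp [g, image_eq_zero_of_notMem_tsupport fun h => hzU (hs h)]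
  obtain ⟨C, hC⟩ := hχ.continuous.bounded_above_of_compact_support hc
  have hgC : ∀ᵐ z, ‖g z‖ ≤ C := by filter_upwards [hgb] with z hz using hz.trans (hC z)
  -- The function `g = χ a` is mollified by even kernels, and `χ` times the mollified function is
  -- used as a test function. In the limit `∫ ∂χ · a · g = -∫ χ · ∂a · g`, which is the claim.
  let ρ : ℕ → ContDiffBump (0 : ℂ) := fun n =>
    ⟨1 / (n + 1), 2 / (n + 1), by positivity, by gcongr; norm_num⟩
  let r : ℕ → ℂ → ℝ := fun n => (ρ n).normed volume
  have hr : ∀ n, ContDiff ℝ ∞ (r n) := fun n => (ρ n).contDiff_normed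
  have hrc : ∀ n, HasCompactSupport (r n) := fun n => (ρ n).hasCompactSupport_normed
  let m : ℕ → ℂ → ℝ := fun n => convolution (r n) g (ContinuousLinearMap.lsmul ℝ ℝ) volume
  have hmc : ∀ n, ContDiff ℝ ∞ (m n) := fun n =>
    (hrc n).contDiff_convolution_left _ (hr n) hgi.locallyIntegrable
  have hmd : ∀ n x, fderiv ℝ (m n) x e = ∫ y, fderiv ℝ (r n) (x - y) e * g y := by
    intro n x
    have e0 : m n = convolution g (r n) (ContinuousLinearMap.lsmul ℝ ℝ).flip volume := by
      rw [convolution_flip]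
    rw [e0, ((hrc n).hasFDerivAt_convolution_right _ hgi.locallyIntegrable
      ((hr n).of_le (by simp)) x).fderiv,
      convolution_precompR_apply _ hgi.locallyIntegrable ((hrc n).fderiv ℝ)
        ((hr n).continuous_fderiv (by simp)), convolution_def]
    simp
  have hmb : ∀ n x, ‖m n x‖ ≤ C := by
    intro n x
    have : m n x = ∫ t, r n t * g (x - t) := by simp [m, convolution_def]
    rw [this]
    have hint : Integrable (fun t => r n t * C) :=
      ((hr n).continuous.integrable_of_hasCompactSupport (hrc n)).mul_const C
    refine (norm_integral_le_of_norm_le hint ?_).trans ?_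
    · have h2 : ∀ᵐ t, ‖g (x - t)‖ ≤ C :=
        (Measure.measurePreserving_sub_left volume x).quasiMeasurePreserving.ae hgC
      filter_upwards [h2] with t ht
      rw [norm_mul, Real.norm_of_nonneg ((ρ n).nonneg_normed t)]
      exact mul_le_mul_of_nonneg_left ht ((ρ n).nonneg_normed t)
    · rw [integral_mul_const, (ρ n).integral_normed, one_mul]
  have hmlim : ∀ᵐ x, Tendsto (fun n => m n x) atTop (𝓝 (g x)) := by
    refine ContDiffBump.ae_convolution_tendsto_right_of_locallyIntegrable (K := 2) ?_ ?_
      hgi.locallyIntegrable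
    · have := tendsto_one_div_add_atTop_nhds_zero_nat (𝕜 := ℝ)
      have h2 := this.const_mul 2
      simp only [mul_zero] at h2
      refine h2.congr fun n => ?_
      simp [ρ]; ring
    · refine Eventually.of_forall fun n => ?_
      simp only [ρ]; apply le_of_eq; ring
  -- The derivative of an even kernel is odd, so exchanging `x` and `y` in the double integral
  -- changes its sign.
  have hanti : ∀ n, ∫ x, g x * fderiv ℝ (m n) x e = 0 := by
    intro n
    have hodd : ∀ x, fderiv ℝ (r n) (-x) e = - fderiv ℝ (r n) x e := by
      intro x
      have h1 : (fun y => r n (-y)) = r n := funext fun y => (ρ n).normed_neg y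
      have h2 : HasFDerivAt (fun y => r n (-y)) _ x :=
        ((hr n).differentiable (by simp) (-x)).hasFDerivAt.comp x (hasFDerivAt_id x).neg
      rw [h1] at h2
      rw [h2.fderiv]; simp
    obtain ⟨C', hC'⟩ := (contDiff_fderiv_apply (hr n) e).continuous.bounded_above_of_compact_support
      ((hrc n).fderiv_apply ℝ e)
    have hint : Integrable (fun p : ℂ × ℂ => fderiv ℝ (r n) (p.1 - p.2) e * (g p.1 * g p.2))
        (volume.prod volume) := by
      refine (hgi.mul_prod hgi).bdd_mul (c := C') ?_ (ae_of_all _ fun p => hC' _)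
      exact ((contDiff_fderiv_apply (hr n) e).continuous.comp
        (continuous_fst.sub continuous_snd)).aestronglyMeasurable
    have e1 : ∫ x, g x * fderiv ℝ (m n) x e =
        ∫ x, ∫ y, fderiv ℝ (r n) (x - y) e * (g x * g y) := by
      refine integral_congr_ae (ae_of_all _ fun x => ?_)
      simp only
      rw [hmd, ← integral_const_mul]
      refine integral_congr_ae (ae_of_all _ fun y => ?_)
      simp only; ring
    have e2 : ∫ x, ∫ y, fderiv ℝ (r n) (x - y) e * (g x * g y) =
        -∫ x, ∫ y, fderiv ℝ (r n) (x - y) e * (g x * g y) := by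
      conv_lhs => rw [integral_integral_swap hint]
      rw [← integral_neg]
      refine integral_congr_ae (ae_of_all _ fun x => ?_)
      simp only
      rw [← integral_neg]
      refine integral_congr_ae (ae_of_all _ fun y => ?_)
      simp only
      rw [← neg_sub x y, hodd, mul_comm (g y)]; ring
    rw [e1]; linarith
  have hformula : ∀ n, ∫ z, (fderiv ℝ χ z e * a z) * m n z = -∫ z, (χ z * Da z e) * m n z := by
    intro n
    have h1 := h.integral_eq (hχ.mul (hmc n)) hc.mul_right
      ((closure_mono (fun z hz => left_ne_zero_of_mul hz)).trans hs) e
    have hprod : ∀ z, fderiv ℝ (fun z => χ z * m n z) z e • a z =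
        (fderiv ℝ χ z e * a z) * m n z + g z * fderiv ℝ (m n) z e := by
      intro z
      rw [fderiv_fun_mul (hχ.differentiable (by simp) z) ((hmc n).differentiable (by simp) z)]
      simp [g]; ring
    simp_rw [hprod] at h1
    have hi1 := integrable_smul_of_tsupport_subset h.1 (contDiff_fderiv_apply hχ e).continuous
      (hc.fderiv_apply ℝ e) ((tsupport_fderiv_apply_subset ℝ e).trans hs)
    have hcg : HasCompactSupport g := hc.mul_right
    rw [integral_add ?_ ?_, hanti n, add_zero] at h1
    · rw [h1]
      congr 1
      refine integral_congr_ae (ae_of_all _ fun z => ?_)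
      simp only [smul_eq_mul]; ring
    · simp only [smul_eq_mul] at hi1
      have := hi1.bdd_mul (c := C) (hmc n).continuous.aestronglyMeasurable (ae_of_all _ (hmb n))
      simpa only [mul_comm] using this
    · have hcf : Continuous fun z => χ z * fderiv ℝ (m n) z e :=
        hχ.continuous.mul (contDiff_fderiv_apply (hmc n) e).continuous
      have := integrable_smul_of_tsupport_subset h.1 hcf hc.mul_right
        ((closure_mono (fun z hz => left_ne_zero_of_mul hz)).trans hs)
      refine this.congr (ae_of_all _ fun z => ?_)
      simp only [smul_eq_mul, g]; ring
  have hi1 := integrable_smul_of_tsupport_subset h.1 (contDiff_fderiv_apply hχ e).continuous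
      (hc.fderiv_apply ℝ e) ((tsupport_fderiv_apply_subset ℝ e).trans hs)
  have hi2 := integrable_smul_of_tsupport_subset (locallyIntegrableOn_clm_apply h.2.1 e)
      hχ.continuous hc hs
  simp only [smul_eq_mul] at hi1 hi2
  have hl : ∀ k : ℂ → ℝ, Integrable k → Tendsto (fun n => ∫ z, k z * m n z) atTop
      (𝓝 (∫ z, k z * g z)) := by
    intro k hk
    refine tendsto_integral_of_dominated_convergence (fun z => ‖k z‖ * C)
      (fun n => hk.aestronglyMeasurable.mul (hmc n).continuous.aestronglyMeasurable)
      (hk.norm.mul_const C) (fun n => ae_of_all _ fun z => ?_) ?_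
    · rw [norm_mul]; exact mul_le_mul_of_nonneg_left (hmb n z) (norm_nonneg _)
    · filter_upwards [hmlim] with z hz using hz.const_mul _
  have := tendsto_nhds_unique (hl _ hi1) (((hl _ hi2).neg).congr fun n => (hformula n).symm)
  convert this using 1
  · refine integral_congr_ae (ae_of_all _ fun z => ?_)
    simp only [g]; ring
  · congr 1
    refine integral_congr_ae (ae_of_all _ fun z => ?_)
    simp only [g]; ring

end weak_derivative_consequences

/-! ### Weakly differentiable maps into the circle. -/

section unit_vector_fields

variable {U : Set ℂ}

theorem locallyIntegrableOn_fun_add {E : Type*} [NormedAddCommGroup E] {u v : ℂ → E}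
    (hu : LocallyIntegrableOn u U) (hv : LocallyIntegrableOn v U) :
    LocallyIntegrableOn (fun z => u z + v z) U := hu.add hv

theorem HasWeakDeriv.add {E : Type*} [NormedAddCommGroup E] [NormedSpace ℝ E] {u u' : ℂ → E}
    {Du Du' : ℂ → ℂ →L[ℝ] E} (h : HasWeakDeriv U u Du) (h' : HasWeakDeriv U u' Du') :
    HasWeakDeriv U (fun z => u z + u' z) (fun z => Du z + Du' z) := by
  have h0 : HasWeakDeriv U (fun z => -u' z) (fun z => -Du' z) := by
    refine ⟨h'.1.neg, h'.2.1.neg, fun φ hφ hc hs e => ?_⟩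
    have := h'.2.2 φ hφ hc hs e
    simp only [smul_neg, _root_.neg_apply, integral_neg, this]
  simpa using h.sub h0

theorem HasWeakDeriv.smooth_mul (hU : IsOpen U) {a b : ℂ → ℝ} {Db : ℂ → ℂ →L[ℝ] ℝ}
    (h : HasWeakDeriv U b Db) (ha : ContDiffOn ℝ ∞ a U) :
    HasWeakDeriv U (fun z => a z * b z) (fun z => a z • Db z + b z • fderiv ℝ a z) := by
  have hda : ContinuousOn (fderiv ℝ a) U := ha.continuousOn_fderiv_of_isOpen hU (by simp)
  have hlc : IsLocallyClosed U := hU.isLocallyClosed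
  have hl1 : LocallyIntegrableOn (fun z => a z * b z) U :=
    h.1.continuousOn_mul ha.continuousOn hlc
  have hl2 : LocallyIntegrableOn (fun z => a z • Db z) U :=
    h.2.1.continuousOn_smul hlc ha.continuousOn
  have hl3 : LocallyIntegrableOn (fun z => b z • fderiv ℝ a z) U :=
    h.1.smul_continuousOn hlc hda
  have hl4 : LocallyIntegrableOn (fun z => a z • Db z + b z • fderiv ℝ a z) U :=
    locallyIntegrableOn_fun_add hl2 hl3
  refine hasWeakDeriv_iff.2 ⟨hl1, hl4, fun φ hφ hc hs e => ?_⟩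
  have hts : tsupport (fun z => φ z * a z) ⊆ tsupport φ :=
    closure_mono fun z hz => left_ne_zero_of_mul hz
  have hφa : ContDiff ℝ ∞ (fun z => φ z * a z) := by
    rw [contDiff_iff_contDiffAt]
    intro z
    by_cases hz : z ∈ tsupport φ
    · exact hφ.contDiffAt.mul (ha.contDiffAt (hU.mem_nhds (hs hz)))
    · have : (fun z => φ z * a z) =ᶠ[𝓝 z] fun _ => 0 := by
        filter_upwards [notMem_tsupport_iff_eventuallyEq.1 hz] with w hw
        simp [hw]
      exact contDiffAt_const.congr_of_eventuallyEq this
  have h1 := h.integral_eq hφa hc.mul_right (hts.trans hs) e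
  have hd : ∀ z, fderiv ℝ (fun z => φ z * a z) z e • b z =
      fderiv ℝ φ z e • (a z * b z) + φ z • (b z * fderiv ℝ a z e) := by
    intro z
    by_cases hz : z ∈ tsupport φ
    · rw [fderiv_fun_mul (hφ.differentiable (by simp) z)
        ((ha.contDiffAt (hU.mem_nhds (hs hz))).differentiableAt (by simp))]
      simp; ring
    · rw [image_eq_zero_of_notMem_tsupport hz,
        image_eq_zero_of_notMem_tsupport fun h => hz (tsupport_fderiv_apply_subset ℝ e h)]
      have := image_eq_zero_of_notMem_tsupport
        fun h => hz (hts (tsupport_fderiv_apply_subset ℝ (f := fun z => φ z * a z) e h))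
      rw [this]; simp
  simp_rw [hd] at h1
  have i1 := integrable_smul_of_tsupport_subset hl1 (contDiff_fderiv_apply hφ e).continuous
    (hc.fderiv_apply ℝ e) ((tsupport_fderiv_apply_subset ℝ e).trans hs)
  have i2 := integrable_smul_of_tsupport_subset (locallyIntegrableOn_clm_apply hl2 e)
      hφ.continuous hc hs
  have i3 := integrable_smul_of_tsupport_subset (locallyIntegrableOn_clm_apply hl3 e)
      hφ.continuous hc hs
  simp only [_root_.smul_apply, smul_eq_mul, _root_.add_apply, mul_add] at i1 i2 i3 h1 ⊢
  rw [integral_add i1 i3] at h1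
  rw [integral_add i2 i3, eq_sub_of_add_eq h1]
  have : ∀ z, φ z * a z * Db z e = φ z * (a z * Db z e) := fun z => by ring
  simp_rw [this]; ring

theorem tsupport_sq_subset (χ : ℂ → ℝ) : tsupport (fun z => χ z ^ 2) ⊆ tsupport χ :=
  closure_mono fun z (hz : χ z ^ 2 ≠ 0) => (fun h0 => hz (by simp [h0]) : χ z ≠ 0)

theorem HasWeakDeriv.re {w : ℂ → ℂ} {Dw : ℂ → ℂ →L[ℝ] ℂ} (h : HasWeakDeriv U w Dw) :
    HasWeakDeriv U (fun z => (w z).re) (fun z => reCLM.comp (Dw z)) := h.clm_comp reCLM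

theorem HasWeakDeriv.im {w : ℂ → ℂ} {Dw : ℂ → ℂ →L[ℝ] ℂ} (h : HasWeakDeriv U w Dw) :
    HasWeakDeriv U (fun z => (w z).im) (fun z => imCLM.comp (Dw z)) := h.clm_comp imCLM

/-- This is the derivative of `|w|² = 1`. Adding the chain rules for the real and imaginary parts,
the integral of `χ² ⟨w, ∂_e w⟩` equals `-∫ χ ∂_e χ |w|² = -½ ∫ ∂_e (χ²) = 0`. -/
theorem HasWeakDeriv.ae_inner_eq_zero (hU : IsOpen U) {w : ℂ → ℂ} {Dw : ℂ → ℂ →L[ℝ] ℂ}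
    (h : HasWeakDeriv U w Dw) (hw : ∀ᵐ z ∂volume.restrict U, ‖w z‖ = 1) (e : ℂ) :
    ∀ᵐ z ∂volume.restrict U, (w z).re * (Dw z e).re + (w z).im * (Dw z e).im = 0 := by
  set k : ℂ → ℝ := fun z => (w z).re * (Dw z e).re + (w z).im * (Dw z e).im with hk
  have hre : ∀ᵐ z ∂volume.restrict U, ‖(w z).re‖ ≤ 1 := by
    filter_upwards [hw] with z hz using hz ▸ Complex.abs_re_le_norm _
  have him : ∀ᵐ z ∂volume.restrict U, ‖(w z).im‖ ≤ 1 := by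
    filter_upwards [hw] with z hz using hz ▸ Complex.abs_im_le_norm _
  have hbl : ∀ a b : ℂ → ℝ, LocallyIntegrableOn a U → LocallyIntegrableOn b U →
      (∀ᵐ z ∂volume.restrict U, ‖a z‖ ≤ 1) → LocallyIntegrableOn (fun z => a z * b z) U := by
    intro a b ha hb hab x hx
    obtain ⟨s, hs, hi⟩ := ha x hx
    obtain ⟨t, ht, hj⟩ := hb x hx
    refine ⟨s ∩ t ∩ U, inter_mem (inter_mem hs ht) self_mem_nhdsWithin, ?_⟩
    exact Integrable.bdd_mul (hj.mono_set (inter_subset_left.trans inter_subset_right)) (c := 1)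
      (hi.mono_set (inter_subset_left.trans inter_subset_left)).aestronglyMeasurable
      (ae_restrict_of_ae_restrict_of_subset inter_subset_right hab)
  have hl1 := hbl _ _ h.re.1 (locallyIntegrableOn_clm_apply h.re.2.1 e) hre
  have hl2 := hbl _ _ h.im.1 (locallyIntegrableOn_clm_apply h.im.2.1 e) him
  have hkl : LocallyIntegrableOn k U := hl1.add hl2
  have hq : ∀ χ : ℂ → ℝ, ContDiff ℝ ∞ χ → HasCompactSupport χ → tsupport χ ⊆ U →
      ∫ z, χ z ^ 2 * k z = 0 := by
    intro χ hχ hc hs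
    have h1 := h.re.integral_sq hre hχ hc hs hU e
    have h2 := h.im.integral_sq him hχ hc hs hU e
    have hsq : ∀ (a : ℂ → ℝ), LocallyIntegrableOn a U → (∀ᵐ z ∂volume.restrict U, ‖a z‖ ≤ 1) →
        Integrable fun z => χ z * fderiv ℝ χ z e * a z ^ 2 := by
      intro a ha hab
      refine (integrable_smul_of_tsupport_subset (hbl a a ha ha hab)
        (hχ.continuous.mul (contDiff_fderiv_apply hχ e).continuous) hc.mul_right
        ((closure_mono fun z hz => left_ne_zero_of_mul hz).trans hs)).congr
        (ae_of_all _ fun z => ?_)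
      simp only [smul_eq_mul, sq, Pi.mul_apply]
    have hc2 : HasCompactSupport fun z => χ z ^ 2 :=
      hc.comp_left (g := fun x : ℝ => x ^ 2) (by simp)
    have hs2 : tsupport (fun z => χ z ^ 2) ⊆ U :=
      (tsupport_sq_subset χ).trans hs
    have j1 : Integrable fun z => χ z ^ 2 * ((w z).re * (reCLM.comp (Dw z)) e) :=
      integrable_smul_of_tsupport_subset hl1 (hχ.continuous.pow 2) hc2 hs2
    have j2 : Integrable fun z => χ z ^ 2 * ((w z).im * (imCLM.comp (Dw z)) e) :=
      integrable_smul_of_tsupport_subset hl2 (hχ.continuous.pow 2) hc2 hs2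
    have hsum := congrArg₂ (· + ·) h1 h2
    rw [← integral_add (hsq _ h.re.1 hre) (hsq _ h.im.1 him), ← neg_add,
      ← integral_add j1 j2] at hsum
    have e1 : ∫ z, (χ z * fderiv ℝ χ z e * (w z).re ^ 2 + χ z * fderiv ℝ χ z e * (w z).im ^ 2) =
        ∫ z, χ z * fderiv ℝ χ z e := by
      refine integral_congr_ae ?_
      rw [ae_restrict_iff' hU.measurableSet] at hw
      filter_upwards [hw] with z hz
      by_cases hzU : z ∈ U
      · have : (w z).re ^ 2 + (w z).im ^ 2 = 1 := by
          have := Complex.sq_norm (w z)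
          rw [hz hzU, Complex.normSq_apply] at this; nlinarith
        rw [← mul_add, this, mul_one]
      · simp [image_eq_zero_of_notMem_tsupport fun h => hzU (hs h)]
    have e2 : ∫ z, χ z * fderiv ℝ χ z e = 0 := by
      have hi : Integrable fun z => χ z * fderiv ℝ χ z e :=
        (hχ.continuous.mul (contDiff_fderiv_apply hχ e).continuous).integrable_of_hasCompactSupport
          hc.mul_right
      have := integral_mul_fderiv_eq_neg_fderiv_mul_of_integrable (μ := volume) (f := χ) (g := χ)
        (v := e) (by simpa only [mul_comm] using hi) hi
        ((hχ.continuous.mul hχ.continuous).integrable_of_hasCompactSupport hc.mul_right)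
        (fun x _ => hχ.differentiable (by simp) x) (fun x _ => hχ.differentiable (by simp) x)
      simp_rw [mul_comm (fderiv ℝ χ _ e)] at this
      linarith
    rw [e1, e2] at hsum
    have := neg_eq_zero.1 hsum.symm
    rw [← this]
    refine integral_congr_ae (ae_of_all _ fun z => ?_)
    simp [hk]; ring
  have hall : ∀ φ : ℂ → ℝ, ContDiff ℝ ∞ φ → HasCompactSupport φ → tsupport φ ⊆ U →
      ∫ z, φ z • k z = 0 := by
    intro φ hφ hc hs
    obtain ⟨χ, hχ, hχc, hχs, hχ1, -⟩ := exists_smooth_cutoff hc hU hs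
    have hφχ : ∀ z, φ z * χ z = φ z := fun z => by
      by_cases hz : z ∈ tsupport φ
      · rw [hχ1.self_of_nhdsSet z hz, mul_one]
      · rw [image_eq_zero_of_notMem_tsupport hz, zero_mul]
    -- So far only squares are admitted as test functions. Polarization, with a cutoff `χ` equal to
    -- `1` on the support of `φ`, gives `4φ = (φ + χ)² - (φ - χ)²`.
    have s1 : tsupport (fun z => φ z + χ z) ⊆ U := (tsupport_add φ χ).trans (union_subset hs hχs)
    have s2 : tsupport (fun z => φ z - χ z) ⊆ U := (tsupport_sub φ χ).trans (union_subset hs hχs)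
    have h1 := hq _ (hφ.add hχ) (hc.add hχc) s1
    have h2 := hq _ (hφ.sub hχ) (hc.sub hχc) s2
    have i : ∀ ψ : ℂ → ℝ, Continuous ψ → HasCompactSupport ψ → tsupport ψ ⊆ U →
        Integrable fun z => ψ z ^ 2 * k z := fun ψ h1 h2 h3 =>
      integrable_smul_of_tsupport_subset hkl (h1.pow 2)
        (h2.comp_left (g := fun x : ℝ => x ^ 2) (by simp))
        ((tsupport_sq_subset ψ).trans h3)
    have h3 : ∫ z, ((φ z + χ z) ^ 2 * k z - (φ z - χ z) ^ 2 * k z) = 0 := by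
      rw [integral_sub (i _ (hφ.add hχ).continuous (hc.add hχc) s1)
        (i _ (hφ.sub hχ).continuous (hc.sub hχc) s2), h1, h2, sub_zero]
    have h4 : ∀ z, (φ z + χ z) ^ 2 * k z - (φ z - χ z) ^ 2 * k z = 4 * (φ z • k z) := fun z => by
      rw [smul_eq_mul]; linear_combination (4 * k z) * hφχ z
    simp_rw [h4] at h3
    rw [integral_const_mul] at h3
    linarith
  rw [ae_restrict_iff' hU.measurableSet]
  exact hU.ae_eq_zero_of_integral_contDiff_smul_eq_zero hkl hall

/-- Both differentials are tangent to the circle and, by hypothesis, have the same angular velocity,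
so `w ū` has zero weak derivative. -/
theorem ae_eq_const_mul_of_pairForm_eq (hU : IsOpen U) (hUc : IsPreconnected U)
    {u w : ℂ → ℂ} {Dw : ℂ → ℂ →L[ℝ] ℂ} (hu : ContDiffOn ℝ ∞ u U) (hu1 : ∀ z ∈ U, ‖u z‖ = 1)
    (h : HasWeakDeriv U w Dw) (hw1 : ∀ᵐ z ∂volume.restrict U, ‖w z‖ = 1)
    (hp : pairForm Dw (fun z => -(I * w z)) =ᵐ[volume.restrict U]
      pairForm (fderiv ℝ u) (fun z => -(I * u z))) :
    ∃ c : ℂ, ∀ᵐ z ∂volume.restrict U, w z = c * u z := by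
  have hre : ContDiffOn ℝ ∞ (fun z => (u z).re) U := reCLM.contDiff.comp_contDiffOn hu
  have him : ContDiffOn ℝ ∞ (fun z => (u z).im) U := imCLM.contDiff.comp_contDiffOn hu
  have hud : ∀ z ∈ U, DifferentiableAt ℝ u z := fun z hz =>
    (hu.contDiffAt (hU.mem_nhds hz)).differentiableAt (by simp)
  have hfre : ∀ z ∈ U, ∀ e, fderiv ℝ (fun z => (u z).re) z e = (fderiv ℝ u z e).re := by
    intro z hz e
    have : HasFDerivAt (fun z => (u z).re) _ z := reCLM.hasFDerivAt.comp z (hud z hz).hasFDerivAt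
    rw [this.fderiv]; simp
  have hfim : ∀ z ∈ U, ∀ e, fderiv ℝ (fun z => (u z).im) z e = (fderiv ℝ u z e).im := by
    intro z hz e
    have : HasFDerivAt (fun z => (u z).im) _ z := imCLM.hasFDerivAt.comp z (hud z hz).hasFDerivAt
    rw [this.fderiv]; simp
  have hnu : ∀ z ∈ U, (u z).re ^ 2 + (u z).im ^ 2 = 1 := fun z hz => by
    have := Complex.sq_norm (u z)
    rw [hu1 z hz, Complex.normSq_apply] at this; nlinarith
  have hou : ∀ z ∈ U, ∀ e, (u z).re * (fderiv ℝ u z e).re + (u z).im * (fderiv ℝ u z e).im = 0 := by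
    intro z hz e
    have h1 : (fun z => (u z).re * (u z).re + (u z).im * (u z).im) =ᶠ[𝓝 z] fun _ => 1 := by
      filter_upwards [hU.mem_nhds hz] with y hy
      rw [← hnu y hy]; ring
    have d1 : HasFDerivAt (fun z => (u z).re) (fderiv ℝ (fun z => (u z).re) z) z := ((hre.contDiffAt (hU.mem_nhds hz)).differentiableAt (by simp)).hasFDerivAt
    have d2 : HasFDerivAt (fun z => (u z).im) (fderiv ℝ (fun z => (u z).im) z) z := ((him.contDiffAt (hU.mem_nhds hz)).differentiableAt (by simp)).hasFDerivAt
    have h2 := h1.fderiv_eq (𝕜 := ℝ)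
    have h3 := (d1.fun_mul d1).fun_add (d2.fun_mul d2)
    rw [h3.fderiv] at h2
    have h4 := congrArg (fun L => L e) h2
    simp [hfre z hz, hfim z hz] at h4
    linarith
  -- the algebra at a point
  have alg : ∀ᵐ z ∂volume.restrict U, ∀ e ∈ ({1, I} : Set ℂ),
      ((u z).re * (Dw z e).re + (w z).re * (fderiv ℝ u z e).re) +
        ((u z).im * (Dw z e).im + (w z).im * (fderiv ℝ u z e).im) = 0 ∧
      ((u z).re * (Dw z e).im + (w z).im * (fderiv ℝ u z e).re) -
        ((u z).im * (Dw z e).re + (w z).re * (fderiv ℝ u z e).im) = 0 := by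
    filter_upwards [hp, h.ae_inner_eq_zero hU hw1 1, h.ae_inner_eq_zero hU hw1 I, hw1,
      ae_restrict_mem hU.measurableSet] with z hz h1 hI hwz hzU e he
    have hnw : (w z).re ^ 2 + (w z).im ^ 2 = 1 := by
      have := Complex.sq_norm (w z)
      rw [hwz, Complex.normSq_apply] at this; nlinarith
    have ho : (w z).re * (Dw z e).re + (w z).im * (Dw z e).im = 0 := by
      rcases he with rfl | rfl
      · exact h1
      · exact hI
    have hpe := congrArg (fun L => L e) hz
    simp only [pairForm, ContinuousLinearMap.comp_apply, innerSL_apply_apply, Complex.inner] at hpe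
    simp at hpe
    have hu' := hou z hzU e
    have hn' := hnu z hzU
    generalize (u z).re = a at *
    generalize (u z).im = b at *
    generalize (w z).re = c at *
    generalize (w z).im = d at *
    generalize (Dw z e).re = p at *
    generalize (Dw z e).im = q at *
    generalize (fderiv ℝ u z e).re = r at *
    generalize (fderiv ℝ u z e).im = s at *
    -- `t` is the common angular velocity: the derivatives in the direction `e` are `t i w` and `t i
    -- u`.
    obtain ⟨t, ht⟩ : ∃ t, t = c * q - d * p := ⟨_, rfl⟩
    have ht' : a * s - b * r = t := by rw [ht]; linarith
    have hp' : p = -(t * d) := by rw [ht]; linear_combination (-p) * hnw + c * ho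
    have hq' : q = t * c := by rw [ht]; linear_combination (-q) * hnw + d * ho
    have hr' : r = -(t * b) := by rw [← ht']; linear_combination (-r) * hn' + a * hu'
    have hs' : s = t * a := by rw [← ht']; linear_combination (-s) * hn' + b * hu'
    constructor
    · rw [hp', hq', hr', hs']; ring
    · rw [hp', hq', hr', hs']; ring
  have k1 := (h.re.smooth_mul hU hre).add (h.im.smooth_mul hU him)
  have k2 := (h.im.smooth_mul hU hre).sub (h.re.smooth_mul hU him)
  -- The real part of `w ū`; the imaginary part comes next.
  have z1 : HasWeakDeriv U (fun z => (u z).re * (w z).re + (u z).im * (w z).im) 0 := by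
    refine k1.congr (Filter.EventuallyEq.refl _ _) ?_
    filter_upwards [alg, ae_restrict_mem hU.measurableSet] with z hz hzU
    refine clm_ext_one_I ?_ ?_
    · simpa [hfre z hzU, hfim z hzU] using (hz 1 (by simp)).1
    · simpa [hfre z hzU, hfim z hzU] using (hz I (by simp)).1
  have z2 : HasWeakDeriv U (fun z => (u z).re * (w z).im - (u z).im * (w z).re) 0 := by
    refine k2.congr (Filter.EventuallyEq.refl _ _) ?_
    filter_upwards [alg, ae_restrict_mem hU.measurableSet] with z hz hzU
    refine clm_ext_one_I ?_ ?_
    · simpa [hfre z hzU, hfim z hzU] using (hz 1 (by simp)).2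
    · simpa [hfre z hzU, hfim z hzU] using (hz I (by simp)).2
  obtain ⟨c₁, hc₁⟩ := z1.ae_const hU hUc
  obtain ⟨c₂, hc₂⟩ := z2.ae_const hU hUc
  refine ⟨⟨c₁, c₂⟩, ?_⟩
  filter_upwards [hc₁, hc₂, ae_restrict_mem hU.measurableSet] with z h1 h2 hzU
  have hn' := hnu z hzU
  apply Complex.ext
  · rw [Complex.mul_re]; simp only [← h1, ← h2]; linear_combination (-(w z).re) * hn'
  · rw [Complex.mul_im]; simp only [← h1, ← h2]; linear_combination (-(w z).im) * hn'

end unit_vector_fields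

/-! ### Fourier coefficients of periodic functions. -/

section fourier

/-- The Fourier coefficients of a `2π`-periodic function. -/
noncomputable abbrev fourierAngle (G : ℝ → ℂ) (n : ℤ) : ℂ := fourierCoeffOn Real.two_pi_pos G n

theorem fourierAngle_eq_integral (G : ℝ → ℂ) (n : ℤ) :
    fourierAngle G n =
      (2 * Real.pi : ℂ)⁻¹ * ∫ θ, exp (-(I * n * θ)) * G θ ∂angleMeasure := by
  rw [fourierAngle, fourierCoeffOn_eq_integral,
    intervalIntegral.integral_of_le Real.two_pi_pos.le, Complex.real_smul]
  congr 1
  · push_cast; simp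
  · refine integral_congr_ae (ae_of_all _ fun θ => ?_)
    simp only [fourier_coe_apply, smul_eq_mul]
    congr 2
    have : (Real.pi : ℂ) ≠ 0 := by exact_mod_cast Real.pi_ne_zero
    push_cast
    rw [sub_zero]
    field_simp

theorem periodic_comp_circlePt {α : Type*} (g : ℂ → α) :
    Function.Periodic (fun θ => g (circlePt θ)) (2 * Real.pi) := fun θ => by
  simp only [circlePt, periodic_circleMap 0 1 θ]

theorem integral_angleMeasure_add {E : Type*} [NormedAddCommGroup E] [NormedSpace ℝ E]
    {F : ℝ → E} (hF : Function.Periodic F (2 * Real.pi)) (h : ℝ) :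
    ∫ θ, F (θ + h) ∂angleMeasure = ∫ θ, F θ ∂angleMeasure := by
  rw [angleMeasure, ← intervalIntegral.integral_of_le Real.two_pi_pos.le,
    ← intervalIntegral.integral_of_le Real.two_pi_pos.le,
    intervalIntegral.integral_comp_add_right, zero_add, add_comm,
    hF.intervalIntegral_add_eq h 0, zero_add]

theorem lintegral_angleMeasure_comp_add {F : ℝ → ENNReal} (hF : Function.Periodic F (2 * Real.pi))
    (h : ℝ) : ∫⁻ θ, F (θ + h) ∂angleMeasure = ∫⁻ θ, F θ ∂angleMeasure := by
  rw [← lintegral_angleMeasure_add F hF h]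
  have := (measurePreserving_add_right volume h).setLIntegral_comp_preimage_emb
    (measurableEmbedding_addRight h) F (Ioc h (h + 2 * Real.pi))
  rw [← this]
  simp [angleMeasure]

theorem ae_angleMeasure_add {p : ℝ → Prop} (hp : ∀ θ, p (θ + 2 * Real.pi) ↔ p θ)
    (h : ∀ᵐ θ ∂angleMeasure, p θ) : ∀ᵐ θ, p θ := by
  classical
  have hn : ∀ (n : ℤ) θ, p (θ + n * (2 * Real.pi)) ↔ p θ := by
    have : Function.Periodic p (2 * Real.pi) := fun θ => propext (hp θ)
    intro n θ
    rw [this.int_mul n θ]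
  rw [ae_restrict_iff' measurableSet_Ioc] at h
  have h2 : ∀ᵐ θ : ℝ, ∀ n : ℤ, θ + n * (2 * Real.pi) ∈ Ioc (0:ℝ) (2 * Real.pi) →
      p (θ + n * (2 * Real.pi)) := by
    rw [ae_all_iff]
    intro n
    exact (measurePreserving_add_right volume (n * (2 * Real.pi) : ℝ)).quasiMeasurePreserving.ae h
  filter_upwards [h2] with θ hθ
  obtain ⟨n, hn', -⟩ := existsUnique_add_zsmul_mem_Ioc Real.two_pi_pos θ 0
  rw [zero_add, zsmul_eq_mul] at hn'
  exact (hn n θ).1 (hθ n hn')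

/-- A translate looks outside the period on which measurability is given; measurability on the line
is recovered by reducing the angle modulo `2π`. -/
theorem memLp_angleMeasure_add {G : ℝ → ℂ} (hG : Function.Periodic G (2 * Real.pi))
    (h : MemLp G 2 angleMeasure) (a : ℝ) : MemLp (fun θ => G (θ + a)) 2 angleMeasure := by
  obtain ⟨hm, hi⟩ := h
  have hm' : AEStronglyMeasurable G volume := by
    have h1 := (isAddFundamentalDomain_Ioc Real.two_pi_pos 0)
    refine ⟨fun θ => hm.mk G (toIocMod Real.two_pi_pos 0 θ), ?_, ?_⟩
    · refine hm.stronglyMeasurable_mk.comp_measurable ?_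
      have : (toIocMod Real.two_pi_pos 0) = fun θ => θ - toIocDiv Real.two_pi_pos 0 θ • (2 * Real.pi) := rfl
      rw [this]
      simp_rw [toIocDiv_eq_neg_floor]
      fun_prop
    · refine ae_angleMeasure_add (p := fun θ => G θ = hm.mk G (toIocMod Real.two_pi_pos 0 θ))
        (fun θ => ?_) ?_
      · rw [hG θ, toIocMod_add_right]
      · filter_upwards [hm.ae_eq_mk, ae_restrict_mem measurableSet_Ioc] with θ h1 h2
        rw [(toIocMod_eq_self Real.two_pi_pos).2 (by simpa using h2), h1]
  refine ⟨((hm'.comp_measurePreserving (measurePreserving_add_right volume a))).restrict, ?_⟩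
  rw [eLpNorm_lt_top_iff_lintegral_rpow_enorm_lt_top (by simp) (by simp)] at hi ⊢
  rw [lintegral_angleMeasure_comp_add (F := fun θ => ‖G θ‖ₑ ^ (2 : ENNReal).toReal)
    (fun θ => by simp only [hG θ])]
  exact hi

theorem fourierAngle_add_angle {G : ℝ → ℂ} (hG : Function.Periodic G (2 * Real.pi)) (h : ℝ) (n : ℤ) :
    fourierAngle (fun θ => G (θ + h)) n = exp (I * n * h) * fourierAngle G n := by
  have hP : Function.Periodic (fun θ : ℝ => exp (-(I * n * θ)) * G θ) (2 * Real.pi) := by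
    intro θ
    simp only [hG θ]
    congr 1
    have : -(I * n * ((θ + 2 * Real.pi : ℝ) : ℂ)) = -(I * n * θ) + (-n : ℤ) * (2 * Real.pi * I) := by
      push_cast; ring
    rw [this, Complex.exp_add, Complex.exp_int_mul_two_pi_mul_I, mul_one]
  have hI : ∫ θ, exp (-(I * n * θ)) * G (θ + h) ∂angleMeasure =
      exp (I * n * h) * ∫ θ, exp (-(I * n * θ)) * G θ ∂angleMeasure := by
    rw [← integral_angleMeasure_add hP h, ← integral_const_mul]
    refine integral_congr_ae (ae_of_all _ fun θ => ?_)
    simp only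
    rw [← mul_assoc, ← Complex.exp_add]
    congr 2
    push_cast; ring
  rw [fourierAngle_eq_integral, fourierAngle_eq_integral, hI]
  ring

theorem MeasureTheory.MemLp.integrable_angle {G : ℝ → ℂ} (hG : MemLp G 2 angleMeasure) :
    Integrable G angleMeasure := hG.integrable (by norm_num)

theorem integrable_exp_mul_angle {G : ℝ → ℂ} (hG : Integrable G angleMeasure) (n : ℤ) :
    Integrable (fun θ : ℝ => exp (-(I * n * θ)) * G θ) angleMeasure := by
  refine Integrable.bdd_mul (c := 1) hG (Continuous.aestronglyMeasurable (by fun_prop))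
    (ae_of_all _ fun θ => ?_)
  have : -(I * n * (θ : ℂ)) = ((-(n * θ) : ℝ) : ℂ) * I := by push_cast; ring
  rw [this, Complex.norm_exp_ofReal_mul_I]

theorem fourierAngle_add {G H : ℝ → ℂ} (hG : Integrable G angleMeasure)
    (hH : Integrable H angleMeasure) (n : ℤ) :
    fourierAngle (fun θ => G θ + H θ) n = fourierAngle G n + fourierAngle H n := by
  simp_rw [fourierAngle_eq_integral, mul_add]
  rw [integral_add (integrable_exp_mul_angle hG n) (integrable_exp_mul_angle hH n), mul_add]

theorem fourierAngle_sub {G H : ℝ → ℂ} (hG : Integrable G angleMeasure)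
    (hH : Integrable H angleMeasure) (n : ℤ) :
    fourierAngle (fun θ => G θ - H θ) n = fourierAngle G n - fourierAngle H n := by
  simp_rw [fourierAngle_eq_integral, mul_sub]
  rw [integral_sub (integrable_exp_mul_angle hG n) (integrable_exp_mul_angle hH n), mul_sub]

theorem hasSum_sq_fourierAngle {G : ℝ → ℂ} (hG : MemLp G 2 angleMeasure) :
    HasSum (fun n => ‖fourierAngle G n‖ ^ 2) ((2 * Real.pi)⁻¹ * ∫ θ, ‖G θ‖ ^ 2 ∂angleMeasure) := by
  have := hasSum_sq_fourierCoeffOn Real.two_pi_pos hG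
  rw [intervalIntegral.integral_of_le Real.two_pi_pos.le, sub_zero, smul_eq_mul] at this
  exact this

theorem integrable_sq_norm {α E : Type*} [MeasurableSpace α] [NormedAddCommGroup E] {μ : Measure α}
    {G : α → E} (hG : MemLp G 2 μ) : Integrable (fun θ => ‖G θ‖ ^ 2) μ :=
  hG.integrable_norm_pow (by norm_num)

/-- Polarization of Parseval's identity. -/
theorem hasSum_re_fourierAngle_mul_conj {G H : ℝ → ℂ} (hG : MemLp G 2 angleMeasure)
    (hH : MemLp H 2 angleMeasure) :
    HasSum (fun n => (fourierAngle G n * conj (fourierAngle H n)).re)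
      ((2 * Real.pi)⁻¹ * ∫ θ, (G θ * conj (H θ)).re ∂angleMeasure) := by
  have pol : ∀ z w : ℂ, (z * conj w).re = (‖z + w‖ ^ 2 - ‖z - w‖ ^ 2) / 4 := by
    intro z w
    rw [Complex.sq_norm, Complex.sq_norm, Complex.normSq_apply, Complex.normSq_apply]
    simp; ring
  simp_rw [pol, ← fourierAngle_add hG.integrable_angle hH.integrable_angle,
    ← fourierAngle_sub hG.integrable_angle hH.integrable_angle]
  have ia : Integrable (fun θ => ‖G θ + H θ‖ ^ 2) angleMeasure := integrable_sq_norm (hG.add hH)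
  have is : Integrable (fun θ => ‖G θ - H θ‖ ^ 2) angleMeasure := integrable_sq_norm (hG.sub hH)
  rw [integral_div, integral_sub ia is, ← mul_div_assoc, mul_sub]
  exact ((hasSum_sq_fourierAngle (hG.add hH)).sub (hasSum_sq_fourierAngle (hG.sub hH))).div_const 4

theorem lintegral_sq_enorm_eq_tsum {G : ℝ → ℂ} (hG : MemLp G 2 angleMeasure) :
    ∫⁻ θ, ‖G θ‖ₑ ^ 2 ∂angleMeasure =
      ENNReal.ofReal (2 * Real.pi) * ∑' n, ‖fourierAngle G n‖ₑ ^ 2 := by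
  have h := hasSum_sq_fourierAngle hG
  have h1 : ∀ z : ℂ, ‖z‖ₑ ^ 2 = ENNReal.ofReal (‖z‖ ^ 2) := fun z => by
    rw [ENNReal.ofReal_pow (norm_nonneg _), ofReal_norm]
  simp_rw [h1]
  rw [← ENNReal.ofReal_tsum_of_nonneg (fun _ => by positivity) h.summable, h.tsum_eq,
    ← ENNReal.ofReal_mul Real.two_pi_pos.le, ← ofReal_integral_eq_lintegral_ofReal
      (integrable_sq_norm hG) (ae_of_all _ fun _ => by positivity)]
  congr 1
  field_simp

end fourier

/-! ### The space `H^{1/2}` of the circle on the Fourier side. -/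

section half_norm

theorem norm_exp_int_mul_sub_one (n : ℕ) (h : ℝ) :
    exp (I * n * h) - 1 = (∑ k ∈ Finset.range n, exp (I * k * h)) * (exp (I * h) - 1) := by
  have : ∀ k : ℕ, exp (I * k * h) = exp (I * h) ^ k := fun k => by
    rw [← Complex.exp_nat_mul]; ring_nf
  simp_rw [this]
  rw [geom_sum_mul]

theorem integral_exp_int_mul (n : ℤ) :
    ∫ θ, exp (I * n * θ) ∂angleMeasure = if n = 0 then (2 * Real.pi : ℂ) else 0 := by
  split_ifs with hn
  · subst hn
    simp [Real.two_pi_pos.le]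
  · rw [angleMeasure, ← intervalIntegral.integral_of_le Real.two_pi_pos.le,
      integral_exp_mul_complex (by simp [hn])]
    have : I * n * ((2 * Real.pi : ℝ) : ℂ) = n * (2 * Real.pi * I) := by push_cast; ring
    rw [this, Complex.exp_int_mul_two_pi_mul_I]
    simp

theorem integral_norm_sq_geom (n : ℕ) :
    ∫ h : ℝ, ‖∑ k ∈ Finset.range n, exp (I * k * h)‖ ^ 2 ∂angleMeasure = 2 * Real.pi * n := by
  have h1 : ∀ h : ℝ, ((‖∑ k ∈ Finset.range n, exp (I * k * h)‖ ^ 2 : ℝ) : ℂ) =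
      ∑ k ∈ Finset.range n, ∑ l ∈ Finset.range n, exp (I * ((k - l : ℤ)) * h) := by
    intro h
    rw [Complex.sq_norm, Complex.normSq_eq_conj_mul_self, map_sum, Finset.sum_mul_sum,
      Finset.sum_comm]
    refine Finset.sum_congr rfl fun k _ => Finset.sum_congr rfl fun l _ => ?_
    rw [← Complex.exp_conj, ← Complex.exp_add]
    congr 1
    simp
    ring
  have hi : ∀ k l : ℕ, Integrable (fun h : ℝ => exp (I * ((k - l : ℤ)) * h)) angleMeasure :=
    fun k l => (Continuous.integrableOn_Ioc (by fun_prop))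
  have h2 : ((∫ h : ℝ, ‖∑ k ∈ Finset.range n, exp (I * k * h)‖ ^ 2 ∂angleMeasure : ℝ) : ℂ) =
      2 * Real.pi * n := by
    rw [← integral_complex_ofReal]
    simp_rw [h1]
    rw [integral_finsetSum _ fun k _ => integrable_finsetSum _ fun l _ => hi k l]
    simp_rw [fun k => integral_finsetSum (μ := angleMeasure) (Finset.range n) fun l _ => hi k l, integral_exp_int_mul]
    have : ∀ k ∈ Finset.range n, ∑ l ∈ Finset.range n,
        (if (k - l : ℤ) = 0 then (2 * Real.pi : ℂ) else 0) = 2 * Real.pi := by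
      intro k hk
      rw [Finset.sum_eq_single k]
      · simp
      · intro b _ hb
        rw [if_neg]; omega
      · exact fun h => absurd hk h
    rw [Finset.sum_congr rfl this]
    simp; ring
  exact_mod_cast h2

theorem ae_exp_ne_one : ∀ᵐ h : ℝ ∂angleMeasure, exp (I * h) - 1 ≠ 0 := by
  rw [ae_restrict_iff' measurableSet_Ioc]
  have : ∀ᵐ h : ℝ, h ≠ 2 * Real.pi := by
    simp [ae_iff, measure_singleton]
  filter_upwards [this] with h hne hh h0
  rw [sub_eq_zero, Complex.exp_eq_one_iff] at h0
  obtain ⟨n, hn⟩ := h0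
  have h1 : (h : ℂ) = ((n * (2 * Real.pi) : ℝ) : ℂ) := by
    apply mul_left_cancel₀ I_ne_zero; rw [hn]; push_cast; ring
  have h2 : h = n * (2 * Real.pi) := by exact_mod_cast h1
  have hp := Real.two_pi_pos
  have n1 : (0:ℝ) < n := by
    by_contra hcon; push Not at hcon
    nlinarith [hh.1]
  have n2 : (n:ℝ) < 2 := by
    by_contra hcon; push Not at hcon
    nlinarith [hh.2]
  have : n = 1 := by
    have a : (0:ℤ) < n := by exact_mod_cast n1
    have b : n < (2:ℤ) := by exact_mod_cast n2
    omega
  subst this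
  simp at h2
  exact hne h2

theorem norm_exp_neg_sub_one (n : ℤ) (h : ℝ) :
    ‖exp (I * n * h) - 1‖ = ‖exp (I * n.natAbs * h) - 1‖ := by
  rcases Int.natAbs_eq n with hn | hn
  · nth_rw 1 [hn]; simp
  · nth_rw 1 [hn]
    rw [← Complex.norm_conj]
    congr 1
    rw [map_sub, ← Complex.exp_conj]
    simp

/-- Up to modulus the quotient is a geometric sum of `|n|` exponentials, whose square integrates to
`2π |n|` by orthogonality. This is the source of the weight `|n|`. -/
theorem lintegral_sq_exp_quotient (n : ℤ) :
    ∫⁻ h : ℝ, (‖exp (I * n * h) - 1‖ₑ / ‖exp (I * h) - 1‖ₑ) ^ 2 ∂angleMeasure =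
      ENNReal.ofReal (2 * Real.pi * |n|) := by
  have h1 : ∫⁻ h : ℝ, (‖exp (I * n * h) - 1‖ₑ / ‖exp (I * h) - 1‖ₑ) ^ 2 ∂angleMeasure =
      ∫⁻ h : ℝ, ENNReal.ofReal (‖∑ k ∈ Finset.range n.natAbs, exp (I * k * h)‖ ^ 2)
        ∂angleMeasure := by
    refine lintegral_congr_ae ?_
    filter_upwards [ae_exp_ne_one] with h hh
    have : ‖exp (I * n * h) - 1‖ₑ =
        ‖∑ k ∈ Finset.range n.natAbs, exp (I * k * h)‖ₑ * ‖exp (I * h) - 1‖ₑ := by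
      rw [← enorm_mul, ← norm_exp_int_mul_sub_one, ← ofReal_norm, ← ofReal_norm,
        norm_exp_neg_sub_one]
    rw [this, ENNReal.mul_div_cancel_right (by simpa using hh) (by simp),
      ENNReal.ofReal_pow (norm_nonneg _), ofReal_norm]
  rw [h1, ← ofReal_integral_eq_lintegral_ofReal _ (ae_of_all _ fun _ => by positivity),
    integral_norm_sq_geom]
  · simp [Nat.cast_natAbs]
  · exact Continuous.integrableOn_Ioc (by fun_prop)

theorem circlePt_eq_exp (θ : ℝ) : circlePt θ = exp (I * θ) := by
  simp [circlePt, circleMap, mul_comm]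

theorem circlePt_add (s t : ℝ) : circlePt (s + t) = circlePt s * circlePt t := by
  simp only [circlePt_eq_exp, ← Complex.exp_add]; congr 1; push_cast; ring

/-- For a fixed shift `h` the denominator is the constant `|e^{ih} - 1|`, and Parseval's identity
applies to the increment. -/
theorem lintegral_translate_quotient {g : ℂ → ℂ} (hm : Measurable g)
    (hg : MemLp (fun θ => g (circlePt θ)) 2 angleMeasure) (h : ℝ) :
    ∫⁻ t, (‖g (circlePt (h + t)) - g (circlePt t)‖ₑ /
        ‖circlePt (h + t) - circlePt t‖ₑ) ^ 2 ∂angleMeasure =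
      ENNReal.ofReal (2 * Real.pi) * ∑' n : ℤ,
        (‖exp (I * n * h) - 1‖ₑ / ‖exp (I * h) - 1‖ₑ) ^ 2 * ‖circleFourier g n‖ₑ ^ 2 := by
  have hcm : Measurable circlePt := (continuous_circleMap 0 1).measurable
  have hP := periodic_comp_circlePt g
  have e1 : ∀ t, ‖circlePt (h + t) - circlePt t‖ₑ = ‖exp (I * h) - 1‖ₑ := by
    intro t
    have : circlePt (h + t) - circlePt t = (exp (I * h) - 1) * circlePt t := by
      rw [circlePt_add, circlePt_eq_exp h]; ring
    rw [this, enorm_mul, ← ofReal_norm (circlePt t), norm_circlePt]; simp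
  have hsh := memLp_angleMeasure_add hP hg h
  have hpar := lintegral_sq_enorm_eq_tsum (hsh.sub hg)
  have e2 : ∀ n : ℤ, fourierAngle ((fun θ => g (circlePt (θ + h))) - fun θ => g (circlePt θ)) n =
      (exp (I * n * h) - 1) * circleFourier g n := by
    intro n
    have := fourierAngle_sub hsh.integrable_angle hg.integrable_angle n
    rw [fourierAngle_add_angle hP] at this
    rw [sub_mul, one_mul]
    exact this
  simp_rw [e2] at hpar
  simp_rw [e1, div_eq_mul_inv, mul_pow]
  rw [lintegral_mul_const _ (by
    have : Measurable fun t => g (circlePt (h + t)) := hm.comp (hcm.comp (measurable_const_add h))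
    have : Measurable fun t => g (circlePt t) := hm.comp hcm
    fun_prop)]
  simp_rw [add_comm h]
  simp only [Pi.sub_apply] at hpar
  rw [hpar, mul_assoc, ← ENNReal.tsum_mul_right]
  congr 1
  refine tsum_congr fun n => ?_
  rw [enorm_mul, mul_pow]; ring

theorem measurable_sq_enorm_quotient {α : Type*} [MeasurableSpace α] {a b c d : α → ℂ}
    (ha : Measurable a) (hb : Measurable b) (hc : Measurable c) (hd : Measurable d) :
    Measurable fun x => (‖a x - b x‖ₑ / ‖c x - d x‖ₑ) ^ 2 := by
  fun_prop

/-- The double integral of the `H^{1/2}` seminorm, computed from the Fourier coefficients. -/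
theorem lintegral_half_eq_tsum_of_measurable {g : ℂ → ℂ} (hm : Measurable g)
    (hg : MemLp (fun θ => g (circlePt θ)) 2 angleMeasure) :
    ∫⁻ s, ∫⁻ t, (‖g (circlePt s) - g (circlePt t)‖ₑ / ‖circlePt s - circlePt t‖ₑ) ^ 2
      ∂angleMeasure ∂angleMeasure =
    ENNReal.ofReal (2 * Real.pi) * ∑' n : ℤ, ENNReal.ofReal (2 * Real.pi * |n|) *
      ‖circleFourier g n‖ₑ ^ 2 := by
  have hcm : Measurable circlePt := (continuous_circleMap 0 1).measurable
  have hmm : Measurable (fun p : ℝ × ℝ =>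
      (‖g (circlePt p.1) - g (circlePt p.2)‖ₑ / ‖circlePt p.1 - circlePt p.2‖ₑ) ^ 2) :=
    measurable_sq_enorm_quotient (hm.comp (hcm.comp measurable_fst))
      (hm.comp (hcm.comp measurable_snd)) (hcm.comp measurable_fst) (hcm.comp measurable_snd)
  have hmm2 : Measurable (fun p : ℝ × ℝ =>
      (‖g (circlePt (p.2 + p.1)) - g (circlePt p.1)‖ₑ /
        ‖circlePt (p.2 + p.1) - circlePt p.1‖ₑ) ^ 2) :=
    measurable_sq_enorm_quotient (hm.comp (hcm.comp (measurable_snd.add measurable_fst)))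
      (hm.comp (hcm.comp measurable_fst)) (hcm.comp (measurable_snd.add measurable_fst))
      (hcm.comp measurable_fst)
  rw [lintegral_lintegral_swap hmm.aemeasurable]
  -- The substitution `s = h + t`, allowed by periodicity, makes the denominator depend on `h`
  -- alone; the order of integration is then exchanged.
  have h1 : ∀ t, ∫⁻ s, (‖g (circlePt s) - g (circlePt t)‖ₑ / ‖circlePt s - circlePt t‖ₑ) ^ 2
      ∂angleMeasure = ∫⁻ h, (‖g (circlePt (h + t)) - g (circlePt t)‖ₑ /
        ‖circlePt (h + t) - circlePt t‖ₑ) ^ 2 ∂angleMeasure := fun t =>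
    (lintegral_angleMeasure_comp_add (periodic_comp_circlePt fun z =>
      (‖g z - g (circlePt t)‖ₑ / ‖z - circlePt t‖ₑ) ^ 2) t).symm
  simp_rw [h1]
  rw [lintegral_lintegral_swap (f := fun t h => (‖g (circlePt (h + t)) - g (circlePt t)‖ₑ /
        ‖circlePt (h + t) - circlePt t‖ₑ) ^ 2) hmm2.aemeasurable]
  simp_rw [lintegral_translate_quotient hm hg]
  have hme : ∀ n : ℤ, Measurable fun h : ℝ =>
      (‖exp (I * n * h) - 1‖ₑ / ‖exp (I * h) - 1‖ₑ) ^ 2 := by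
    intro n; fun_prop
  rw [lintegral_const_mul _ (by
    exact Measurable.tsum fun n => (hme n).mul_const _), lintegral_tsum fun n =>
      ((hme n).mul_const _).aemeasurable]
  congr 1
  refine tsum_congr fun n => ?_
  rw [lintegral_mul_const _ (hme n), lintegral_sq_exp_quotient]

/-- Only values on the circle matter, so a Borel representative can be rebuilt from the argument of
the point. The iterated integrals can then be exchanged. -/
theorem exists_measurable_circle {E : Type*} [NormedAddCommGroup E] [MeasurableSpace E]
    [BorelSpace E] {g : ℂ → E}
    (hg : AEStronglyMeasurable (fun θ => g (circlePt θ)) angleMeasure) :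
    ∃ g' : ℂ → E, Measurable g' ∧ ∀ᵐ θ ∂angleMeasure, g (circlePt θ) = g' (circlePt θ) := by
  refine ⟨fun z => hg.mk _ (toIocMod Real.two_pi_pos 0 (arg z)), ?_, ?_⟩
  · refine hg.stronglyMeasurable_mk.measurable.comp ?_
    have : (toIocMod Real.two_pi_pos 0) = fun θ => θ - toIocDiv Real.two_pi_pos 0 θ • (2 * Real.pi) := rfl
    rw [this]
    simp_rw [toIocDiv_eq_neg_floor]
    have := Complex.measurable_arg
    fun_prop
  · filter_upwards [hg.ae_eq_mk, ae_restrict_mem measurableSet_Ioc] with θ h1 h2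
    rw [h1]
    congr 1
    have : arg (circlePt θ) = toIocMod Real.two_pi_pos (-Real.pi) θ := by
      rw [circlePt_eq_exp, mul_comm I, Complex.arg_exp_mul_I]
    rw [this, toIocMod_toIocMod]
    exact ((toIocMod_eq_self Real.two_pi_pos).2 (by simpa using h2)).symm

theorem circleFourier_congr {g g' : ℂ → ℂ}
    (h : ∀ᵐ θ ∂angleMeasure, g (circlePt θ) = g' (circlePt θ)) :
    circleFourier g = circleFourier g' := by
  ext n
  exact congrFun (fourierCoeffOn_congr_ae Real.two_pi_pos h) n

theorem lintegral_half_congr {E : Type*} [NormedAddCommGroup E] {g g' : ℂ → E}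
    (h : ∀ᵐ θ ∂angleMeasure, g (circlePt θ) = g' (circlePt θ)) :
    ∫⁻ s, ∫⁻ t, (‖g (circlePt s) - g (circlePt t)‖ₑ / ‖circlePt s - circlePt t‖ₑ) ^ 2
      ∂angleMeasure ∂angleMeasure =
    ∫⁻ s, ∫⁻ t, (‖g' (circlePt s) - g' (circlePt t)‖ₑ / ‖circlePt s - circlePt t‖ₑ) ^ 2
      ∂angleMeasure ∂angleMeasure := by
  refine lintegral_congr_ae ?_
  filter_upwards [h] with s hs
  refine lintegral_congr_ae ?_
  filter_upwards [h] with t ht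
  rw [hs, ht]

theorem MemHHalfCircle.congr {E : Type*} [NormedAddCommGroup E] {g g' : ℂ → E}
    (hg : MemHHalfCircle g)
    (h : ∀ᵐ θ ∂angleMeasure, g (circlePt θ) = g' (circlePt θ)) : MemHHalfCircle g' :=
  ⟨hg.1.ae_eq h, lintegral_half_congr h ▸ hg.2⟩

theorem lintegral_half_eq_tsum {g : ℂ → ℂ}
    (hg : MemLp (fun θ => g (circlePt θ)) 2 angleMeasure) :
    ∫⁻ s, ∫⁻ t, (‖g (circlePt s) - g (circlePt t)‖ₑ / ‖circlePt s - circlePt t‖ₑ) ^ 2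
      ∂angleMeasure ∂angleMeasure =
    ENNReal.ofReal (2 * Real.pi) * ∑' n : ℤ, ENNReal.ofReal (2 * Real.pi * |n|) *
      ‖circleFourier g n‖ₑ ^ 2 := by
  obtain ⟨g', hm, h⟩ := exists_measurable_circle hg.1
  rw [lintegral_half_congr h, circleFourier_congr h]
  exact lintegral_half_eq_tsum_of_measurable hm (hg.ae_eq h)

/-- The double integral is `4π²` times the sum of `|n| |ĝ(n)|²`. -/
theorem memHHalfCircle_iff_summable {g : ℂ → ℂ} : MemHHalfCircle g ↔
    MemLp (fun θ => g (circlePt θ)) 2 angleMeasure ∧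
      Summable fun n : ℤ => |(n : ℝ)| * ‖circleFourier g n‖ ^ 2 := by
  refine and_congr_right fun hg => ?_
  rw [lintegral_half_eq_tsum hg]
  have hp : ENNReal.ofReal (2 * Real.pi) ≠ 0 := by simp [Real.pi_pos]
  have e : ∀ n : ℤ, ENNReal.ofReal (2 * Real.pi * |n|) * ‖circleFourier g n‖ₑ ^ 2 =
      ENNReal.ofReal (2 * Real.pi) * ENNReal.ofReal (|(n : ℝ)| * ‖circleFourier g n‖ ^ 2) := by
    intro n
    rw [← ofReal_norm, ← ENNReal.ofReal_pow (norm_nonneg _),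
      ← ENNReal.ofReal_mul (by positivity), ← ENNReal.ofReal_mul (by positivity), ← Int.cast_abs]
    ring_nf
  simp_rw [e]
  rw [ENNReal.tsum_mul_left]
  constructor
  · intro h
    have h1 : ∑' n : ℤ, ENNReal.ofReal (|(n : ℝ)| * ‖circleFourier g n‖ ^ 2) ≠ ⊤ := by
      intro h2
      rw [h2, ENNReal.mul_top hp, ENNReal.mul_top hp] at h
      exact lt_irrefl _ h
    have := ENNReal.summable_toReal h1
    refine this.congr fun n => ?_
    rw [ENNReal.toReal_ofReal (by positivity)]
  · intro h
    rw [← ENNReal.ofReal_tsum_of_nonneg (fun n => by positivity) h]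
    exact ENNReal.mul_lt_top ENNReal.ofReal_lt_top
      (ENNReal.mul_lt_top ENNReal.ofReal_lt_top ENNReal.ofReal_lt_top)

theorem memHHalfCircle_ofReal_iff {φ : ℂ → ℝ} :
    MemHHalfCircle (fun z => (φ z : ℂ)) ↔ MemHHalfCircle φ := by
  unfold MemHHalfCircle
  refine and_congr ⟨fun h => by simpa using h.re, fun h => h.ofReal⟩ ?_
  have : ∀ s t, ‖(φ (circlePt s) : ℂ) - φ (circlePt t)‖ₑ = ‖φ (circlePt s) - φ (circlePt t)‖ₑ := by
    intro s t
    rw [← ofReal_sub, ← ofReal_norm, ← ofReal_norm, Complex.norm_real]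
  simp_rw [this]

/-- Since `(A y + B)² ≤ 2 A² y² + 2 B²`, increments may be compared pointwise. This handles
Lipschitz compositions and products with smooth or unimodular factors. -/
theorem MemHHalfCircle.of_norm_sub_le {E E' : Type*} [NormedAddCommGroup E] [NormedAddCommGroup E']
    {g : ℂ → E} {p : ℂ → E'} (hp : MemHHalfCircle p)
    (hg : MemLp (fun θ => g (circlePt θ)) 2 angleMeasure) {A B : ℝ}
    (h : ∀ s t, ‖g (circlePt s) - g (circlePt t)‖ ≤
      A * ‖p (circlePt s) - p (circlePt t)‖ + B * ‖circlePt s - circlePt t‖) :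
    MemHHalfCircle g := by
  refine ⟨hg, ?_⟩
  have key : ∀ s t, (‖g (circlePt s) - g (circlePt t)‖ₑ / ‖circlePt s - circlePt t‖ₑ) ^ 2 ≤
      ENNReal.ofReal (2 * A ^ 2) *
        (‖p (circlePt s) - p (circlePt t)‖ₑ / ‖circlePt s - circlePt t‖ₑ) ^ 2 +
      ENNReal.ofReal (2 * B ^ 2) := by
    intro s t
    by_cases hst : circlePt s = circlePt t
    · simp [hst]
    · have h0 : 0 < ‖circlePt s - circlePt t‖ := norm_pos_iff.2 (sub_ne_zero.2 hst)
      rw [← ofReal_norm, ← ofReal_norm, ← ofReal_norm, ← ENNReal.ofReal_div_of_pos h0,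
        ← ENNReal.ofReal_div_of_pos h0, ← ENNReal.ofReal_pow (by positivity),
        ← ENNReal.ofReal_pow (by positivity), ← ENNReal.ofReal_mul (by positivity),
        ← ENNReal.ofReal_add (by positivity) (by positivity)]
      refine ENNReal.ofReal_le_ofReal ?_
      have h1 : ‖g (circlePt s) - g (circlePt t)‖ / ‖circlePt s - circlePt t‖ ≤
          A * (‖p (circlePt s) - p (circlePt t)‖ / ‖circlePt s - circlePt t‖) + B := by
        rw [div_le_iff₀ h0, add_mul, mul_assoc, div_mul_cancel₀ _ h0.ne']
        exact h s t
      have h2 : 0 ≤ ‖g (circlePt s) - g (circlePt t)‖ / ‖circlePt s - circlePt t‖ := by positivity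
      generalize ‖g (circlePt s) - g (circlePt t)‖ / ‖circlePt s - circlePt t‖ = x at *
      generalize ‖p (circlePt s) - p (circlePt t)‖ / ‖circlePt s - circlePt t‖ = y at *
      nlinarith [sq_nonneg (A * y - B)]
  refine lt_of_le_of_lt (lintegral_mono fun s => lintegral_mono fun t => key s t) ?_
  have hfin : ENNReal.ofReal (2 * A ^ 2) ≠ ⊤ := ENNReal.ofReal_ne_top
  simp_rw [fun s => lintegral_add_right (μ := angleMeasure) (fun t => ENNReal.ofReal (2 * A ^ 2) *
      (‖p (circlePt s) - p (circlePt t)‖ₑ / ‖circlePt s - circlePt t‖ₑ) ^ 2)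
      (measurable_const (a := ENNReal.ofReal (2 * B ^ 2))), lintegral_const_mul' _ _ hfin]
  rw [lintegral_add_right _ measurable_const, lintegral_const_mul' _ _ hfin]
  refine ENNReal.add_lt_top.2 ⟨ENNReal.mul_lt_top ENNReal.ofReal_lt_top hp.2, ?_⟩
  simp only [lintegral_const]
  exact ENNReal.mul_lt_top (ENNReal.mul_lt_top ENNReal.ofReal_lt_top (measure_lt_top _ _)) (measure_lt_top _ _)

theorem memHHalfCircle_zero : MemHHalfCircle (fun _ : ℂ => (0 : ℝ)) := by
  refine ⟨by simp, by simp⟩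

theorem memHHalfCircle_of_lipschitz {E : Type*} [NormedAddCommGroup E] {g : ℂ → E} {B : ℝ}
    (hg : MemLp (fun θ => g (circlePt θ)) 2 angleMeasure)
    (h : ∀ s t, ‖g (circlePt s) - g (circlePt t)‖ ≤ B * ‖circlePt s - circlePt t‖) :
    MemHHalfCircle g :=
  memHHalfCircle_zero.of_norm_sub_le hg (A := 0) (B := B) fun s t => by simpa using h s t

end half_norm

/-! ### The duality bracket of `∂_θ g` with `χ i g`. -/

section pairing

/-- A quadratic bound valid for all real `x` is the right one: it will be integrated against
increments that are controlled only in `L²`. -/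
theorem abs_sin_sub_self_le (x : ℝ) : |Real.sin x - x| ≤ 2 * x ^ 2 := by
  rcases le_total |x| 1 with h | h
  · have h1 := Real.sin_bound h
    have h2 : |Real.sin x - x| ≤ |Real.sin x - (x - x ^ 3 / 6)| + |x ^ 3 / 6| := by
      have : Real.sin x - x = (Real.sin x - (x - x ^ 3 / 6)) - x ^ 3 / 6 := by ring
      rw [this]; exact abs_sub _ _
    have h3 : |x ^ 3 / 6| = |x| ^ 3 / 6 := by rw [abs_div, abs_pow]; norm_num
    rw [h3] at h2
    have h0 := abs_nonneg x
    rw [← sq_abs x]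
    have h4 : |x| ^ 3 ≤ |x| ^ 2 := pow_le_pow_of_le_one h0 h (by norm_num)
    have h5 : |x| ^ 4 ≤ |x| ^ 2 := pow_le_pow_of_le_one h0 h (by norm_num)
    nlinarith [sq_nonneg |x|]
  · have h1 : |Real.sin x - x| ≤ |Real.sin x| + |x| := abs_sub _ _
    have h2 := Real.abs_sin_le_one x
    rw [← sq_abs x]
    nlinarith

theorem exists_bound_closedBall {χ : ℂ → ℝ} (hχ : ContDiff ℝ ∞ χ) :
    ∃ M : ℝ, 0 ≤ M ∧ (∀ z ∈ Metric.closedBall (0 : ℂ) 1, |χ z| ≤ M ∧ ‖fderiv ℝ χ z‖ ≤ M) ∧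
      ∀ z ∈ Metric.closedBall (0 : ℂ) 1, ∀ w ∈ Metric.closedBall (0 : ℂ) 1,
        |χ z - χ w| ≤ M * ‖z - w‖ := by
  obtain ⟨A, hA⟩ := (isCompact_closedBall (0 : ℂ) 1).exists_bound_of_continuousOn
    hχ.continuous.continuousOn
  obtain ⟨B, hB⟩ := (isCompact_closedBall (0 : ℂ) 1).exists_bound_of_continuousOn
    (hχ.continuous_fderiv (by simp)).continuousOn
  refine ⟨max 0 (max A B), le_max_left _ _, fun z hz => ⟨?_, ?_⟩, fun z hz w hw => ?_⟩
  · exact (hA z hz).trans ((le_max_left _ _).trans (le_max_right _ _))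
  · exact (hB z hz).trans ((le_max_right _ _).trans (le_max_right _ _))
  · exact (convex_closedBall (0:ℂ) 1).norm_image_sub_le_of_norm_fderiv_le (𝕜 := ℝ)
      (fun x _ => hχ.differentiable (by simp) x)
      (fun x hx => (hB x hx).trans ((le_max_right _ _).trans (le_max_right _ _))) hw hz

theorem circlePt_mem_closedBall (θ : ℝ) : circlePt θ ∈ Metric.closedBall (0 : ℂ) 1 := by
  simp

theorem continuous_circlePt : Continuous circlePt := continuous_circleMap 0 1

theorem norm_exp_I_mul_ofReal' (x : ℝ) : ‖exp (I * x)‖ = 1 := by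
  rw [mul_comm, Complex.norm_exp_ofReal_mul_I]

theorem norm_exp_I_mul_sub_le (x y : ℝ) : ‖exp (I * x) - exp (I * y)‖ ≤ |x - y| := by
  have : exp (I * x) - exp (I * y) = exp (I * y) * (exp (I * (x - y : ℝ)) - 1) := by
    rw [mul_sub, ← Complex.exp_add, mul_one]; congr 2; push_cast; ring
  rw [this, norm_mul, norm_exp_I_mul_ofReal', one_mul]
  exact Real.norm_exp_I_mul_ofReal_sub_one_le

theorem aestronglyMeasurable_exp_I_mul {α : Type*} [MeasurableSpace α] {μ : Measure α} {φ : α → ℝ}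
    (h : AEStronglyMeasurable φ μ) : AEStronglyMeasurable (fun x => exp (I * φ x)) μ :=
  (by fun_prop : Continuous fun x : ℝ => exp (I * x)).comp_aestronglyMeasurable h

/-- A map with an `H^{1/2}` lifting is in `H^{1/2}`. -/
theorem MemHHalfCircle.circlePt_mul_exp {φ : ℂ → ℝ} (hφ : MemHHalfCircle φ) :
    MemHHalfCircle (fun z => z * exp (I * φ z)) := by
  refine hφ.of_norm_sub_le (A := 1) (B := 1) ?_ fun s t => ?_
  · refine MemLp.of_bound (C := 1) ?_ (ae_of_all _ fun θ => ?_)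
    · exact (continuous_circlePt.aestronglyMeasurable).mul (aestronglyMeasurable_exp_I_mul hφ.1.1)
    · rw [norm_mul, norm_circlePt, norm_exp_I_mul_ofReal', one_mul]
  · have : circlePt s * exp (I * φ (circlePt s)) - circlePt t * exp (I * φ (circlePt t)) =
      circlePt s * (exp (I * φ (circlePt s)) - exp (I * φ (circlePt t))) +
        (circlePt s - circlePt t) * exp (I * φ (circlePt t)) := by ring
    rw [this]
    refine (norm_add_le _ _).trans ?_
    rw [norm_mul, norm_mul, norm_circlePt, norm_exp_I_mul_ofReal', one_mul, mul_one, one_mul,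
      one_mul]
    gcongr
    exact norm_exp_I_mul_sub_le _ _

theorem memHHalfCircle_smooth_mul {χ : ℂ → ℝ} (hχ : ContDiff ℝ ∞ χ) {g : ℂ → ℂ}
    (hg : MemHHalfCircle g) (hg1 : ∀ θ, ‖g (circlePt θ)‖ = 1) :
    MemHHalfCircle (fun z => χ z * (I * g z)) := by
  obtain ⟨M, hM, hb, hl⟩ := exists_bound_closedBall hχ
  refine hg.of_norm_sub_le (A := M) (B := M) ?_ fun s t => ?_
  · refine MemLp.of_bound (C := M) ?_ (ae_of_all _ fun θ => ?_)
    · refine AEStronglyMeasurable.mul ?_ (hg.1.1.const_mul _)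
      exact (continuous_ofReal.comp (hχ.continuous.comp continuous_circlePt)).aestronglyMeasurable
    · rw [norm_mul, norm_mul, hg1, Complex.norm_real, Complex.norm_I, mul_one, mul_one]
      exact (hb _ (circlePt_mem_closedBall θ)).1
  · have : (χ (circlePt s) : ℂ) * (I * g (circlePt s)) - χ (circlePt t) * (I * g (circlePt t)) =
      (χ (circlePt s) : ℂ) * (I * (g (circlePt s) - g (circlePt t))) +
        ((χ (circlePt s) - χ (circlePt t) : ℝ) : ℂ) * (I * g (circlePt t)) := by push_cast; ring
    rw [this]
    refine (norm_add_le _ _).trans ?_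
    rw [norm_mul, norm_mul, norm_mul, norm_mul, hg1, Complex.norm_real, Complex.norm_real,
      Complex.norm_I, mul_one, mul_one, one_mul]
    gcongr
    · exact (hb _ (circlePt_mem_closedBall s)).1
    · exact hl _ (circlePt_mem_closedBall s) _ (circlePt_mem_closedBall t)

theorem norm_exp_int_sub_one_le (n : ℤ) (h : ℝ) : ‖exp (I * n * h) - 1‖ ≤ |(n : ℝ)| * |h| := by
  have := norm_exp_I_mul_sub_le (n * h) 0
  simp only [ofReal_zero, mul_zero, Complex.exp_zero, sub_zero, abs_mul] at this
  convert this using 4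
  push_cast; ring

/-- `‖φ(· + h) - φ‖² = o(h)` in `L²`, for `φ` in `H^{1/2}`. -/
theorem MemHHalfCircle.tendsto_translate {φ : ℂ → ℝ} (hφ : MemHHalfCircle φ) :
    Tendsto (fun h : ℝ => |h|⁻¹ * ∫ θ, (φ (circlePt (θ + h)) - φ (circlePt θ)) ^ 2 ∂angleMeasure)
      (𝓝[≠] 0) (𝓝 0) := by
  set g : ℂ → ℂ := fun z => φ z with hgdef
  have hg : MemHHalfCircle g := memHHalfCircle_ofReal_iff.2 hφ
  have hP := periodic_comp_circlePt g
  have hs := (memHHalfCircle_iff_summable.1 hg).2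
  have e : ∀ h : ℝ, |h|⁻¹ * ∫ θ, (φ (circlePt (θ + h)) - φ (circlePt θ)) ^ 2 ∂angleMeasure =
      2 * Real.pi * ∑' n : ℤ, |h|⁻¹ * (‖exp (I * n * h) - 1‖ ^ 2 * ‖circleFourier g n‖ ^ 2) := by
    intro h
    have hsh := memLp_angleMeasure_add hP hg.1 h
    have hpar := (hasSum_sq_fourierAngle (hsh.sub hg.1)).tsum_eq
    have e2 : ∀ n : ℤ, fourierAngle ((fun θ => g (circlePt (θ + h))) - fun θ => g (circlePt θ)) n =
        (exp (I * n * h) - 1) * circleFourier g n := by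
      intro n
      have := fourierAngle_sub hsh.integrable_angle hg.1.integrable_angle n
      rw [fourierAngle_add_angle hP] at this
      rw [sub_mul, one_mul]
      exact this
    simp_rw [e2, norm_mul, mul_pow] at hpar
    have e3 : ∀ θ, ‖((fun θ => g (circlePt (θ + h))) - fun θ => g (circlePt θ)) θ‖ ^ 2 =
        (φ (circlePt (θ + h)) - φ (circlePt θ)) ^ 2 := by
      intro θ
      simp only [Pi.sub_apply, hgdef]
      rw [← ofReal_sub, Complex.norm_real, Real.norm_eq_abs, sq_abs]
    simp_rw [e3] at hpar
    rw [tsum_mul_left, hpar]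
    field_simp
  simp_rw [e]
  have key : Tendsto (fun h : ℝ => ∑' n : ℤ,
      |h|⁻¹ * (‖exp (I * n * h) - 1‖ ^ 2 * ‖circleFourier g n‖ ^ 2)) (𝓝[≠] 0)
      (𝓝 (∑' _ : ℤ, (0 : ℝ))) := by
    -- Each term is `O(h)`. The bounds `|e^{inh} - 1| ≤ 2` and `|e^{inh} - 1| ≤ |n h|` multiply to
    -- `2 |n| |h|`, which is the summable domination.
    refine tendsto_tsum_of_dominated_convergence (bound := fun n : ℤ =>
      2 * (|(n : ℝ)| * ‖circleFourier g n‖ ^ 2)) (hs.mul_left 2) ?_ ?_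
    · intro n
      have hb : ∀ᶠ h : ℝ in 𝓝[≠] 0, ‖|h|⁻¹ * (‖exp (I * n * h) - 1‖ ^ 2 *
          ‖circleFourier g n‖ ^ 2)‖ ≤ |h| * (|(n : ℝ)| ^ 2 * ‖circleFourier g n‖ ^ 2) := by
        filter_upwards [self_mem_nhdsWithin] with h hh
        have hh' : 0 < |h| := abs_pos.2 hh
        rw [Real.norm_of_nonneg (by positivity), inv_mul_le_iff₀ hh']
        have := pow_le_pow_left₀ (norm_nonneg _) (norm_exp_int_sub_one_le n h) 2
        calc _ ≤ (|(n : ℝ)| * |h|) ^ 2 * ‖circleFourier g n‖ ^ 2 := by gcongr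
          _ = _ := by ring
      refine squeeze_zero_norm' hb ?_
      have : Tendsto (fun h : ℝ => |h| * (|(n : ℝ)| ^ 2 * ‖circleFourier g n‖ ^ 2)) (𝓝 0)
          (𝓝 (|0| * (|(n : ℝ)| ^ 2 * ‖circleFourier g n‖ ^ 2))) :=
        (continuous_abs.mul continuous_const).tendsto 0
      simp only [abs_zero, zero_mul] at this
      exact this.mono_left nhdsWithin_le_nhds
    · filter_upwards [self_mem_nhdsWithin] with h hh n
      have hh' : 0 < |h| := abs_pos.2 hh
      rw [Real.norm_of_nonneg (by positivity), inv_mul_le_iff₀ hh']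
      have h1 := norm_exp_int_sub_one_le n h
      have h2 : ‖exp (I * n * h) - 1‖ ≤ 2 := by
        refine (norm_sub_le _ _).trans ?_
        have : I * n * (h : ℂ) = I * (n * h : ℝ) := by push_cast; ring
        rw [this, norm_exp_I_mul_ofReal', norm_one]; norm_num
      have h3 : ‖exp (I * n * h) - 1‖ ^ 2 ≤ 2 * (|(n : ℝ)| * |h|) := by
        rw [sq]; exact mul_le_mul h2 h1 (norm_nonneg _) (by norm_num)
      calc _ ≤ 2 * (|(n : ℝ)| * |h|) * ‖circleFourier g n‖ ^ 2 := by gcongr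
        _ = _ := by ring
  rw [tsum_zero] at key
  simpa using key.const_mul (2 * Real.pi)

end pairing

section pairing

theorem hasDerivAt_comp_circlePt {χ : ℂ → ℝ} (hχ : ContDiff ℝ ∞ χ) (θ : ℝ) :
    HasDerivAt (fun θ => χ (circlePt θ)) (fderiv ℝ χ (circlePt θ) (I * circlePt θ)) θ := by
  have h1 : HasDerivAt circlePt (circlePt θ * I) θ := by
    simpa using hasDerivAt_circleMap 0 1 θ
  have := ((hχ.differentiable (by simp)) (circlePt θ)).hasFDerivAt.comp_hasDerivAt θ h1
  rwa [mul_comm] at this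

theorem abs_comp_circlePt_sub_le {χ : ℂ → ℝ} {M : ℝ}
    (hl : ∀ z ∈ Metric.closedBall (0 : ℂ) 1, ∀ w ∈ Metric.closedBall (0 : ℂ) 1,
        |χ z - χ w| ≤ M * ‖z - w‖) (hM : 0 ≤ M) (s t : ℝ) :
    |χ (circlePt s) - χ (circlePt t)| ≤ M * |s - t| := by
  refine (hl _ (circlePt_mem_closedBall s) _ (circlePt_mem_closedBall t)).trans ?_
  gcongr
  rw [circlePt_eq_exp, circlePt_eq_exp]
  exact norm_exp_I_mul_sub_le s t

/-- The limit of the difference quotients of `φ`, tested against a smooth function. -/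
theorem tendsto_integral_quotient {φ : ℂ → ℝ}
    (hφ : MemLp (fun θ => φ (circlePt θ)) 2 angleMeasure)
    {χ : ℂ → ℝ} (hχ : ContDiff ℝ ∞ χ) :
    Tendsto (fun h : ℝ => ∫ θ, χ (circlePt θ) *
        (1 + h⁻¹ * (φ (circlePt (θ + h)) - φ (circlePt θ))) ∂angleMeasure) (𝓝[≠] 0)
      (𝓝 ((∫ θ, χ (circlePt θ) ∂angleMeasure) -
        ∫ θ, φ (circlePt θ) * fderiv ℝ χ (circlePt θ) (I * circlePt θ) ∂angleMeasure)) := by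
  obtain ⟨M, hM, hb, hl⟩ := exists_bound_closedBall hχ
  have hφi : Integrable (fun θ => φ (circlePt θ)) angleMeasure := hφ.integrable (by norm_num)
  have hφs : ∀ h, Integrable (fun θ => φ (circlePt (θ + h))) angleMeasure := by
    intro h
    have := (memLp_angleMeasure_add (periodic_comp_circlePt fun z => (φ z : ℂ)) hφ.ofReal h).re
    simpa using this.integrable (by norm_num)
  have hχc : ∀ h : ℝ, Continuous fun θ => χ (circlePt (θ + h)) := fun h =>
    hχ.continuous.comp (continuous_circlePt.comp (by fun_prop))
  have hmul : ∀ (h : ℝ) (p : ℝ → ℝ), Integrable p angleMeasure →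
      Integrable (fun θ => χ (circlePt (θ + h)) * p θ) angleMeasure := fun h p hp =>
    hp.bdd_mul (c := M) (hχc h).aestronglyMeasurable
      (ae_of_all _ fun θ => (hb _ (circlePt_mem_closedBall _)).1)
  have hmul0 : ∀ (p : ℝ → ℝ), Integrable p angleMeasure →
      Integrable (fun θ => χ (circlePt θ) * p θ) angleMeasure := fun p hp => by
    simpa using hmul 0 p hp
  have hχi : Integrable (fun θ => χ (circlePt θ)) angleMeasure := by
    simpa using hmul0 (fun _ => 1) (integrable_const _)
  -- Discrete integration by parts: a translation moves the difference quotient from `φ` to the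
  -- smooth function `χ`, with the opposite shift.
  have e : ∀ h : ℝ, ∫ θ, χ (circlePt θ) *
        (1 + h⁻¹ * (φ (circlePt (θ + h)) - φ (circlePt θ))) ∂angleMeasure =
      (∫ θ, χ (circlePt θ) ∂angleMeasure) +
        ∫ θ, φ (circlePt θ) * (h⁻¹ * (χ (circlePt (θ + -h)) - χ (circlePt θ))) ∂angleMeasure := by
    intro h
    have e1 : ∫ θ, χ (circlePt (θ + -h)) * φ (circlePt θ) ∂angleMeasure =
        ∫ θ, χ (circlePt θ) * φ (circlePt (θ + h)) ∂angleMeasure := by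
      have hP : Function.Periodic (fun θ => χ (circlePt (θ + -h)) * φ (circlePt θ))
          (2 * Real.pi) := by
        intro θ
        have a1 := periodic_comp_circlePt χ (θ + -h)
        have a2 := periodic_comp_circlePt φ θ
        simp only at a1 a2 ⊢
        rw [a2, show θ + 2 * Real.pi + -h = θ + -h + 2 * Real.pi by ring, a1]
      rw [← integral_angleMeasure_add hP h]
      simp
    have e2 : ∀ θ, χ (circlePt θ) * (1 + h⁻¹ * (φ (circlePt (θ + h)) - φ (circlePt θ))) =
        χ (circlePt θ) + h⁻¹ * (χ (circlePt θ) * φ (circlePt (θ + h)) -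
          χ (circlePt θ) * φ (circlePt θ)) := fun θ => by ring
    have e3 : ∀ θ, φ (circlePt θ) * (h⁻¹ * (χ (circlePt (θ + -h)) - χ (circlePt θ))) =
        h⁻¹ * (χ (circlePt (θ + -h)) * φ (circlePt θ) - χ (circlePt θ) * φ (circlePt θ)) :=
      fun θ => by ring
    simp_rw [e2, e3]
    have i1 : Integrable (fun θ => χ (circlePt θ) * φ (circlePt (θ + h)) -
        χ (circlePt θ) * φ (circlePt θ)) angleMeasure := (hmul0 _ (hφs h)).sub (hmul0 _ hφi)
    rw [integral_add hχi (i1.const_mul _), integral_const_mul,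
      integral_const_mul, integral_sub (hmul0 _ (hφs h)) (hmul0 _ hφi),
      integral_sub (hmul (-h) _ hφi) (hmul0 _ hφi), e1]
  simp_rw [e]
  rw [sub_eq_add_neg, ← integral_neg]
  refine tendsto_const_nhds.add (tendsto_integral_filter_of_dominated_convergence
    (fun θ => M * |φ (circlePt θ)|) ?_ ?_ (hφi.abs.const_mul M) ?_)
  · filter_upwards with h
    refine hφi.aestronglyMeasurable.mul ?_
    exact (continuous_const.mul ((hχc (-h)).sub (by simpa using hχc 0))).aestronglyMeasurable
  · filter_upwards [self_mem_nhdsWithin] with h hh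
    have hh' : 0 < |h| := abs_pos.2 hh
    refine ae_of_all _ fun θ => ?_
    rw [norm_mul, norm_mul, Real.norm_eq_abs, Real.norm_eq_abs, Real.norm_eq_abs, abs_inv, mul_comm M]
    gcongr
    rw [inv_mul_le_iff₀ hh', mul_comm]
    refine (abs_comp_circlePt_sub_le hl hM _ _).trans (le_of_eq ?_)
    congr 1
    rw [add_sub_cancel_left, abs_neg]
  · refine ae_of_all _ fun θ => ?_
    have hd := (hasDerivAt_comp_circlePt hχ θ)
    rw [hasDerivAt_iff_tendsto_slope_zero] at hd
    have hneg : Tendsto (fun h : ℝ => -h) (𝓝[≠] 0) (𝓝[≠] 0) := by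
      refine tendsto_nhdsWithin_iff.2 ⟨?_, ?_⟩
      · have : Tendsto (fun h : ℝ => -h) (𝓝 0) (𝓝 (-0)) := continuous_neg.tendsto 0
        rw [neg_zero] at this
        exact this.mono_left nhdsWithin_le_nhds
      · filter_upwards [self_mem_nhdsWithin] with h hh
        simpa using hh
    have := ((hd.comp hneg).neg).const_mul (φ (circlePt θ))
    rw [mul_neg] at this
    refine this.congr fun h => ?_
    simp only [Function.comp_apply, smul_eq_mul, inv_neg]
    ring

theorem re_neg_I_mul_exp_sub_one (x : ℝ) : (-I * (exp (I * x) - 1)).re = Real.sin x := by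
  rw [mul_comm I (x : ℂ), Complex.exp_mul_I, ← Complex.ofReal_sin, ← Complex.ofReal_cos]
  simp
  exact Complex.sin_ofReal_re x

/-- The duality bracket of `∂_θ g` with `χ i g`, in terms of a lifting of `g`. -/
theorem hasTangentialPairing_of_lift {φ : ℂ → ℝ} (hφ : MemHHalfCircle φ) {χ : ℂ → ℝ}
    (hχ : ContDiff ℝ ∞ χ) :
    HasTangentialPairing (fun z => z * exp (I * φ z))
      (fun z => χ z * (I * (z * exp (I * φ z))))
      ((∫ θ, χ (circlePt θ) ∂angleMeasure) -
        ∫ θ, φ (circlePt θ) * fderiv ℝ χ (circlePt θ) (I * circlePt θ) ∂angleMeasure) := by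
  obtain ⟨M, hM, hb, hl⟩ := exists_bound_closedBall hχ
  set g : ℂ → ℂ := fun z => z * exp (I * φ z) with hgdef
  set p : ℂ → ℂ := fun z => χ z * (I * g z) with hpdef
  have hg : MemHHalfCircle g := hφ.circlePt_mul_exp
  have hg1 : ∀ θ, ‖g (circlePt θ)‖ = 1 := fun θ => by
    rw [hgdef]; simp only
    rw [norm_mul, norm_circlePt, norm_exp_I_mul_ofReal', one_mul]
  have hp : MemHHalfCircle p := memHHalfCircle_smooth_mul hχ hg hg1
  have hP := periodic_comp_circlePt g
  have sg := (memHHalfCircle_iff_summable.1 hg).2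
  have sp := (memHHalfCircle_iff_summable.1 hp).2
  set c := circleFourier g with hc
  set d := circleFourier p with hd
  have hbs : Summable fun n : ℤ => |(n : ℝ)| * (‖c n‖ * ‖d n‖) := by
    refine Summable.of_nonneg_of_le (fun n => by positivity) (fun n => ?_) (sg.add sp)
    rw [← mul_add]
    gcongr
    nlinarith [sq_nonneg (‖c n‖ - ‖d n‖), sq_nonneg (‖c n‖), sq_nonneg ‖d n‖]
  -- the difference quotients
  have hq : ∀ h : ℝ, HasSum (fun n : ℤ => (((exp (I * n * h) - 1) / h) * c n * conj (d n)).re)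
      ((2 * Real.pi)⁻¹ * (h⁻¹ * ∫ θ, χ (circlePt θ) *
        Real.sin (h + (φ (circlePt (θ + h)) - φ (circlePt θ))) ∂angleMeasure)) := by
    intro h
    have hsh := memLp_angleMeasure_add hP hg.1 h
    have := (hasSum_re_fourierAngle_mul_conj (hsh.sub hg.1) hp.1).mul_left h⁻¹
    have e2 : ∀ n : ℤ, fourierAngle ((fun θ => g (circlePt (θ + h))) - fun θ => g (circlePt θ)) n =
        (exp (I * n * h) - 1) * c n := by
      intro n
      have := fourierAngle_sub hsh.integrable_angle hg.1.integrable_angle n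
      rw [fourierAngle_add_angle hP] at this
      rw [sub_mul, one_mul]
      exact this
    -- Writing `δ` for the increment of `φ`, `g(θ + h)` times the conjugate of `g(θ)` is `e^{i(h +
    -- δ)}`. The real product of the increment of `g` with `χ i g` is therefore `χ sin(h + δ)`.
    have e3 : ∀ θ, ((((fun θ => g (circlePt (θ + h))) - fun θ => g (circlePt θ)) θ) *
        conj (p (circlePt θ))).re = χ (circlePt θ) *
        Real.sin (h + (φ (circlePt (θ + h)) - φ (circlePt θ))) := by
      intro θ
      have a1 : conj (circlePt θ) * circlePt θ = 1 := by
        rw [← Complex.normSq_eq_conj_mul_self, Complex.normSq_eq_norm_sq, norm_circlePt]; simp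
      have a2 : ∀ x : ℝ, conj (exp (I * x)) = exp (I * (-x : ℝ)) := fun x => by
        rw [← Complex.exp_conj]; simp
      have a3 : g (circlePt (θ + h)) * conj (g (circlePt θ)) =
          exp (I * ((h + (φ (circlePt (θ + h)) - φ (circlePt θ)) : ℝ))) := by
        rw [hgdef]; simp only [map_mul]
        generalize φ (circlePt (θ + h)) = y
        generalize φ (circlePt θ) = x
        rw [circlePt_add, a2]
        calc _ = (conj (circlePt θ) * circlePt θ) * (circlePt h *
              (exp (I * y) * exp (I * (-x : ℝ)))) := by ring
          _ = _ := by
              rw [a1, one_mul, circlePt_eq_exp h, ← Complex.exp_add, ← Complex.exp_add]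
              congr 1; push_cast; ring
      have a4 : g (circlePt θ) * conj (g (circlePt θ)) = 1 := by
        rw [mul_comm, ← Complex.normSq_eq_conj_mul_self, Complex.normSq_eq_norm_sq, hg1]; simp
      have a5 : (((fun θ => g (circlePt (θ + h))) - fun θ => g (circlePt θ)) θ) *
          conj (p (circlePt θ)) = χ (circlePt θ) * (-I * (g (circlePt (θ + h)) *
            conj (g (circlePt θ)) - g (circlePt θ) * conj (g (circlePt θ)))) := by
        simp only [Pi.sub_apply, hpdef, map_mul, Complex.conj_ofReal, Complex.conj_I]
        ring
      rw [a5, a3, a4, Complex.re_ofReal_mul, re_neg_I_mul_exp_sub_one]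
    simp_rw [e2] at this
    rw [integral_congr_ae (ae_of_all _ e3)] at this
    have e5 : h⁻¹ * ((2 * Real.pi)⁻¹ * ∫ θ, χ (circlePt θ) *
        Real.sin (h + (φ (circlePt (θ + h)) - φ (circlePt θ))) ∂angleMeasure) =
      ((2 * Real.pi)⁻¹ * (h⁻¹ * ∫ θ, χ (circlePt θ) *
        Real.sin (h + (φ (circlePt (θ + h)) - φ (circlePt θ))) ∂angleMeasure)) := by ring
    rw [← e5]
    refine this.congr_fun fun n => ?_
    rw [← Complex.re_ofReal_mul]
    congr 1
    push_cast
    change _ = (h : ℂ)⁻¹ * ((exp (I * n * h) - 1) * c n * conj (d n))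
    ring
  -- limit of the sums
  have hT : Tendsto (fun h : ℝ => ∑' n : ℤ, (((exp (I * n * h) - 1) / h) * c n * conj (d n)).re)
      (𝓝[≠] 0) (𝓝 (∑' n : ℤ, (I * n * c n * conj (d n)).re)) := by
    -- The multiplier `(e^{inh} - 1)/h` tends to `i n` and is bounded by `|n|`, while `∑ |n| |c n|
    -- |d n|` converges because both functions lie in `H^{1/2}`.
    refine tendsto_tsum_of_dominated_convergence hbs ?_ ?_
    · intro n
      have h1 : HasDerivAt (fun h : ℝ => exp (I * n * h)) (I * n) 0 := by
        have h2 : HasDerivAt (fun h : ℝ => I * n * (h : ℂ)) (I * n * 1) 0 :=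
          (Complex.ofRealCLM.hasDerivAt (x := (0:ℝ))).const_mul (I * n)
        simpa using h2.cexp
      rw [hasDerivAt_iff_tendsto_slope_zero] at h1
      have h3 := ((h1.mul_const (c n)).mul_const (conj (d n)))
      refine (Complex.continuous_re.tendsto _).comp (h3.congr fun h => ?_)
      simp [div_eq_inv_mul]
    · filter_upwards [self_mem_nhdsWithin] with h hh n
      have hh' : 0 < |h| := abs_pos.2 hh
      rw [Real.norm_eq_abs]
      refine (Complex.abs_re_le_norm _).trans ?_
      rw [norm_mul, norm_mul, norm_div, Complex.norm_real, Complex.norm_conj, mul_assoc]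
      gcongr
      rw [Real.norm_eq_abs, div_le_iff₀ hh']
      exact norm_exp_int_sub_one_le n h
  -- limit of the integrals
  have hφi : Integrable (fun θ => φ (circlePt θ)) angleMeasure := hφ.1.integrable (by norm_num)
  have hφsL : ∀ h, MemLp (fun θ => φ (circlePt (θ + h))) 2 angleMeasure := by
    intro h
    have := (memLp_angleMeasure_add (periodic_comp_circlePt fun z => (φ z : ℂ)) hφ.1.ofReal h).re
    simpa using this
  have hχb : ∀ (q : ℝ → ℝ), Integrable q angleMeasure →
      Integrable (fun θ => χ (circlePt θ) * q θ) angleMeasure := fun q hq =>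
    hq.bdd_mul (c := M) (hχ.continuous.comp continuous_circlePt).aestronglyMeasurable
      (ae_of_all _ fun θ => (hb _ (circlePt_mem_closedBall _)).1)
  have hR : Tendsto (fun h : ℝ => h⁻¹ * ∫ θ, χ (circlePt θ) *
        Real.sin (h + (φ (circlePt (θ + h)) - φ (circlePt θ))) ∂angleMeasure) (𝓝[≠] 0)
      (𝓝 ((∫ θ, χ (circlePt θ) ∂angleMeasure) -
        ∫ θ, φ (circlePt θ) * fderiv ℝ χ (circlePt θ) (I * circlePt θ) ∂angleMeasure)) := by
    -- This is the cost of replacing `sin(h + δ)` by `h + δ` and dividing by `h`. It vanishes in the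
    -- limit because the `L²` norm squared of the increment is `o(h)`.
    have h0 : Tendsto (fun h : ℝ => M * (4 * (|h| * (2 * Real.pi) +
        |h|⁻¹ * ∫ θ, (φ (circlePt (θ + h)) - φ (circlePt θ)) ^ 2 ∂angleMeasure))) (𝓝[≠] 0)
        (𝓝 0) := by
      have h1 : Tendsto (fun h : ℝ => |h| * (2 * Real.pi)) (𝓝[≠] 0) (𝓝 (|0| * (2 * Real.pi))) :=
        ((continuous_abs.mul continuous_const).tendsto 0).mono_left nhdsWithin_le_nhds
      have := ((h1.add hφ.tendsto_translate).const_mul 4).const_mul M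
      simpa using this
    rw [tendsto_iff_norm_sub_tendsto_zero] 
    have hlim := tendsto_integral_quotient hφ.1 hχ
    rw [tendsto_iff_norm_sub_tendsto_zero] at hlim
    refine squeeze_zero' (Eventually.of_forall fun _ => norm_nonneg _) ?_
      (by simpa using h0.add hlim)
    filter_upwards [self_mem_nhdsWithin] with h hh
    have hh' : 0 < |h| := abs_pos.2 hh
    have hh0 : h ≠ 0 := hh
    refine (norm_sub_le_norm_sub_add_norm_sub _ (∫ θ, χ (circlePt θ) *
        (1 + h⁻¹ * (φ (circlePt (θ + h)) - φ (circlePt θ))) ∂angleMeasure) _).trans ?_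
    refine add_le_add ?_ (le_of_eq (Real.norm_eq_abs _))
    have hδ : MemLp (fun θ => φ (circlePt (θ + h)) - φ (circlePt θ)) 2 angleMeasure :=
      (hφsL h).sub hφ.1
    have hδi := hδ.integrable (by norm_num)
    have hδ2 : Integrable (fun θ => (φ (circlePt (θ + h)) - φ (circlePt θ)) ^ 2) angleMeasure :=
      hδ.integrable_sq
    have hsi : Integrable (fun θ => Real.sin (h + (φ (circlePt (θ + h)) - φ (circlePt θ))))
        angleMeasure := by
      refine Integrable.of_bound (C := 1) ?_ (ae_of_all _ fun θ => Real.abs_sin_le_one _)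
      exact Real.continuous_sin.comp_aestronglyMeasurable
        (aestronglyMeasurable_const.add hδi.aestronglyMeasurable)
    have i1 : Integrable (fun θ => χ (circlePt θ) *
        (1 + h⁻¹ * (φ (circlePt (θ + h)) - φ (circlePt θ)))) angleMeasure :=
      hχb _ ((integrable_const 1).add (hδi.const_mul _))
    rw [← integral_const_mul, ← integral_sub ((hχb _ hsi).const_mul _) i1]
    have hint : Integrable (fun θ => M * (4 * (|h| +
        |h|⁻¹ * (φ (circlePt (θ + h)) - φ (circlePt θ)) ^ 2))) angleMeasure :=
      (((integrable_const _).add (hδ2.const_mul _)).const_mul _).const_mul _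
    refine (norm_integral_le_of_norm_le hint (ae_of_all _ fun θ => ?_)).trans (le_of_eq ?_)
    · set x := φ (circlePt (θ + h)) - φ (circlePt θ)
      have e1 : h⁻¹ * (χ (circlePt θ) * Real.sin (h + x)) - χ (circlePt θ) * (1 + h⁻¹ * x) =
          χ (circlePt θ) * (h⁻¹ * (Real.sin (h + x) - (h + x))) := by
        field_simp
      rw [e1, norm_mul, norm_mul, norm_inv, Real.norm_eq_abs, Real.norm_eq_abs, Real.norm_eq_abs]
      refine mul_le_mul (hb _ (circlePt_mem_closedBall _)).1 ?_ (by positivity) hM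
      rw [inv_mul_le_iff₀ hh']
      refine (abs_sin_sub_self_le _).trans ?_
      have : |h| * (4 * (|h| + |h|⁻¹ * x ^ 2)) = 4 * (h ^ 2 + x ^ 2) := by
        rw [← sq_abs h]; field_simp
      rw [this]
      nlinarith [sq_nonneg (h - x)]
    · rw [integral_const_mul, integral_const_mul, integral_add (integrable_const _)
        (hδ2.const_mul _), integral_const_mul]
      simp [Real.pi_pos.le, mul_comm]
  have hlim := hT.congr fun h => (hq h).tsum_eq
  have := tendsto_nhds_unique hlim (hR.const_mul (2 * Real.pi)⁻¹)
  have hsum : Summable fun n : ℤ => (I * n * c n * conj (d n)).re := by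
    refine Summable.of_norm_bounded hbs fun n => ?_
    rw [Real.norm_eq_abs]
    refine (Complex.abs_re_le_norm _).trans (le_of_eq ?_)
    rw [norm_mul, norm_mul, norm_mul, Complex.norm_I, one_mul, Complex.norm_conj, mul_assoc,
      Complex.norm_intCast]
  have hfin := hsum.hasSum.mul_left (2 * Real.pi)
  rw [this, mul_inv_cancel_left₀ Real.two_pi_pos.ne'] at hfin
  exact hfin

end pairing

/-! ### Uniformizations: inverse, derivative, logarithm, rotations. -/

section univalent

theorem isOpen_unitDisk : IsOpen unitDisk := Metric.isOpen_ball

theorem zero_mem_unitDisk : (0 : ℂ) ∈ unitDisk := Metric.mem_ball_self one_pos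

namespace IsUniformization

variable {f : ℂ → ℂ} {Ω : Set ℂ}

theorem analyticOnNhd (hf : IsUniformization f Ω) : AnalyticOnNhd ℂ f unitDisk :=
  hf.1.analyticOnNhd isOpen_unitDisk

theorem differentiableAt (hf : IsUniformization f Ω) {z : ℂ} (hz : z ∈ unitDisk) :
    DifferentiableAt ℂ f z := hf.1.differentiableAt (isOpen_unitDisk.mem_nhds hz)

theorem discInv_mem (hf : IsUniformization f Ω) {w : ℂ} (hw : w ∈ Ω) : discInv f w ∈ unitDisk :=
  Function.invFunOn_mem (hf.2.surjOn hw)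

theorem apply_discInv (hf : IsUniformization f Ω) {w : ℂ} (hw : w ∈ Ω) : f (discInv f w) = w :=
  Function.invFunOn_eq (hf.2.surjOn hw)

theorem discInv_apply (hf : IsUniformization f Ω) {z : ℂ} (hz : z ∈ unitDisk) :
    discInv f (f z) = z :=
  hf.2.injOn (hf.discInv_mem (hf.2.mapsTo hz)) hz (hf.apply_discInv (hf.2.mapsTo hz))

theorem not_eventually_const (hf : IsUniformization f Ω) {z : ℂ} (hz : z ∈ unitDisk) :
    ¬∀ᶠ w in 𝓝 z, f w = f z := by
  intro h
  have h1 : ∀ᶠ w in 𝓝[≠] z, w ≠ z ∧ f w = f z ∧ w ∈ unitDisk := by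
    filter_upwards [self_mem_nhdsWithin, h.filter_mono nhdsWithin_le_nhds,
      mem_nhdsWithin_of_mem_nhds (isOpen_unitDisk.mem_nhds hz)] with w h1 h2 h3 using ⟨h1, h2, h3⟩
  obtain ⟨w, h1, h2, h3⟩ := h1.exists
  exact h1 (hf.2.injOn h3 hz h2)

theorem nhds_le_map (hf : IsUniformization f Ω) {z : ℂ} (hz : z ∈ unitDisk) :
    𝓝 (f z) ≤ map f (𝓝 z) :=
  (hf.analyticOnNhd z hz).eventually_constant_or_nhds_le_map_nhds.resolve_left
    (hf.not_eventually_const hz)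

theorem isOpen (hf : IsUniformization f Ω) : IsOpen Ω := by
  rw [isOpen_iff_mem_nhds]
  intro w hw
  obtain ⟨z, hz, rfl⟩ := hf.2.surjOn hw
  refine hf.nhds_le_map hz ?_
  exact mem_map.2 (mem_of_superset (isOpen_unitDisk.mem_nhds hz) hf.2.mapsTo)

theorem continuousAt_discInv (hf : IsUniformization f Ω) {w : ℂ} (hw : w ∈ Ω) :
    ContinuousAt (discInv f) w := by
  intro s hs
  have h1 := hf.nhds_le_map (hf.discInv_mem hw)
  rw [hf.apply_discInv hw] at h1
  refine mem_map.2 (h1 (mem_map.2 ?_))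
  filter_upwards [hs, isOpen_unitDisk.mem_nhds (hf.discInv_mem hw)] with z hz hzD
  simpa [hf.discInv_apply hzD] using hz

theorem hasDerivAt_discInv_of_ne (hf : IsUniformization f Ω) {w : ℂ} (hw : w ∈ Ω)
    (h : deriv f (discInv f w) ≠ 0) :
    HasDerivAt (discInv f) (deriv f (discInv f w))⁻¹ w := by
  refine HasDerivAt.of_local_left_inverse (hf.continuousAt_discInv hw)
    (hf.differentiableAt (hf.discInv_mem hw)).hasDerivAt h ?_
  filter_upwards [hf.isOpen.mem_nhds hw] with y hy using hf.apply_discInv hy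

/-- A zero of `f'` would be isolated, since otherwise `f` would be locally constant. The inverse is
then holomorphic off one point and continuous there, hence holomorphic, and the chain rule gives `0
= 1`. -/
theorem deriv_ne_zero (hf : IsUniformization f Ω) {z : ℂ} (hz : z ∈ unitDisk) :
    deriv f z ≠ 0 := by
  have hw : f z ∈ Ω := hf.2.mapsTo hz
  have hz' := hf.discInv_apply hz
  have han : AnalyticAt ℂ (deriv f) z := (hf.analyticOnNhd z hz).deriv
  rcases han.eventually_eq_zero_or_eventually_ne_zero with h | h
  · exfalso
    obtain ⟨r, hr, hb⟩ := Metric.eventually_nhds_iff_ball.1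
      (h.and (isOpen_unitDisk.eventually_mem hz))
    refine hf.not_eventually_const hz ?_
    filter_upwards [Metric.ball_mem_nhds z hr] with y hy
    refine (convex_ball z r).is_const_of_fderivWithin_eq_zero (𝕜 := ℂ)
      (fun x hx => (hf.differentiableAt (hb x hx).2).differentiableWithinAt) (fun x hx => ?_) hy
      (Metric.mem_ball_self hr)
    rw [fderivWithin_of_isOpen Metric.isOpen_ball hx]
    ext
    simpa using (hb x hx).1
  · rw [eventually_nhdsWithin_iff] at h
    have hc := hf.continuousAt_discInv hw
    have h1 : ∀ᶠ y in 𝓝 (f z), (discInv f y ≠ z → deriv f (discInv f y) ≠ 0) := by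
      have := hc.eventually (by rw [hz']; exact h)
      exact this
    obtain ⟨r, hr, hb⟩ := Metric.eventually_nhds_iff_ball.1
      (h1.and (hf.isOpen.eventually_mem hw))
    have hd : DifferentiableOn ℂ (discInv f) (Metric.ball (f z) r) := by
      refine (Complex.differentiableOn_compl_singleton_and_continuousAt_iff
        (Metric.ball_mem_nhds (f z) hr)).1 ⟨fun y hy => ?_, hc⟩
      have hyΩ := (hb y hy.1).2
      refine (hf.hasDerivAt_discInv_of_ne hyΩ ((hb y hy.1).1 fun h0 => hy.2 ?_)
        ).differentiableAt.differentiableWithinAt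
      have := hf.apply_discInv hyΩ
      rw [h0] at this
      exact this.symm
    have hda := (hd.differentiableAt (Metric.ball_mem_nhds _ hr)).hasDerivAt
    have hcomp := hda.comp z (hf.differentiableAt hz).hasDerivAt
    have hid : HasDerivAt (discInv f ∘ f) 1 z := by
      refine (hasDerivAt_id z).congr_of_eventuallyEq ?_
      filter_upwards [isOpen_unitDisk.mem_nhds hz] with y hy using hf.discInv_apply hy
    have := hcomp.unique hid
    intro h0
    rw [h0, mul_zero] at this
    exact zero_ne_one this

theorem hasDerivAt_discInv (hf : IsUniformization f Ω) {w : ℂ} (hw : w ∈ Ω) :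
    HasDerivAt (discInv f) (deriv f (discInv f w))⁻¹ w :=
  hf.hasDerivAt_discInv_of_ne hw (hf.deriv_ne_zero (hf.discInv_mem hw))

theorem differentiableOn_discInv (hf : IsUniformization f Ω) :
    DifferentiableOn ℂ (discInv f) Ω := fun _ hw =>
  (hf.hasDerivAt_discInv hw).differentiableAt.differentiableWithinAt

theorem differentiableOn_deriv (hf : IsUniformization f Ω) :
    DifferentiableOn ℂ (deriv f) unitDisk := hf.1.deriv isOpen_unitDisk

/-- The punctured disk is the image of `(0, 1) × ℝ` under polar coordinates. -/
theorem isPreconnected_diff {a : ℂ} (hf : IsUniformization f Ω) (hfa : f 0 = a) :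
    IsPreconnected (Ω \ {a}) := by
  have h1 : Ω \ {a} = f '' (unitDisk \ {0}) := by
    rw [hf.2.injOn.image_sdiff_subset (by simp), hf.2.image_eq,
      image_singleton, hfa]
  rw [h1]
  refine IsPreconnected.image ?_ f (hf.1.continuousOn.mono sdiff_subset)
  have h2 : unitDisk \ {0} = (fun p : ℝ × ℝ => circleMap 0 p.1 p.2) '' (Ioo 0 1 ×ˢ univ) := by
    ext z
    constructor
    · rintro ⟨hz, hz0⟩
      refine ⟨(‖z‖, arg z), ⟨⟨norm_pos_iff.2 hz0, by simpa using hz⟩, mem_univ _⟩, ?_⟩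
      simp [circleMap]
    · rintro ⟨p, ⟨⟨h0, h1⟩, -⟩, rfl⟩
      refine ⟨?_, ?_⟩
      · simp only [Metric.mem_ball, dist_zero_right, norm_circleMap_zero]
        rwa [abs_of_pos h0]
      · simp [h0.ne']
  rw [h2]
  exact (isPreconnected_Ioo.prod isPreconnected_univ).image _ continuous_circleMap_prod.continuousOn

/-- A primitive of `f''/f'` exists on the disk; with the value `log f'(0)` at the origin, `exp ψ /
f'` is constant and equal to `1`. -/
theorem exists_log_deriv (hf : IsUniformization f Ω) : ∃ ψ : ℂ → ℂ,
    (∀ z ∈ unitDisk, HasDerivAt ψ (deriv (deriv f) z / deriv f z) z) ∧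
    ∀ z ∈ unitDisk, exp (ψ z) = deriv f z := by
  have h1 : DifferentiableOn ℂ (fun z => deriv (deriv f) z / deriv f z) unitDisk :=
    (hf.differentiableOn_deriv.deriv isOpen_unitDisk).div hf.differentiableOn_deriv
      fun z hz => hf.deriv_ne_zero hz
  obtain ⟨ψ, hψ0, hψ⟩ := h1.isExactOn_ball.with_val_at 0 (log (deriv f 0))
  refine ⟨ψ, hψ, fun z hz => ?_⟩
  have hd : ∀ x ∈ unitDisk, HasDerivAt (fun x => exp (ψ x) / deriv f x) 0 x := by
    intro x hx
    have h2 := (hψ x hx).cexp.div (hf.differentiableOn_deriv.differentiableAt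
      (isOpen_unitDisk.mem_nhds hx)).hasDerivAt (hf.deriv_ne_zero hx)
    have h0 := hf.deriv_ne_zero hx
    have h3 : exp (ψ x) * (deriv (deriv f) x / deriv f x) * deriv f x -
        exp (ψ x) * deriv (deriv f) x = 0 := by field_simp; ring
    rw [h3, zero_div] at h2
    exact h2
  have hconst := (convex_ball (0:ℂ) 1).is_const_of_fderivWithin_eq_zero (𝕜 := ℂ)
      (fun x hx => (hd x hx).differentiableAt.differentiableWithinAt) (fun x hx => by
        rw [fderivWithin_of_isOpen Metric.isOpen_ball hx]
        ext; simpa using (hd x hx).deriv) hz zero_mem_unitDisk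
  rw [hψ0, Complex.exp_log (hf.deriv_ne_zero zero_mem_unitDisk),
    div_self (hf.deriv_ne_zero zero_mem_unitDisk), div_eq_one_iff_eq (hf.deriv_ne_zero hz)] at hconst
  exact hconst

/-- Schwarz's lemma for the self-map `f⁻¹ ∘ g` of the disk, which fixes the origin. -/
theorem norm_discInv_comp_le {g : ℂ → ℂ} (hf : IsUniformization f Ω) (hg : IsUniformization g Ω)
    (h0 : f 0 = g 0) {z : ℂ} (hz : z ∈ unitDisk) : ‖discInv f (g z)‖ ≤ ‖z‖ := by
  refine Complex.norm_le_norm_of_mapsTo_ball (f := discInv f ∘ g) (R := 1) ?_ ?_ ?_ ?_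
  · exact hf.differentiableOn_discInv.comp hg.1 hg.2.mapsTo
  · exact fun x hx => Metric.ball_subset_closedBall (hf.discInv_mem (hg.2.mapsTo hx))
  · simp only [Function.comp_apply]
    rw [← h0, hf.discInv_apply zero_mem_unitDisk]
  · simpa using hz

/-- Two uniformizations with the same value at the origin differ by a rotation. -/
theorem exists_rotation {g : ℂ → ℂ} (hf : IsUniformization f Ω) (hg : IsUniformization g Ω)
    (h0 : f 0 = g 0) : ∃ c : ℂ, ‖c‖ = 1 ∧ ∀ z ∈ unitDisk, g z = f (c * z) := by
  have hm0 : discInv f (g 0) = 0 := by rw [← h0, hf.discInv_apply zero_mem_unitDisk]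
  have hn : ∀ z ∈ unitDisk, ‖discInv f (g z)‖ = ‖z‖ := by
    intro z hz
    refine le_antisymm (hf.norm_discInv_comp_le hg h0 hz) ?_
    have := hg.norm_discInv_comp_le hf h0.symm (hf.discInv_mem (hg.2.mapsTo hz))
    rwa [hf.apply_discInv (hg.2.mapsTo hz), hg.discInv_apply hz] at this
  have hz0 : (1 / 2 : ℂ) ∈ unitDisk := by simp; norm_num
  -- Schwarz's lemma in both directions gives `|f⁻¹(g(z))| = |z|`; equality at the single point
  -- `1/2` already makes the map linear.
  obtain ⟨c, hc, he⟩ := Complex.affine_of_mapsTo_ball_of_exists_norm_dslope_eq_div'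
    (f := discInv f ∘ g) (c := 0) (R₁ := 1) (R₂ := 1)
    (hf.differentiableOn_discInv.comp hg.1 hg.2.mapsTo) (fun x hx => by
      simp only [Function.comp_apply, hm0]
      exact Metric.ball_subset_closedBall (hf.discInv_mem (hg.2.mapsTo hx)))
    ⟨1 / 2, hz0, by
      rw [dslope_of_ne _ (by norm_num), slope_def_module]
      simp only [Function.comp_apply, hm0, sub_zero, norm_smul, hn _ hz0]
      simp⟩
  refine ⟨c, by simpa using hc, fun z hz => ?_⟩
  have := he hz
  simp only [Function.comp_apply, hm0, sub_zero, zero_add, smul_eq_mul] at this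
  rw [mul_comm c, ← this, hf.apply_discInv (hg.2.mapsTo hz)]

end IsUniformization

end univalent

/-! ### Change of variables under injective holomorphic maps. -/

section conformal

theorem det_mul_complex (c : ℂ) : (ContinuousLinearMap.mul ℝ ℂ c).det = ‖c‖ ^ 2 := by
  have : (ContinuousLinearMap.mul ℝ ℂ c).det = Algebra.norm ℝ c := rfl
  rw [this, Algebra.norm_complex_apply, Complex.normSq_eq_norm_sq]

theorem HasDerivAt.hasFDerivAt_mul {g : ℂ → ℂ} {c z : ℂ} (h : HasDerivAt g c z) :
    HasFDerivAt g (ContinuousLinearMap.mul ℝ ℂ c) z := by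
  have := h.hasFDerivAt.restrictScalars ℝ
  exact this.congr_fderiv (by ext x; simp [mul_comm])

variable {E : Type*} [NormedAddCommGroup E] [NormedSpace ℝ E]

theorem integrableOn_image_iff_of_conformal {g g' : ℂ → ℂ} {s : Set ℂ} (hs : MeasurableSet s)
    (hg : ∀ z ∈ s, HasDerivAt g (g' z) z) (hi : InjOn g s) (F : ℂ → E) :
    IntegrableOn F (g '' s) ↔ IntegrableOn (fun z => ‖g' z‖ ^ 2 • F (g z)) s := by
  have := integrableOn_image_iff_integrableOn_abs_det_fderiv_smul volume hs
    (fun z hz => (hg z hz).hasFDerivAt_mul.hasFDerivWithinAt) hi F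
  simpa only [det_mul_complex, abs_pow, abs_norm] using this

theorem integral_image_of_conformal {g g' : ℂ → ℂ} {s : Set ℂ} (hs : MeasurableSet s)
    (hg : ∀ z ∈ s, HasDerivAt g (g' z) z) (hi : InjOn g s) (F : ℂ → E) :
    ∫ w in g '' s, F w = ∫ z in s, ‖g' z‖ ^ 2 • F (g z) := by
  have := integral_image_eq_integral_abs_det_fderiv_smul volume hs
    (fun z hz => (hg z hz).hasFDerivAt_mul.hasFDerivWithinAt) hi F
  simpa only [det_mul_complex, abs_pow, abs_norm] using this

end conformal

/-! ### Invariance of the finite energy condition. -/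

section preschwarzian

/-- The logarithmic derivative of `f'` is square integrable. -/
def HasFiniteEnergy (f : ℂ → ℂ) : Prop :=
  IntegrableOn (fun z => ‖deriv (deriv f) z / deriv f z‖ ^ 2) unitDisk

variable {f : ℂ → ℂ} {Ω : Set ℂ}

theorem IsUniformization.comp (hf : IsUniformization f Ω) {σ : ℂ → ℂ}
    (hσ : IsUniformization σ unitDisk) : IsUniformization (f ∘ σ) Ω :=
  ⟨hf.1.comp hσ.1 hσ.2.mapsTo, hf.2.comp hσ.2⟩

theorem HasFiniteEnergy.congr (hf : HasFiniteEnergy f) {g : ℂ → ℂ} (h : EqOn g f unitDisk) :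
    HasFiniteEnergy g := by
  have h1 : EqOn (deriv g) (deriv f) unitDisk := h.deriv isOpen_unitDisk
  have h2 : EqOn (deriv (deriv g)) (deriv (deriv f)) unitDisk := h1.deriv isOpen_unitDisk
  refine IntegrableOn.congr_fun (f := fun z => ‖deriv (deriv f) z / deriv f z‖ ^ 2) hf
    (fun z hz => ?_) isOpen_unitDisk.measurableSet
  simp only [h1 hz, h2 hz]

/-- Chain rule for the logarithmic derivative of the derivative: `f''/f'` is composed with `σ` and
multiplied by `σ'`, and `σ''/σ'` is added. The first term keeps its `L²` norm by conformal
invariance, and the second is bounded. -/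
theorem HasFiniteEnergy.comp (h : HasFiniteEnergy f) (hf : IsUniformization f Ω) {σ : ℂ → ℂ}
    (hσ : IsUniformization σ unitDisk) {C : ℝ}
    (hC : ∀ z ∈ unitDisk, ‖deriv (deriv σ) z / deriv σ z‖ ≤ C) : HasFiniteEnergy (f ∘ σ) := by
  have d1 : ∀ z ∈ unitDisk, deriv (f ∘ σ) z = deriv f (σ z) * deriv σ z := fun z hz =>
    ((hf.differentiableAt (hσ.2.mapsTo hz)).hasDerivAt.comp z
      (hσ.differentiableAt hz).hasDerivAt).deriv
  have hd : ∀ z ∈ unitDisk, HasDerivAt (deriv f) (deriv (deriv f) z) z := fun z hz =>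
    (hf.differentiableOn_deriv.differentiableAt (isOpen_unitDisk.mem_nhds hz)).hasDerivAt
  have hdσ : ∀ z ∈ unitDisk, HasDerivAt (deriv σ) (deriv (deriv σ) z) z := fun z hz =>
    (hσ.differentiableOn_deriv.differentiableAt (isOpen_unitDisk.mem_nhds hz)).hasDerivAt
  have d2 : ∀ z ∈ unitDisk, deriv (deriv (f ∘ σ)) z =
      deriv (deriv f) (σ z) * deriv σ z * deriv σ z + deriv f (σ z) * deriv (deriv σ) z := by
    intro z hz
    have e : deriv (f ∘ σ) =ᶠ[𝓝 z] fun z => deriv f (σ z) * deriv σ z := by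
      filter_upwards [isOpen_unitDisk.mem_nhds hz] with y hy using d1 y hy
    rw [e.deriv_eq]
    have h1 : HasDerivAt (fun z => deriv f (σ z)) _ z :=
      (hd _ (hσ.2.mapsTo hz)).comp z (hσ.differentiableAt hz).hasDerivAt
    exact (h1.mul (hdσ z hz)).deriv
  have hq : ∀ z ∈ unitDisk, deriv (deriv (f ∘ σ)) z / deriv (f ∘ σ) z =
      deriv (deriv f) (σ z) / deriv f (σ z) * deriv σ z + deriv (deriv σ) z / deriv σ z := by
    intro z hz
    have h1 := hf.deriv_ne_zero (hσ.2.mapsTo hz)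
    have h2 := hσ.deriv_ne_zero hz
    rw [d1 z hz, d2 z hz]
    field_simp
  have h1 : IntegrableOn (fun z => ‖deriv σ z‖ ^ 2 • ‖deriv (deriv f) (σ z) / deriv f (σ z)‖ ^ 2)
      unitDisk := by
    rw [← integrableOn_image_iff_of_conformal isOpen_unitDisk.measurableSet
      (fun z hz => (hσ.differentiableAt hz).hasDerivAt) hσ.2.injOn
      (fun z => ‖deriv (deriv f) z / deriv f z‖ ^ 2), hσ.2.image_eq]
    exact h
  have h2 : IntegrableOn (fun z => 2 * (‖deriv σ z‖ ^ 2 •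
      ‖deriv (deriv f) (σ z) / deriv f (σ z)‖ ^ 2) + 2 * C ^ 2) unitDisk :=
    (h1.const_mul 2).add (integrableOn_const (measure_ball_lt_top.ne))
  have hcont : ContinuousOn (fun z => deriv (deriv (f ∘ σ)) z / deriv (f ∘ σ) z) unitDisk :=
    ((hf.comp hσ).differentiableOn_deriv.deriv isOpen_unitDisk).continuousOn.div
      (hf.comp hσ).differentiableOn_deriv.continuousOn fun z hz => (hf.comp hσ).deriv_ne_zero hz
  refine Integrable.mono' h2 (((hcont.norm.pow 2).aestronglyMeasurable
    isOpen_unitDisk.measurableSet)) ?_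
  filter_upwards [ae_restrict_mem isOpen_unitDisk.measurableSet] with z hz
  rw [Real.norm_of_nonneg (by positivity), hq z hz, smul_eq_mul]
  have h3 := norm_add_le (deriv (deriv f) (σ z) / deriv f (σ z) * deriv σ z)
    (deriv (deriv σ) z / deriv σ z)
  rw [norm_mul] at h3
  have h4 := hC z hz
  have h5 := pow_le_pow_left₀ (norm_nonneg _) (h3.trans (add_le_add_right h4 _)) 2
  refine h5.trans ?_
  nlinarith [sq_nonneg (‖deriv (deriv f) (σ z) / deriv f (σ z)‖ * ‖deriv σ z‖ - C)]

theorem isUniformization_rotation {c : ℂ} (hc : ‖c‖ = 1) :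
    IsUniformization (fun z => c * z) unitDisk := by
  have hc0 : c ≠ 0 := by rintro rfl; simp at hc
  refine ⟨by fun_prop, fun z hz => ?_, fun z _ w _ h => mul_left_cancel₀ hc0 h, fun w hw => ?_⟩
  · simpa [hc] using hz
  · refine ⟨c⁻¹ * w, by simpa [hc] using hw, ?_⟩
    simp [hc0]

theorem HasFiniteEnergy.of_apply_zero_eq (h : HasFiniteEnergy f) (hf : IsUniformization f Ω)
    {g : ℂ → ℂ} (hg : IsUniformization g Ω) (h0 : f 0 = g 0) : HasFiniteEnergy g := by
  obtain ⟨c, hc, he⟩ := hf.exists_rotation hg h0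
  refine (h.comp hf (isUniformization_rotation hc) (C := 0) fun z _ => ?_).congr he
  have : deriv (fun z => c * z) = fun _ => c := by
    ext z; simp
  simp [this]

/-- The disk automorphism `z ↦ (z + c) / (1 + c̄ z)`. -/
noncomputable def diskShift (c z : ℂ) : ℂ := (z + c) / (1 + conj c * z)

theorem one_sub_norm_le_norm_one_add {c z : ℂ} (hz : z ∈ unitDisk) :
    1 - ‖c‖ ≤ ‖1 + conj c * z‖ := by
  have h1 : ‖conj c * z‖ ≤ ‖c‖ := by
    rw [norm_mul, Complex.norm_conj]
    exact mul_le_of_le_one_right (norm_nonneg _) (by simpa using (show ‖z‖ < 1 by simpa using hz).le)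
  have h2 := norm_sub_norm_le (1 : ℂ) (-(conj c * z))
  rw [norm_one, norm_neg, sub_neg_eq_add] at h2
  linarith

theorem one_add_conj_mul_ne_zero {c z : ℂ} (hc : ‖c‖ < 1) (hz : z ∈ unitDisk) :
    1 + conj c * z ≠ 0 := norm_pos_iff.1 ((sub_pos.2 hc).trans_le (one_sub_norm_le_norm_one_add hz))

theorem diskShift_mem {c z : ℂ} (hc : ‖c‖ < 1) (hz : z ∈ unitDisk) : diskShift c z ∈ unitDisk := by
  have h0 := one_add_conj_mul_ne_zero hc hz
  have hz' : ‖z‖ < 1 := by simpa using hz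
  rw [Metric.mem_ball, dist_zero_right, diskShift, norm_div, div_lt_one (norm_pos_iff.2 h0),
    ← sq_lt_sq₀ (norm_nonneg _) (norm_nonneg _), Complex.sq_norm, Complex.sq_norm,
    Complex.normSq_apply, Complex.normSq_apply]
  have a := pow_lt_one₀ (norm_nonneg c) hc two_ne_zero
  have b := pow_lt_one₀ (norm_nonneg z) hz' two_ne_zero
  rw [Complex.sq_norm, Complex.normSq_apply] at a b
  simp
  nlinarith [mul_pos (sub_pos.2 a) (sub_pos.2 b)]

theorem diskShift_neg_diskShift {c z : ℂ} (hc : ‖c‖ < 1) (hz : z ∈ unitDisk) :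
    diskShift (-c) (diskShift c z) = z := by
  have h0 := one_add_conj_mul_ne_zero hc hz
  have h1 : 1 - conj c * c ≠ 0 := by
    rw [← Complex.normSq_eq_conj_mul_self, Complex.normSq_eq_norm_sq, ← ofReal_one, ← ofReal_sub,
      Ne, ofReal_eq_zero]
    have a := pow_lt_one₀ (norm_nonneg c) hc two_ne_zero
    linarith
  rw [diskShift, diskShift]
  have h2 : 1 + conj (-c) * ((z + c) / (1 + conj c * z)) = (1 - conj c * c) / (1 + conj c * z) := by
    rw [map_neg]; field_simp; ring
  have h3 : (z + c) / (1 + conj c * z) + -c = z * (1 - conj c * c) / (1 + conj c * z) := by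
    rw [← sub_eq_add_neg, eq_div_iff h0, sub_mul, div_mul_cancel₀ _ h0]; ring
  rw [h2, h3, div_div_div_cancel_right₀ h0, mul_div_cancel_right₀ _ h1]

theorem isUniformization_diskShift {c : ℂ} (hc : ‖c‖ < 1) :
    IsUniformization (diskShift c) unitDisk := by
  refine ⟨?_, fun z hz => diskShift_mem hc hz, fun z hz w hw h => ?_, fun w hw => ?_⟩
  · intro z hz
    have h0 := one_add_conj_mul_ne_zero hc hz
    have : DifferentiableAt ℂ (diskShift c) z := by
      unfold diskShift
      exact DifferentiableAt.fun_div (by fun_prop) (by fun_prop) h0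
    exact this.differentiableWithinAt
  · rw [← diskShift_neg_diskShift hc hz, h, diskShift_neg_diskShift hc hw]
  · refine ⟨diskShift (-c) w, diskShift_mem (by simpa using hc) hw, ?_⟩
    have := diskShift_neg_diskShift (c := -c) (by simpa using hc) hw
    rwa [neg_neg] at this

theorem hasDerivAt_diskShift {c z : ℂ} (hc : ‖c‖ < 1) (hz : z ∈ unitDisk) :
    HasDerivAt (diskShift c) ((1 - conj c * c) / (1 + conj c * z) ^ 2) z := by
  have h0 := one_add_conj_mul_ne_zero hc hz
  have h1 : HasDerivAt (fun z => 1 + conj c * z) (conj c) z := by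
    simpa using ((hasDerivAt_id z).const_mul (conj c)).const_add 1
  have := ((hasDerivAt_id z).add_const c).fun_div h1 h0
  refine HasDerivAt.congr_deriv (f := diskShift c) this ?_
  simp only [id]
  ring

theorem norm_deriv_deriv_diskShift_le {c z : ℂ} (hc : ‖c‖ < 1) (hz : z ∈ unitDisk) :
    ‖deriv (deriv (diskShift c)) z / deriv (diskShift c) z‖ ≤ 2 / (1 - ‖c‖) := by
  have h0 := one_add_conj_mul_ne_zero hc hz
  have h1 : HasDerivAt (fun z => 1 + conj c * z) (conj c) z := by
    simpa using ((hasDerivAt_id z).const_mul (conj c)).const_add 1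
  have hne := (isUniformization_diskShift hc).deriv_ne_zero hz
  have hd := (hasDerivAt_diskShift hc hz).deriv
  have e : deriv (diskShift c) =ᶠ[𝓝 z] fun z => (1 - conj c * c) / (1 + conj c * z) ^ 2 := by
    filter_upwards [isOpen_unitDisk.mem_nhds hz] with y hy using (hasDerivAt_diskShift hc hy).deriv
  have h2 := ((hasDerivAt_const z (1 - conj c * c)).fun_div (h1.fun_pow 2) (pow_ne_zero 2 h0)).deriv
  have h3 : 1 - conj c * c ≠ 0 := by
    intro h; rw [hd, h, zero_div] at hne; exact hne rfl
  rw [e.deriv_eq, h2, hd]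
  have h4 : (0 * (1 + conj c * z) ^ 2 - (1 - conj c * c) * (((2 : ℕ) : ℂ) * (1 + conj c * z) ^ (2 - 1) * conj c)) /
      ((1 + conj c * z) ^ 2) ^ 2 / ((1 - conj c * c) / (1 + conj c * z) ^ 2) =
      -(2 * conj c) / (1 + conj c * z) := by
    field_simp
    push_cast
    ring
  rw [h4, norm_div, norm_neg, norm_mul, Complex.norm_conj]
  have h5 := one_sub_norm_le_norm_one_add (c := c) hz
  have h6 : 0 < 1 - ‖c‖ := sub_pos.2 hc
  gcongr
  simp
  linarith

/-- Every uniformization of a Weil-Petersson domain has finite energy. -/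
theorem HasFiniteEnergy.of_isUniformization (h : HasFiniteEnergy f) (hf : IsUniformization f Ω)
    {g : ℂ → ℂ} (hg : IsUniformization g Ω) : HasFiniteEnergy g := by
  -- Shifting the disk by `f⁻¹(g(0))` makes the values at the origin agree; what remains is a
  -- rotation.
  have hc := hf.discInv_mem (hg.2.mapsTo zero_mem_unitDisk)
  have hc' : ‖discInv f (g 0)‖ < 1 := by simpa using hc
  refine (h.comp hf (isUniformization_diskShift hc') fun z hz =>
    norm_deriv_deriv_diskShift_le hc' hz).of_apply_zero_eq
      (hf.comp (isUniformization_diskShift hc')) hg ?_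
  simp only [Function.comp_apply, diskShift, zero_add, mul_zero, add_zero, div_one]
  exact hf.apply_discInv (hg.2.mapsTo zero_mem_unitDisk)

end preschwarzian

/-! ### Mean values and the little Bloch property. -/

section bloch

theorem integral_circle_of_differentiableOn {G : ℂ → ℂ} (hG : DifferentiableOn ℂ G unitDisk)
    {r : ℝ} (hr : r ∈ Ioo (0 : ℝ) 1) :
    ∫ θ, G (circleMap 0 r θ) ∂angleMeasure = 2 * Real.pi * G 0 := by
  have hsub : Metric.closedBall (0 : ℂ) |r| ⊆ unitDisk :=
    Metric.closedBall_subset_ball (by rw [abs_of_pos hr.1]; exact hr.2)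
  have h := DiffContOnCl.circleAverage (f := G) (c := 0) (R := r)
    ((hG.mono hsub).diffContOnCl_ball subset_rfl)
  rw [Real.circleAverage_def, intervalIntegral.integral_of_le Real.two_pi_pos.le,
    inv_smul_eq_iff₀ Real.two_pi_pos.ne', Complex.real_smul] at h
  rw [angleMeasure, h]; push_cast; ring

theorem integral_unitDisk_of_differentiableOn {G : ℂ → ℂ} (hG : DifferentiableOn ℂ G unitDisk)
    (hi : IntegrableOn G unitDisk) : ∫ z in unitDisk, G z = Real.pi * G 0 := by
  rw [setIntegral_unitDisk_eq hi, integral_prod _ (integrable_rectMeasure_of_integrableOn hi)]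
  have h1 : ∀ r ∈ Ioo (0 : ℝ) 1, ∫ θ, (r : ℝ) • G (circleMap 0 r θ) ∂angleMeasure =
      r • (2 * Real.pi * G 0) := fun r hr => by
    rw [integral_smul, integral_circle_of_differentiableOn hG hr]
  rw [setIntegral_congr_fun measurableSet_Ioo h1, integral_smul_const,
    ← integral_Ioc_eq_integral_Ioo, ← intervalIntegral.integral_of_le zero_le_one, integral_id]
  rw [Complex.real_smul]; push_cast; ring

/-- The mean value property of the holomorphic function `g²`, after rescaling the ball to the unit
disk. -/
theorem norm_sq_mul_le_integral {g : ℂ → ℂ} {z : ℂ} {ρ : ℝ} (hρ : 0 < ρ)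
    (hg : DifferentiableOn ℂ g (Metric.ball z ρ))
    (hi : IntegrableOn (fun w => ‖g w‖ ^ 2) (Metric.ball z ρ)) :
    ‖g z‖ ^ 2 * (Real.pi * ρ ^ 2) ≤ ∫ w in Metric.ball z ρ, ‖g w‖ ^ 2 := by
  have him : (fun w : ℂ => z + ρ * w) '' unitDisk = Metric.ball z ρ := by
    ext w
    constructor
    · rintro ⟨x, hx, rfl⟩
      have hx' : ‖x‖ < 1 := by simpa using hx
      simp only [Metric.mem_ball, dist_self_add_left, norm_mul, Complex.norm_real,
        Real.norm_of_nonneg hρ.le]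
      nlinarith
    · intro hw
      have hρ' : (ρ : ℂ) ≠ 0 := by exact_mod_cast hρ.ne'
      refine ⟨(w - z) / ρ, ?_, by field_simp; ring⟩
      rw [Metric.mem_ball, dist_zero_right, norm_div, Complex.norm_real, Real.norm_of_nonneg hρ.le,
        div_lt_one hρ, ← dist_eq_norm]
      exact hw
  have hd : ∀ w ∈ unitDisk, HasDerivAt (fun w : ℂ => z + ρ * w) (ρ : ℂ) w := fun w _ => by
    simpa using ((hasDerivAt_id w).const_mul (ρ : ℂ)).const_add z
  have hinj : InjOn (fun w : ℂ => z + ρ * w) unitDisk := fun x _ y _ h => by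
    have hρ' : (ρ : ℂ) ≠ 0 := by exact_mod_cast hρ.ne'
    exact mul_left_cancel₀ hρ' (add_left_cancel h)
  have hmaps : MapsTo (fun w : ℂ => z + ρ * w) unitDisk (Metric.ball z ρ) := by
    rw [← him]; exact mapsTo_image _ _
  rw [← him] at hi ⊢
  rw [integrableOn_image_iff_of_conformal isOpen_unitDisk.measurableSet hd hinj] at hi
  rw [integral_image_of_conformal isOpen_unitDisk.measurableSet hd hinj]
  simp only [Complex.norm_real, Real.norm_of_nonneg hρ.le] at hi ⊢
  rw [integral_smul]
  have hi' : IntegrableOn (fun w => ‖g (z + ρ * w)‖ ^ 2) unitDisk := by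
    have := hi.smul (ρ ^ 2)⁻¹
    refine this.congr (ae_of_all _ fun w => ?_)
    simp only [Pi.smul_apply]
    rw [inv_smul_smul₀ (by positivity)]
  have hG : DifferentiableOn ℂ (fun w => g (z + ρ * w) ^ 2) unitDisk :=
    (hg.comp (fun w hw => (hd w hw).differentiableAt.differentiableWithinAt) hmaps).pow 2
  have hGi : IntegrableOn (fun w => g (z + ρ * w) ^ 2) unitDisk := by
    refine Integrable.mono' hi' (hG.continuousOn.aestronglyMeasurable
      isOpen_unitDisk.measurableSet) (ae_of_all _ fun w => by rw [norm_pow])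
  have h1 := integral_unitDisk_of_differentiableOn hG hGi
  have h2 := norm_integral_le_integral_norm (μ := volume.restrict unitDisk)
    (fun w => g (z + ρ * w) ^ 2)
  rw [h1] at h2
  simp only [mul_zero, add_zero, norm_mul, norm_pow, Complex.norm_real,
    Real.norm_of_nonneg Real.pi_pos.le] at h2
  rw [smul_eq_mul]
  calc _ = ρ ^ 2 * (Real.pi * ‖g z‖ ^ 2) := by ring
    _ ≤ _ := by gcongr

/-- The little Bloch property of functions of finite Dirichlet integral. -/
theorem exists_mul_norm_le_of_integrable {N : ℂ → ℂ} (hN : DifferentiableOn ℂ N unitDisk)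
    (hi : IntegrableOn (fun w => ‖N w‖ ^ 2) unitDisk) {ε : ℝ} (hε : 0 < ε) :
    ∃ h₀ ∈ Ioo (0 : ℝ) 1, ∀ t ∈ Ioc 0 h₀, ∀ z : ℂ, ‖z‖ ≤ 1 - t → t * ‖N z‖ ≤ ε := by
  -- Annuli shrinking to the boundary, whose energy tends to zero.
  set S : ℕ → Set ℂ := fun n => unitDisk \ Metric.closedBall 0 (1 - 2 / (n + 1)) with hS
  have hSm : ∀ n, MeasurableSet (S n) := fun n =>
    isOpen_unitDisk.measurableSet.diff Metric.isClosed_closedBall.measurableSet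
  have hSa : Antitone S := by
    intro m n hmn
    refine sdiff_subset_sdiff_right (Metric.closedBall_subset_closedBall ?_)
    gcongr
  have hSe : ⋂ n, S n = ∅ := by
    rw [eq_empty_iff_forall_notMem]
    intro z hz
    rw [mem_iInter] at hz
    have hz1 : ‖z‖ < 1 := by simpa using (hz 0).1
    obtain ⟨n, hn⟩ := exists_nat_gt (2 / (1 - ‖z‖))
    refine (hz n).2 ?_
    rw [mem_closedBall_zero_iff]
    have h1 : 0 < 1 - ‖z‖ := by linarith
    have h2 : 2 / ((n : ℝ) + 1) ≤ 1 - ‖z‖ := by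
      rw [div_le_iff₀ (by positivity)]
      rw [div_lt_iff₀ h1] at hn
      nlinarith
    linarith
  have hlim := tendsto_setIntegral_of_antitone hSm hSa
    ⟨0, hi.mono_set sdiff_subset⟩
  rw [hSe, setIntegral_empty] at hlim
  have hpos : 0 < Real.pi * ε ^ 2 := by positivity
  obtain ⟨n, hn⟩ := (hlim.eventually (gt_mem_nhds hpos)).exists
  set δ : ℝ := 1 / (n + 1) with hδ
  have hδ0 : 0 < δ := by positivity
  set T := ∫ w in unitDisk, ‖N w‖ ^ 2 with hT
  have hT0 : 0 ≤ T := integral_nonneg fun _ => by positivity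
  refine ⟨min (1 / 2) (ε * δ / (T + 1)), ⟨by positivity, (min_le_left _ _).trans_lt (by norm_num)⟩,
    fun t ht z hz => ?_⟩
  have ht0 := ht.1
  have hball : ∀ ρ, ρ ≤ 1 - ‖z‖ → Metric.ball z ρ ⊆ unitDisk := fun ρ hρ =>
    Metric.ball_subset_ball' (by rw [dist_zero_right]; linarith)
  -- The annulus has width `2δ`. If `z` is within `δ` of the circle, the ball of radius `1 - |z|`
  -- stays in the annulus, where the energy is below `π ε²`. Otherwise the ball of radius `δ` and
  -- the total energy bound `|N z|`, and `t` has been chosen small enough.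
  rcases le_or_gt (1 - ‖z‖) δ with h | h
  · set d := 1 - ‖z‖ with hd
    have hd0 : 0 < d := by linarith
    have hsub : Metric.ball z d ⊆ S n := by
      refine subset_sdiff.2 ⟨hball d le_rfl, ?_⟩
      rw [Set.disjoint_left]
      intro w hw hw'
      rw [Metric.mem_ball, dist_eq_norm] at hw
      rw [mem_closedBall_zero_iff] at hw'
      have h1 := norm_sub_norm_le z w
      rw [norm_sub_rev] at hw
      have h2 : 2 / ((n : ℝ) + 1) = 2 * δ := by rw [hδ]; ring
      rw [h2] at hw'
      linarith
    have h1 := norm_sq_mul_le_integral hd0 (hN.mono (hball d le_rfl))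
      (hi.mono_set (hball d le_rfl))
    have h2 : ∫ w in Metric.ball z d, ‖N w‖ ^ 2 ≤ ∫ w in S n, ‖N w‖ ^ 2 :=
      setIntegral_mono_set (hi.mono_set sdiff_subset) (ae_of_all _ fun _ => by positivity)
        hsub.eventuallyLE
    have h3 : (d * ‖N z‖) ^ 2 ≤ ε ^ 2 := by
      have h4 : Real.pi * (d * ‖N z‖) ^ 2 ≤ Real.pi * ε ^ 2 := by
        calc _ = ‖N z‖ ^ 2 * (Real.pi * d ^ 2) := by ring
          _ ≤ _ := (h1.trans h2).trans hn.le
      exact le_of_mul_le_mul_left h4 Real.pi_pos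
    have h5 : d * ‖N z‖ ≤ ε := (sq_le_sq₀ (by positivity) hε.le).1 h3
    refine le_trans ?_ h5
    gcongr
    linarith
  · have h1 := norm_sq_mul_le_integral hδ0 (hN.mono (hball δ h.le)) (hi.mono_set (hball δ h.le))
    have h2 : ∫ w in Metric.ball z δ, ‖N w‖ ^ 2 ≤ T :=
      setIntegral_mono_set hi (ae_of_all _ fun _ => by positivity) (hball δ h.le).eventuallyLE
    have h3 : (δ * ‖N z‖) ^ 2 ≤ (T + 1) ^ 2 := by
      have hpi : (1 : ℝ) ≤ Real.pi := by linarith [Real.pi_gt_three]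
      have h4 : (δ * ‖N z‖) ^ 2 ≤ Real.pi * (δ * ‖N z‖) ^ 2 :=
        le_mul_of_one_le_left (by positivity) hpi
      calc _ ≤ _ := h4
        _ = ‖N z‖ ^ 2 * (Real.pi * δ ^ 2) := by ring
        _ ≤ T := h1.trans h2
        _ ≤ _ := by nlinarith
    have h5 : δ * ‖N z‖ ≤ T + 1 := (sq_le_sq₀ (by positivity) (by positivity)).1 h3
    have h6 : t ≤ ε * δ / (T + 1) := ht.2.trans (min_le_right _ _)
    calc t * ‖N z‖ ≤ ε * δ / (T + 1) * ‖N z‖ := by gcongr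
      _ = ε / (T + 1) * (δ * ‖N z‖) := by ring
      _ ≤ ε / (T + 1) * (T + 1) := by gcongr
      _ = ε := by field_simp

end bloch

/-! ### Distortion of `f` at small scales. -/

section distortion

theorem norm_exp_sub_one_le_exp_norm (x : ℂ) : ‖exp x - 1‖ ≤ Real.exp ‖x‖ - 1 := by
  simpa using Complex.norm_exp_sub_sum_le_exp_norm_sub_sum x 1

theorem Real.exp_sub_one_le_two_mul {x : ℝ} (h0 : 0 ≤ x) (h1 : x ≤ 1) : Real.exp x - 1 ≤ 2 * x := by
  have := Real.abs_exp_sub_one_le (x := x) (by rwa [abs_of_nonneg h0])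
  rw [abs_of_nonneg h0] at this
  exact (le_abs_self _).trans this

/-- A function on the disk with `exp ∘ ψ = f'` and `ψ' = N`, and the Bloch bound at scales below
`h₀`. -/
structure BlochLog (f ψ N : ℂ → ℂ) (ε h₀ : ℝ) : Prop where
  pos : 0 < ε
  le_half : ε ≤ 1 / 2
  mem : h₀ ∈ Ioo (0 : ℝ) 1
  hasDerivAt_map : ∀ z ∈ unitDisk, HasDerivAt f (exp (ψ z)) z
  hasDerivAt_log : ∀ z ∈ unitDisk, HasDerivAt ψ (N z) z
  bound : ∀ t ∈ Ioc 0 h₀, ∀ z : ℂ, ‖z‖ ≤ 1 - t → t * ‖N z‖ ≤ ε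

namespace BlochLog

variable {f ψ N : ℂ → ℂ} {ε h₀ h : ℝ} {z : ℂ}

/-- The path from `(1 - h) z` to `z`. -/
noncomputable def path (h : ℝ) (z : ℂ) (s : ℝ) : ℂ := ((1 - Real.exp (-s) * h : ℝ) : ℂ) * z

theorem path_zero : path h z 0 = (1 - h) * z := by simp [path]

theorem hasDerivAt_path (s : ℝ) :
    HasDerivAt (path h z) ((Real.exp (-s) * h : ℝ) * z) s := by
  have h1 : HasDerivAt (fun s : ℝ => 1 - Real.exp (-s) * h) (Real.exp (-s) * h) s := by
    have := (((hasDerivAt_neg s).exp).mul_const h).const_sub 1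
    simpa using this
  exact (h1.ofReal_comp).mul_const z

theorem norm_path_le (hz : ‖z‖ ≤ 1) (hh : h ∈ Ioc (0 : ℝ) 1) {s : ℝ} (hs : 0 ≤ s) :
    ‖path h z s‖ ≤ 1 - Real.exp (-s) * h := by
  have h1 : Real.exp (-s) ≤ 1 := Real.exp_le_one_iff.2 (by linarith)
  have h2 : 0 ≤ 1 - Real.exp (-s) * h := by
    have := mul_le_one₀ h1 hh.1.le hh.2
    linarith
  rw [path, norm_mul, Complex.norm_real, Real.norm_of_nonneg h2]
  exact mul_le_of_le_one_right h2 hz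

theorem path_mem (hz : ‖z‖ ≤ 1) (hh : h ∈ Ioc (0 : ℝ) 1) {s : ℝ} (hs : 0 ≤ s) :
    path h z s ∈ unitDisk := by
  have := norm_path_le hz hh hs
  have h3 : 0 < Real.exp (-s) * h := mul_pos (Real.exp_pos _) hh.1
  simp only [Metric.mem_ball, dist_zero_right]
  linarith

/-- In the exponential parametrization the distance to the circle is at least `e^{-s} h` and the
speed is at most `e^{-s} h`, so the Bloch bound gives `ψ ∘ path` speed at most `ε`. -/
theorem norm_log_path_sub_le (H : BlochLog f ψ N ε h₀) (hz : ‖z‖ ≤ 1) (hh : h ∈ Ioc 0 h₀)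
    {s : ℝ} (hs : 0 ≤ s) : ‖ψ (path h z s) - ψ ((1 - h) * z)‖ ≤ ε * s := by
  have hh1 : h ∈ Ioc (0 : ℝ) 1 := ⟨hh.1, hh.2.trans H.mem.2.le⟩
  have hd : ∀ x ∈ Icc 0 s, HasDerivAt (fun x => ψ (path h z x))
      (((Real.exp (-x) * h : ℝ) * z) • N (path h z x)) x := fun x hx =>
    (H.hasDerivAt_log _ (path_mem hz hh1 hx.1)).scomp x (hasDerivAt_path x)
  have := norm_image_sub_le_of_norm_deriv_le_segment' (C := ε)
    (fun x hx => (hd x hx).hasDerivWithinAt) (fun x hx => ?_) s ⟨hs, le_rfl⟩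
  · rwa [path_zero, sub_zero] at this
  · have h1 : Real.exp (-x) ≤ 1 := Real.exp_le_one_iff.2 (by linarith [hx.1])
    have h3 : 0 < Real.exp (-x) * h := mul_pos (Real.exp_pos _) hh.1
    rw [norm_smul, norm_mul, Complex.norm_real, Real.norm_of_nonneg h3.le]
    calc _ ≤ Real.exp (-x) * h * 1 * ‖N (path h z x)‖ := by gcongr
      _ = Real.exp (-x) * h * ‖N (path h z x)‖ := by ring
      _ ≤ ε := H.bound _ ⟨h3, (mul_le_of_le_one_left hh.1.le h1).trans hh.2⟩ _
          (norm_path_le hz hh1 hx.1)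

/-- The derivative is frozen at the start of the path. By the preceding estimate its relative error
at time `s` is at most `e^{εs} - 1`, against a speed `e^{-s} h`, which is integrable up to the
boundary. -/
theorem norm_map_path_sub_le (H : BlochLog f ψ N ε h₀) (hz : ‖z‖ ≤ 1) (hh : h ∈ Ioc 0 h₀)
    {s : ℝ} (hs : 0 ≤ s) :
    ‖f (path h z s) - f ((1 - h) * z) - exp (ψ ((1 - h) * z)) * (path h z s - (1 - h) * z)‖ ≤
      2 * ε * h * ‖exp (ψ ((1 - h) * z))‖ := by
  have hh1 : h ∈ Ioc (0 : ℝ) 1 := ⟨hh.1, hh.2.trans H.mem.2.le⟩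
  set c := exp (ψ ((1 - h) * z)) with hc
  have hε := H.pos
  have hε2 := H.le_half
  have h1ε : 0 < 1 - ε := by linarith
  have hd : ∀ x ∈ Icc 0 s, HasDerivAt (fun x => f (path h z x) - f ((1 - h) * z) -
      c * (path h z x - (1 - h) * z))
      (((Real.exp (-x) * h : ℝ) * z) • exp (ψ (path h z x)) - c * ((Real.exp (-x) * h : ℝ) * z)) x :=
    fun x hx =>
      (((H.hasDerivAt_map _ (path_mem hz hh1 hx.1)).scomp x (hasDerivAt_path x)).sub_const _).sub
        (((hasDerivAt_path x).sub_const _).const_mul c)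
  -- An explicit primitive of the bound `|c| h (e^{-(1-ε)x} - e^{-x})`. It stays below `|c| h
  -- ε/(1-ε)`, hence below `2 ε h |c|` since `ε ≤ 1/2`.
  have hB : ∀ x, HasDerivAt (fun x => ‖c‖ * h * ((1 - Real.exp (-((1 - ε) * x))) / (1 - ε) -
      (1 - Real.exp (-x)))) (‖c‖ * h * (Real.exp (-((1 - ε) * x)) - Real.exp (-x))) x := by
    intro x
    have a1 : HasDerivAt (fun x => Real.exp (-((1 - ε) * x)))
        (Real.exp (-((1 - ε) * x)) * -((1 - ε) * 1)) x :=
      (((hasDerivAt_id x).const_mul (1 - ε)).neg).exp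
    have a2 : HasDerivAt (fun x => Real.exp (-x)) (Real.exp (-x) * -1) x := (hasDerivAt_neg x).exp
    have := (((a1.const_sub 1).div_const (1 - ε)).sub (a2.const_sub 1)).const_mul (‖c‖ * h)
    refine this.congr_deriv ?_
    field_simp
  have key := image_norm_le_of_norm_deriv_right_le_deriv_boundary
    (fun x hx => (hd x hx).continuousAt.continuousWithinAt)
    (fun x hx => (hd x ⟨hx.1, hx.2.le⟩).hasDerivWithinAt) (a := 0) (b := s)
    (by simp [path_zero]) hB (fun x hx => ?_) ⟨hs, le_rfl⟩
  · refine key.trans ?_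
    have e1 : Real.exp (-s) ≤ Real.exp (-((1 - ε) * s)) := Real.exp_le_exp.2 (by nlinarith)
    have e2 : Real.exp (-((1 - ε) * s)) ≤ Real.exp (-((1 - ε) * s)) / (1 - ε) := by
      rw [le_div_iff₀ h1ε]
      nlinarith [Real.exp_pos (-((1 - ε) * s))]
    have e3 : (1 - Real.exp (-((1 - ε) * s))) / (1 - ε) =
        1 + ε / (1 - ε) - Real.exp (-((1 - ε) * s)) / (1 - ε) := by field_simp; ring
    have e4 : ε / (1 - ε) ≤ 2 * ε := by rw [div_le_iff₀ h1ε]; nlinarith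
    calc _ ≤ ‖c‖ * h * (2 * ε) := by
          have := hh.1
          gcongr
          rw [e3]; linarith
      _ = _ := by ring
  · have h3 : 0 < Real.exp (-x) * h := mul_pos (Real.exp_pos _) hh.1
    have e1 : ((Real.exp (-x) * h : ℝ) * z) • exp (ψ (path h z x)) -
        c * ((Real.exp (-x) * h : ℝ) * z) =
        (((Real.exp (-x) * h : ℝ) * z) * c) * (exp (ψ (path h z x) - ψ ((1 - h) * z)) - 1) := by
      rw [Complex.exp_sub, hc, smul_eq_mul]
      field_simp
    have e2 := norm_exp_sub_one_le_exp_norm (ψ (path h z x) - ψ ((1 - h) * z))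
    have e3 := Real.exp_le_exp.2 (H.norm_log_path_sub_le hz hh hx.1)
    rw [e1, norm_mul, norm_mul, norm_mul, Complex.norm_real, Real.norm_of_nonneg h3.le]
    calc _ ≤ (Real.exp (-x) * h * 1 * ‖c‖) * (Real.exp (ε * x) - 1) := by
          gcongr
          exact e2.trans (by linarith)
      _ = ‖c‖ * h * (Real.exp (-x) * Real.exp (ε * x) - Real.exp (-x)) := by ring
      _ = _ := by rw [← Real.exp_add]; ring_nf

theorem norm_map_sub_le (H : BlochLog f ψ N ε h₀) (hz : z ∈ unitDisk) (hh : h ∈ Ioc 0 h₀) :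
    ‖f z - f ((1 - h) * z) - exp (ψ ((1 - h) * z)) * (h * z)‖ ≤
      2 * ε * h * ‖exp (ψ ((1 - h) * z))‖ := by
  have hz1 : ‖z‖ ≤ 1 := by
    have : ‖z‖ < 1 := by simpa using hz
    exact this.le
  have hp : Tendsto (path h z) atTop (𝓝 z) := by
    have h1 : Tendsto (fun s : ℝ => 1 - Real.exp (-s) * h) atTop (𝓝 (1 - 0 * h)) :=
      ((Real.tendsto_exp_neg_atTop_nhds_zero).mul_const h).const_sub 1
    have h2 := ((Complex.continuous_ofReal.tendsto _).comp h1).mul_const z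
    simp only [zero_mul, sub_zero, ofReal_one, one_mul] at h2
    exact h2
  have hf : Tendsto (fun s => f (path h z s)) atTop (𝓝 (f z)) :=
    (H.hasDerivAt_map z hz).continuousAt.tendsto.comp hp
  have hlim := ((hf.sub_const (f ((1 - h) * z))).sub
    ((hp.sub_const ((1 - h) * z)).const_mul (exp (ψ ((1 - h) * z))))).norm
  have e : z - (1 - h) * z = h * z := by ring
  rw [e] at hlim
  refine le_of_tendsto hlim ?_
  filter_upwards [eventually_ge_atTop 0] with s hs using H.norm_map_path_sub_le hz1 hh hs

theorem norm_log_sub_le (H : BlochLog f ψ N ε h₀) (hh : h ∈ Ioc 0 h₀) {u v : ℂ}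
    (hu : ‖u‖ ≤ 1 - h) (hv : ‖v‖ ≤ 1 - h) (huv : ‖u - v‖ ≤ h) : ‖ψ u - ψ v‖ ≤ ε := by
  have hm : ∀ x : ℂ, ‖x‖ ≤ 1 - h → x ∈ unitDisk := fun x hx => by
    have := hh.1
    simp only [Metric.mem_ball, dist_zero_right]; linarith
  have := (convex_closedBall (0 : ℂ) (1 - h)).norm_image_sub_le_of_norm_hasDerivWithin_le
    (f := ψ) (f' := N) (C := ε / h) (x := v) (y := u)
    (fun x hx => (H.hasDerivAt_log x (hm x (by simpa using hx))).hasDerivWithinAt)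
    (fun x hx => by
      rw [le_div_iff₀ hh.1, mul_comm]
      exact H.bound h hh x (by simpa using hx)) (by simpa using hv) (by simpa using hu)
  refine this.trans ?_
  rw [div_mul_eq_mul_div, div_le_iff₀ hh.1]
  have := H.pos
  gcongr

theorem norm_exp_log_sub_le (H : BlochLog f ψ N ε h₀) (hh : h ∈ Ioc 0 h₀) {u v : ℂ}
    (hu : ‖u‖ ≤ 1 - h) (hv : ‖v‖ ≤ 1 - h) (huv : ‖u - v‖ ≤ h) :
    ‖exp (ψ u) - exp (ψ v)‖ ≤ 2 * ε * ‖exp (ψ v)‖ := by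
  have h1 := H.norm_log_sub_le hh hu hv huv
  have h2 := norm_exp_sub_one_le_exp_norm (ψ u - ψ v)
  have h3 := Real.exp_le_exp.2 h1
  have h4 := Real.exp_sub_one_le_two_mul H.pos.le (by linarith [H.le_half])
  have e : exp (ψ u) - exp (ψ v) = (exp (ψ u - ψ v) - 1) * exp (ψ v) := by
    rw [sub_mul, ← Complex.exp_add, sub_add_cancel, one_mul]
  rw [e, norm_mul]
  gcongr
  linarith

theorem norm_map_sub_sub_le (H : BlochLog f ψ N ε h₀) (hh : h ∈ Ioc 0 h₀) {u v : ℂ}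
    (hu : ‖u‖ ≤ 1 - h) (hv : ‖v‖ ≤ 1 - h) (huv : ‖u - v‖ ≤ h) :
    ‖f u - f v - exp (ψ v) * (u - v)‖ ≤ 2 * ε * h * ‖exp (ψ v)‖ := by
  have hm : ∀ x : ℂ, ‖x‖ ≤ 1 - h → x ∈ unitDisk := fun x hx => by
    have := hh.1
    simp only [Metric.mem_ball, dist_zero_right]; linarith
  set s := Metric.closedBall (0 : ℂ) (1 - h) ∩ Metric.closedBall v h
  have hs : Convex ℝ s := (convex_closedBall _ _).inter (convex_closedBall _ _)
  have := hs.norm_image_sub_le_of_norm_hasDerivWithin_le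
    (f := fun x => f x - exp (ψ v) * x) (f' := fun x => exp (ψ x) - exp (ψ v))
    (C := 2 * ε * ‖exp (ψ v)‖) (x := v) (y := u)
    (fun x hx => by
      have h1 := (H.hasDerivAt_map x (hm x (by simpa using hx.1)))
      have h2 := (hasDerivAt_id x).const_mul (exp (ψ v))
      rw [mul_one] at h2
      exact (h1.sub h2).hasDerivWithinAt)
    (fun x hx => H.norm_exp_log_sub_le hh (by simpa using hx.1) hv
      (by simpa [dist_eq_norm] using hx.2)) ⟨by simpa using hv, by simpa using hh.1.le⟩
      ⟨by simpa using hu, by simpa [dist_eq_norm] using huv⟩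
  have e : f u - f v - exp (ψ v) * (u - v) = f u - exp (ψ v) * u - (f v - exp (ψ v) * v) := by ring
  rw [e]
  refine this.trans ?_
  have h1 := H.pos
  calc _ ≤ 2 * ε * ‖exp (ψ v)‖ * h := by gcongr
    _ = _ := by ring

theorem norm_one_sub_mul_le (hh : h ∈ Ioc (0 : ℝ) 1) (hz : ‖z‖ ≤ 1) : ‖(1 - h) * z‖ ≤ 1 - h := by
  rw [← ofReal_one, ← ofReal_sub, norm_mul, Complex.norm_real,
    Real.norm_of_nonneg (by linarith [hh.2])]
  exact mul_le_of_le_one_right (by linarith [hh.2]) hz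

/-- The distortion estimate: at scale `h`, the map `f` is almost affine. -/
theorem norm_sub_sub_le (H : BlochLog f ψ N ε h₀) {z w : ℂ} (hz : z ∈ unitDisk)
    (hw : w ∈ unitDisk) (hh : h ∈ Ioc 0 h₀) (hzw : ‖z - w‖ ≤ h) :
    ‖f z - f w - exp (ψ ((1 - h) * z)) * (z - w)‖ ≤
      10 * ε * h * ‖exp (ψ ((1 - h) * z))‖ := by
  have hh1 : h ∈ Ioc (0 : ℝ) 1 := ⟨hh.1, hh.2.trans H.mem.2.le⟩
  have hz1 : ‖z‖ < 1 := by simpa using hz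
  have hw1 : ‖w‖ < 1 := by simpa using hw
  have hε := H.pos
  have hh0 := hh.1
  have hu := norm_one_sub_mul_le hh1 hz1.le
  have hv := norm_one_sub_mul_le hh1 hw1.le
  have huv : ‖(1 - h) * z - (1 - h) * w‖ ≤ h := by
    rw [← mul_sub, ← ofReal_one, ← ofReal_sub, norm_mul, Complex.norm_real,
      Real.norm_of_nonneg (by linarith [hh1.2])]
    calc _ ≤ 1 * ‖z - w‖ := by gcongr; linarith
      _ ≤ h := by rwa [one_mul]
  have a1 := H.norm_map_sub_le hz hh
  have a2 := H.norm_map_sub_le hw hh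
  have a3 := H.norm_map_sub_sub_le hh hv hu (by rwa [norm_sub_rev])
  have a4 := H.norm_exp_log_sub_le hh hv hu (by rwa [norm_sub_rev])
  set u := (1 - h) * z
  set v := (1 - h) * w
  set c := exp (ψ u)
  set d := exp (ψ v)
  have hd : ‖d‖ ≤ 2 * ‖c‖ := by
    have := norm_sub_norm_le d c
    nlinarith [norm_nonneg c, H.le_half]
  have a5 : ‖(d - c) * (h * w)‖ ≤ 2 * ε * ‖c‖ * h := by
    rw [norm_mul, norm_mul, Complex.norm_real, Real.norm_of_nonneg hh0.le]
    calc _ ≤ 2 * ε * ‖c‖ * (h * 1) := by gcongr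
      _ = _ := by ring
  -- The comparison goes from `z` down to `u = (1-h)z`, across to `v = (1-h)w` and up to `w`. In
  -- units of `ε h |c|` the four terms cost `2`, `4`, `2` and `2`, the `4` because `|d| ≤ 2|c|`.
  have e : f z - f w - c * (z - w) = (f z - f u - c * (h * z)) - (f w - f v - d * (h * w)) -
      (f v - f u - c * (v - u)) - (d - c) * (h * w) := by
    simp only [u, v]; ring
  rw [e]
  have b1 := norm_sub_le ((f z - f u - c * (h * z)) - (f w - f v - d * (h * w)) -
      (f v - f u - c * (v - u))) ((d - c) * (h * w))
  have b2 := norm_sub_le ((f z - f u - c * (h * z)) - (f w - f v - d * (h * w)))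
      (f v - f u - c * (v - u))
  have b3 := norm_sub_le (f z - f u - c * (h * z)) (f w - f v - d * (h * w))
  have b4 : 2 * ε * h * ‖d‖ ≤ 2 * ε * h * (2 * ‖c‖) := by gcongr
  linarith

end BlochLog

end distortion

/-! ### Continuous extension to the closed disk. -/

section boundary_extension

theorem closure_unitDisk : closure unitDisk = Metric.closedBall (0 : ℂ) 1 :=
  closure_ball 0 one_ne_zero

theorem unitDisk_subset_closedBall : unitDisk ⊆ Metric.closedBall (0 : ℂ) 1 :=
  Metric.ball_subset_closedBall

variable {f ψ : ℂ → ℂ} {Ω : Set ℂ}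

/-- A logarithm of the derivative of a uniformization of finite energy. -/
structure IsLogDeriv (f ψ : ℂ → ℂ) (Ω : Set ℂ) : Prop where
  unif : IsUniformization f Ω
  energy : HasFiniteEnergy f
  hasDerivAt : ∀ z ∈ unitDisk, HasDerivAt ψ (deriv (deriv f) z / deriv f z) z
  exp_eq : ∀ z ∈ unitDisk, exp (ψ z) = deriv f z

namespace IsLogDeriv

theorem exists_blochLog (H : IsLogDeriv f ψ Ω) {ε : ℝ} (hε : 0 < ε) (hε2 : ε ≤ 1 / 2) :
    ∃ h₀, BlochLog f ψ (fun z => deriv (deriv f) z / deriv f z) ε h₀ := by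
  obtain ⟨h₀, hm, hb⟩ := exists_mul_norm_le_of_integrable
    ((H.unif.differentiableOn_deriv.deriv isOpen_unitDisk).div H.unif.differentiableOn_deriv
      fun z hz => H.unif.deriv_ne_zero hz) H.energy hε
  refine ⟨h₀, hε, hε2, hm, fun z hz => ?_, H.hasDerivAt, hb⟩
  rw [H.exp_eq z hz]
  exact (H.unif.differentiableAt hz).hasDerivAt

theorem continuousOn_log (H : IsLogDeriv f ψ Ω) : ContinuousOn ψ unitDisk := fun z hz =>
  (H.hasDerivAt z hz).continuousAt.continuousWithinAt

/-- With `h = e^{-s} h₀`, the Bloch bound at `ε = 1/2` lets `|ψ|` grow at most like `C + s/2`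
towards the boundary, so `h |f'|` is at most `h₀ e^C e^{-s/2}`. -/
theorem exists_mul_norm_le (H : IsLogDeriv f ψ Ω) {η : ℝ} (hη : 0 < η) :
    ∃ h₁ ∈ Ioo (0 : ℝ) 1, ∀ h ∈ Ioc 0 h₁, ∀ z : ℂ, ‖z‖ ≤ 1 →
      h * ‖exp (ψ ((1 - h) * z))‖ ≤ η := by
  obtain ⟨h₀, B⟩ := H.exists_blochLog (ε := 1 / 2) (by norm_num) le_rfl
  have h0 := B.mem.1
  have hsub : Metric.closedBall (0 : ℂ) (1 - h₀) ⊆ unitDisk :=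
    Metric.closedBall_subset_ball (by linarith)
  obtain ⟨C, hC⟩ := (isCompact_closedBall (0 : ℂ) (1 - h₀)).exists_bound_of_continuousOn
    (H.continuousOn_log.mono hsub)
  have hlim : Tendsto (fun s : ℝ => h₀ * Real.exp C * Real.exp (-(1 / 2 * s))) atTop (𝓝 0) := by
    have h1 : Tendsto (fun s : ℝ => 1 / 2 * s) atTop atTop :=
      tendsto_id.const_mul_atTop (by norm_num)
    simpa using (Real.tendsto_exp_neg_atTop_nhds_zero.comp h1).const_mul (h₀ * Real.exp C)
  obtain ⟨S, hS⟩ := ((hlim.eventually (gt_mem_nhds hη)).and (eventually_ge_atTop 0)).exists_forall_of_atTop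
  have hS0 := (hS S le_rfl).2
  have hS1 : Real.exp (-S) ≤ 1 := Real.exp_le_one_iff.2 (by linarith)
  refine ⟨Real.exp (-S) * h₀, ⟨mul_pos (Real.exp_pos _) h0,
    (mul_le_of_le_one_left h0.le hS1).trans_lt B.mem.2⟩, fun h hh z hz => ?_⟩
  set s := Real.log (h₀ / h) with hs
  have hh0 := hh.1
  have hexp : Real.exp (-s) * h₀ = h := by
    rw [hs, Real.exp_neg, Real.exp_log (by positivity)]; field_simp
  have hsS : S ≤ s := by
    have : Real.exp (-s) ≤ Real.exp (-S) := by
      refine le_of_mul_le_mul_right ?_ h0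
      rw [hexp]; exact hh.2
    have := Real.exp_le_exp.1 this
    linarith
  have h1 := B.norm_log_path_sub_le hz ⟨h0, le_rfl⟩ (hS0.trans hsS)
  have e1 : BlochLog.path h₀ z s = (1 - h) * z := by
    rw [BlochLog.path, hexp]; push_cast; ring
  rw [e1] at h1
  have h2 := hC ((1 - h₀) * z) (by
    rw [mem_closedBall_zero_iff]
    exact BlochLog.norm_one_sub_mul_le ⟨h0, B.mem.2.le⟩ hz)
  have h3 : ‖ψ ((1 - h) * z)‖ ≤ C + 1 / 2 * s := by
    have := norm_sub_norm_le (ψ ((1 - h) * z)) (ψ ((1 - h₀) * z))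
    linarith
  have h4 : ‖exp (ψ ((1 - h) * z))‖ ≤ Real.exp (C + 1 / 2 * s) :=
    (Complex.norm_exp_le_exp_norm _).trans (Real.exp_le_exp.2 h3)
  calc _ ≤ Real.exp (-s) * h₀ * Real.exp (C + 1 / 2 * s) := by rw [hexp]; gcongr
    _ = h₀ * Real.exp C * Real.exp (-(1 / 2 * s)) := by
        rw [Real.exp_add]
        have : Real.exp (-s) * Real.exp (1 / 2 * s) = Real.exp (-(1 / 2 * s)) := by
          rw [← Real.exp_add]; ring_nf
        rw [← this]; ring
    _ ≤ η := (hS s hsS).1.le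

theorem exists_norm_sub_le (H : IsLogDeriv f ψ Ω) {η : ℝ} (hη : 0 < η) :
    ∃ δ > 0, ∀ z ∈ unitDisk, ∀ w ∈ unitDisk, ‖z - w‖ ≤ δ → ‖f z - f w‖ ≤ η := by
  obtain ⟨h₀, B⟩ := H.exists_blochLog (ε := 1 / 10) (by norm_num) (by norm_num)
  obtain ⟨h₁, hm, hb⟩ := H.exists_mul_norm_le (η := η / 2) (by positivity)
  have hpos : 0 < min h₀ h₁ := lt_min B.mem.1 hm.1
  refine ⟨min h₀ h₁, hpos, fun z hz w hw hzw => ?_⟩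
  set h := min h₀ h₁
  have hz1 : ‖z‖ < 1 := by simpa using hz
  have h1 := B.norm_sub_sub_le hz hw ⟨hpos, min_le_left _ _⟩ hzw
  have h2 := hb h ⟨hpos, min_le_right _ _⟩ z hz1.le
  set c := exp (ψ ((1 - h) * z))
  have h3 := norm_sub_norm_le (f z - f w) (c * (z - w))
  rw [norm_mul] at h3
  have h4 : ‖c‖ * ‖z - w‖ ≤ ‖c‖ * h := by gcongr
  linarith

theorem uniformContinuousOn (H : IsLogDeriv f ψ Ω) : UniformContinuousOn f unitDisk := by
  rw [Metric.uniformContinuousOn_iff_le]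
  intro η hη
  obtain ⟨δ, hδ, h⟩ := H.exists_norm_sub_le hη
  exact ⟨δ, hδ, fun z hz w hw hzw => by
    rw [dist_eq_norm] at hzw ⊢; exact h z hz w hw hzw⟩

theorem exists_tendsto (H : IsLogDeriv f ψ Ω) {ζ : ℂ} (hζ : ζ ∈ Metric.closedBall (0 : ℂ) 1) :
    ∃ y, Tendsto f (𝓝[unitDisk] ζ) (𝓝 y) := by
  have hne : (𝓝[unitDisk] ζ).NeBot := mem_closure_iff_nhdsWithin_neBot.1 (closure_unitDisk ▸ hζ)
  have hc : Cauchy (map f (𝓝[unitDisk] ζ)) := by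
    refine (cauchy_nhds.mono nhdsWithin_le_nhds : Cauchy (𝓝[unitDisk] ζ)).map_of_le
      H.uniformContinuousOn (by simpa using self_mem_nhdsWithin)
  exact CompleteSpace.complete hc

theorem tendsto_boundaryMap (H : IsLogDeriv f ψ Ω) {ζ : ℂ}
    (hζ : ζ ∈ Metric.closedBall (0 : ℂ) 1) :
    Tendsto f (𝓝[unitDisk] ζ) (𝓝 (boundaryMap f ζ)) := tendsto_extendFrom (H.exists_tendsto hζ)

theorem continuousOn_boundaryMap (H : IsLogDeriv f ψ Ω) :
    ContinuousOn (boundaryMap f) (Metric.closedBall (0 : ℂ) 1) :=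
  continuousOn_extendFrom closure_unitDisk.ge fun _ => H.exists_tendsto

theorem boundaryMap_eq (H : IsLogDeriv f ψ Ω) {z : ℂ} (hz : z ∈ unitDisk) :
    boundaryMap f z = f z := extendFrom_extends H.unif.1.continuousOn z hz

theorem image_boundaryMap (H : IsLogDeriv f ψ Ω) :
    boundaryMap f '' Metric.closedBall (0 : ℂ) 1 = closure Ω := by
  have himg : boundaryMap f '' unitDisk = Ω := by
    rw [← H.unif.2.image_eq]
    exact image_congr fun z hz => H.boundaryMap_eq hz
  refine Subset.antisymm ?_ ?_
  · have hc : ContinuousOn (boundaryMap f) (closure unitDisk) := by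
      rw [closure_unitDisk]; exact H.continuousOn_boundaryMap
    have := hc.image_closure
    rwa [closure_unitDisk, himg] at this
  · refine closure_minimal ?_
      ((isCompact_closedBall 0 1).image_of_continuousOn H.continuousOn_boundaryMap).isClosed
    rw [← himg]
    exact image_mono unitDisk_subset_closedBall

theorem isBounded (H : IsLogDeriv f ψ Ω) : Bornology.IsBounded Ω :=
  (((isCompact_closedBall 0 1).image_of_continuousOn
    H.continuousOn_boundaryMap).isBounded).subset (H.image_boundaryMap ▸ subset_closure)

/-- If the limit lay in `Ω`, continuity of the inverse there would make `z = f⁻¹(f(z))` converge to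
an interior point instead of `ζ`. -/
theorem boundaryMap_notMem (H : IsLogDeriv f ψ Ω) {ζ : ℂ} (hζ : ‖ζ‖ = 1) :
    boundaryMap f ζ ∉ Ω := by
  intro hm
  have hζ' : ζ ∈ Metric.closedBall (0 : ℂ) 1 := by simp [hζ]
  have hne : (𝓝[unitDisk] ζ).NeBot := mem_closure_iff_nhdsWithin_neBot.1 (closure_unitDisk ▸ hζ')
  have h1 : Tendsto (fun z => discInv f (f z)) (𝓝[unitDisk] ζ)
      (𝓝 (discInv f (boundaryMap f ζ))) :=
    (H.unif.continuousAt_discInv hm).tendsto.comp (H.tendsto_boundaryMap hζ')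
  have h2 : Tendsto (fun z => discInv f (f z)) (𝓝[unitDisk] ζ) (𝓝 ζ) := by
    refine (tendsto_id.mono_left nhdsWithin_le_nhds).congr' ?_
    filter_upwards [self_mem_nhdsWithin] with z hz using (H.unif.discInv_apply hz).symm
  have h3 := tendsto_nhds_unique h1 h2
  have h4 := H.unif.discInv_mem hm
  rw [h3] at h4
  simp [hζ] at h4

/-- The distortion estimate on the closed disk. -/
theorem norm_boundaryMap_sub_sub_le (H : IsLogDeriv f ψ Ω) {N : ℂ → ℂ} {ε h₀ h : ℝ}
    (B : BlochLog f ψ N ε h₀) {ζ ξ : ℂ} (hζ : ζ ∈ Metric.closedBall (0 : ℂ) 1)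
    (hξ : ξ ∈ Metric.closedBall (0 : ℂ) 1) (hh : h ∈ Ioc 0 h₀) (hζξ : ‖ζ - ξ‖ ≤ h) :
    ‖boundaryMap f ζ - boundaryMap f ξ - exp (ψ ((1 - h) * ζ)) * (ζ - ξ)‖ ≤
      10 * ε * h * ‖exp (ψ ((1 - h) * ζ))‖ := by
  have hr : ∀ x ∈ Metric.closedBall (0 : ℂ) 1, ∀ r ∈ Ioo (0 : ℝ) 1, (r : ℂ) * x ∈ unitDisk := by
    intro x hx r hr
    rw [mem_closedBall_zero_iff] at hx
    rw [Metric.mem_ball, dist_zero_right, norm_mul, Complex.norm_real, Real.norm_of_nonneg hr.1.le]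
    nlinarith [hr.1, hr.2]
  have hev : ∀ᶠ r : ℝ in 𝓝[<] 1, r ∈ Ioo (0 : ℝ) 1 := Ioo_mem_nhdsLT zero_lt_one
  have hlim0 : ∀ x : ℂ, Tendsto (fun r : ℝ => (r : ℂ) * x) (𝓝[<] 1) (𝓝 x) := by
    intro x
    have : Tendsto (fun r : ℝ => (r : ℂ) * x) (𝓝 1) (𝓝 ((1 : ℝ) * x)) :=
      (Continuous.tendsto (by fun_prop) 1)
    rw [ofReal_one, one_mul] at this
    exact this.mono_left nhdsWithin_le_nhds
  have hlim : ∀ x ∈ Metric.closedBall (0 : ℂ) 1,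
      Tendsto (fun r : ℝ => f (r * x)) (𝓝[<] 1) (𝓝 (boundaryMap f x)) := by
    intro x hx
    refine (H.tendsto_boundaryMap hx).comp (tendsto_nhdsWithin_iff.2 ⟨hlim0 x, ?_⟩)
    filter_upwards [hev] with r hr' using hr x hx r hr'
  have hmem : (1 - h) * ζ ∈ unitDisk := by
    have := BlochLog.norm_one_sub_mul_le (h := h) ⟨hh.1, hh.2.trans B.mem.2.le⟩
      (mem_closedBall_zero_iff.1 hζ)
    simp only [Metric.mem_ball, dist_zero_right]; linarith [hh.1]
  have hlimψ : Tendsto (fun r : ℝ => exp (ψ ((1 - h) * (r * ζ)))) (𝓝[<] 1)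
      (𝓝 (exp (ψ ((1 - h) * ζ)))) := by
    refine (Complex.continuous_exp.tendsto _).comp ?_
    have h1 : ContinuousAt ψ ((1 - h) * ζ) := (H.hasDerivAt _ hmem).continuousAt
    exact h1.tendsto.comp ((hlim0 ζ).const_mul (1 - (h : ℂ)))
  refine le_of_tendsto_of_tendsto (((hlim ζ hζ).sub (hlim ξ hξ)).sub
    (hlimψ.mul ((hlim0 ζ).sub (hlim0 ξ)))).norm (hlimψ.norm.const_mul (10 * ε * h)) ?_
  filter_upwards [hev] with r hr'
  refine B.norm_sub_sub_le (hr ζ hζ r hr') (hr ξ hξ r hr') hh ?_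
  rw [← mul_sub, norm_mul, Complex.norm_real, Real.norm_of_nonneg hr'.1.le]
  calc _ ≤ 1 * ‖ζ - ξ‖ := by gcongr; exact hr'.2.le
    _ ≤ h := by rwa [one_mul]

end IsLogDeriv

theorem exists_isLogDeriv (hf : IsUniformization f Ω) (he : HasFiniteEnergy f) :
    ∃ ψ, IsLogDeriv f ψ Ω := by
  obtain ⟨ψ, h1, h2⟩ := hf.exists_log_deriv
  exact ⟨ψ, hf, he, h1, h2⟩

end boundary_extension

/-! ### Injectivity and differentiability on the circle; the outward normal. -/

section normal

/-- If the normals differ, `n' - n` makes an obtuse angle with `n` and an acute one with `n'`, so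
points in that direction would lie both in `Ω` and outside its closure. -/
theorem IsOutwardUnitNormal.unique {Ω : Set ℂ} {p n n' : ℂ} (h : IsOutwardUnitNormal Ω p n)
    (h' : IsOutwardUnitNormal Ω p n') : n = n' := by
  by_contra hne
  have hd : 0 < ‖n' - n‖ := norm_pos_iff.2 (sub_ne_zero.2 (Ne.symm hne))
  have hs : ‖n' - n‖ ^ 2 = 2 - 2 * inner ℝ n' n := by
    rw [norm_sub_sq_real, h.1, h'.1]; ring
  have i1 : inner ℝ (n' - n) n = -(‖n' - n‖ ^ 2 / 2) := by
    rw [inner_sub_left, real_inner_self_eq_norm_sq, h.1, hs]; ring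
  have i2 : inner ℝ (n' - n) n' = ‖n' - n‖ ^ 2 / 2 := by
    rw [inner_sub_left, real_inner_self_eq_norm_sq, h'.1, hs, real_inner_comm]; ring
  set ε := ‖n' - n‖ / 4 with hε
  have hev := (h.2 ε (by positivity)).and (h'.2 ε (by positivity))
  have hlim : Tendsto (fun t : ℝ => p + t • (n' - n)) (𝓝[>] 0) (𝓝 p) := by
    have : Tendsto (fun t : ℝ => p + t • (n' - n)) (𝓝 0) (𝓝 (p + (0 : ℝ) • (n' - n))) :=
      Continuous.tendsto (by fun_prop) 0
    rw [zero_smul, add_zero] at this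
    exact this.mono_left nhdsWithin_le_nhds
  obtain ⟨t, ht, h1⟩ := ((hlim.eventually hev).and self_mem_nhdsWithin).exists
  have ht0 : 0 < t := h1
  simp only [add_sub_cancel_left, norm_smul, inner_smul_left, Real.norm_of_nonneg ht0.le, i1, i2,
    RCLike.conj_to_real] at ht
  have hq : p + t • (n' - n) ∈ Ω := by
    refine ht.1.1 ?_
    have : t * (‖n' - n‖ ^ 2 / 4) > 0 := by positivity
    rw [hε]; nlinarith
  refine ht.2.2 ?_ (subset_closure hq)
  have : t * (‖n' - n‖ ^ 2 / 4) > 0 := by positivity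
  rw [hε]; nlinarith

theorem IsOutwardUnitNormal.outwardNormal_eq {Ω : Set ℂ} {p n : ℂ}
    (h : IsOutwardUnitNormal Ω p n) : outwardNormal Ω p = n := by
  have hex : ∃ n, IsOutwardUnitNormal Ω p n := ⟨n, h⟩
  rw [outwardNormal, dif_pos hex]
  exact hex.choose_spec.unique h

variable {f ψ : ℂ → ℂ} {Ω : Set ℂ}

namespace IsLogDeriv

theorem tendsto_ofReal_mul (x : ℂ) : Tendsto (fun r : ℝ => (r : ℂ) * x) (𝓝[<] 1) (𝓝 x) := by
  have : Tendsto (fun r : ℝ => (r : ℂ) * x) (𝓝 1) (𝓝 ((1 : ℝ) * x)) :=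
    (Continuous.tendsto (by fun_prop) 1)
  rw [ofReal_one, one_mul] at this
  exact this.mono_left nhdsWithin_le_nhds

theorem ofReal_mul_mem {x : ℂ} (hx : ‖x‖ ≤ 1) {r : ℝ} (hr : r ∈ Ioo (0 : ℝ) 1) :
    (r : ℂ) * x ∈ unitDisk := by
  rw [Metric.mem_ball, dist_zero_right, norm_mul, Complex.norm_real, Real.norm_of_nonneg hr.1.le]
  nlinarith [hr.1, hr.2]

theorem tendsto_radial (H : IsLogDeriv f ψ Ω) {x : ℂ} (hx : ‖x‖ ≤ 1) :
    Tendsto (fun r : ℝ => f (r * x)) (𝓝[<] 1) (𝓝 (boundaryMap f x)) := by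
  refine (H.tendsto_boundaryMap (by simpa using hx)).comp
    (tendsto_nhdsWithin_iff.2 ⟨tendsto_ofReal_mul x, ?_⟩)
  filter_upwards [Ioo_mem_nhdsLT zero_lt_one] with r hr using ofReal_mul_mem hx hr

/-- Suppose two boundary points have the same image `p`. For `r` near `1` the `F`-preimages of
`f(rζ)` and `f(rξ)` are close to `F⁻¹(p)`, and the segment joining them stays in the disk. Its image
under `F` is a short curve in `Ω`, and `f⁻¹` carries this curve to a path from `rζ` to `rξ`. Some
point of the path is at distance exactly `h` from `rζ`, where distortion forces `f` to move by at
least `h m / 2`, contradicting the shortness of the curve. -/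
theorem boundaryMap_ne_of_ne (H : IsLogDeriv f ψ Ω) (F : ℂ ≃ₜ ℂ) (hF : Ω = F '' unitDisk)
    {ζ ξ : ℂ} (hζ : ‖ζ‖ = 1) (hξ : ‖ξ‖ = 1) (hne : ζ ≠ ξ) :
    boundaryMap f ζ ≠ boundaryMap f ξ := by
  intro heq
  set p := boundaryMap f ζ with hp
  obtain ⟨h₀, B⟩ := H.exists_blochLog (ε := 1 / 20) (by norm_num) (by norm_num)
  have hd : 0 < ‖ζ - ξ‖ := norm_pos_iff.2 (sub_ne_zero.2 hne)
  -- Since `r > 1/2`, the endpoints `rζ` and `rξ` are more than `h` apart, so the path must cross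
  -- distance `h`.
  set h := min h₀ (‖ζ - ξ‖ / 2) with hh
  have h0 : 0 < h := lt_min B.mem.1 (by positivity)
  have hh0 : h ∈ Ioc 0 h₀ := ⟨h0, min_le_left _ _⟩
  have h1 : h < 1 := (min_le_left _ _).trans_lt B.mem.2
  have hsub : Metric.closedBall (0 : ℂ) (1 - h) ⊆ unitDisk :=
    Metric.closedBall_subset_ball (by linarith)
  obtain ⟨x₀, hx₀, hmin⟩ := (isCompact_closedBall (0 : ℂ) (1 - h)).exists_isMinOn
    ⟨0, by simp [h1.le]⟩ (f := fun z => ‖exp (ψ z)‖)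
    ((Complex.continuous_exp.comp_continuousOn (H.continuousOn_log.mono hsub)).norm)
  set m := ‖exp (ψ x₀)‖ with hm
  have hm0 : 0 < m := norm_pos_iff.2 (Complex.exp_ne_zero _)
  set q₀ := F.symm p with hq₀
  obtain ⟨δ, hδ, hFδ⟩ := Metric.continuousAt_iff.1 (F.continuous.continuousAt (x := q₀))
    (h * m / 8) (by positivity)
  have lim : ∀ x : ℂ, ‖x‖ = 1 → boundaryMap f x = p →
      Tendsto (fun r : ℝ => F.symm (f (r * x))) (𝓝[<] 1) (𝓝 q₀) := fun x hx hxp => by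
    have := H.tendsto_radial hx.le
    rw [hxp] at this
    exact (F.symm.continuous.tendsto p).comp this
  have e1 := (lim ζ hζ rfl).eventually (Metric.ball_mem_nhds q₀ hδ)
  have e2 := (lim ξ hξ heq.symm).eventually (Metric.ball_mem_nhds q₀ hδ)
  obtain ⟨r, ⟨⟨ha, hb⟩, hr⟩⟩ := ((e1.and e2).and
    (Ioo_mem_nhdsLT (show (1 / 2 : ℝ) < 1 by norm_num))).exists
  have hr' : r ∈ Ioo (0 : ℝ) 1 := ⟨by linarith [hr.1], hr.2⟩
  set a := F.symm (f (r * ζ)) with hadef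
  set b := F.symm (f (r * ξ)) with hbdef
  have hzD := ofReal_mul_mem hζ.le hr'
  have hwD := ofReal_mul_mem hξ.le hr'
  have haD : ∀ x ∈ unitDisk, F.symm (f x) ∈ unitDisk := by
    intro x hx
    have := H.unif.2.mapsTo hx
    rw [hF] at this
    obtain ⟨y, hy, hyx⟩ := this
    rw [← hyx]; simpa using hy
  set k : ℝ → ℂ := fun t => discInv f (F (AffineMap.lineMap a b t)) with hk
  have hseg : ∀ t ∈ Icc (0 : ℝ) 1, AffineMap.lineMap a b t ∈ unitDisk := fun t ht =>
    (convex_ball (0 : ℂ) 1).lineMap_mem (haD _ hzD) (haD _ hwD) ht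
  have hsegΩ : ∀ t ∈ Icc (0 : ℝ) 1, F (AffineMap.lineMap a b t) ∈ Ω := fun t ht => by
    rw [hF]; exact mem_image_of_mem F (hseg t ht)
  have hkc : ContinuousOn (fun t => ‖k t - r * ζ‖) (Icc 0 1) := by
    refine ContinuousOn.norm (ContinuousOn.sub ?_ continuousOn_const)
    intro t ht
    have hc : Continuous fun t : ℝ => F (AffineMap.lineMap a b t) :=
      F.continuous.comp (AffineMap.lineMap_continuous)
    exact (ContinuousAt.comp (f := fun t : ℝ => F (AffineMap.lineMap a b t)) (g := discInv f)
      (H.unif.continuousAt_discInv (hsegΩ t ht)) hc.continuousAt).continuousWithinAt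
  have hk0 : k 0 = r * ζ := by
    simp only [hk, AffineMap.lineMap_apply_zero, hadef, Homeomorph.apply_symm_apply,
      H.unif.discInv_apply hzD]
  have hk1 : k 1 = r * ξ := by
    simp only [hk, AffineMap.lineMap_apply_one, hbdef, Homeomorph.apply_symm_apply,
      H.unif.discInv_apply hwD]
  obtain ⟨t, ht, hkt⟩ : h ∈ (fun t => ‖k t - r * ζ‖) '' Icc 0 1 := by
    refine intermediate_value_Icc zero_le_one hkc ⟨?_, ?_⟩
    · simp only [hk0, sub_self, norm_zero]; exact h0.le
    · simp only [hk1]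
      rw [← mul_sub, norm_mul, Complex.norm_real, Real.norm_of_nonneg hr'.1.le, norm_sub_rev]
      have : h ≤ ‖ζ - ξ‖ / 2 := min_le_right _ _
      nlinarith [hr.1]
  simp only at hkt
  have hkD : k t ∈ unitDisk := H.unif.discInv_mem (hsegΩ t ht)
  have hAC := B.norm_sub_sub_le hzD hkD hh0 (by rw [norm_sub_rev, hkt])
  have hc : m ≤ ‖exp (ψ ((1 - h) * (r * ζ)))‖ := by
    refine hmin ?_
    have hz1 : ‖(r : ℂ) * ζ‖ < 1 := by simpa using hzD
    rw [mem_closedBall_zero_iff]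
    exact BlochLog.norm_one_sub_mul_le ⟨h0, h1.le⟩ hz1.le
  set c := exp (ψ ((1 - h) * (r * ζ)))
  have h2 : ‖f (r * ζ) - f (k t)‖ < h * m / 4 := by
    have f1 : f (r * ζ) = F a := by simp [hadef]
    have f2 : f (k t) = F (AffineMap.lineMap a b t) := H.unif.apply_discInv (hsegΩ t ht)
    have g1 := hFδ (x := a) ha
    have g2 := hFδ (x := AffineMap.lineMap a b t)
      ((convex_ball q₀ δ).lineMap_mem ha hb ht)
    rw [f1, f2, ← dist_eq_norm]
    have := dist_triangle_right (F a) (F (AffineMap.lineMap a b t)) (F q₀)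
    linarith
  have h3 := norm_sub_norm_le (c * (r * ζ - k t)) (f (r * ζ) - f (k t))
  rw [norm_sub_rev (c * (r * ζ - k t)), norm_mul, norm_sub_rev _ (k t), hkt] at h3
  nlinarith

theorem injOn_boundaryMap (H : IsLogDeriv f ψ Ω) (F : ℂ ≃ₜ ℂ) (hF : Ω = F '' unitDisk) :
    InjOn (boundaryMap f) (Metric.closedBall (0 : ℂ) 1) := by
  have key : ∀ z ∈ unitDisk, ∀ ζ : ℂ, ‖ζ‖ = 1 → boundaryMap f z ≠ boundaryMap f ζ := by
    intro z hz ζ hζ h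
    refine H.boundaryMap_notMem hζ ?_
    rw [← h, H.boundaryMap_eq hz]
    exact H.unif.2.mapsTo hz
  intro z hz w hw h
  rw [mem_closedBall_zero_iff] at hz hw
  rcases hz.lt_or_eq with hz | hz <;> rcases hw.lt_or_eq with hw | hw
  · have hz' : z ∈ unitDisk := by simpa using hz
    have hw' : w ∈ unitDisk := by simpa using hw
    rw [H.boundaryMap_eq hz', H.boundaryMap_eq hw'] at h
    exact H.unif.2.injOn hz' hw' h
  · exact absurd h (key z (by simpa using hz) w hw)
  · exact absurd h.symm (key w (by simpa using hw) z hz)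
  · by_contra hne
    exact H.boundaryMap_ne_of_ne F hF hz hw hne h

/-- At a point with a radial limit of the logarithm of the derivative, the boundary map is
differentiable within the closed disk. -/
theorem exists_norm_boundaryMap_sub_le (H : IsLogDeriv f ψ Ω) {ζ L : ℂ} (hζ : ‖ζ‖ = 1)
    (hL : Tendsto (fun r : ℝ => ψ (r * ζ)) (𝓝[<] 1) (𝓝 L)) {ε : ℝ} (hε : 0 < ε) :
    ∃ δ > 0, ∀ ξ ∈ Metric.closedBall (0 : ℂ) 1, ‖ξ - ζ‖ ≤ δ →
      ‖boundaryMap f ξ - boundaryMap f ζ - exp L * (ξ - ζ)‖ ≤ ε * ‖ξ - ζ‖ := by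
  set A := exp L with hA
  have hA0 : 0 ≤ ‖A‖ := norm_nonneg _
  -- Chosen so that the distortion error `10 ε' (|A| + 1)` is at most `ε / 2`; the other half pays
  -- for replacing the frozen derivative by its radial limit.
  set ε' := min (1 / 2) (ε / (20 * (‖A‖ + 1))) with hε'
  have hε'0 : 0 < ε' := by positivity
  obtain ⟨h₀, B⟩ := H.exists_blochLog hε'0 (min_le_left _ _)
  have hlim : Tendsto (fun r : ℝ => exp (ψ (r * ζ))) (𝓝[<] 1) (𝓝 A) :=
    (Complex.continuous_exp.tendsto L).comp hL
  have hev := hlim.eventually (Metric.ball_mem_nhds A (show 0 < min (ε / 2) 1 by positivity))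
  rw [eventually_nhdsWithin_iff] at hev
  obtain ⟨δ, hδ, hb⟩ := Metric.eventually_nhds_iff.1 hev
  refine ⟨min (δ / 2) h₀, lt_min (by positivity) B.mem.1, fun ξ hξ hd => ?_⟩
  rcases eq_or_ne ξ ζ with rfl | hne
  · simp
  set h := ‖ξ - ζ‖ with hh
  have h0 : 0 < h := norm_pos_iff.2 (sub_ne_zero.2 hne)
  -- The scale is the distance `|ξ - ζ|` itself. The frozen derivative is then taken on the radius
  -- of `ζ`, where it converges, so no restriction on the approach of `ξ` is needed.
  have h1 := H.norm_boundaryMap_sub_sub_le B (ζ := ζ) (ξ := ξ) (by simp [hζ]) hξ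
    ⟨h0, hd.trans (min_le_right _ _)⟩ (by rw [norm_sub_rev])
  have h2 := @hb (1 - h) (by
    rw [Real.dist_eq]
    have : h ≤ δ / 2 := hd.trans (min_le_left _ _)
    rw [show 1 - h - 1 = -h by ring, abs_neg, abs_of_pos h0]; linarith)
    (by simp only [mem_Iio]; linarith)
  push_cast at h2
  set c := exp (ψ ((1 - h) * ζ))
  rw [dist_eq_norm, lt_min_iff] at h2
  have h3 : ‖c‖ ≤ ‖A‖ + 1 := by
    have := norm_sub_norm_le c A
    linarith
  have h4 : ε' * (20 * (‖A‖ + 1)) ≤ ε := by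
    have := min_le_right (1 / 2) (ε / (20 * (‖A‖ + 1)))
    rwa [← hε', le_div_iff₀ (by positivity)] at this
  have e : boundaryMap f ξ - boundaryMap f ζ - A * (ξ - ζ) =
      -(boundaryMap f ζ - boundaryMap f ξ - c * (ζ - ξ)) + (c - A) * (ξ - ζ) := by ring
  rw [e]
  refine (norm_add_le _ _).trans ?_
  rw [norm_neg, norm_mul]
  have h5 : ‖c - A‖ * ‖ξ - ζ‖ ≤ ε / 2 * h := by
    rw [← hh]; have := h2.1.le; gcongr
  have h6 : 10 * ε' * h * ‖c‖ ≤ 10 * ε' * h * (‖A‖ + 1) := by gcongr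
  nlinarith

/-- By injectivity the image of the compact complement of a ball around `ζ` misses the image of `ζ`,
hence keeps a positive distance from it. -/
theorem exists_dist_lt_of_dist_lt (H : IsLogDeriv f ψ Ω) (F : ℂ ≃ₜ ℂ) (hF : Ω = F '' unitDisk)
    {ζ : ℂ} (hζ : ‖ζ‖ = 1) {δ : ℝ} (hδ : 0 < δ) :
    ∃ η > 0, ∀ ξ ∈ Metric.closedBall (0 : ℂ) 1,
      ‖boundaryMap f ξ - boundaryMap f ζ‖ < η → ‖ξ - ζ‖ < δ := by
  have hK : IsCompact (Metric.closedBall (0 : ℂ) 1 \ Metric.ball ζ δ) :=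
    (isCompact_closedBall 0 1).diff Metric.isOpen_ball
  have hc := (hK.image_of_continuousOn (H.continuousOn_boundaryMap.mono sdiff_subset)).isClosed
  have hn : boundaryMap f ζ ∉ boundaryMap f '' (Metric.closedBall (0 : ℂ) 1 \ Metric.ball ζ δ) := by
    rintro ⟨ξ, hξ, he⟩
    have := H.injOn_boundaryMap F hF hξ.1 (by simp [hζ]) he
    rw [this] at hξ
    exact hξ.2 (Metric.mem_ball_self hδ)
  obtain ⟨η, hη, hb⟩ := Metric.isOpen_iff.1 hc.isOpen_compl _ hn
  refine ⟨η, hη, fun ξ hξ hd => ?_⟩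
  by_contra hcon
  have hm : boundaryMap f ξ ∈ Metric.ball (boundaryMap f ζ) η := by
    rwa [Metric.mem_ball, dist_eq_norm]
  exact hb hm ⟨ξ, ⟨hξ, by simpa [Metric.mem_ball, dist_eq_norm] using hcon⟩, rfl⟩

/-- The normal component of the linearized map is nonpositive on the closed disk, and on the circle
it is quadratic in `|ξ - ζ|`. -/
theorem inner_mul_sub (A ζ ξ : ℂ) (hζ : ‖ζ‖ = 1) (hA : A ≠ 0) :
    inner ℝ (A * (ξ - ζ)) (ζ * A / ‖A‖) = ‖A‖ * ((‖ξ‖ ^ 2 - 1 - ‖ξ - ζ‖ ^ 2) / 2) := by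
  have hA' : ‖A‖ ≠ 0 := norm_ne_zero_iff.2 hA
  have e : ζ * A / ‖A‖ = (‖A‖⁻¹ : ℝ) • (A * ζ) := by
    rw [Complex.real_smul]; push_cast; ring
  have e2 : inner ℝ (A * (ξ - ζ)) (A * ζ) = ‖A‖ ^ 2 * inner ℝ (ξ - ζ) ζ := by
    rw [Complex.sq_norm, Complex.normSq_apply, Complex.inner, Complex.inner]
    simp; ring
  have e3 : inner ℝ (ξ - ζ) ζ = (‖ξ‖ ^ 2 - 1 - ‖ξ - ζ‖ ^ 2) / 2 := by
    rw [norm_sub_sq_real, hζ, inner_sub_left, real_inner_self_eq_norm_sq, hζ]; ring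
  rw [e, inner_smul_right, e2, e3]
  field_simp

/-- At a point with a radial limit of the logarithm of the derivative, there is an outward
normal. -/
theorem isOutwardUnitNormal (H : IsLogDeriv f ψ Ω) (F : ℂ ≃ₜ ℂ) (hF : Ω = F '' unitDisk)
    {ζ L : ℂ} (hζ : ‖ζ‖ = 1) (hL : Tendsto (fun r : ℝ => ψ (r * ζ)) (𝓝[<] 1) (𝓝 L)) :
    IsOutwardUnitNormal Ω (boundaryMap f ζ) (ζ * exp L / ‖exp L‖) := by
  set A := exp L with hA
  have hA0 : A ≠ 0 := Complex.exp_ne_zero _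
  have hA' : 0 < ‖A‖ := norm_pos_iff.2 hA0
  set n := ζ * A / ‖A‖ with hn
  have hn1 : ‖n‖ = 1 := by
    rw [hn, norm_div, norm_mul, hζ, one_mul, Complex.norm_real, norm_norm, div_self hA'.ne']
  set p := boundaryMap f ζ with hp
  suffices main : ∀ ε : ℝ, 0 < ε → ε ≤ 1 / 2 → ∀ᶠ q in 𝓝 p,
      (inner ℝ (q - p) n < -(ε * ‖q - p‖) → q ∈ Ω) ∧
      (ε * ‖q - p‖ < inner ℝ (q - p) n → q ∉ closure Ω) by
    refine ⟨hn1, fun ε hε => ?_⟩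
    filter_upwards [main (min ε (1 / 2)) (by positivity) (min_le_right _ _)] with q hq
    have : min ε (1 / 2) * ‖q - p‖ ≤ ε * ‖q - p‖ := by gcongr; exact min_le_left _ _
    exact ⟨fun h => hq.1 (by linarith), fun h => hq.2 (by linarith)⟩
  intro ε hε hε2
  set ε₁ := ε * ‖A‖ / 4 with hε₁
  have hε₁0 : 0 < ε₁ := by positivity
  obtain ⟨δ₁, hδ₁, hder⟩ := H.exists_norm_boundaryMap_sub_le hζ hL hε₁0
  set δ := min δ₁ (ε / 2) with hδ
  have hδ0 : 0 < δ := by positivity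
  obtain ⟨η, hη, hinv⟩ := H.exists_dist_lt_of_dist_lt F hF hζ hδ0
  -- estimates at points of the closure
  have est : ∀ ξ ∈ Metric.closedBall (0 : ℂ) 1, ‖ξ - ζ‖ ≤ δ →
      ‖A‖ / 2 * ‖ξ - ζ‖ ≤ ‖boundaryMap f ξ - p‖ ∧
      ‖boundaryMap f ξ - p‖ ≤ 2 * ‖A‖ * ‖ξ - ζ‖ ∧
      |inner ℝ (boundaryMap f ξ - p) n - ‖A‖ * ((‖ξ‖ ^ 2 - 1 - ‖ξ - ζ‖ ^ 2) / 2)| ≤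
        ε₁ * ‖ξ - ζ‖ := by
    intro ξ hξ hd
    have h1 := hder ξ hξ (hd.trans (min_le_left _ _))
    have hx := norm_nonneg (ξ - ζ)
    have h2 := norm_sub_norm_le (A * (ξ - ζ)) (boundaryMap f ξ - p)
    rw [norm_sub_rev (A * (ξ - ζ)), norm_mul] at h2
    have h3 := norm_sub_norm_le (boundaryMap f ξ - p) (A * (ξ - ζ))
    rw [norm_mul] at h3
    have h5 : ε₁ * ‖ξ - ζ‖ ≤ ‖A‖ / 8 * ‖ξ - ζ‖ := by
      gcongr; rw [hε₁]; nlinarith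
    have h6 : 0 ≤ ‖A‖ * ‖ξ - ζ‖ := by positivity
    refine ⟨by linarith, by linarith, ?_⟩
    rw [← inner_mul_sub A ζ ξ hζ hA0, ← inner_sub_left]
    refine (abs_real_inner_le_norm _ _).trans ?_
    rw [hn1, mul_one]
    exact h1
  have hclo : ∀ q ∈ closure Ω, ‖q - p‖ < η →
      ∃ ξ ∈ Metric.closedBall (0 : ℂ) 1, boundaryMap f ξ = q ∧ ‖ξ - ζ‖ ≤ δ := by
    intro q hq hd
    rw [← H.image_boundaryMap] at hq
    obtain ⟨ξ, hξ, rfl⟩ := hq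
    exact ⟨ξ, hξ, rfl, (hinv ξ hξ hd).le⟩
  have hδ2 : δ ≤ ε / 2 := min_le_right _ _
  -- No boundary point near `p` lies in the inner cone: it comes from the circle, where the normal
  -- component is quadratically small plus an error of size `ε₁ |ξ - ζ|`, both below `ε |q - p|`.
  have hfr : ∀ q ∈ closure Ω, q ∉ Ω → ‖q - p‖ < η → ¬inner ℝ (q - p) n < -(ε * ‖q - p‖) := by
    intro q hq hqΩ hd
    obtain ⟨ξ, hξ, rfl, hξd⟩ := hclo q hq hd
    have hξ1 : ‖ξ‖ = 1 := by
      by_contra hne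
      have hξD : ξ ∈ unitDisk := by
        simpa using lt_of_le_of_ne (mem_closedBall_zero_iff.1 hξ) hne
      exact hqΩ (by rw [H.boundaryMap_eq hξD]; exact H.unif.2.mapsTo hξD)
    obtain ⟨e1, e2, e3⟩ := est ξ hξ hξd
    rw [hξ1, abs_le] at e3
    have hx := norm_nonneg (ξ - ζ)
    have h4 : ‖ξ - ζ‖ ^ 2 ≤ ε / 2 * ‖ξ - ζ‖ := by
      rw [sq]; gcongr; exact hξd.trans hδ2
    have h5 : ‖A‖ * ‖ξ - ζ‖ ^ 2 ≤ ‖A‖ * (ε / 2 * ‖ξ - ζ‖) := by gcongr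
    have h6 : ε * (‖A‖ / 2 * ‖ξ - ζ‖) ≤ ε * ‖boundaryMap f ξ - p‖ := by gcongr
    rw [hε₁] at e3
    nlinarith [e3.1]
  have hcone : Convex ℝ {q : ℂ | inner ℝ (q - p) n < -(ε * ‖q - p‖)} := by
    intro x hx y hy s t hs ht hst
    have e : s • x + t • y - p = s • (x - p) + t • (y - p) := by
      have : p = s • p + t • p := by rw [← add_smul, hst, one_smul]
      nth_rw 1 [this]; module
    have hx' : inner ℝ (x - p) n < -(ε * ‖x - p‖) := hx
    have hy' : inner ℝ (y - p) n < -(ε * ‖y - p‖) := hy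
    change inner ℝ (s • x + t • y - p) n < -(ε * ‖s • x + t • y - p‖)
    rw [e, inner_add_left, real_inner_smul_left, real_inner_smul_left]
    have hnorm := norm_add_le (s • (x - p)) (t • (y - p))
    rw [norm_smul, norm_smul, Real.norm_of_nonneg hs, Real.norm_of_nonneg ht] at hnorm
    have h1 := mul_le_mul_of_nonneg_left hnorm hε.le
    have h2 : s * inner ℝ (x - p) n + t * inner ℝ (y - p) n <
        s * -(ε * ‖x - p‖) + t * -(ε * ‖y - p‖) := by
      rcases hs.eq_or_lt with rfl | hs'
      · have : t = 1 := by linarith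
        subst this; linarith
      · have := mul_lt_mul_of_pos_left hx' hs'
        have := mul_le_mul_of_nonneg_left hy'.le ht
        linarith
    linarith
  have hCpre : IsPreconnected ({q : ℂ | inner ℝ (q - p) n < -(ε * ‖q - p‖)} ∩ Metric.ball p η) :=
    (hcone.inter (convex_ball p η)).isPreconnected
  -- The radius ending at `ζ` is mapped into the cone, since there the normal component is `-|A|(1 -
  -- r)` to first order.
  have hmeet : (({q : ℂ | inner ℝ (q - p) n < -(ε * ‖q - p‖)} ∩ Metric.ball p η) ∩ Ω).Nonempty := by
    have h1 : ∀ᶠ r : ℝ in 𝓝[<] 1, f (r * ζ) ∈ Metric.ball p η :=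
      (H.tendsto_radial hζ.le).eventually (Metric.ball_mem_nhds p hη)
    have h2 : ∀ᶠ r : ℝ in 𝓝[<] 1, r ∈ Ioo (max 0 (1 - δ)) 1 :=
      Ioo_mem_nhdsLT (by rw [max_lt_iff]; constructor <;> linarith)
    obtain ⟨r, hr1, hr2⟩ := (h1.and h2).exists
    have hr0 : 0 < r := (le_max_left _ _).trans_lt hr2.1
    have hrδ : 1 - δ < r := (le_max_right _ _).trans_lt hr2.1
    have hrD := ofReal_mul_mem hζ.le ⟨hr0, hr2.2⟩
    have hnd : ‖(r : ℂ) * ζ - ζ‖ = 1 - r := by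
      rw [show (r : ℂ) * ζ - ζ = ((r - 1 : ℝ) : ℂ) * ζ by push_cast; ring, norm_mul, hζ, mul_one,
        Complex.norm_real, Real.norm_eq_abs, abs_of_neg (by linarith [hr2.2])]
      ring
    obtain ⟨e1, e2, e3⟩ := est _ (unitDisk_subset_closedBall hrD) (by rw [hnd]; linarith)
    rw [H.boundaryMap_eq hrD] at e1 e2 e3
    refine ⟨f (r * ζ), ⟨?_, hr1⟩, H.unif.2.mapsTo hrD⟩
    change inner ℝ (f (r * ζ) - p) n < -(ε * ‖f (r * ζ) - p‖)
    have h1r : 0 < 1 - r := by linarith [hr2.2]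
    rw [hnd, abs_le, norm_mul, hζ, Complex.norm_real, Real.norm_of_nonneg hr0.le] at e3
    have hder' := hder _ (unitDisk_subset_closedBall hrD) (by
      rw [hnd]; have := min_le_left δ₁ (ε / 2); linarith)
    rw [H.boundaryMap_eq hrD, hnd] at hder'
    have h7 := norm_sub_norm_le (f (r * ζ) - p) (A * (r * ζ - ζ))
    rw [norm_mul, hnd] at h7
    have h8 : ‖f (r * ζ) - p‖ ≤ (‖A‖ + ε₁) * (1 - r) := by linarith
    have h9 : ε * ‖f (r * ζ) - p‖ ≤ 1 / 2 * ((‖A‖ + ε₁) * (1 - r)) := by gcongr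
    have h10 : ε₁ ≤ ‖A‖ / 8 := by rw [hε₁]; nlinarith
    have h11 : ε₁ * (1 - r) ≤ ‖A‖ / 8 * (1 - r) := by gcongr
    have h12 : 0 < ‖A‖ * (1 - r) := by positivity
    have h13 : ‖A‖ * (((r * 1) ^ 2 - 1 - (1 - r) ^ 2) / 2) = -(‖A‖ * (1 - r)) := by ring
    rw [h13] at e3
    nlinarith [e3.2]
  -- The truncated cone is connected, meets `Ω` and avoids its boundary, so it lies in `Ω`.
  have hsubΩ := hCpre.subset_left_of_subset_union H.unif.isOpen isClosed_closure.isOpen_compl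
    (Set.disjoint_left.2 fun x hx hx' => hx' (subset_closure hx)) (fun q hq => by
      by_cases hqΩ : q ∈ Ω
      · exact Or.inl hqΩ
      · refine Or.inr fun hqc => hfr q hqc hqΩ ?_ hq.1
        rw [← dist_eq_norm]; exact hq.2) hmeet
  filter_upwards [Metric.ball_mem_nhds p hη] with q hq
  refine ⟨fun h => hsubΩ ⟨h, hq⟩, fun h hqc => ?_⟩
  -- For the outer cone the main term is nonpositive on the whole closed disk, and the error `ε₁ |ξ
  -- - ζ|` is too small to reach `ε |q - p|`.
  obtain ⟨ξ, hξ, rfl, hξd⟩ := hclo q hqc (by rw [← dist_eq_norm]; exact hq)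
  obtain ⟨e1, e2, e3⟩ := est ξ hξ hξd
  rw [abs_le] at e3
  have hx := norm_nonneg (ξ - ζ)
  have h4 : ‖ξ‖ ^ 2 ≤ 1 := by
    have := mem_closedBall_zero_iff.1 hξ
    exact pow_le_one₀ (norm_nonneg _) this
  have h5 : ‖A‖ * ((‖ξ‖ ^ 2 - 1 - ‖ξ - ζ‖ ^ 2) / 2) ≤ 0 := by
    refine mul_nonpos_of_nonneg_of_nonpos hA'.le ?_
    nlinarith [sq_nonneg ‖ξ - ζ‖]
  have h6 : ε * (‖A‖ / 2 * ‖ξ - ζ‖) ≤ ε * ‖boundaryMap f ξ - p‖ := by gcongr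
  rw [hε₁] at e3
  nlinarith [e3.2, mul_nonneg (mul_nonneg hε.le hA'.le) hx]

end IsLogDeriv

end normal

/-! ### Radial limits of functions of finite Dirichlet integral. -/

section trace

/-- Expand `0 ≤ ∫ (g - S)²`, where `S` is the integral of `g`. -/
theorem sq_integral_le_of_measureReal_le_one {α : Type*} [MeasurableSpace α] {μ : Measure α}
    [IsFiniteMeasure μ] (hμ : μ.real univ ≤ 1) {g : α → ℝ} (hg : Integrable g μ)
    (hg2 : Integrable (fun x => g x ^ 2) μ) : (∫ x, g x ∂μ) ^ 2 ≤ ∫ x, g x ^ 2 ∂μ := by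
  set S := ∫ x, g x ∂μ with hS
  have h0 : 0 ≤ ∫ x, (g x ^ 2 - 2 * S * g x + S ^ 2) ∂μ :=
    integral_nonneg fun x => by
      show 0 ≤ g x ^ 2 - 2 * S * g x + S ^ 2
      nlinarith [sq_nonneg (g x - S)]
  have i1 : Integrable (fun x => 2 * S * g x) μ := hg.const_mul _
  have i2 : Integrable (fun x => g x ^ 2 - 2 * S * g x) μ := hg2.sub i1
  rw [integral_add i2 (integrable_const _), integral_sub hg2 i1, integral_const_mul, ← hS,
    integral_const, smul_eq_mul] at h0
  nlinarith [mul_le_mul_of_nonneg_right hμ (sq_nonneg S)]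

theorem integrableOn_of_integrableOn_sq_norm {γ' : ℝ → ℂ} (hc : ContinuousOn γ' (Ioo 0 1))
    (hi : IntegrableOn (fun r => ‖γ' r‖ ^ 2) (Ioo (1 / 2) 1)) :
    IntegrableOn γ' (Ioo (1 / 2) 1) := by
  have hsub : Ioo (1 / 2 : ℝ) 1 ⊆ Ioo 0 1 := Ioo_subset_Ioo_left (by norm_num)
  have i1 : IntegrableOn (fun r : ℝ => (1 : ℝ) + ‖γ' r‖ ^ 2) (Ioo (1 / 2) 1) :=
    Integrable.add (integrable_const _) hi
  refine Integrable.mono' i1 ((hc.mono hsub).aestronglyMeasurable measurableSet_Ioo)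
    (ae_of_all _ fun r => ?_)
  nlinarith [sq_nonneg (‖γ' r‖ - 1 / 2)]

theorem exists_tendsto_and_norm_le_of_path {γ γ' : ℝ → ℂ}
    (hγ : ∀ r ∈ Ioo (0 : ℝ) 1, HasDerivAt γ (γ' r) r) (hc : ContinuousOn γ' (Ioo 0 1))
    (hi : IntegrableOn (fun r => ‖γ' r‖ ^ 2) (Ioo (1 / 2) 1)) :
    (∃ L, Tendsto γ (𝓝[<] 1) (𝓝 L)) ∧ ∀ r ∈ Ico (1 / 2 : ℝ) 1,
      ‖γ r‖ ≤ ‖γ (1 / 2)‖ + √(∫ r in Ioo (1 / 2) 1, ‖γ' r‖ ^ 2) := by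
  have i := integrableOn_of_integrableOn_sq_norm hc hi
  have hii : IntervalIntegrable γ' volume (1 / 2) 1 := by
    rw [intervalIntegrable_iff_integrableOn_Ioo_of_le (by norm_num)]; exact i
  have hftc : ∀ r ∈ Ico (1 / 2 : ℝ) 1, γ r = γ (1 / 2) + ∫ x in (1 / 2 : ℝ)..r, γ' x := by
    intro r hr
    rw [intervalIntegral.integral_eq_sub_of_hasDerivAt, add_sub_cancel]
    · intro x hx
      rw [uIcc_of_le hr.1] at hx
      exact hγ x ⟨by linarith [hx.1], by linarith [hx.2, hr.2]⟩
    · refine hii.mono_set ?_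
      rw [uIcc_of_le hr.1, uIcc_of_le (by norm_num)]
      exact Icc_subset_Icc_right hr.2.le
  constructor
  · refine ⟨γ (1 / 2) + ∫ x in (1 / 2 : ℝ)..1, γ' x, ?_⟩
    have hcont := intervalIntegral.continuousOn_primitive_interval' hii
      (left_mem_uIcc (a := (1 / 2 : ℝ)) (b := 1))
    have h1 : Tendsto (fun r => ∫ x in (1 / 2 : ℝ)..r, γ' x) (𝓝[<] 1)
        (𝓝 (∫ x in (1 / 2 : ℝ)..1, γ' x)) := by
      refine (hcont 1 right_mem_uIcc).mono_left ?_
      rw [uIcc_of_le (by norm_num)]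
      refine nhdsWithin_le_iff.2 ?_
      filter_upwards [Ioo_mem_nhdsLT (show (1 / 2 : ℝ) < 1 by norm_num)] with r hr
        using Ioo_subset_Icc_self hr
    refine (h1.const_add (γ (1 / 2))).congr' ?_
    filter_upwards [Ioo_mem_nhdsLT (show (1 / 2 : ℝ) < 1 by norm_num)] with r hr
      using (hftc r ⟨hr.1.le, hr.2⟩).symm
  · intro r hr
    rw [hftc r hr]
    refine (norm_add_le _ _).trans (add_le_add_right ?_ _)
    have h1 : ‖∫ x in (1 / 2 : ℝ)..r, γ' x‖ ≤ ∫ x in Ioo (1 / 2 : ℝ) 1, ‖γ' x‖ := by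
      rw [intervalIntegral.integral_of_le hr.1]
      refine (norm_integral_le_integral_norm _).trans
        (setIntegral_mono_set i.norm (ae_of_all _ fun _ => norm_nonneg _)
          (LE.le.eventuallyLE fun x hx => ⟨hx.1, hx.2.trans_lt hr.2⟩))
    refine h1.trans (Real.le_sqrt_of_sq_le (sq_integral_le_of_measureReal_le_one ?_ i.norm hi))
    simp only [measureReal_restrict_apply_univ, Real.volume_real_Ioo]
    norm_num

/-- For radii above `1/2` the polar density can be divided out. Radial limits only concern this
range. -/
theorem integrable_outer_rect_of_integrableOn {F : ℂ → ℝ} (hi : IntegrableOn F unitDisk) :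
    Integrable (fun p : ℝ × ℝ => F (circleMap 0 p.1 p.2))
      ((volume.restrict (Ioo (1 / 2 : ℝ) 1)).prod angleMeasure) := by
  have h1 := integrable_rectMeasure_of_integrableOn hi
  have hle : (volume.restrict (Ioo (1 / 2 : ℝ) 1)).prod angleMeasure ≤ rectMeasure :=
    Measure.prod_mono (Measure.restrict_mono_set _ (Ioo_subset_Ioo_left (by norm_num))) le_rfl
  have h2 := h1.mono_measure hle
  have hmem : ∀ᵐ p ∂((volume.restrict (Ioo (1 / 2 : ℝ) 1)).prod angleMeasure),
      p.1 ∈ Ioo (1 / 2 : ℝ) 1 := by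
    have : ∀ᵐ r ∂(volume.restrict (Ioo (1 / 2 : ℝ) 1)), r ∈ Ioo (1 / 2 : ℝ) 1 :=
      ae_restrict_mem measurableSet_Ioo
    exact Measure.quasiMeasurePreserving_fst.ae this
  -- The maximum with `1/2` keeps the factor continuous and bounded everywhere; on the rectangle it
  -- is `1/r`.
  have h3 : Integrable (fun p : ℝ × ℝ => (max p.1 (1 / 2))⁻¹ *
      (p.1 • F (circleMap 0 p.1 p.2)))
      ((volume.restrict (Ioo (1 / 2 : ℝ) 1)).prod angleMeasure) := by
    refine h2.bdd_mul (c := 2) ?_ (ae_of_all _ fun p => ?_)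
    · refine Continuous.aestronglyMeasurable (Continuous.inv₀ (by fun_prop) fun p => ?_)
      exact (lt_max_of_lt_right (by norm_num)).ne'
    · have : (1 / 2 : ℝ) ≤ max p.1 (1 / 2) := le_max_right _ _
      rw [norm_inv, Real.norm_of_nonneg (by linarith)]
      exact inv_le_of_inv_le₀ (by norm_num) (by linarith)
  refine h3.congr ?_
  filter_upwards [hmem] with p hp
  have : p.1 ≠ 0 := by linarith [hp.1]
  rw [max_eq_left hp.1.le, smul_eq_mul, inv_mul_cancel_left₀ this]

/-- The radial limits of a function on the unit disk. -/
noncomputable def radialLimit (ψ : ℂ → ℂ) (ζ : ℂ) : ℂ :=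
  limUnder (𝓝[<] (1 : ℝ)) fun r : ℝ => ψ (r * ζ)

variable {ψ N : ℂ → ℂ}

theorem circleMap_mem_unitDisk {r : ℝ} (hr : r ∈ Ioo (0 : ℝ) 1) (θ : ℝ) :
    circleMap 0 r θ ∈ unitDisk := by
  rw [mem_ball_zero_iff, circleMap_eq_mul, norm_mul, norm_circlePt, mul_one, Complex.norm_real,
    Real.norm_of_nonneg hr.1.le]
  exact hr.2

/-- On almost every radius Cauchy-Schwarz bounds the variation of `ψ` by the square root of the
radial energy, which gives the limit and a bound for all radii. By Fubini this square root is square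
integrable in the angle. -/
theorem exists_radial_majorant (hd : ∀ z ∈ unitDisk, HasDerivAt ψ (N z) z)
    (hN : ContinuousOn N unitDisk) (hi : IntegrableOn (fun z => ‖N z‖ ^ 2) unitDisk) :
    ∃ H : ℝ → ℝ, MemLp H 2 angleMeasure ∧ ∀ᵐ θ ∂angleMeasure,
      (∀ r ∈ Ioo (0 : ℝ) 1, ‖ψ (circleMap 0 r θ)‖ ≤ H θ) ∧
      Tendsto (fun r : ℝ => ψ (circleMap 0 r θ)) (𝓝[<] 1) (𝓝 (radialLimit ψ (circlePt θ))) := by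
  have hint := integrable_outer_rect_of_integrableOn hi
  obtain ⟨M, hM⟩ := (isCompact_closedBall (0 : ℂ) (1 / 2)).exists_bound_of_continuousOn
    (f := ψ) (fun z hz => (hd z (Metric.closedBall_subset_ball (by norm_num) hz)).continuousAt
      |>.continuousWithinAt)
  have hB := hint.integral_prod_right
  refine ⟨fun θ => M + √(∫ r in Ioo (1 / 2 : ℝ) 1, ‖N (circleMap 0 r θ)‖ ^ 2), ?_, ?_⟩
  · refine MemLp.add (memLp_const M) ?_
    have hm : AEStronglyMeasurable
        (fun θ => √(∫ r in Ioo (1 / 2 : ℝ) 1, ‖N (circleMap 0 r θ)‖ ^ 2)) angleMeasure :=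
      Real.continuous_sqrt.comp_aestronglyMeasurable hB.aestronglyMeasurable
    rw [memLp_two_iff_integrable_sq hm]
    refine hB.congr (ae_of_all _ fun θ => (Real.sq_sqrt ?_).symm)
    exact integral_nonneg fun r => sq_nonneg ‖N (circleMap 0 r θ)‖
  · filter_upwards [hint.prod_left_ae] with θ hθ
    have hpath : ∀ r ∈ Ioo (0 : ℝ) 1, HasDerivAt (fun r : ℝ => ψ (circleMap 0 r θ))
        (N (circleMap 0 r θ) * circlePt θ) r := fun r hr =>
      (hd _ (circleMap_mem_unitDisk hr θ)).comp r (hasDerivAt_circleMap_radius θ r)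
    have hcc : Continuous fun r : ℝ => circleMap 0 r θ :=
      continuous_circleMap_prod.comp (by fun_prop : Continuous fun r : ℝ => (r, θ))
    have hcN : ContinuousOn (fun r : ℝ => N (circleMap 0 r θ) * circlePt θ) (Ioo 0 1) :=
      (hN.comp hcc.continuousOn fun r hr => circleMap_mem_unitDisk hr θ).mul continuousOn_const
    have e : ∀ r : ℝ, ‖N (circleMap 0 r θ) * circlePt θ‖ = ‖N (circleMap 0 r θ)‖ := fun r => by
      rw [norm_mul, norm_circlePt, mul_one]
    obtain ⟨⟨L, hL⟩, hb⟩ := exists_tendsto_and_norm_le_of_path hpath hcN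
      (by simp only [e]; exact hθ)
    simp only [e] at hb
    have hhalf : ∀ r ∈ Ioc (0 : ℝ) (1 / 2), ‖ψ (circleMap 0 r θ)‖ ≤ M := fun r hr => by
      refine hM _ ?_
      rw [mem_closedBall_zero_iff, circleMap_eq_mul, norm_mul, norm_circlePt, mul_one,
        Complex.norm_real, Real.norm_of_nonneg hr.1.le]
      exact hr.2
    refine ⟨fun r hr => ?_, ?_⟩
    · rcases le_total r (1 / 2) with h | h
      · exact (hhalf r ⟨hr.1, h⟩).trans (le_add_of_nonneg_right (Real.sqrt_nonneg _))
      · exact (hb r ⟨h, hr.2⟩).trans (add_le_add_left (hhalf _ ⟨by norm_num, le_rfl⟩) _)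
    · have : radialLimit ψ (circlePt θ) = L := by
        refine Tendsto.limUnder_eq (hL.congr fun r => ?_)
        rw [circleMap_eq_mul]
      rw [this]; exact hL

theorem memLp_radialLimit (hψ : ContinuousOn ψ unitDisk) {H : ℝ → ℝ} (hH : MemLp H 2 angleMeasure)
    (h : ∀ᵐ θ ∂angleMeasure, (∀ r ∈ Ioo (0 : ℝ) 1, ‖ψ (circleMap 0 r θ)‖ ≤ H θ) ∧
      Tendsto (fun r : ℝ => ψ (circleMap 0 r θ)) (𝓝[<] 1) (𝓝 (radialLimit ψ (circlePt θ)))) :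
    MemLp (fun θ => radialLimit ψ (circlePt θ)) 2 angleMeasure := by
  obtain ⟨s, -, hs, hs1⟩ := exists_seq_strictMono_tendsto' (zero_lt_one (α := ℝ))
  have hs' : Tendsto s atTop (𝓝[<] 1) :=
    tendsto_nhdsWithin_iff.2 ⟨hs1, Eventually.of_forall fun n => (hs n).2⟩
  have hm : AEStronglyMeasurable (fun θ => radialLimit ψ (circlePt θ)) angleMeasure := by
    refine aestronglyMeasurable_of_tendsto_ae atTop
      (f := fun n θ => ψ (circleMap 0 (s n) θ)) (fun n => ?_) ?_
    · refine Continuous.aestronglyMeasurable ?_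
      exact hψ.comp_continuous (continuous_circleMap _ _) fun θ => circleMap_mem_unitDisk (hs n) θ
    · filter_upwards [h] with θ hθ using hθ.2.comp hs'
  refine hH.mono hm ?_
  filter_upwards [h] with θ hθ
  refine le_of_tendsto hθ.2.norm ?_
  filter_upwards [Ioo_mem_nhdsLT zero_lt_one] with r hr
  exact (hθ.1 r hr).trans (le_abs_self _)

/-- Up to a constant factor this is the integral of `z^{-n-1} ψ(z)` over the circle of radius `r`,
which does not depend on `r` by Cauchy's theorem in the annulus. -/
theorem fourierAngle_circle_eq_mul_pow (hd : DifferentiableOn ℂ ψ unitDisk) {r ρ : ℝ}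
    (hr : r ∈ Ioo (0 : ℝ) 1) (hρ : ρ ∈ Ioo (0 : ℝ) 1) (n : ℤ) :
    fourierAngle (fun θ => ψ (circleMap 0 r θ)) n * (r : ℂ) ^ (-n) =
      fourierAngle (fun θ => ψ (circleMap 0 ρ θ)) n * (ρ : ℂ) ^ (-n) := by
  wlog hle : r ≤ ρ generalizing r ρ
  · exact (this hρ hr (le_of_not_ge hle)).symm
  have key : ∀ s ∈ Ioo (0 : ℝ) 1, fourierAngle (fun θ => ψ (circleMap 0 s θ)) n *
      (s : ℂ) ^ (-n) = (2 * Real.pi : ℂ)⁻¹ *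
        (I⁻¹ * ∮ z in C(0, s), (z - 0)⁻¹ • (z ^ (-n) * ψ z)) := by
    intro s hs
    have hs0 : (s : ℂ) ≠ 0 := by exact_mod_cast hs.1.ne'
    rw [fourierAngle_eq_integral, mul_assoc, mul_comm _ ((s : ℂ) ^ (-n)),
      ← integral_const_mul ((s : ℂ) ^ (-n)), circleIntegral,
      intervalIntegral.integral_of_le Real.two_pi_pos.le, ← integral_const_mul I⁻¹]
    congr 1
    refine integral_congr_ae (ae_of_all _ fun θ => ?_)
    have hz : circleMap 0 s θ ≠ 0 := circleMap_ne_center hs.1.ne'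
    simp only [deriv_circleMap, sub_zero, smul_eq_mul]
    have e : (circleMap 0 s θ) ^ (-n) = (s : ℂ) ^ (-n) * exp (-(I * n * θ)) := by
      rw [circleMap_eq_mul, circlePt_eq_exp, mul_zpow, ← Complex.exp_int_mul]
      congr 2; push_cast; ring
    rw [e]
    field_simp
  rw [key r hr, key ρ hρ]
  congr 2
  refine (circleIntegral_sub_center_inv_smul_eq_of_differentiable_on_annulus_off_countable hr.1 hle
    countable_empty ?_ ?_).symm
  · intro z hz
    have hz0 : z ≠ 0 := fun h => hz.2 (by rw [h]; exact Metric.mem_ball_self hr.1)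
    have hzD : z ∈ unitDisk := Metric.closedBall_subset_ball hρ.2 hz.1
    exact ((continuousAt_zpow₀ z (-n) (Or.inl hz0)).mul
      (hd.differentiableAt (isOpen_unitDisk.mem_nhds hzD)).continuousAt).continuousWithinAt
  · intro z hz
    have hz0 : z ≠ 0 := fun h => hz.1.2 (by rw [h]; exact Metric.mem_closedBall_self hr.1.le)
    have hzD : z ∈ unitDisk := Metric.ball_subset_ball hρ.2.le hz.1.1
    exact (differentiableAt_zpow.2 (Or.inl hz0)).mul
      (hd.differentiableAt (isOpen_unitDisk.mem_nhds hzD))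

theorem fourierAngle_circle_of_neg (hd : DifferentiableOn ℂ ψ unitDisk) {r : ℝ}
    (hr : r ∈ Ioo (0 : ℝ) 1) {n : ℤ} (hn : n < 0) :
    fourierAngle (fun θ => ψ (circleMap 0 r θ)) n = 0 := by
  obtain ⟨m, hm⟩ : ∃ m : ℕ, n = -((m : ℤ) + 1) := ⟨(-n - 1).toNat, by omega⟩
  have h := integral_circle_of_differentiableOn (G := fun z => z ^ (m + 1) * ψ z)
    ((differentiableOn_pow _).mul hd) hr
  rw [zero_pow (by omega), zero_mul, mul_zero] at h
  have hr0 : (r : ℂ) ≠ 0 := by exact_mod_cast hr.1.ne'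
  have e : ∀ θ : ℝ, (circleMap 0 r θ) ^ (m + 1) * ψ (circleMap 0 r θ) =
      (r : ℂ) ^ (m + 1) * (exp (-(I * n * θ)) * ψ (circleMap 0 r θ)) := fun θ => by
    rw [circleMap_eq_mul, circlePt_eq_exp, mul_pow, ← Complex.exp_nat_mul, hm, mul_assoc]
    congr 3; push_cast; ring
  simp only [e, integral_const_mul] at h
  rw [fourierAngle_eq_integral, (mul_eq_zero.1 h).resolve_left (pow_ne_zero _ hr0), mul_zero]

theorem fourierAngle_circle_deriv (hd : ∀ z ∈ unitDisk, HasDerivAt ψ (N z) z)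
    (hN : ContinuousOn N unitDisk) {r : ℝ} (hr : r ∈ Ioo (0 : ℝ) 1) {n : ℤ} (hn : n ≠ 0) :
    n * fourierAngle (fun θ => ψ (circleMap 0 r θ)) n =
      fourierAngle (fun θ => circleMap 0 r θ * N (circleMap 0 r θ)) n := by
  have hD : ∀ θ : ℝ, HasDerivAt (fun θ => ψ (circleMap 0 r θ))
      (N (circleMap 0 r θ) * (circleMap 0 r θ * I)) θ := fun θ =>
    (hd _ (circleMap_mem_unitDisk hr θ)).comp θ (hasDerivAt_circleMap 0 r θ)
  have hcN : Continuous fun θ => N (circleMap 0 r θ) :=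
    hN.comp_continuous (continuous_circleMap 0 r) fun θ => circleMap_mem_unitDisk hr θ
  have hcD : Continuous fun θ => N (circleMap 0 r θ) * (circleMap 0 r θ * I) :=
    hcN.mul ((continuous_circleMap 0 r).mul continuous_const)
  have h := fourierCoeffOn_of_hasDerivAt Real.two_pi_pos hn (fun x _ => hD x)
    (hcD.intervalIntegrable _ _)
  have hper : circleMap 0 r (2 * Real.pi) = circleMap 0 r 0 := by
    simpa using periodic_circleMap 0 r 0
  have e : fourierAngle (fun θ => N (circleMap 0 r θ) * (circleMap 0 r θ * I)) n =
      I * fourierAngle (fun θ => circleMap 0 r θ * N (circleMap 0 r θ)) n := by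
    rw [fourierAngle_eq_integral, fourierAngle_eq_integral, mul_left_comm, ← integral_const_mul I]
    congr 1
    refine integral_congr_ae (ae_of_all _ fun θ => ?_)
    simp only; ring
  rw [show fourierCoeffOn Real.two_pi_pos (fun θ => N (circleMap 0 r θ) * (circleMap 0 r θ * I)) n =
    fourierAngle (fun θ => N (circleMap 0 r θ) * (circleMap 0 r θ * I)) n from rfl, e] at h
  rw [fourierAngle, h, hper, sub_self, mul_zero]
  have hn' : (n : ℂ) ≠ 0 := by exact_mod_cast hn
  have hpi : (Real.pi : ℂ) ≠ 0 := by exact_mod_cast Real.pi_ne_zero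
  push_cast
  field_simp
  ring

theorem fourierAngle_radialLimit (hd : DifferentiableOn ℂ ψ unitDisk) {H : ℝ → ℝ}
    (hH : MemLp H 2 angleMeasure)
    (h : ∀ᵐ θ ∂angleMeasure, (∀ r ∈ Ioo (0 : ℝ) 1, ‖ψ (circleMap 0 r θ)‖ ≤ H θ) ∧
      Tendsto (fun r : ℝ => ψ (circleMap 0 r θ)) (𝓝[<] 1) (𝓝 (radialLimit ψ (circlePt θ))))
    {r : ℝ} (hr : r ∈ Ioo (0 : ℝ) 1) (n : ℤ) :
    fourierAngle (fun θ => ψ (circleMap 0 r θ)) n =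
      circleFourier (radialLimit ψ) n * (r : ℂ) ^ n := by
  have hr0 : (r : ℂ) ≠ 0 := by exact_mod_cast hr.1.ne'
  have hlim : Tendsto (fun s : ℝ => fourierAngle (fun θ => ψ (circleMap 0 s θ)) n * (s : ℂ) ^ (-n))
      (𝓝[<] 1) (𝓝 (circleFourier (radialLimit ψ) n * ((1 : ℝ) : ℂ) ^ (-n))) := by
    refine Tendsto.mul ?_ ?_
    · rw [circleFourier]
      change Tendsto _ _ (𝓝 (fourierAngle (fun θ => radialLimit ψ (circlePt θ)) n))
      simp only [fourierAngle_eq_integral]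
      refine Tendsto.const_mul _ ?_
      refine tendsto_integral_filter_of_dominated_convergence H ?_ ?_
        (hH.integrable (by norm_num)) ?_
      · filter_upwards [Ioo_mem_nhdsLT zero_lt_one] with s hs
        refine Continuous.aestronglyMeasurable (Continuous.mul (by fun_prop) ?_)
        exact hd.continuousOn.comp_continuous (continuous_circleMap 0 s)
          fun θ => circleMap_mem_unitDisk hs θ
      · filter_upwards [Ioo_mem_nhdsLT zero_lt_one] with s hs
        filter_upwards [h] with θ hθ
        have : ‖exp (-(I * n * θ))‖ = 1 := by
          rw [show -(I * (n : ℂ) * θ) = I * ((-(n * θ) : ℝ) : ℂ) by push_cast; ring,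
            norm_exp_I_mul_ofReal']
        rw [norm_mul, this, one_mul]
        exact hθ.1 s hs
      · filter_upwards [h] with θ hθ using hθ.2.const_mul _
    · refine (ContinuousAt.tendsto ?_).mono_left nhdsWithin_le_nhds
      exact (continuousAt_zpow₀ _ _ (Or.inl (by simp))).comp Complex.continuous_ofReal.continuousAt
  have hconst : Tendsto (fun s : ℝ => fourierAngle (fun θ => ψ (circleMap 0 s θ)) n *
      (s : ℂ) ^ (-n)) (𝓝[<] 1) (𝓝 (fourierAngle (fun θ => ψ (circleMap 0 r θ)) n *
        (r : ℂ) ^ (-n))) := by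
    refine tendsto_const_nhds.congr' ?_
    filter_upwards [Ioo_mem_nhdsLT zero_lt_one] with s hs
      using fourierAngle_circle_eq_mul_pow hd hr hs n
  have := tendsto_nhds_unique hlim hconst
  rw [Complex.ofReal_one, one_zpow, mul_one] at this
  rw [this, mul_assoc, ← zpow_add₀ hr0, neg_add_cancel, zpow_zero, mul_one]

/-- The coefficients of `z ψ'` on the circle of radius `r` are `n a_n r^n`. Bessel's inequality
there, divided by `r` and integrated over `(0, 1)`, gives `½ ∑ |n| |a_n|²` because `r^{2|n| - 1}`
integrates to `1/(2|n|)`. The truncated exponent at `n = 0` is harmless, since that term has weight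
zero. -/
theorem summable_fourier_radialLimit (hd : ∀ z ∈ unitDisk, HasDerivAt ψ (N z) z)
    (hN : ContinuousOn N unitDisk) (hi : IntegrableOn (fun z => ‖N z‖ ^ 2) unitDisk)
    {H : ℝ → ℝ} (hH : MemLp H 2 angleMeasure)
    (h : ∀ᵐ θ ∂angleMeasure, (∀ r ∈ Ioo (0 : ℝ) 1, ‖ψ (circleMap 0 r θ)‖ ≤ H θ) ∧
      Tendsto (fun r : ℝ => ψ (circleMap 0 r θ)) (𝓝[<] 1) (𝓝 (radialLimit ψ (circlePt θ)))) :
    Summable fun n : ℤ => |(n : ℝ)| * ‖circleFourier (radialLimit ψ) n‖ ^ 2 := by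
  have hdiff : DifferentiableOn ℂ ψ unitDisk := fun z hz =>
    (hd z hz).differentiableAt.differentiableWithinAt
  set a : ℤ → ℂ := circleFourier (radialLimit ψ) with ha
  have hrect := integrable_rectMeasure_of_integrableOn hi
  refine summable_of_sum_le (c := 2 * ((2 * Real.pi)⁻¹ * ∫ r in Ioo (0 : ℝ) 1,
    ∫ θ, r • ‖N (circleMap 0 r θ)‖ ^ 2 ∂angleMeasure)) (fun n => by positivity) fun s => ?_
  have hle : ∀ r ∈ Ioo (0 : ℝ) 1, ∑ n ∈ s, (|(n : ℝ)| ^ 2 * ‖a n‖ ^ 2) * r ^ (2 * n.natAbs - 1) ≤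
      (2 * Real.pi)⁻¹ * ∫ θ, r • ‖N (circleMap 0 r θ)‖ ^ 2 ∂angleMeasure := by
    intro r hr
    have hcN : Continuous fun θ => circleMap 0 r θ * N (circleMap 0 r θ) :=
      (continuous_circleMap 0 r).mul
        (hN.comp_continuous (continuous_circleMap 0 r) fun θ => circleMap_mem_unitDisk hr θ)
    have hmem : MemLp (fun θ => circleMap 0 r θ * N (circleMap 0 r θ)) 2 angleMeasure := by
      obtain ⟨M, hM⟩ := (isCompact_Icc (a := (0 : ℝ)) (b := 2 * Real.pi)).exists_bound_of_continuousOn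
        hcN.continuousOn
      refine MemLp.of_bound hcN.aestronglyMeasurable M ?_
      filter_upwards [ae_restrict_mem measurableSet_Ioc] with θ hθ
        using hM θ (Ioc_subset_Icc_self hθ)
    have hB := sum_le_hasSum s (fun n _ => by positivity) (hasSum_sq_fourierAngle hmem)
    have e1 : ∀ θ, ‖circleMap 0 r θ * N (circleMap 0 r θ)‖ ^ 2 =
        r * (r • ‖N (circleMap 0 r θ)‖ ^ 2) := fun θ => by
      rw [norm_mul, circleMap_eq_mul, norm_mul, norm_circlePt, mul_one, Complex.norm_real,
        Real.norm_of_nonneg hr.1.le, smul_eq_mul]; ring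
    simp only [e1, integral_const_mul] at hB
    have e2 : ∀ n ∈ s, r * ((|(n : ℝ)| ^ 2 * ‖a n‖ ^ 2) * r ^ (2 * n.natAbs - 1)) ≤
        ‖fourierAngle (fun θ => circleMap 0 r θ * N (circleMap 0 r θ)) n‖ ^ 2 := by
      intro n _
      rcases eq_or_ne n 0 with rfl | hn
      · simp
      rw [← fourierAngle_circle_deriv hd hN hr hn, fourierAngle_radialLimit hdiff hH h hr,
        norm_mul, norm_mul, norm_zpow, Complex.norm_real, Real.norm_of_nonneg hr.1.le,
        Complex.norm_intCast]
      rcases lt_or_ge n 0 with hneg | hpos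
      · have h0 := fourierAngle_circle_of_neg hdiff hr hneg
        rw [fourierAngle_radialLimit hdiff hH h hr] at h0
        have : a n = 0 := (mul_eq_zero.1 h0).resolve_right
          (zpow_ne_zero _ (by exact_mod_cast hr.1.ne'))
        simp [this, ← ha]
      · obtain ⟨m, rfl⟩ := Int.eq_ofNat_of_zero_le hpos
        have hm : 1 ≤ m := by omega
        simp only [Int.natAbs_natCast, zpow_natCast]
        obtain ⟨k, rfl⟩ := Nat.exists_eq_add_of_le' hm
        rw [show 2 * (k + 1) - 1 = 2 * k + 1 by omega]
        exact le_of_eq (by ring)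
    have e3 := (Finset.sum_le_sum e2).trans hB
    rw [← Finset.mul_sum, mul_left_comm] at e3
    exact le_of_mul_le_mul_left e3 hr.1
  have hint : ∀ n : ℤ, n ≠ 0 → ∫ r in Ioo (0 : ℝ) 1, r ^ (2 * n.natAbs - 1) = (2 * |(n : ℝ)|)⁻¹ := by
    intro n hn
    rw [← integral_Ioc_eq_integral_Ioo, ← intervalIntegral.integral_of_le zero_le_one, integral_pow]
    have : 1 ≤ n.natAbs := Int.natAbs_pos.2 hn
    obtain ⟨k, hk⟩ := Nat.exists_eq_add_of_le' this
    have h2 : |(n : ℝ)| = k + 1 := by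
      rw [← Int.cast_abs, Int.abs_eq_natAbs, hk]; push_cast; ring
    rw [h2, hk, show 2 * (k + 1) - 1 = 2 * k + 1 by omega]
    push_cast
    rw [one_pow, zero_pow (by omega), sub_zero]
    field_simp
    ring
  have hI : ∀ n ∈ s, IntegrableOn (fun r : ℝ => (|(n : ℝ)| ^ 2 * ‖a n‖ ^ 2) *
      r ^ (2 * n.natAbs - 1)) (Ioo 0 1) := fun n _ =>
    ((continuous_const.mul (continuous_pow _)).integrableOn_Icc (a := 0) (b := 1)).mono_set
      Ioo_subset_Icc_self
  have hfin := setIntegral_mono_on (integrable_finsetSum s hI)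
    (hrect.integral_prod_left.const_mul _) measurableSet_Ioo hle
  rw [integral_finsetSum s hI, integral_const_mul] at hfin
  refine le_trans ?_ (mul_le_mul_of_nonneg_left hfin zero_le_two)
  rw [Finset.mul_sum]
  refine Finset.sum_le_sum fun n _ => ?_
  rcases eq_or_ne n 0 with rfl | hn
  · simp
  rw [integral_const_mul, hint n hn]
  have : |(n : ℝ)| ≠ 0 := abs_ne_zero.2 (by exact_mod_cast hn)
  exact le_of_eq (by field_simp)

theorem memHHalfCircle_radialLimit (hd : ∀ z ∈ unitDisk, HasDerivAt ψ (N z) z)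
    (hN : ContinuousOn N unitDisk) (hi : IntegrableOn (fun z => ‖N z‖ ^ 2) unitDisk) :
    MemHHalfCircle (radialLimit ψ) := by
  obtain ⟨H, hH, h⟩ := exists_radial_majorant hd hN hi
  exact memHHalfCircle_iff_summable.2 ⟨memLp_radialLimit
    (fun z hz => (hd z hz).continuousAt.continuousWithinAt) hH h,
    summable_fourier_radialLimit hd hN hi hH h⟩

end trace

/-! ### Unit vector fields with holomorphic phase. -/

section phase

/-- The covector `e ↦ Re (κ e)`. -/
noncomputable def reForm (κ : ℂ) : ℂ →L[ℝ] ℝ := reCLM.comp (ContinuousLinearMap.mul ℝ ℂ κ)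

/-- The covector `e ↦ Im (κ e)`. -/
noncomputable def imForm (κ : ℂ) : ℂ →L[ℝ] ℝ := imCLM.comp (ContinuousLinearMap.mul ℝ ℂ κ)

@[simp] theorem reForm_apply (κ e : ℂ) : reForm κ e = (κ * e).re := rfl

@[simp] theorem imForm_apply (κ e : ℂ) : imForm κ e = (κ * e).im := rfl

theorem continuous_reForm : Continuous reForm := by unfold reForm; fun_prop

theorem continuous_imForm : Continuous imForm := by unfold imForm; fun_prop

theorem HasDerivAt.re_hasFDerivAt {L : ℂ → ℂ} {l z : ℂ} (h : HasDerivAt L l z) :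
    HasFDerivAt (fun w => (L w).re) (reForm l) z :=
  reCLM.hasFDerivAt.comp z h.hasFDerivAt_mul

theorem HasDerivAt.im_hasFDerivAt {L : ℂ → ℂ} {l z : ℂ} (h : HasDerivAt L l z) :
    HasFDerivAt (fun w => (L w).im) (imForm l) z :=
  imCLM.hasFDerivAt.comp z h.hasFDerivAt_mul

/-- The unit vector field `(z / |z|) e^{i (Im ψ + c)}`. -/
noncomputable def phaseMap (ψ : ℂ → ℂ) (c : ℝ) (z : ℂ) : ℂ :=
  z / ‖z‖ * exp (I * (((ψ z).im + c : ℝ) : ℂ))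

/-- The potential `log |z| + Re ψ`. -/
noncomputable def logPotential (ψ : ℂ → ℂ) (z : ℂ) : ℝ := Real.log ‖z‖ + (ψ z).re

theorem norm_phaseMap (ψ : ℂ → ℂ) (c : ℝ) {z : ℂ} (hz : z ≠ 0) : ‖phaseMap ψ c z‖ = 1 := by
  rw [phaseMap, norm_mul, norm_exp_I_mul_ofReal', norm_div, Complex.norm_real, norm_norm,
    div_self (norm_ne_zero_iff.2 hz), mul_one]

theorem norm_phaseMap_le (ψ : ℂ → ℂ) (c : ℝ) (z : ℂ) : ‖phaseMap ψ c z‖ ≤ 1 := by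
  rcases eq_or_ne z 0 with rfl | hz
  · simp [phaseMap]
  · exact (norm_phaseMap ψ c hz).le

theorem hasFDerivAt_mul_exp_im {L : ℂ → ℂ} {l z : ℂ} (h : HasDerivAt L l z) (A : ℂ) (c : ℝ) :
    HasFDerivAt (fun w => A * exp (I * (((L w).im + c : ℝ) : ℂ)))
      ((imForm l).smulRight (I * (A * exp (I * (((L z).im + c : ℝ) : ℂ))))) z := by
  have h1 : HasFDerivAt (fun w => (((L w).im + c : ℝ) : ℂ)) (ofRealCLM.comp (imForm l)) z :=
    ofRealCLM.hasFDerivAt.comp z (h.im_hasFDerivAt.add_const c)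
  have h2 := (Complex.hasDerivAt_exp (I * (((L z).im + c : ℝ) : ℂ))).hasFDerivAt_mul.comp z
    (h1.const_mul I)
  refine (h2.const_mul A).congr_fderiv ?_
  ext e
  simp
  all_goals ring

/-- Dividing by the base point keeps the principal logarithm holomorphic near `z₀`. Direction and
modulus of `z` are then governed by the imaginary and real parts of one holomorphic function. -/
theorem log_div_eq {z₀ z : ℂ} (h₀ : z₀ ≠ 0) (hz : z ≠ 0) :
    z / ‖z‖ = z₀ / ‖z₀‖ * exp (I * ((log (z / z₀)).im : ℂ)) ∧
    Real.log ‖z‖ = Real.log ‖z₀‖ + (log (z / z₀)).re := by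
  have hq : z / z₀ ≠ 0 := div_ne_zero hz h₀
  have hn : (‖z‖ : ℂ) ≠ 0 := by exact_mod_cast norm_ne_zero_iff.2 hz
  have hn₀ : (‖z₀‖ : ℂ) ≠ 0 := by exact_mod_cast norm_ne_zero_iff.2 h₀
  constructor
  · have h1 := norm_mul_exp_arg_mul_I (z / z₀)
    have hqn : (‖z / z₀‖ : ℂ) ≠ 0 := by exact_mod_cast norm_ne_zero_iff.2 hq
    have h2 : (‖z‖ : ℂ) = ‖z₀‖ * ‖z / z₀‖ := by
      rw [norm_div]; push_cast; field_simp
    have h3 : z = z₀ * (‖z / z₀‖ * exp (arg (z / z₀) * I)) := by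
      rw [h1]; field_simp
    rw [log_im, mul_comm I, h2]
    nth_rewrite 1 [h3]
    field_simp
  · rw [log_re, norm_div, Real.log_div (norm_ne_zero_iff.2 hz) (norm_ne_zero_iff.2 h₀)]
    ring

theorem hasDerivAt_log_div {z₀ : ℂ} (h₀ : z₀ ≠ 0) :
    HasDerivAt (fun z => log (z / z₀)) z₀⁻¹ z₀ := by
  have h := ((hasDerivAt_id z₀).div_const z₀).clog (by simp [h₀])
  simpa [h₀] using h

theorem hasFDerivAt_phaseMap {ψ : ℂ → ℂ} {n z : ℂ} (hz : z ≠ 0) (h : HasDerivAt ψ n z) (c : ℝ) :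
    HasFDerivAt (phaseMap ψ c) ((imForm (z⁻¹ + n)).smulRight (I * phaseMap ψ c z)) z := by
  have hL := (hasDerivAt_log_div hz).fun_add h
  have h1 := hasFDerivAt_mul_exp_im hL (z / ‖z‖) c
  have e : ∀ w : ℂ, w ≠ 0 → phaseMap ψ c w =
      z / ‖z‖ * exp (I * (((log (w / z) + ψ w).im + c : ℝ) : ℂ)) := fun w hw => by
    rw [phaseMap, (log_div_eq hz hw).1, mul_assoc, ← Complex.exp_add, add_im]
    congr 2; push_cast; ring
  rw [← e z hz] at h1
  refine h1.congr_of_eventuallyEq ?_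
  filter_upwards [isOpen_compl_singleton.mem_nhds hz] with w hw using e w hw

theorem hasFDerivAt_logPotential {ψ : ℂ → ℂ} {n z : ℂ} (hz : z ≠ 0) (h : HasDerivAt ψ n z) :
    HasFDerivAt (logPotential ψ) (reForm (z⁻¹ + n)) z := by
  have hL := ((hasDerivAt_log_div hz).fun_add h).re_hasFDerivAt.const_add (Real.log ‖z‖)
  refine hL.congr_of_eventuallyEq ?_
  filter_upwards [isOpen_compl_singleton.mem_nhds hz] with w hw
  rw [logPotential, (log_div_eq hz hw).2, add_re, add_assoc]

/-- With `dw = Im(κ dz) i w` the Cartan form `⟨dw, -iw⟩` is `-Im(κ dz)`, and rotating the argument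
by `i` turns it into `Re(κ dz)`. This is the Cauchy-Riemann relation behind the potential. -/
theorem pairForm_smulRight (D : ℂ → ℂ →L[ℝ] ℂ) (u : ℂ → ℂ) {κ p : ℂ} (hu : ‖u p‖ = 1)
    (hD : D p = (imForm κ).smulRight (I * u p)) :
    hodgeStar (pairForm D (fun z => -(I * u z))) p = reForm κ := by
  have hn : (u p).re ^ 2 + (u p).im ^ 2 = 1 := by
    have := Complex.sq_norm (u p)
    rw [hu, normSq_apply] at this
    linarith
  ext e
  simp only [hodgeStar, pairForm, hD, Complex.inner, ContinuousLinearMap.comp_apply,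
    ContinuousLinearMap.smulRight_apply, innerSL_apply_apply, _root_.neg_apply, imForm_apply,
    ContinuousLinearMap.mul_apply', reForm_apply]
  simp
  linear_combination (κ.re * e.re - κ.im * e.im) * hn

/-- The phase is locally the imaginary part of a primitive of `K`, hence harmonic. In the sum of the
second derivatives along `1` and `I` the terms with `K'` cancel, and `-|K|² w` remains. -/
theorem laplacian_of_fderiv_eq {U : Set ℂ} (hU : IsOpen U) {w K : ℂ → ℂ}
    (hK : DifferentiableOn ℂ K U)
    (hw : ∀ p ∈ U, HasFDerivAt w ((imForm (K p)).smulRight (I * w p)) p)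
    (hs : ContDiffOn ℝ ∞ w U) {p : ℂ} (hp : p ∈ U) :
    -(Laplacian.laplacian w p) = (‖K p‖ ^ 2 : ℝ) • w p := by
  have hd : DifferentiableAt ℝ (fderiv ℝ w) p :=
    ((hs.contDiffAt (hU.mem_nhds hp)).fderiv_right (m := 1) (by
      rw [one_add_one_eq_two]; exact two_le_infty)).differentiableAt (by simp)
  have h1 : ∀ e : ℂ, fderiv ℝ (fun q => fderiv ℝ w q e) p e =
      ((deriv K p * e * e).im : ℂ) * (I * w p) - (((K p * e).im : ℂ)) ^ 2 * w p := by
    intro e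
    have hev : (fun q => fderiv ℝ w q e) =ᶠ[𝓝 p] fun q => (((K q * e).im : ℝ) : ℂ) * (I * w q) := by
      filter_upwards [hU.mem_nhds hp] with q hq
      rw [(hw q hq).fderiv]
      simp
    have hKe : HasDerivAt (fun q => K q * e) (deriv K p * e) p :=
      (hK.differentiableAt (hU.mem_nhds hp)).hasDerivAt.mul_const e
    have h2 := (ofRealCLM.hasFDerivAt.comp p hKe.im_hasFDerivAt).fun_mul ((hw p hp).const_mul I)
    rw [hev.fderiv_eq (𝕜 := ℝ)]
    erw [h2.fderiv]
    simp
    all_goals ring_nf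
    simp
    all_goals ring
  rw [laplacian_eq_fderiv_fderiv hd, h1, h1, Complex.real_smul, Complex.sq_norm, normSq_apply]
  simp
  all_goals ring_nf

theorem isHarmonicMapToCircle_of_fderiv_eq {U : Set ℂ} (hU : IsOpen U) {w K : ℂ → ℂ}
    (hK : DifferentiableOn ℂ K U) (h1 : ∀ p ∈ U, ‖w p‖ = 1)
    (hw : ∀ p ∈ U, HasFDerivAt w ((imForm (K p)).smulRight (I * w p)) p)
    (hs : ContDiffOn ℝ ∞ w U) : IsHarmonicMapToCircle U w := by
  refine ⟨hs, h1, fun p hp => ?_⟩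
  rw [laplacian_of_fderiv_eq hU hK hw hs hp, (hw p hp).fderiv]
  congr 1
  simp [h1 p hp, Complex.sq_norm, normSq_apply]
  all_goals ring

end phase

/-! ### The polar frame and the boundary frame in terms of `log f'`. -/

section frame

/-- The holomorphic function `z ↦ (log (z f'))'` in the coordinate of `Ω`. -/
noncomputable def logSlope (f : ℂ → ℂ) (p : ℂ) : ℂ :=
  ((discInv f p)⁻¹ + deriv (deriv f) (discInv f p) / deriv f (discInv f p)) *
    (deriv f (discInv f p))⁻¹

theorem IsUniformization.discInv_ne_zero {f : ℂ → ℂ} {Ω : Set ℂ} {a p : ℂ}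
    (hf : IsUniformization f Ω) (hfa : f 0 = a) (hp : p ∈ Ω \ {a}) : discInv f p ≠ 0 := fun h =>
  hp.2 (by rw [mem_singleton_iff, ← hf.apply_discInv hp.1, h, hfa])

theorem IsUniformization.isOpen_diff {f : ℂ → ℂ} {Ω : Set ℂ} (hf : IsUniformization f Ω) (a : ℂ) :
    IsOpen (Ω \ {a}) := hf.isOpen.sdiff isClosed_singleton

theorem IsUniformization.differentiableOn_logSlope {f : ℂ → ℂ} {Ω : Set ℂ} {a : ℂ}
    (hf : IsUniformization f Ω) (hfa : f 0 = a) : DifferentiableOn ℂ (logSlope f) (Ω \ {a}) := by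
  have hm : MapsTo (discInv f) (Ω \ {a}) unitDisk := fun p hp => hf.discInv_mem hp.1
  have h0 : DifferentiableOn ℂ (discInv f) (Ω \ {a}) :=
    hf.differentiableOn_discInv.mono sdiff_subset
  have h1 : DifferentiableOn ℂ (fun p => deriv f (discInv f p)) (Ω \ {a}) :=
    hf.differentiableOn_deriv.comp h0 hm
  have h2 : DifferentiableOn ℂ (fun p => deriv (deriv f) (discInv f p)) (Ω \ {a}) :=
    (hf.differentiableOn_deriv.deriv isOpen_unitDisk).comp h0 hm
  have hne : ∀ p ∈ Ω \ {a}, deriv f (discInv f p) ≠ 0 := fun p hp => hf.deriv_ne_zero (hm hp)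
  exact ((h0.inv fun p hp => hf.discInv_ne_zero hfa hp).add (h2.div h1 hne)).mul (h1.inv hne)

theorem contDiffOn_phaseMap {ψ : ℂ → ℂ} (hψ : DifferentiableOn ℂ ψ unitDisk) (c : ℝ) :
    ContDiffOn ℝ ∞ (phaseMap ψ c) (unitDisk \ {0}) := by
  have h1 : ContDiffOn ℝ ∞ ψ (unitDisk \ {0}) :=
    ((hψ.contDiffOn (n := ∞) isOpen_unitDisk).restrict_scalars ℝ).mono sdiff_subset
  have hn : ContDiffOn ℝ ∞ (fun z : ℂ => (‖z‖ : ℂ)) (unitDisk \ {0}) :=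
    ofRealCLM.contDiff.comp_contDiffOn (contDiffOn_id.norm ℝ fun z hz => hz.2)
  have hi : ContDiffOn ℝ ∞ (fun z : ℂ => z / ‖z‖) (unitDisk \ {0}) :=
    contDiffOn_id.mul (hn.inv fun z hz => by exact_mod_cast norm_ne_zero_iff.2 hz.2)
  have hre : ContDiffOn ℝ ∞ (fun z => (((ψ z).im + c : ℝ) : ℂ)) (unitDisk \ {0}) :=
    ofRealCLM.contDiff.comp_contDiffOn ((imCLM.contDiff.comp_contDiffOn h1).add contDiffOn_const)
  exact hi.mul (contDiffOn_const.mul hre).cexp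

theorem angularDeriv_eq {f : ℂ → ℂ} {z : ℂ} (h : DifferentiableAt ℂ f z) :
    angularDeriv f z = I * (z * deriv f z) := by
  rw [angularDeriv, h.hasDerivAt.hasFDerivAt_mul.fderiv]
  simp only [ContinuousLinearMap.mul_apply', mul_one]
  linear_combination (I * deriv f z) * re_add_im z - z.im * deriv f z * I_sq

theorem radialDeriv_eq {f : ℂ → ℂ} {z : ℂ} (h : DifferentiableAt ℂ f z) :
    radialDeriv f z = z * deriv f z / ‖z‖ := by
  rw [radialDeriv, h.hasDerivAt.hasFDerivAt_mul.fderiv]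
  simp only [ContinuousLinearMap.mul_apply', mul_one]
  congr 1
  linear_combination (deriv f z) * re_add_im z

theorem exp_div_norm_exp (L : ℂ) : exp L / ‖exp L‖ = exp (I * (L.im : ℂ)) := by
  have h : (Real.exp L.re : ℂ) ≠ 0 := by exact_mod_cast (Real.exp_pos _).ne'
  rw [norm_exp]
  nth_rewrite 1 [← re_add_im L]
  rw [Complex.exp_add, ← ofReal_exp, mul_comm I]
  field_simp

namespace IsLogDeriv

variable {f ψ : ℂ → ℂ} {Ω : Set ℂ} {a : ℂ}

theorem differentiableOn_log (H : IsLogDeriv f ψ Ω) : DifferentiableOn ℂ ψ unitDisk := fun z hz =>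
  (H.hasDerivAt z hz).differentiableAt.differentiableWithinAt

theorem frameV_eq (H : IsLogDeriv f ψ Ω) {p : ℂ} (hp : p ∈ Ω) :
    frameV f p = phaseMap ψ 0 (discInv f p) := by
  have hz := H.unif.discInv_mem hp
  set z := discInv f p with hzdef
  -- At the base point both sides are `0` by the convention for division by zero, so the identity
  -- holds on all of `Ω`.
  rcases eq_or_ne z 0 with h0 | h0
  · simp [frameV, ← hzdef, h0, phaseMap, radialDeriv]
  have hn : (‖z‖ : ℂ) ≠ 0 := by exact_mod_cast norm_ne_zero_iff.2 h0
  have he : (‖exp (ψ z)‖ : ℂ) ≠ 0 := by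
    exact_mod_cast norm_ne_zero_iff.2 (Complex.exp_ne_zero _)
  rw [frameV, Function.comp_apply, ← hzdef, radialDeriv_eq (H.unif.differentiableAt hz), phaseMap,
    add_zero, ← exp_div_norm_exp, ← H.exp_eq z hz, norm_div, norm_mul, Complex.norm_real, norm_norm]
  push_cast
  field_simp

theorem frameU_eq (H : IsLogDeriv f ψ Ω) {p : ℂ} (hp : p ∈ Ω) :
    frameU f p = phaseMap ψ (Real.pi / 2) (discInv f p) := by
  have hz := H.unif.discInv_mem hp
  set z := discInv f p with hzdef
  have e : exp (I * (((ψ z).im + Real.pi / 2 : ℝ) : ℂ)) = I * exp (I * ((ψ z).im : ℂ)) := by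
    rw [ofReal_add, mul_add, Complex.exp_add]
    have : exp (I * ((Real.pi / 2 : ℝ) : ℂ)) = I := by
      rw [mul_comm]; push_cast; exact exp_pi_div_two_mul_I
    rw [this, mul_comm]
  rw [frameU, Function.comp_apply, ← hzdef, angularDeriv_eq (H.unif.differentiableAt hz), phaseMap,
    e, ← exp_div_norm_exp, ← H.exp_eq z hz, norm_mul, norm_mul, norm_I, one_mul]
  push_cast
  ring

theorem logConformalFactor_eq (H : IsLogDeriv f ψ Ω) {p : ℂ} (hp : p ∈ Ω) :
    logConformalFactor f p + Real.log ‖discInv f p‖ = logPotential ψ (discInv f p) := by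
  rw [logConformalFactor, Function.comp_apply, ← H.exp_eq _ (H.unif.discInv_mem hp), norm_exp,
    Real.log_exp, logPotential, add_comm]

theorem hasFDerivAt_phase (H : IsLogDeriv f ψ Ω) (hfa : f 0 = a) (c : ℝ) {p : ℂ}
    (hp : p ∈ Ω \ {a}) : HasFDerivAt (phaseMap ψ c ∘ discInv f)
      ((imForm (logSlope f p)).smulRight (I * (phaseMap ψ c ∘ discInv f) p)) p := by
  have h0 := H.unif.discInv_ne_zero hfa hp
  have h1 := hasFDerivAt_phaseMap h0 (H.hasDerivAt _ (H.unif.discInv_mem hp.1)) c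
  refine (h1.comp p (H.unif.hasDerivAt_discInv hp.1).hasFDerivAt_mul).congr_fderiv ?_
  ext e
  simp only [ContinuousLinearMap.comp_apply, ContinuousLinearMap.smulRight_apply, imForm_apply,
    ContinuousLinearMap.mul_apply', logSlope, Function.comp_apply, mul_assoc]

theorem hasFDerivAt_logPotential (H : IsLogDeriv f ψ Ω) (hfa : f 0 = a) {p : ℂ}
    (hp : p ∈ Ω \ {a}) : HasFDerivAt (logPotential ψ ∘ discInv f) (reForm (logSlope f p)) p := by
  have h0 := H.unif.discInv_ne_zero hfa hp
  have h1 := _root_.hasFDerivAt_logPotential h0 (H.hasDerivAt _ (H.unif.discInv_mem hp.1))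
  refine (h1.comp p (H.unif.hasDerivAt_discInv hp.1).hasFDerivAt_mul).congr_fderiv ?_
  ext e
  simp only [ContinuousLinearMap.comp_apply, reForm_apply,
    ContinuousLinearMap.mul_apply', logSlope, mul_assoc]

theorem contDiffOn_phase (H : IsLogDeriv f ψ Ω) (hfa : f 0 = a) (c : ℝ) :
    ContDiffOn ℝ ∞ (phaseMap ψ c ∘ discInv f) (Ω \ {a}) :=
  (contDiffOn_phaseMap H.differentiableOn_log c).comp
    (((H.unif.differentiableOn_discInv.contDiffOn (n := ∞) H.unif.isOpen).restrict_scalars ℝ).mono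
      sdiff_subset)
    fun _ hp => ⟨H.unif.discInv_mem hp.1, H.unif.discInv_ne_zero hfa hp⟩

theorem norm_phase (H : IsLogDeriv f ψ Ω) (hfa : f 0 = a) (c : ℝ) {p : ℂ} (hp : p ∈ Ω \ {a}) :
    ‖(phaseMap ψ c ∘ discInv f) p‖ = 1 := norm_phaseMap _ _ (H.unif.discInv_ne_zero hfa hp)

theorem hodgeStar_pairForm_phase (H : IsLogDeriv f ψ Ω) (hfa : f 0 = a) (c : ℝ) {p : ℂ}
    (hp : p ∈ Ω \ {a}) :
    hodgeStar (pairForm (fderiv ℝ (phaseMap ψ c ∘ discInv f))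
      (fun z => -(I * (phaseMap ψ c ∘ discInv f) z))) p = reForm (logSlope f p) :=
  pairForm_smulRight _ (phaseMap ψ c ∘ discInv f) (H.norm_phase hfa c hp)
    (H.hasFDerivAt_phase hfa c hp).fderiv

theorem frameU_eq_I_mul_frameV (H : IsLogDeriv f ψ Ω) {p : ℂ} (hp : p ∈ Ω) :
    frameU f p = I * frameV f p := by
  rw [H.frameU_eq hp, H.frameV_eq hp, phaseMap, phaseMap, add_zero, ofReal_add, mul_add,
    Complex.exp_add]
  have : exp (I * ((Real.pi / 2 : ℝ) : ℂ)) = I := by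
    rw [mul_comm]; push_cast; exact exp_pi_div_two_mul_I
  rw [this]; ring

/-- Since `v = -iu`, the form `⟨du, v⟩` is the Cartan form of `u` itself. -/
theorem hodgeStar_cartanForm (H : IsLogDeriv f ψ Ω) (hfa : f 0 = a) {p : ℂ} (hp : p ∈ Ω \ {a}) :
    hodgeStar (cartanForm f) p = reForm (logSlope f p) := by
  have hev : frameU f =ᶠ[𝓝 p] phaseMap ψ (Real.pi / 2) ∘ discInv f := by
    filter_upwards [H.unif.isOpen.mem_nhds hp.1] with q hq using H.frameU_eq hq
  rw [← H.hodgeStar_pairForm_phase hfa (Real.pi / 2) hp]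
  have hv : frameV f p = -(I * (phaseMap ψ (Real.pi / 2) ∘ discInv f) p) := by
    rw [Function.comp_apply, ← H.frameU_eq hp.1, H.frameU_eq_I_mul_frameV hp.1, ← mul_assoc, I_mul_I]
    ring
  simp only [hodgeStar, cartanForm, pairForm, hv, hev.fderiv_eq (𝕜 := ℝ)]

theorem integrableOn_sq (H : IsLogDeriv f ψ Ω) :
    IntegrableOn (fun z => ‖deriv (deriv f) z / deriv f z‖ ^ 2) unitDisk := H.energy

theorem continuousOn_logDeriv (H : IsLogDeriv f ψ Ω) :
    ContinuousOn (fun z => deriv (deriv f) z / deriv f z) unitDisk :=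
  ((H.unif.differentiableOn_deriv.deriv isOpen_unitDisk).div H.unif.differentiableOn_deriv
    fun _ hz => H.unif.deriv_ne_zero hz).continuousOn

/-- The phase of the outward normal in the coordinate of the disk, up to `arg z`. -/
theorem memHHalfCircle_phase (H : IsLogDeriv f ψ Ω) (c : ℝ) :
    MemHHalfCircle (fun z => (radialLimit ψ z).im + c) := by
  have h := memHHalfCircle_radialLimit H.hasDerivAt H.continuousOn_logDeriv H.integrableOn_sq
  refine h.of_norm_sub_le (A := 1) (B := 0) ?_ fun s t => ?_
  · exact (h.1.im).add (memLp_const c)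
  · rw [one_mul, zero_mul, add_zero, add_sub_add_right_eq_sub, ← sub_im]
    exact abs_im_le_norm _

/-- Almost every radius carries a limit of `ψ`, and at its endpoint the normal is explicit. -/
theorem ae_outwardNormal_eq (H : IsLogDeriv f ψ Ω) (F : ℂ ≃ₜ ℂ) (hF : Ω = F '' unitDisk) :
    ∀ᵐ θ ∂angleMeasure, outwardNormal Ω (boundaryMap f (circlePt θ)) =
      circlePt θ * exp (I * ((radialLimit ψ (circlePt θ)).im : ℂ)) := by
  obtain ⟨M, -, h⟩ := exists_radial_majorant H.hasDerivAt H.continuousOn_logDeriv H.integrableOn_sq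
  filter_upwards [h] with θ hθ
  have hL : Tendsto (fun r : ℝ => ψ (r * circlePt θ)) (𝓝[<] 1)
      (𝓝 (radialLimit ψ (circlePt θ))) := hθ.2.congr fun r => by rw [circleMap_eq_mul]
  rw [(H.isOutwardUnitNormal F hF (norm_circlePt θ) hL).outwardNormal_eq, mul_div_assoc,
    exp_div_norm_exp]

theorem ae_unitTangent_eq (H : IsLogDeriv f ψ Ω) (F : ℂ ≃ₜ ℂ) (hF : Ω = F '' unitDisk) :
    ∀ᵐ θ ∂angleMeasure, unitTangent Ω (boundaryMap f (circlePt θ)) =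
      circlePt θ * exp (I * (((radialLimit ψ (circlePt θ)).im + Real.pi / 2 : ℝ) : ℂ)) := by
  filter_upwards [H.ae_outwardNormal_eq F hF] with θ hθ
  have : exp (I * ((Real.pi / 2 : ℝ) : ℂ)) = I := by
    rw [mul_comm]; push_cast; exact exp_pi_div_two_mul_I
  rw [unitTangent, hθ, ofReal_add, mul_add, Complex.exp_add, this]
  ring

end IsLogDeriv

end frame

/-! ### Integrability of logarithmic singularities and radially dominated functions. -/

section integrability

instance isFiniteMeasure_restrict_unitDisk : IsFiniteMeasure (volume.restrict unitDisk) :=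
  ⟨by rw [Measure.restrict_apply_univ]; exact measure_ball_lt_top⟩

theorem abs_log_le_rpow {x : ℝ} (h0 : 0 < x) (h1 : x ≤ 1) :
    |Real.log x| ≤ 2 * x ^ (-(1 / 2) : ℝ) := by
  have h := Real.abs_log_mul_self_rpow_lt x (1 / 2) h0 h1 (by norm_num)
  have hx : 0 < x ^ (1 / 2 : ℝ) := Real.rpow_pos_of_pos h0 _
  rw [abs_mul, abs_of_pos hx] at h
  rw [Real.rpow_neg h0.le, ← div_eq_mul_inv, le_div_iff₀ hx]
  linarith

theorem integrableOn_unitDisk_of_norm_le_rpow {E : Type*} [NormedAddCommGroup E] {F : ℂ → E}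
    {C α : ℝ} (hα : α < 2) (h : ∀ z ∈ unitDisk \ {0}, ‖F z‖ ≤ C * ‖z‖ ^ (-α))
    (hm : AEStronglyMeasurable F (volume.restrict unitDisk)) : IntegrableOn F unitDisk := by
  have hm' : AEStronglyMeasurable (unitDisk.indicator F) volume :=
    (aestronglyMeasurable_indicator_iff isOpen_unitDisk.measurableSet).2 hm
  have h1 : IntegrableOn (unitDisk.indicator F) (Metric.ball 0 1) := by
    refine integrableOn_ball_of_norm_le_rpow (C := C) (α := α) (by simp) (by simpa using hα) ?_ hm'
    filter_upwards [ae_restrict_mem isOpen_unitDisk.measurableSet,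
      ae_restrict_of_ae (Measure.ae_ne volume (0 : ℂ))] with z hz hz0
    rw [indicator_of_mem hz]
    exact h z ⟨hz, hz0⟩
  refine h1.congr ?_
  filter_upwards [ae_restrict_mem isOpen_unitDisk.measurableSet] with z hz
  rw [indicator_of_mem hz]

theorem integrableOn_inv_norm : IntegrableOn (fun z : ℂ => ‖z‖⁻¹) unitDisk := by
  refine integrableOn_unitDisk_of_norm_le_rpow (C := 1) (α := 1) (by norm_num) (fun z _ => ?_)
    (by fun_prop)
  rw [norm_inv, norm_norm, one_mul, Real.rpow_neg_one]

theorem measurable_log_norm : Measurable fun z : ℂ => Real.log ‖z‖ :=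
  Real.measurable_log.comp measurable_norm

theorem integrableOn_inv_norm_mul_log :
    IntegrableOn (fun z : ℂ => ‖z‖⁻¹ * Real.log ‖z‖) unitDisk := by
  refine integrableOn_unitDisk_of_norm_le_rpow (C := 2) (α := 3 / 2) (by norm_num) (fun z hz => ?_)
    (measurable_norm.inv.mul measurable_log_norm).aestronglyMeasurable
  have h0 : 0 < ‖z‖ := norm_pos_iff.2 hz.2
  have h1 : ‖z‖ ≤ 1 := (mem_ball_zero_iff.1 hz.1).le
  rw [norm_mul, norm_inv, norm_norm, Real.norm_eq_abs]
  calc ‖z‖⁻¹ * |Real.log ‖z‖| ≤ ‖z‖⁻¹ * (2 * ‖z‖ ^ (-(1 / 2) : ℝ)) := by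
        gcongr; exact abs_log_le_rpow h0 h1
    _ = 2 * ‖z‖ ^ (-(3 / 2) : ℝ) := by
        rw [← Real.rpow_neg_one, mul_left_comm, ← Real.rpow_add h0]; norm_num

theorem memLp_log_norm : MemLp (fun z : ℂ => Real.log ‖z‖) 2 (volume.restrict unitDisk) := by
  rw [memLp_two_iff_integrable_sq measurable_log_norm.aestronglyMeasurable]
  refine integrableOn_unitDisk_of_norm_le_rpow (C := 4) (α := 1) (by norm_num) (fun z hz => ?_)
    (measurable_log_norm.pow_const 2).aestronglyMeasurable
  have h0 : 0 < ‖z‖ := norm_pos_iff.2 hz.2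
  have h1 : ‖z‖ ≤ 1 := (mem_ball_zero_iff.1 hz.1).le
  rw [norm_pow, Real.norm_eq_abs]
  calc |Real.log ‖z‖| ^ 2 ≤ (2 * ‖z‖ ^ (-(1 / 2) : ℝ)) ^ 2 := by
        gcongr; exact abs_log_le_rpow h0 h1
    _ = 4 * ‖z‖ ^ (-1 : ℝ) := by
        rw [mul_pow, ← Real.rpow_mul_natCast h0.le]; norm_num

variable {ψ N : ℂ → ℂ} {H : ℝ → ℝ}

theorem ae_rectMeasure_of_ae_angle {p : ℝ → ℝ → Prop}
    (h : ∀ᵐ θ ∂angleMeasure, ∀ r ∈ Ioo (0 : ℝ) 1, p r θ) :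
    ∀ᵐ q ∂rectMeasure, p q.1 q.2 := by
  filter_upwards [ae_rectMeasure_mem, Measure.quasiMeasurePreserving_snd.ae h] with q h1 h2
    using h2 _ h1

/-- The polar density `r` cancels the singular factor, leaving the integral of the majorant over a
rectangle. -/
theorem integrableOn_inv_norm_smul_of_majorant {E : Type*} [NormedAddCommGroup E]
    [NormedSpace ℝ E] {F : ℂ → E}
    (hm : AEStronglyMeasurable F (volume.restrict unitDisk))
    (hH : Integrable H angleMeasure)
    (h : ∀ᵐ θ ∂angleMeasure, ∀ r ∈ Ioo (0 : ℝ) 1, ‖F (circleMap 0 r θ)‖ ≤ H θ) :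
    IntegrableOn (fun z => ‖z‖⁻¹ • F z) unitDisk := by
  have hm' : AEStronglyMeasurable (fun z => ‖z‖⁻¹ • F z) (volume.restrict unitDisk) :=
    measurable_norm.inv.aestronglyMeasurable.smul hm
  refine ⟨hm', ?_⟩
  rw [HasFiniteIntegral, setLIntegral_unitDisk_eq hm'.enorm]
  have hi : Integrable (fun q : ℝ × ℝ => H q.2) rectMeasure := hH.comp_snd _
  refine lt_of_le_of_lt (lintegral_mono_ae ?_) hi.2
  filter_upwards [ae_rectMeasure_of_ae_angle h, ae_rectMeasure_mem] with q hq hq1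
  have e : ‖circleMap 0 q.1 q.2‖ = q.1 := by
    rw [circleMap_eq_mul, norm_mul, norm_circlePt, mul_one, Complex.norm_real,
      Real.norm_of_nonneg hq1.1.le]
  rw [← ofReal_norm, ← ENNReal.ofReal_mul hq1.1.le, norm_smul, norm_inv, norm_norm, e,
    mul_inv_cancel_left₀ hq1.1.ne', ← ofReal_norm]
  exact ENNReal.ofReal_le_ofReal (hq.trans (le_abs_self _))

theorem memLp_two_unitDisk_of_majorant (hm : AEStronglyMeasurable ψ (volume.restrict unitDisk))
    (hH : MemLp H 2 angleMeasure)
    (h : ∀ᵐ θ ∂angleMeasure, ∀ r ∈ Ioo (0 : ℝ) 1, ‖ψ (circleMap 0 r θ)‖ ≤ H θ) :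
    MemLp ψ 2 (volume.restrict unitDisk) := by
  rw [memLp_two_iff_integrable_sq_norm hm]
  have h1 := integrableOn_inv_norm_smul_of_majorant (F := fun z => ‖ψ z‖ ^ 2) (hm.norm.pow 2)
    hH.integrable_sq (by
      filter_upwards [h] with θ hθ r hr
      rw [norm_pow, norm_norm]
      exact pow_le_pow_left₀ (norm_nonneg _) (hθ r hr) 2)
  have h2 : IntegrableOn (fun z => ‖z‖ * (‖z‖⁻¹ • ‖ψ z‖ ^ 2)) unitDisk := by
    refine Integrable.bdd_mul (c := 1) h1 continuous_norm.aestronglyMeasurable ?_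
    filter_upwards [ae_restrict_mem isOpen_unitDisk.measurableSet] with z hz
    rw [norm_norm]; exact (mem_ball_zero_iff.1 hz).le
  refine h2.congr ?_
  filter_upwards [ae_restrict_of_ae (Measure.ae_ne volume (0 : ℂ))] with z hz
  rw [smul_eq_mul, mul_inv_cancel_left₀ (norm_ne_zero_iff.2 hz)]

theorem norm_reForm_le (κ : ℂ) : ‖reForm κ‖ ≤ ‖κ‖ := by
  refine ContinuousLinearMap.opNorm_le_bound _ (norm_nonneg _) fun e => ?_
  rw [reForm_apply, ← norm_mul]; exact abs_re_le_norm _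

theorem norm_imForm_le (κ : ℂ) : ‖imForm κ‖ ≤ ‖κ‖ := by
  refine ContinuousLinearMap.opNorm_le_bound _ (norm_nonneg _) fun e => ?_
  rw [imForm_apply, ← norm_mul]; exact abs_im_le_norm _

theorem memLp_of_sq_integrableOn (hN : ContinuousOn N unitDisk)
    (hi : IntegrableOn (fun z => ‖N z‖ ^ 2) unitDisk) : MemLp N 2 (volume.restrict unitDisk) :=
  (memLp_two_iff_integrable_sq_norm (hN.aestronglyMeasurable isOpen_unitDisk.measurableSet)).2 hi

theorem integrableOn_inv_add (hN : MemLp N 2 (volume.restrict unitDisk)) :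
    IntegrableOn (fun z => z⁻¹ + N z) unitDisk := by
  refine Integrable.add ?_ (hN.integrable (by norm_num))
  refine Integrable.mono integrableOn_inv_norm (by fun_prop) (ae_of_all _ fun z => ?_)
  rw [norm_inv, norm_inv, norm_norm]

theorem memLp_inv_add (hN : MemLp N 2 (volume.restrict unitDisk)) {δ : ℝ} (hδ : 0 < δ) :
    MemLp (fun z => z⁻¹ + N z) 2 (volume.restrict (unitDisk \ Metric.closedBall 0 δ)) := by
  refine MemLp.add ?_ (hN.mono_measure (Measure.restrict_mono_set _ sdiff_subset))
  have : IsFiniteMeasure (volume.restrict (unitDisk \ Metric.closedBall (0 : ℂ) δ)) :=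
    ⟨by rw [Measure.restrict_apply_univ]
        exact (measure_mono sdiff_subset).trans_lt measure_ball_lt_top⟩
  refine MemLp.of_bound (by fun_prop) δ⁻¹ ?_
  filter_upwards [ae_restrict_mem (isOpen_unitDisk.measurableSet.diff
    Metric.isClosed_closedBall.measurableSet)] with z hz
  rw [norm_inv]
  have : δ < ‖z‖ := by simpa using hz.2
  gcongr

end integrability

/-! ### Gauss-Green formulas for the frame fields and for the phase. -/

section gaussGreen

theorem tendsto_circleMap_radius (θ : ℝ) :
    Tendsto (fun r : ℝ => circleMap 0 r θ) (𝓝[<] 1) (𝓝 (circlePt θ)) :=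
  (IsLogDeriv.tendsto_ofReal_mul (circlePt θ)).congr fun r => (circleMap_eq_mul r θ).symm

theorem ContinuousOn.clm_smulRight {A : ℂ → ℂ →L[ℝ] ℝ} {B : ℂ → ℂ} {s : Set ℂ}
    (hA : ContinuousOn A s) (hB : ContinuousOn B s) :
    ContinuousOn (fun z => (A z).smulRight (B z)) s :=
  ((ContinuousLinearMap.smulRightL ℝ ℂ ℂ).continuous.comp_continuousOn hA).clm_apply hB

variable {ψ N : ℂ → ℂ}

/-- The derivative of `phaseMap ψ c` when `ψ' = N`. -/
noncomputable def phaseDeriv (ψ N : ℂ → ℂ) (c : ℝ) (z : ℂ) : ℂ →L[ℝ] ℂ :=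
  (imForm (z⁻¹ + N z)).smulRight (I * phaseMap ψ c z)

theorem norm_phaseDeriv_le (ψ N : ℂ → ℂ) (c : ℝ) (z : ℂ) : ‖phaseDeriv ψ N c z‖ ≤ ‖z⁻¹ + N z‖ := by
  rw [phaseDeriv, ContinuousLinearMap.norm_smulRight_apply, norm_mul, norm_I, one_mul]
  calc _ ≤ ‖z⁻¹ + N z‖ * 1 := by
        gcongr
        · exact norm_imForm_le _
        · exact norm_phaseMap_le _ _ _
    _ = _ := mul_one _

theorem continuousOn_inv_add (hN : ContinuousOn N unitDisk) :
    ContinuousOn (fun z => z⁻¹ + N z) (unitDisk \ {0}) :=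
  (continuousOn_id.inv₀ fun _ hz => hz.2).add (hN.mono sdiff_subset)

theorem continuousOn_phaseMap (hψ : DifferentiableOn ℂ ψ unitDisk) (c : ℝ) :
    ContinuousOn (phaseMap ψ c) (unitDisk \ {0}) := (contDiffOn_phaseMap hψ c).continuousOn

theorem continuousOn_phaseDeriv (hψ : DifferentiableOn ℂ ψ unitDisk) (hN : ContinuousOn N unitDisk)
    (c : ℝ) : ContinuousOn (phaseDeriv ψ N c) (unitDisk \ {0}) := by
  have h1 : ContinuousOn (fun z => imForm (z⁻¹ + N z)) (unitDisk \ {0}) :=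
    continuous_imForm.comp_continuousOn (continuousOn_inv_add hN)
  have h2 := ContinuousOn.mul (continuousOn_const (c := I)) (continuousOn_phaseMap hψ c)
  exact h1.clm_smulRight h2

theorem aestronglyMeasurable_unitDisk_of_continuousOn {E : Type*} [NormedAddCommGroup E]
    [SecondCountableTopology E] {F : ℂ → E}
    (h : ContinuousOn F (unitDisk \ {0})) : AEStronglyMeasurable F (volume.restrict unitDisk) := by
  have h1 := h.aestronglyMeasurable (μ := volume)
    (isOpen_unitDisk.measurableSet.diff (measurableSet_singleton 0))
  rwa [Measure.restrict_congr_set (sdiff_null_ae_eq_self (measure_singleton 0))] at h1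

theorem tendsto_smul_zero_of_norm_le {E : Type*} [NormedAddCommGroup E] [NormedSpace ℝ E]
    {V : ℂ → E} {M : ℝ} (hV : ∀ z ∈ unitDisk, ‖V z‖ ≤ M) (θ : ℝ) :
    Tendsto (fun r : ℝ => r • V (circleMap 0 r θ)) (𝓝[>] 0) (𝓝 0) := by
  have h1 : Tendsto (fun r : ℝ => r * M) (𝓝[>] 0) (𝓝 0) := by
    have : Tendsto (fun r : ℝ => r * M) (𝓝 0) (𝓝 (0 * M)) := Continuous.tendsto (by fun_prop) 0
    rw [zero_mul] at this
    exact this.mono_left nhdsWithin_le_nhds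
  refine squeeze_zero_norm' ?_ h1
  filter_upwards [Ioo_mem_nhdsGT (zero_lt_one (α := ℝ))] with r hr
  rw [norm_smul, Real.norm_of_nonneg hr.1.le]
  exact mul_le_mul_of_nonneg_left (hV _ (circleMap_mem_unitDisk hr θ)) hr.1.le

/-- The field is bounded, so the origin contributes nothing; its derivative is bounded by `1/|z| +
|N|`, hence integrable; and its boundary values exist along almost every radius. -/
theorem integral_phase_gauss_green (hd : ∀ z ∈ unitDisk, HasDerivAt ψ (N z) z)
    (hN : ContinuousOn N unitDisk) (hi : IntegrableOn (fun z => ‖N z‖ ^ 2) unitDisk) (c : ℝ)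
    {χ : ℂ → ℝ} (hχ : ContDiff ℝ ∞ χ) (e : ℂ) :
    ∫ z in unitDisk, ((fderiv ℝ χ z e) • phaseMap ψ c z + χ z • phaseDeriv ψ N c z e) =
      ∫ θ, (inner ℝ e (circlePt θ) * χ (circlePt θ)) •
        (circlePt θ * exp (I * (((radialLimit ψ (circlePt θ)).im + c : ℝ) : ℂ))) ∂angleMeasure := by
  have hdiff : DifferentiableOn ℂ ψ unitDisk := fun z hz =>
    (hd z hz).differentiableAt.differentiableWithinAt
  obtain ⟨M, hM0, hM, -⟩ := exists_bound_closedBall hχ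
  obtain ⟨H, hH, hHb⟩ := exists_radial_majorant hd hN hi
  have hbd : ∀ z ∈ unitDisk, ‖χ z • phaseMap ψ c z‖ ≤ M := fun z hz => by
    rw [norm_smul]
    calc _ ≤ M * 1 := by
          gcongr
          · exact (hM z (unitDisk_subset_closedBall hz)).1
          · exact norm_phaseMap_le _ _ _
      _ = M := mul_one M
  have hcU := continuousOn_phaseMap hdiff c
  have hcDU := continuousOn_phaseDeriv hdiff hN c
  have hcχ' : Continuous (fderiv ℝ χ) := hχ.continuous_fderiv (by simp)
  have hcV : ContinuousOn (fun z => χ z • phaseMap ψ c z) (unitDisk \ {0}) :=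
    hχ.continuous.continuousOn.smul hcU
  have hcDV : ContinuousOn (fun z => χ z • phaseDeriv ψ N c z +
      (fderiv ℝ χ z).smulRight (phaseMap ψ c z)) (unitDisk \ {0}) :=
    (hχ.continuous.continuousOn.smul hcDU).add (hcχ'.continuousOn.clm_smulRight hcU)
  have hNm := memLp_of_sq_integrableOn hN hi
  have hGG := integral_unitDisk_fderiv_eq_boundary (V := fun z => χ z • phaseMap ψ c z)
    (DV := fun z => χ z • phaseDeriv ψ N c z + (fderiv ℝ χ z).smulRight (phaseMap ψ c z))
    (Vb := fun θ => χ (circlePt θ) • (circlePt θ *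
      exp (I * (((radialLimit ψ (circlePt θ)).im + c : ℝ) : ℂ)))) ?_ hcDV ?_ ?_ ?_ ?_ e
  · simp only [smul_smul] at hGG
    rw [← hGG]
    refine integral_congr_ae (ae_of_all _ fun z => ?_)
    simp [add_comm]
  · intro z hz
    exact (hχ.differentiable (by simp) z).hasFDerivAt.fun_smul
      (hasFDerivAt_phaseMap hz.2 (hd z hz.1) c)
  · have hm := aestronglyMeasurable_unitDisk_of_continuousOn hcV
    refine Integrable.mono' (integrableOn_inv_norm.mul_const M)
      (measurable_norm.inv.aestronglyMeasurable.smul hm) ?_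
    filter_upwards [ae_restrict_mem isOpen_unitDisk.measurableSet] with z hz
    rw [norm_smul, norm_inv, norm_norm]
    exact mul_le_mul_of_nonneg_left (hbd z hz) (inv_nonneg.2 (norm_nonneg _))
  · have hint : IntegrableOn (fun z => M * ‖z⁻¹ + N z‖ + M) unitDisk :=
      ((integrableOn_inv_add hNm).norm.const_mul M).add (integrable_const M)
    refine Integrable.mono' hint (aestronglyMeasurable_unitDisk_of_continuousOn hcDV) ?_
    filter_upwards [ae_restrict_mem isOpen_unitDisk.measurableSet] with z hz
    have hb := hM z (unitDisk_subset_closedBall hz)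
    refine (norm_add_le _ _).trans (add_le_add ?_ ?_)
    · rw [norm_smul]
      exact mul_le_mul hb.1 (norm_phaseDeriv_le _ _ _ _) (norm_nonneg _) hM0
    · rw [ContinuousLinearMap.norm_smulRight_apply]
      exact (mul_le_mul hb.2 (norm_phaseMap_le _ _ _) (norm_nonneg _) hM0).trans (mul_one M).le
  · exact ae_of_all _ fun θ => tendsto_smul_zero_of_norm_le hbd θ
  · filter_upwards [hHb] with θ hθ
    have hcirc := tendsto_circleMap_radius θ
    have h2 : Tendsto (fun r : ℝ => circlePt θ *
        exp (I * (((ψ (circleMap 0 r θ)).im + c : ℝ) : ℂ))) (𝓝[<] 1) (𝓝 (circlePt θ *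
        exp (I * (((radialLimit ψ (circlePt θ)).im + c : ℝ) : ℂ)))) := by
      have h3 : Continuous fun w : ℂ => circlePt θ * exp (I * ((w.im + c : ℝ) : ℂ)) := by fun_prop
      exact (h3.tendsto _).comp hθ.2
    refine Tendsto.smul ((hχ.continuous.tendsto _).comp hcirc) (h2.congr' ?_)
    filter_upwards [Ioo_mem_nhdsLT (zero_lt_one (α := ℝ))] with r hr
    have hr0 : (r : ℂ) ≠ 0 := by exact_mod_cast hr.1.ne'
    rw [phaseMap]
    congr 1
    rw [circleMap_eq_mul, norm_mul, norm_circlePt, mul_one, Complex.norm_real,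
      Real.norm_of_nonneg hr.1.le]
    field_simp

/-- Here the integrand has no singularity at the origin. The radial majorant of `ψ` replaces a
uniform bound near the circle. -/
theorem integral_im_gauss_green (hd : ∀ z ∈ unitDisk, HasDerivAt ψ (N z) z)
    (hN : ContinuousOn N unitDisk) (hi : IntegrableOn (fun z => ‖N z‖ ^ 2) unitDisk) (c : ℝ)
    {s : ℂ → ℝ} (hs : ContDiff ℝ ∞ s) (e : ℂ) :
    IntegrableOn (fun z => s z * (N z * e).im + ((ψ z).im + c) * fderiv ℝ s z e) unitDisk ∧
    ∫ z in unitDisk, (s z * (N z * e).im + ((ψ z).im + c) * fderiv ℝ s z e) =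
      ∫ θ, inner ℝ e (circlePt θ) *
        (s (circlePt θ) * ((radialLimit ψ (circlePt θ)).im + c)) ∂angleMeasure := by
  have hcψ : ContinuousOn ψ unitDisk := fun z hz => (hd z hz).continuousAt.continuousWithinAt
  have hcq : ContinuousOn (fun z => (ψ z).im + c) unitDisk :=
    (continuous_im.comp_continuousOn hcψ).add continuousOn_const
  obtain ⟨M, hM0, hM, -⟩ := exists_bound_closedBall hs
  obtain ⟨H, hH, hHb⟩ := exists_radial_majorant hd hN hi
  have hqb : ∀ᵐ θ ∂angleMeasure, ∀ r ∈ Ioo (0 : ℝ) 1,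
      ‖(ψ (circleMap 0 r θ)).im + c‖ ≤ H θ + |c| := by
    filter_upwards [hHb] with θ hθ r hr
    exact (norm_add_le _ _).trans (add_le_add ((abs_im_le_norm _).trans (hθ.1 r hr)) le_rfl)
  have hH1 : Integrable (fun θ => H θ + |c|) angleMeasure :=
    (hH.integrable (by norm_num)).add (integrable_const _)
  have hcs' : Continuous (fderiv ℝ s) := hs.continuous_fderiv (by simp)
  have hcDV : ContinuousOn (fun z => s z • imForm (N z) + ((ψ z).im + c) • fderiv ℝ s z)
      unitDisk :=
    (hs.continuous.continuousOn.smul (continuous_imForm.comp_continuousOn hN)).add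
      (hcq.smul hcs'.continuousOn)
  have hNm := memLp_of_sq_integrableOn hN hi
  have hq2 : MemLp (fun z => (ψ z).im + c) 2 (volume.restrict unitDisk) :=
    (memLp_two_unitDisk_of_majorant (hcψ.aestronglyMeasurable isOpen_unitDisk.measurableSet) hH
      (by filter_upwards [hHb] with θ hθ using hθ.1)).im.add (memLp_const c)
  have hDVi : IntegrableOn (fun z => s z • imForm (N z) + ((ψ z).im + c) • fderiv ℝ s z)
      unitDisk := by
    have hint : IntegrableOn (fun z => M * ‖N z‖ + ‖(ψ z).im + c‖ * M) unitDisk :=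
      ((hNm.integrable (by norm_num)).norm.const_mul M).add
        ((hq2.integrable (by norm_num)).norm.mul_const M)
    refine Integrable.mono' hint (hcDV.aestronglyMeasurable isOpen_unitDisk.measurableSet) ?_
    filter_upwards [ae_restrict_mem isOpen_unitDisk.measurableSet] with z hz
    have hb := hM z (unitDisk_subset_closedBall hz)
    refine (norm_add_le _ _).trans (add_le_add ?_ ?_)
    · rw [norm_smul]
      exact mul_le_mul hb.1 (norm_imForm_le _) (norm_nonneg _) hM0
    · rw [norm_smul]
      exact mul_le_mul_of_nonneg_left hb.2 (norm_nonneg _)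
  have hGG := integral_unitDisk_fderiv_eq_boundary (V := fun z => s z * ((ψ z).im + c))
    (DV := fun z => s z • imForm (N z) + ((ψ z).im + c) • fderiv ℝ s z)
    (Vb := fun θ => s (circlePt θ) * ((radialLimit ψ (circlePt θ)).im + c)) ?_
    (hcDV.mono sdiff_subset) ?_ hDVi ?_ ?_ e
  · refine ⟨?_, ?_⟩
    · refine ((ContinuousLinearMap.apply ℝ ℝ e).integrable_comp hDVi).congr (ae_of_all _ fun z => ?_)
      simp
    · simp only [smul_eq_mul] at hGG
      rw [← hGG]
      refine integral_congr_ae (ae_of_all _ fun z => ?_)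
      simp
  · intro z hz
    exact (hs.differentiable (by simp) z).hasFDerivAt.fun_mul
      ((hd z hz.1).im_hasFDerivAt.add_const c)
  · refine integrableOn_inv_norm_smul_of_majorant (H := fun θ => M * (H θ + |c|))
      ((hs.continuous.continuousOn.mul hcq).aestronglyMeasurable isOpen_unitDisk.measurableSet)
      (hH1.const_mul M) ?_
    filter_upwards [hqb] with θ hθ r hr
    rw [norm_mul]
    exact mul_le_mul (hM _ (unitDisk_subset_closedBall (circleMap_mem_unitDisk hr θ))).1 (hθ r hr)
      (norm_nonneg _) hM0
  · filter_upwards [hHb] with θ hθ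
    have h0 : Tendsto (fun r : ℝ => circleMap 0 r θ) (𝓝[>] 0) (𝓝 0) := by
      have hc : Continuous fun r : ℝ => circleMap 0 r θ :=
        continuous_circleMap_prod.comp (by fun_prop : Continuous fun r : ℝ => (r, θ))
      have := (hc.tendsto 0).mono_left (nhdsWithin_le_nhds (s := Ioi 0))
      rwa [circleMap_zero_radius] at this
    have h1 : Tendsto (fun r : ℝ => s (circleMap 0 r θ) * ((ψ (circleMap 0 r θ)).im + c)) (𝓝[>] 0)
        (𝓝 (s 0 * ((ψ 0).im + c))) :=
      (((hs.continuous.continuousOn.mul hcq).continuousAt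
        (isOpen_unitDisk.mem_nhds zero_mem_unitDisk)).tendsto).comp h0
    have h2 : Tendsto (fun r : ℝ => r) (𝓝[>] 0) (𝓝 0) := nhdsWithin_le_nhds
    have h3 := h2.smul h1
    rwa [zero_smul] at h3
  · filter_upwards [hHb] with θ hθ
    have hcirc := tendsto_circleMap_radius θ
    exact ((hs.continuous.tendsto _).comp hcirc).mul
      (((continuous_im.tendsto _).comp hθ.2).add_const c)

end gaussGreen

/-! ### The Neumann potential `log |z| + Re ψ`. -/

section neumann

variable {ψ N : ℂ → ℂ}

theorem covectorInner_reForm (κ : ℂ) (ℓ : ℂ →L[ℝ] ℝ) :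
    covectorInner (reForm κ) ℓ = ℓ (conj κ) := by
  have h : conj κ = κ.re • (1 : ℂ) + (-κ.im) • I := by
    apply Complex.ext <;> simp
  rw [h, map_add, map_smul, map_smul, covectorInner]
  simp

theorem fderiv_fderiv_apply_comm {χ : ℂ → ℝ} (hχ : ContDiff ℝ ∞ χ) (z u v : ℂ) :
    fderiv ℝ (fun z => fderiv ℝ χ z u) z v = fderiv ℝ (fun z => fderiv ℝ χ z v) z u := by
  have hd : DifferentiableAt ℝ (fderiv ℝ χ) z :=
    (hχ.fderiv_right (m := 1) (by rw [one_add_one_eq_two]; exact two_le_infty)).differentiable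
      (by simp) z
  have e : ∀ w : ℂ, fderiv ℝ (fun z => fderiv ℝ χ z w) z = (fderiv ℝ (fderiv ℝ χ) z).flip w :=
    fun w => by
      rw [fderiv_clm_apply hd (differentiableAt_const w)]
      simp
  rw [e, e]
  exact (hχ.contDiffAt.isSymmSndFDerivAt (by
    rw [minSmoothness_of_isRCLikeNormedField]; exact two_le_infty)).eq v u

/-- The weak form of `Δ log |z| = 2π δ₀` with test functions that need not vanish on the circle. In
polar coordinates `r ⟨∇ log |z|, ∇χ⟩` is the radial derivative of `χ`, which integrates to `χ(ζ) -
χ(0)` on each radius. -/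
theorem integral_covectorInner_inv {χ : ℂ → ℝ} (hχ : ContDiff ℝ ∞ χ) :
    IntegrableOn (fun z => covectorInner (reForm z⁻¹) (fderiv ℝ χ z)) unitDisk ∧
    ∫ z in unitDisk, covectorInner (reForm z⁻¹) (fderiv ℝ χ z) =
      (∫ θ, χ (circlePt θ) ∂angleMeasure) - 2 * Real.pi * χ 0 := by
  obtain ⟨M, hM0, hM, -⟩ := exists_bound_closedBall hχ
  have hcχ' : Continuous (fderiv ℝ χ) := hχ.continuous_fderiv (by simp)
  have hcinv : ContinuousOn (fun z : ℂ => conj z⁻¹) (unitDisk \ {0}) :=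
    continuous_conj.comp_continuousOn (continuousOn_id.inv₀ fun z hz => hz.2)
  have hi : IntegrableOn (fun z => covectorInner (reForm z⁻¹) (fderiv ℝ χ z)) unitDisk := by
    simp only [covectorInner_reForm]
    refine Integrable.mono' (integrableOn_inv_norm.const_mul M)
      (aestronglyMeasurable_unitDisk_of_continuousOn (hcχ'.continuousOn.clm_apply hcinv)) ?_
    filter_upwards [ae_restrict_mem isOpen_unitDisk.measurableSet] with z hz
    refine (ContinuousLinearMap.le_opNorm _ _).trans ?_
    rw [RCLike.norm_conj, norm_inv]
    exact mul_le_mul_of_nonneg_right (hM z (unitDisk_subset_closedBall hz)).2 (by positivity)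
  refine ⟨hi, ?_⟩
  have hrect := integrable_rectMeasure_of_integrableOn hi
  have e : (fun p : ℝ × ℝ => p.1 • covectorInner (reForm (circleMap 0 p.1 p.2)⁻¹)
      (fderiv ℝ χ (circleMap 0 p.1 p.2))) =ᵐ[rectMeasure]
      fun p => fderiv ℝ χ (circleMap 0 p.1 p.2) (circlePt p.2) := by
    filter_upwards [ae_rectMeasure_mem] with p hp
    rw [covectorInner_reForm, ← map_smul]
    congr 1
    have hp0 : (p.1 : ℂ) ≠ 0 := by exact_mod_cast hp.1.ne'
    have h1 : conj (circlePt p.2)⁻¹ = circlePt p.2 := by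
      rw [Complex.inv_eq_conj (norm_circlePt p.2), conj_conj]
    rw [circleMap_eq_mul, mul_inv, map_mul, h1, Complex.real_smul, map_inv₀, conj_ofReal,
      mul_inv_cancel_left₀ hp0]
  rw [setIntegral_unitDisk_eq hi, integral_congr_ae e, integral_prod_symm _ (hrect.congr e)]
  have hin : ∀ θ : ℝ, ∫ r in Ioo (0 : ℝ) 1, fderiv ℝ χ (circleMap 0 r θ) (circlePt θ) =
      χ (circlePt θ) - χ 0 := fun θ => by
    have hcc : Continuous fun r : ℝ => circleMap 0 r θ :=
      continuous_circleMap_prod.comp (by fun_prop : Continuous fun r : ℝ => (r, θ))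
    rw [← integral_Ioc_eq_integral_Ioo, ← intervalIntegral.integral_of_le zero_le_one,
      intervalIntegral.integral_eq_sub_of_hasDerivAt (f := fun r => χ (circleMap 0 r θ))]
    · rw [circleMap_zero_radius]; rfl
    · intro r _
      exact (hχ.differentiable (by simp) _).hasFDerivAt.comp_hasDerivAt r
        (hasDerivAt_circleMap_radius θ r)
    · exact ((hcχ'.comp hcc).clm_apply continuous_const).intervalIntegrable _ _
  simp only [hin]
  have hcont : Continuous fun θ => χ (circlePt θ) := hχ.continuous.comp continuous_circlePt
  rw [integral_sub (hcont.integrableOn_Ioc) (integrable_const _), integral_const, smul_eq_mul,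
    measureReal_restrict_apply_univ, Real.volume_real_Ioc, sub_zero,
    max_eq_left Real.two_pi_pos.le]

/-- By the Cauchy-Riemann equations, with `q = Im ψ + c`, the pairing `⟨∇ Re ψ, ∇χ⟩` is `∂_y q ∂_x χ
- ∂_x q ∂_y χ = ∂_y(q ∂_x χ) - ∂_x(q ∂_y χ)`. Gauss-Green leaves only the boundary values of `q`
against the tangential derivative of `χ`, so no trace of `ψ'` is needed. -/
theorem integral_covectorInner_deriv (hd : ∀ z ∈ unitDisk, HasDerivAt ψ (N z) z)
    (hN : ContinuousOn N unitDisk) (hi : IntegrableOn (fun z => ‖N z‖ ^ 2) unitDisk) (c : ℝ)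
    {χ : ℂ → ℝ} (hχ : ContDiff ℝ ∞ χ) :
    IntegrableOn (fun z => covectorInner (reForm (N z)) (fderiv ℝ χ z)) unitDisk ∧
    ∫ z in unitDisk, covectorInner (reForm (N z)) (fderiv ℝ χ z) =
      - ∫ θ, ((radialLimit ψ (circlePt θ)).im + c) *
        fderiv ℝ χ (circlePt θ) (I * circlePt θ) ∂angleMeasure := by
  obtain ⟨i1, h1⟩ := integral_im_gauss_green hd hN hi c (contDiff_fderiv_apply hχ 1) I
  obtain ⟨i2, h2⟩ := integral_im_gauss_green hd hN hi c (contDiff_fderiv_apply hχ I) 1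
  have e : ∀ z, covectorInner (reForm (N z)) (fderiv ℝ χ z) =
      (fderiv ℝ χ z 1 * (N z * I).im +
        ((ψ z).im + c) * fderiv ℝ (fun z => fderiv ℝ χ z 1) z I) -
      (fderiv ℝ χ z I * (N z * 1).im +
        ((ψ z).im + c) * fderiv ℝ (fun z => fderiv ℝ χ z I) z 1) := fun z => by
    rw [fderiv_fderiv_apply_comm hχ z 1 I, covectorInner]
    simp
    ring
  simp only [e]
  refine ⟨i1.sub i2, ?_⟩
  rw [integral_sub i1 i2, h1, h2]
  obtain ⟨M, hM0, hM, -⟩ := exists_bound_closedBall hχ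
  have hq := (memHHalfCircle_radialLimit hd hN hi).1.im.integrable (by norm_num)
  have hcχ' : Continuous (fderiv ℝ χ) := hχ.continuous_fderiv (by simp)
  have hint : ∀ e v : ℂ, ‖v‖ ≤ 1 → ‖e‖ ≤ 1 → Integrable (fun θ => inner ℝ e (circlePt θ) *
      (fderiv ℝ χ (circlePt θ) v * ((radialLimit ψ (circlePt θ)).im + c))) angleMeasure := by
    intro e v hv he
    have hq' : Integrable (fun θ => (radialLimit ψ (circlePt θ)).im + c) angleMeasure :=
      hq.add (integrable_const c)
    have := hq'.bdd_mul (c := 1 * M) (f := fun θ => inner ℝ e (circlePt θ) *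
      fderiv ℝ χ (circlePt θ) v) ?_ (ae_of_all _ fun θ => ?_)
    · refine this.congr (ae_of_all _ fun θ => ?_)
      simp only; ring
    · exact ((continuous_const.inner continuous_circlePt).mul
        ((hcχ'.comp continuous_circlePt).clm_apply continuous_const)).aestronglyMeasurable
    · rw [norm_mul]
      gcongr
      · refine (norm_inner_le_norm _ _).trans ?_
        rw [norm_circlePt, mul_one]; exact he
      · refine (ContinuousLinearMap.le_opNorm _ _).trans ?_
        exact (mul_le_mul (hM _ (circlePt_mem_closedBall θ)).2 hv (norm_nonneg _) hM0).trans
          (mul_one M).le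
  rw [← integral_sub (hint I 1 (by simp) (by simp)) (hint 1 I (by simp) (by simp)), ← integral_neg]
  refine integral_congr_ae (ae_of_all _ fun θ => ?_)
  have hI : ∀ ζ : ℂ, I * ζ = (-ζ.im) • (1 : ℂ) + ζ.re • I := fun ζ => by
    apply Complex.ext <;> simp
  beta_reduce
  rw [hI]
  generalize circlePt θ = ζ
  simp only [map_add, map_smul, Complex.inner, smul_eq_mul]
  simp
  ring

theorem HasTangentialPairing.congr {g g' η η' : ℂ → ℂ} {L : ℝ} (h : HasTangentialPairing g η L)
    (hg : ∀ᵐ θ ∂angleMeasure, g (circlePt θ) = g' (circlePt θ))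
    (hη : ∀ᵐ θ ∂angleMeasure, η (circlePt θ) = η' (circlePt θ)) :
    HasTangentialPairing g' η' L := by
  rw [HasTangentialPairing, ← circleFourier_congr hg, ← circleFourier_congr hη]
  exact h

/-- The potential is so mildly singular at the origin that even its quotient by `|z|` is integrable,
so the origin can be removed. -/
theorem hasWeakDeriv_logPotential (hd : ∀ z ∈ unitDisk, HasDerivAt ψ (N z) z)
    (hN : ContinuousOn N unitDisk) (hi : IntegrableOn (fun z => ‖N z‖ ^ 2) unitDisk) :
    HasWeakDeriv unitDisk (logPotential ψ) (fun z => reForm (z⁻¹ + N z)) ∧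
      MemLp (logPotential ψ) 2 (volume.restrict unitDisk) ∧
      IntegrableOn (fun z => reForm (z⁻¹ + N z)) unitDisk := by
  have hcψ : ContinuousOn ψ unitDisk := fun z hz => (hd z hz).continuousAt.continuousWithinAt
  obtain ⟨H, hH, hHb⟩ := exists_radial_majorant hd hN hi
  have hHb' : ∀ᵐ θ ∂angleMeasure, ∀ r ∈ Ioo (0 : ℝ) 1, ‖ψ (circleMap 0 r θ)‖ ≤ H θ := by
    filter_upwards [hHb] with θ hθ using hθ.1
  have hmψ := hcψ.aestronglyMeasurable (μ := volume) isOpen_unitDisk.measurableSet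
  have hNm := memLp_of_sq_integrableOn hN hi
  have hc : ContinuousOn (fun z => reForm (z⁻¹ + N z)) (unitDisk \ {0}) :=
    continuous_reForm.comp_continuousOn (continuousOn_inv_add hN)
  have hL2 : MemLp (logPotential ψ) 2 (volume.restrict unitDisk) :=
    memLp_log_norm.add (memLp_two_unitDisk_of_majorant hmψ hH hHb').re
  have hD : IntegrableOn (fun z => reForm (z⁻¹ + N z)) unitDisk := by
    refine Integrable.mono (integrableOn_inv_add hNm)
      (aestronglyMeasurable_unitDisk_of_continuousOn hc) (ae_of_all _ fun z => norm_reForm_le _)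
  have hr : IntegrableOn (fun z => ‖z‖⁻¹ • logPotential ψ z) unitDisk := by
    have h1 := integrableOn_inv_norm_smul_of_majorant hmψ (hH.integrable (by norm_num)) hHb'
    refine (integrableOn_inv_norm_mul_log.add h1.re).congr (ae_of_all _ fun z => ?_)
    simp [logPotential, mul_add]
  have hL1 : IntegrableOn (logPotential ψ) unitDisk := hL2.integrable (by norm_num)
  refine ⟨HasWeakDeriv.of_punctured (a := 0) (hasWeakDeriv_of_hasFDerivAt
    (isOpen_unitDisk.sdiff isClosed_singleton)
      (fun z hz => hasFDerivAt_logPotential hz.2 (hd z hz.1)) hc)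
    hL1.locallyIntegrableOn
    hD.locallyIntegrableOn ?_, hL2, hD⟩
  simp only [sub_zero]
  exact hr.locallyIntegrableOn

/-- The two Dirichlet pairings add up to `∫ χ - 2π χ(0) - ∫ φ ∂_θ χ` with `φ = Im ψ + c`. After
adding `2π χ(0)`, this is the bracket computed from the lifting of `g`. -/
theorem isNeumannPotential_logPotential (hd : ∀ z ∈ unitDisk, HasDerivAt ψ (N z) z)
    (hN : ContinuousOn N unitDisk) (hi : IntegrableOn (fun z => ‖N z‖ ^ 2) unitDisk) (c : ℝ)
    (hφ : MemHHalfCircle (fun z => (radialLimit ψ z).im + c)) {g : ℂ → ℂ}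
    (hg : ∀ᵐ θ ∂angleMeasure, g (circlePt θ) = circlePt θ *
      exp (I * (((radialLimit ψ (circlePt θ)).im + c : ℝ) : ℂ))) :
    IsNeumannPotential g (logPotential ψ) := by
  obtain ⟨hw, hL2, hD⟩ := hasWeakDeriv_logPotential hd hN hi
  have hNm := memLp_of_sq_integrableOn hN hi
  refine ⟨_, hw, hL2.integrable (by norm_num), hD, fun δ hδ =>
    ⟨hL2.mono_measure (Measure.restrict_mono_set _ sdiff_subset), ?_⟩, fun χ hχ => ?_⟩
  · exact (memLp_inv_add hNm hδ).mono
      (hD.aestronglyMeasurable.mono_measure (Measure.restrict_mono_set _ sdiff_subset))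
      (ae_of_all _ fun z => norm_reForm_le _)
  · obtain ⟨i1, h1⟩ := integral_covectorInner_inv hχ
    obtain ⟨i2, h2⟩ := integral_covectorInner_deriv hd hN hi c hχ
    have e : ∀ z, covectorInner (reForm (z⁻¹ + N z)) (fderiv ℝ χ z) =
        covectorInner (reForm z⁻¹) (fderiv ℝ χ z) + covectorInner (reForm (N z)) (fderiv ℝ χ z) :=
      fun z => by simp only [covectorInner_reForm, map_add]
    simp only [e]
    rw [integral_add i1 i2, h1, h2, show ∀ A B C : ℝ, A - C + -B + C = A - B by intros; ring]
    refine (hasTangentialPairing_of_lift hφ hχ).congr ?_ ?_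
    · filter_upwards [hg] with θ hθ using hθ.symm
    · filter_upwards [hg] with θ hθ
      rw [hθ]

theorem hasCircleTrace_phaseMap (hd : ∀ z ∈ unitDisk, HasDerivAt ψ (N z) z)
    (hN : ContinuousOn N unitDisk) (hi : IntegrableOn (fun z => ‖N z‖ ^ 2) unitDisk) (c : ℝ)
    {g U : ℂ → ℂ} (hU : EqOn U (phaseMap ψ c) unitDisk)
    (hg : ∀ᵐ θ ∂angleMeasure, g (circlePt θ) = circlePt θ *
      exp (I * (((radialLimit ψ (circlePt θ)).im + c : ℝ) : ℂ))) : HasCircleTrace U g := by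
  have hdiff : DifferentiableOn ℂ ψ unitDisk := fun z hz =>
    (hd z hz).differentiableAt.differentiableWithinAt
  have hNm := memLp_of_sq_integrableOn hN hi
  have hq := (memHHalfCircle_radialLimit hd hN hi).1.aestronglyMeasurable
  have hmeas : AEStronglyMeasurable (fun θ => circlePt θ *
      exp (I * (((radialLimit ψ (circlePt θ)).im + c : ℝ) : ℂ))) angleMeasure :=
    continuous_circlePt.aestronglyMeasurable.mul (aestronglyMeasurable_exp_I_mul
      ((continuous_im.comp_aestronglyMeasurable hq).add aestronglyMeasurable_const))
  refine ⟨?_, phaseDeriv ψ N c, fun δ hδ => ⟨?_, ?_⟩, fun χ hχ _ _ e => ?_⟩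
  · have : Integrable (fun θ => circlePt θ *
        exp (I * (((radialLimit ψ (circlePt θ)).im + c : ℝ) : ℂ))) angleMeasure := by
      refine Integrable.of_bound hmeas 1 (ae_of_all _ fun θ => ?_)
      rw [norm_mul, norm_circlePt, norm_exp_I_mul_ofReal', mul_one]
    refine this.congr ?_
    filter_upwards [hg] with θ hθ using hθ.symm
  · have h1 : MemLp (phaseMap ψ c) 2 (volume.restrict unitDisk) :=
      MemLp.of_bound (aestronglyMeasurable_unitDisk_of_continuousOn (continuousOn_phaseMap hdiff c))
        1 (ae_of_all _ fun z => norm_phaseMap_le _ _ _)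
    refine (h1.ae_eq ?_).mono_measure (Measure.restrict_mono_set _ sdiff_subset)
    filter_upwards [ae_restrict_mem isOpen_unitDisk.measurableSet] with z hz using (hU hz).symm
  · exact (memLp_inv_add hNm hδ).mono
      ((aestronglyMeasurable_unitDisk_of_continuousOn
        (continuousOn_phaseDeriv hdiff hN c)).mono_measure
          (Measure.restrict_mono_set _ sdiff_subset))
      (ae_of_all _ fun z => norm_phaseDeriv_le _ _ _ _)
  · have h1 : ∫ θ, (inner ℝ e (circlePt θ) * χ (circlePt θ)) • g (circlePt θ) ∂angleMeasure =
        ∫ θ, (inner ℝ e (circlePt θ) * χ (circlePt θ)) • (circlePt θ *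
          exp (I * (((radialLimit ψ (circlePt θ)).im + c : ℝ) : ℂ))) ∂angleMeasure := by
      refine integral_congr_ae ?_
      filter_upwards [hg] with θ hθ
      rw [hθ]
    rw [h1, ← integral_phase_gauss_green hd hN hi c hχ e]
    refine setIntegral_congr_fun isOpen_unitDisk.measurableSet fun z hz => ?_
    simp only [hU hz]

end neumann

/-! ### The frame fields have the defining properties. -/

section canonical

namespace IsLogDeriv

variable {f ψ w : ℂ → ℂ} {Ω : Set ℂ} {a : ℂ} {c : ℝ}

/-- The derivative of the unit vector field `w` with phase `arg f⁻¹ + Im ψ ∘ f⁻¹ + c`. -/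
noncomputable def frameDeriv (f w : ℂ → ℂ) (p : ℂ) : ℂ →L[ℝ] ℂ :=
  (imForm (logSlope f p)).smulRight (I * w p)

theorem hasFDerivAt_frame (H : IsLogDeriv f ψ Ω) (hfa : f 0 = a)
    (hw : EqOn w (phaseMap ψ c ∘ discInv f) Ω) {p : ℂ} (hp : p ∈ Ω \ {a}) :
    HasFDerivAt w (frameDeriv f w p) p := by
  rw [frameDeriv, hw hp.1]
  exact (H.hasFDerivAt_phase hfa c hp).congr_of_eventuallyEq
    (hw.eventuallyEq_of_mem (H.unif.isOpen.mem_nhds hp.1))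

theorem norm_frame (H : IsLogDeriv f ψ Ω) (hfa : f 0 = a)
    (hw : EqOn w (phaseMap ψ c ∘ discInv f) Ω) {p : ℂ} (hp : p ∈ Ω \ {a}) : ‖w p‖ = 1 := by
  rw [hw hp.1]; exact H.norm_phase hfa c hp

theorem contDiffOn_frame (H : IsLogDeriv f ψ Ω) (hfa : f 0 = a)
    (hw : EqOn w (phaseMap ψ c ∘ discInv f) Ω) : ContDiffOn ℝ ∞ w (Ω \ {a}) :=
  (H.contDiffOn_phase hfa c).congr fun _ hp => hw hp.1

theorem continuousOn_frameDeriv (H : IsLogDeriv f ψ Ω) (hfa : f 0 = a)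
    (hw : EqOn w (phaseMap ψ c ∘ discInv f) Ω) : ContinuousOn (frameDeriv f w) (Ω \ {a}) :=
  (continuous_imForm.comp_continuousOn (H.unif.differentiableOn_logSlope hfa).continuousOn)
    |>.clm_smulRight (continuousOn_const.mul (H.contDiffOn_frame hfa hw).continuousOn)

/-- Conformal invariance of the energy density: in the disk coordinate the slope is that of `log z +
ψ`. -/
theorem norm_logSlope_mul (H : IsLogDeriv f ψ Ω) {z : ℂ} (hz : z ∈ unitDisk) :
    ‖deriv f z‖ ^ 2 * ‖logSlope f (f z)‖ ^ 2 =
      ‖z⁻¹ + deriv (deriv f) z / deriv f z‖ ^ 2 := by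
  have h := norm_ne_zero_iff.2 (H.unif.deriv_ne_zero hz)
  rw [logSlope, H.unif.discInv_apply hz, norm_mul, norm_inv, ← mul_pow]
  congr 1
  field_simp

theorem mapsTo_diff (H : IsLogDeriv f ψ Ω) (hfa : f 0 = a) :
    MapsTo f (unitDisk \ {0}) (Ω \ {a}) := fun _ hz =>
  ⟨H.unif.2.mapsTo hz.1, fun h => hz.2 (H.unif.2.injOn hz.1 zero_mem_unitDisk (h.trans hfa.symm))⟩

theorem exists_subset_image_diff (H : IsLogDeriv f ψ Ω) (hfa : f 0 = a) {C : Set ℂ}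
    (hC : IsClosed C) (ha : a ∉ C) :
    ∃ δ > 0, C ∩ Ω ⊆ f '' (unitDisk \ Metric.closedBall 0 δ) := by
  have hca : ContinuousAt f 0 := (H.unif.differentiableAt zero_mem_unitDisk).continuousAt
  have h1 : f ⁻¹' Cᶜ ∈ 𝓝 (0 : ℂ) := hca (by rw [hfa]; exact hC.isOpen_compl.mem_nhds ha)
  obtain ⟨δ, hδ, hb⟩ := Metric.nhds_basis_closedBall.mem_iff.1 h1
  refine ⟨δ, hδ, fun p hp => ?_⟩
  obtain ⟨z, hz, rfl⟩ := H.unif.2.surjOn hp.2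
  exact ⟨z, ⟨hz, fun h => hb h hp.1⟩, rfl⟩

theorem memLp_frameDeriv (H : IsLogDeriv f ψ Ω) (hfa : f 0 = a)
    (hw : EqOn w (phaseMap ψ c ∘ discInv f) Ω) {δ : ℝ} (hδ : 0 < δ) :
    MemLp (frameDeriv f w) 2 (volume.restrict (f '' (unitDisk \ Metric.closedBall 0 δ))) := by
  have hsub : unitDisk \ Metric.closedBall 0 δ ⊆ unitDisk \ {0} :=
    sdiff_subset_sdiff_right (singleton_subset_iff.2 (Metric.mem_closedBall_self hδ.le))
  have hAm : MeasurableSet (unitDisk \ Metric.closedBall (0 : ℂ) δ) :=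
    isOpen_unitDisk.measurableSet.diff Metric.isClosed_closedBall.measurableSet
  have hm : AEStronglyMeasurable (frameDeriv f w)
      (volume.restrict (f '' (unitDisk \ Metric.closedBall 0 δ))) :=
    ((H.continuousOn_frameDeriv hfa hw).aestronglyMeasurable
      (H.unif.isOpen_diff a).measurableSet).mono_measure
      (Measure.restrict_mono_set _ ((image_mono hsub).trans (H.mapsTo_diff hfa).image_subset))
  have hsub' : unitDisk \ Metric.closedBall 0 δ ⊆ unitDisk := sdiff_subset
  refine (memLp_two_iff_integrable_sq_norm hm).2 ((integrableOn_image_iff_of_conformal hAm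
    (fun z hz => (H.unif.differentiableAt (hsub' hz)).hasDerivAt)
    (H.unif.2.injOn.mono hsub') _).2 ?_)
  have hL2 := memLp_inv_add (memLp_of_sq_integrableOn H.continuousOn_logDeriv H.integrableOn_sq) hδ
  refine Integrable.mono' ((memLp_two_iff_integrable_sq_norm hL2.1).1 hL2) ?_ ?_
  · refine ContinuousOn.aestronglyMeasurable ?_ hAm
    exact ((H.unif.differentiableOn_deriv.continuousOn.mono hsub').norm.pow 2).smul
      (((H.continuousOn_frameDeriv hfa hw).comp (H.unif.1.continuousOn.mono hsub')
        fun z hz => H.mapsTo_diff hfa (hsub hz)).norm.pow 2)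
  · filter_upwards [ae_restrict_mem hAm] with z hz
    rw [← H.norm_logSlope_mul (hsub' hz), norm_smul, norm_pow, norm_norm, norm_pow, norm_norm]
    gcongr
    rw [frameDeriv, ContinuousLinearMap.norm_smulRight_apply, norm_mul, norm_I, one_mul,
      H.norm_frame hfa hw (H.mapsTo_diff hfa (hsub hz)), mul_one]
    exact norm_imForm_le _

theorem hasH1LocDeriv_frame (H : IsLogDeriv f ψ Ω) (hfa : f 0 = a)
    (hw : EqOn w (phaseMap ψ c ∘ discInv f) Ω) : HasH1LocDeriv Ω a w (frameDeriv f w) := by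
  refine ⟨hasWeakDeriv_of_hasFDerivAt (H.unif.isOpen_diff a)
    (fun p hp => H.hasFDerivAt_frame hfa hw hp) (H.continuousOn_frameDeriv hfa hw),
    fun C hC hCs => ⟨?_, ?_⟩⟩
  · have hmeas : MeasurableSet (C ∩ Ω) := hC.measurableSet.inter H.unif.isOpen.measurableSet
    have hsub : C ∩ Ω ⊆ Ω \ {a} := fun p hp => ⟨hp.2, (hCs hp.1).2⟩
    have : IsFiniteMeasure (volume.restrict (C ∩ Ω)) :=
      ⟨by rw [Measure.restrict_apply_univ]
          exact (measure_mono inter_subset_left).trans_lt hC.measure_lt_top⟩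
    refine MemLp.of_bound (((H.contDiffOn_frame hfa hw).continuousOn.mono
      hsub).aestronglyMeasurable hmeas) 1 ?_
    filter_upwards [ae_restrict_mem hmeas] with p hp
    exact (H.norm_frame hfa hw (hsub hp)).le
  · obtain ⟨δ, hδ, hs⟩ := H.exists_subset_image_diff hfa hC.isClosed fun h => (hCs h).2 rfl
    exact (H.memLp_frameDeriv hfa hw hδ).mono_measure (Measure.restrict_mono_set _ hs)

/-- Near `a` one has `f⁻¹(p) = (p - a) k(p)` with `k` holomorphic and `k(a) ≠ 0`. On a small circle
`p = a + rζ` the field is `ζ` times a unimodular factor, whose phase `arg k(a) + Im(log(k/k(a)) + ψ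
∘ f⁻¹) + c` is Lipschitz, hence in `H^{1/2}`. -/
theorem hasDegreeAt_frame (H : IsLogDeriv f ψ Ω) (hfa : f 0 = a)
    (hw : EqOn w (phaseMap ψ c ∘ discInv f) Ω) : HasDegreeAt w a 1 := by
  have haΩ : a ∈ Ω := hfa ▸ H.unif.2.mapsTo zero_mem_unitDisk
  have ha0 : discInv f a = 0 := by rw [← hfa, H.unif.discInv_apply zero_mem_unitDisk]
  have hΩn := H.unif.isOpen.mem_nhds haΩ
  set k := dslope (discInv f) a with hk
  have hka : k a ≠ 0 := by
    rw [hk, dslope_same, (H.unif.hasDerivAt_discInv haΩ).deriv]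
    exact inv_ne_zero (H.unif.deriv_ne_zero (H.unif.discInv_mem haΩ))
  have hkan : AnalyticAt ℂ k a :=
    ((Complex.differentiableOn_dslope hΩn).2 H.unif.differentiableOn_discInv).analyticAt hΩn
  have hDan : AnalyticAt ℂ (discInv f) a := H.unif.differentiableOn_discInv.analyticAt hΩn
  have hψan : AnalyticAt ℂ ψ (discInv f a) :=
    H.differentiableOn_log.analyticAt (isOpen_unitDisk.mem_nhds (H.unif.discInv_mem haΩ))
  set M : ℂ → ℂ := fun p => log (k p / k a) + ψ (discInv f p) with hM
  have hMan : AnalyticAt ℂ M a :=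
    ((hkan.div analyticAt_const hka).clog (by simp [hka])).add (hψan.comp hDan)
  obtain ⟨K, t, ht, hlip⟩ := (hMan.contDiffAt (n := 1)).exists_lipschitzOnWith
  obtain ⟨r₀, hr₀, hb⟩ := Metric.mem_nhds_iff.1
    (inter_mem (inter_mem ht hΩn) (hkan.continuousAt.eventually_ne hka))
  refine ⟨r₀, hr₀, ?_⟩
  filter_upwards [ae_restrict_mem measurableSet_Ioo] with r hr
  have hmem : ∀ θ : ℝ, a + r * circlePt θ ∈ Metric.ball a r₀ := fun θ => by
    rw [mem_ball_iff_norm, add_sub_cancel_left, norm_mul, norm_circlePt, mul_one,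
      Complex.norm_real, Real.norm_of_nonneg hr.1.le]
    exact hr.2
  set φ : ℂ → ℝ := fun ζ => arg (k a) + (M (a + r * ζ)).im + c with hφ
  have hl : ∀ s t, ‖φ (circlePt s) - φ (circlePt t)‖ ≤
      (K * r) * ‖circlePt s - circlePt t‖ := fun s t => by
    have h1 := hlip.dist_le_mul _ (hb (hmem s)).1.1 _ (hb (hmem t)).1.1
    rw [dist_eq_norm, dist_eq_norm, add_sub_add_left_eq_sub, ← mul_sub, norm_mul,
      Complex.norm_real, Real.norm_of_nonneg hr.1.le] at h1
    have h2 : φ (circlePt s) - φ (circlePt t) =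
        (M (a + r * circlePt s) - M (a + r * circlePt t)).im := by
      simp only [hφ, sub_im]; ring
    rw [h2, mul_assoc]
    exact (abs_im_le_norm _).trans h1
  have hcont : Continuous fun θ => φ (circlePt θ) := by
    have h1 : Continuous fun θ => M (a + r * circlePt θ) :=
      hlip.continuousOn.comp_continuous
        (continuous_const.add (continuous_const.mul continuous_circlePt))
        fun θ => (hb (hmem θ)).1.1
    exact (continuous_const.add (continuous_im.comp h1)).add continuous_const
  have hbound : ∀ θ, ‖φ (circlePt θ)‖ ≤ K * r * 2 + ‖φ (circlePt 0)‖ := fun θ => by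
    have h1 := norm_le_norm_sub_add (φ (circlePt θ)) (φ (circlePt 0))
    have h2 := hl θ 0
    have h3 : ‖circlePt θ - circlePt 0‖ ≤ 2 := by
      refine (norm_sub_le _ _).trans ?_
      rw [norm_circlePt, norm_circlePt]; norm_num
    have h4 : (0 : ℝ) ≤ K * r := mul_nonneg K.2 hr.1.le
    nlinarith
  refine ⟨φ, memHHalfCircle_of_lipschitz (MemLp.of_bound hcont.aestronglyMeasurable _
    (ae_of_all _ hbound)) hl, ae_of_all _ fun θ => ?_⟩
  set p := a + r * circlePt θ with hp
  have hpb := hb (hmem θ)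
  have hkp : k p ≠ 0 := hpb.2
  have hz : discInv f p = r * circlePt θ * k p := by
    have := sub_smul_dslope (discInv f) a p
    rw [ha0, sub_zero, hp, add_sub_cancel_left, smul_eq_mul] at this
    exact this.symm
  have hr0 : (r : ℂ) ≠ 0 := by exact_mod_cast hr.1.ne'
  have hdir : discInv f p / ‖discInv f p‖ = circlePt θ * (k p / ‖k p‖) := by
    have hn : (‖k p‖ : ℂ) ≠ 0 := by exact_mod_cast norm_ne_zero_iff.2 hkp
    rw [hz, norm_mul, norm_mul, norm_circlePt, mul_one, Complex.norm_real,
      Real.norm_of_nonneg hr.1.le]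
    push_cast
    field_simp
  have hka' : k a / ‖k a‖ = exp (I * (arg (k a) : ℂ)) := by
    have hn : (‖k a‖ : ℂ) ≠ 0 := by exact_mod_cast norm_ne_zero_iff.2 hka
    have h1 := norm_mul_exp_arg_mul_I (k a)
    rw [mul_comm I]
    nth_rewrite 1 [← h1]
    field_simp
  change w p = _
  rw [(hw hpb.1.2 : w p = _), Function.comp_apply, phaseMap, hdir, (log_div_eq hka hkp).1, hka', zpow_one,
    mul_assoc, ← Complex.exp_add, ← Complex.exp_add]
  congr 2
  simp only [hφ, hM, add_im]
  push_cast
  ring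

theorem hasCanonicalProperties (H : IsLogDeriv f ψ Ω) (hfa : f 0 = a)
    (hw : EqOn w (phaseMap ψ c ∘ discInv f) Ω) {g : ℂ → ℂ}
    (hg : ∀ᵐ θ ∂angleMeasure, g (boundaryMap f (circlePt θ)) = circlePt θ *
      exp (I * (((radialLimit ψ (circlePt θ)).im + c : ℝ) : ℂ))) :
    HasCanonicalProperties Ω g a w := by
  have hφ := H.memHHalfCircle_phase c
  have hg' : ∀ᵐ θ ∂angleMeasure, (g ∘ boundaryMap f) (circlePt θ) = circlePt θ *
      exp (I * (((radialLimit ψ (circlePt θ)).im + c : ℝ) : ℂ)) := hg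
  refine ⟨⟨f, H.unif, ?_, ?_⟩, ⟨f, H.unif, _, hφ, ?_⟩, ?_, H.hasDegreeAt_frame hfa hw,
    ⟨f, H.unif, hfa, ?_⟩, ⟨_, H.hasH1LocDeriv_frame hfa hw, f, H.unif, hfa, logPotential ψ, ?_, ?_⟩⟩
  · refine hφ.circlePt_mul_exp.congr ?_
    filter_upwards [hg'] with θ hθ using hθ.symm
  · filter_upwards [hg'] with θ hθ
    rw [hθ, norm_mul, norm_circlePt, norm_exp_I_mul_ofReal', mul_one]
  · filter_upwards [hg'] with θ hθ
    rw [hθ, zpow_one]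
  · filter_upwards [ae_restrict_mem (H.unif.isOpen_diff a).measurableSet] with p hp
      using H.norm_frame hfa hw hp
  · refine hasCircleTrace_phaseMap H.hasDerivAt H.continuousOn_logDeriv H.integrableOn_sq c
      (fun z hz => ?_) hg'
    rw [Function.comp_apply, hw (H.unif.2.mapsTo hz), Function.comp_apply, H.unif.discInv_apply hz]
  · exact isNeumannPotential_logPotential H.hasDerivAt H.continuousOn_logDeriv H.integrableOn_sq c
      hφ hg'
  · refine (hasWeakDeriv_of_hasFDerivAt (H.unif.isOpen_diff a)
      (fun p hp => H.hasFDerivAt_logPotential hfa hp) (continuous_reForm.comp_continuousOn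
        (H.unif.differentiableOn_logSlope hfa).continuousOn)).congr EventuallyEq.rfl ?_
    filter_upwards [ae_restrict_mem (H.unif.isOpen_diff a).measurableSet] with p hp
    exact (pairForm_smulRight _ w (H.norm_frame hfa hw hp) rfl).symm

end IsLogDeriv

end canonical

/-! ### The trace determines the constant factor. -/

section uniqueness

theorem integral_sq_eq_zero_of_fourierAngle_eq_zero {G : ℝ → ℂ} (hG : MemLp G 2 angleMeasure)
    (h : ∀ n, fourierAngle G n = 0) : ∫ θ, ‖G θ‖ ^ 2 ∂angleMeasure = 0 := by
  have h1 := hasSum_sq_fourierAngle hG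
  simp only [h, norm_zero, ne_eq, OfNat.ofNat_ne_zero, not_false_eq_true, zero_pow] at h1
  exact (mul_eq_zero.1 (h1.unique hasSum_zero)).resolve_left
    (inv_ne_zero Real.two_pi_pos.ne')

theorem integrableOn_smul_of_eqOn_zero {E : Type*} [NormedAddCommGroup E] [NormedSpace ℝ E]
    {F : ℂ → E} {δ : ℝ} (hF : MemLp F 2 (volume.restrict (unitDisk \ Metric.closedBall 0 δ)))
    {s : ℂ → ℝ} (hs : Continuous s) (h0 : ∀ z ∈ Metric.closedBall (0 : ℂ) δ, s z = 0) :
    IntegrableOn (fun z => s z • F z) unitDisk := by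
  obtain ⟨M, hM⟩ := (isCompact_closedBall (0 : ℂ) 1).exists_bound_of_continuousOn hs.continuousOn
  have : IsFiniteMeasure (volume.restrict (unitDisk \ Metric.closedBall (0 : ℂ) δ)) :=
    isFiniteMeasure_of_le _ (Measure.restrict_mono_set volume sdiff_subset :
      _ ≤ volume.restrict unitDisk)
  have hm : MeasurableSet (unitDisk \ Metric.closedBall (0 : ℂ) δ) :=
    isOpen_unitDisk.measurableSet.diff Metric.isClosed_closedBall.measurableSet
  have h1 : IntegrableOn (fun z => s z • F z) (unitDisk \ Metric.closedBall 0 δ) := by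
    refine (hF.integrable (by norm_num)).bdd_smul M hs.aestronglyMeasurable ?_
    filter_upwards [ae_restrict_mem hm] with z hz using hM z (unitDisk_subset_closedBall hz.1)
  have h2 : IntegrableOn (fun z => s z • F z) (unitDisk ∩ Metric.closedBall 0 δ) :=
    integrableOn_zero.congr_fun (fun z hz => by simp [h0 z hz.2])
      (isOpen_unitDisk.measurableSet.inter Metric.isClosed_closedBall.measurableSet)
  have h3 := h1.union h2
  rwa [sdiff_union_inter] at h3

theorem integrable_smul_circle {g : ℂ → ℂ}
    (hg : Integrable (fun θ => g (circlePt θ)) angleMeasure) {p : ℂ → ℝ} (hp : Continuous p) :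
    Integrable (fun θ => p (circlePt θ) • g (circlePt θ)) angleMeasure := by
  obtain ⟨M, hM⟩ := (isCompact_closedBall (0 : ℂ) 1).exists_bound_of_continuousOn hp.continuousOn
  exact hg.bdd_smul M (hp.comp continuous_circlePt).aestronglyMeasurable
    (ae_of_all _ fun θ => hM _ (circlePt_mem_closedBall θ))

/-- The choices `(1, χ x ρ)` and `(I, χ y ρ)` for the direction and the test function add up to `ρ`,
because `x² + y² = 1` on the circle. The cutoff `χ` is `1` there and removes the origin. -/
theorem integral_smul_circle_eq_zero {g : ℂ → ℂ}
    (hg : Integrable (fun θ => g (circlePt θ)) angleMeasure)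
    (h : ∀ φ : ℂ → ℝ, ContDiff ℝ ∞ φ → HasCompactSupport φ → (0 : ℂ) ∉ tsupport φ → ∀ e : ℂ,
      ∫ θ, (inner ℝ e (circlePt θ) * φ (circlePt θ)) • g (circlePt θ) ∂angleMeasure = 0)
    {ρ : ℂ → ℝ} (hρ : ContDiff ℝ ∞ ρ) :
    ∫ θ, ρ (circlePt θ) • g (circlePt θ) ∂angleMeasure = 0 := by
  obtain ⟨χ, hχ, hχc, hχs, hχ1, -⟩ := exists_smooth_cutoff (isCompact_sphere (0 : ℂ) 1)
    (isOpen_compl_singleton (x := (0 : ℂ))) fun z hz => by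
      have : ‖z‖ = 1 := by simpa using hz
      exact norm_ne_zero_iff.1 (by rw [this]; exact one_ne_zero)
  have hχθ : ∀ θ, χ (circlePt θ) = 1 := fun θ =>
    hχ1.self_of_nhdsSet _ (by simp [-circleMap_zero_radius])
  have hz : (0 : ℂ) ∉ tsupport χ := fun h0 => hχs h0 rfl
  have key : ∀ p : ℂ → ℝ, ContDiff ℝ ∞ p → ∀ e : ℂ,
      ∫ θ, (inner ℝ e (circlePt θ) * (p (circlePt θ) * ρ (circlePt θ))) •
        g (circlePt θ) ∂angleMeasure = 0 := fun p hp e => by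
    have h1 := h (fun z => χ z * (p z * ρ z)) (hχ.mul (hp.mul hρ)) (hχc.mul_right)
      (fun h0 => hz (tsupport_mul_subset_left h0)) e
    simpa only [hχθ, one_mul] using h1
  have h1 := key re reCLM.contDiff 1
  have h2 := key im imCLM.contDiff I
  have hint : ∀ (p : ℂ → ℝ), Continuous p → ∀ e : ℂ, Integrable (fun θ =>
      (inner ℝ e (circlePt θ) * (p (circlePt θ) * ρ (circlePt θ))) • g (circlePt θ))
      angleMeasure := fun p hp e =>
    integrable_smul_circle hg (p := fun z => inner ℝ e z * (p z * ρ z))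
      ((continuous_const.inner continuous_id).mul (hp.mul hρ.continuous))
  have h3 := (integral_add (hint re continuous_re 1) (hint im continuous_im I)).trans
    (by rw [h1, h2, add_zero])
  rw [← h3]
  refine integral_congr_ae (ae_of_all _ fun θ => ?_)
  beta_reduce
  rw [← add_smul]
  congr 1
  have h4 : (circlePt θ).re * (circlePt θ).re + (circlePt θ).im * (circlePt θ).im = 1 := by
    rw [← normSq_apply, normSq_eq_norm_sq, norm_circlePt, one_pow]
  generalize circlePt θ = ζ at h4 ⊢
  simp only [Complex.inner]
  simp
  linear_combination (-ρ ζ) * h4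

theorem fourierAngle_eq_zero_of_integral {g : ℂ → ℂ}
    (hg : Integrable (fun θ => g (circlePt θ)) angleMeasure)
    (h : ∀ ρ : ℂ → ℝ, ContDiff ℝ ∞ ρ → ∫ θ, ρ (circlePt θ) • g (circlePt θ) ∂angleMeasure = 0)
    (n : ℤ) : fourierAngle (fun θ => g (circlePt θ)) n = 0 := by
  have hp : ContDiff ℝ ∞ fun z : ℂ => z ^ n.natAbs := contDiff_id.pow _
  have h1 := h _ (reCLM.contDiff.comp hp)
  have h2 := h _ (imCLM.contDiff.comp hp)
  have i1 := integrable_smul_circle hg (reCLM.contDiff.comp hp).continuous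
  have i2 := integrable_smul_circle hg (imCLM.contDiff.comp hp).continuous
  rw [fourierAngle_eq_integral]
  -- On the circle the exponential is `z^{|n|}` or its conjugate, hence a combination of two smooth
  -- real functions, with `σ = -I` for `n ≥ 0` and `σ = I` for `n ≤ 0`.
  have e : ∃ σ : ℂ, ∀ θ : ℝ, exp (-(I * n * θ)) * g (circlePt θ) =
      (reCLM ∘ fun z : ℂ => z ^ n.natAbs) (circlePt θ) • g (circlePt θ) +
      σ * ((imCLM ∘ fun z : ℂ => z ^ n.natAbs) (circlePt θ) • g (circlePt θ)) := by
    rcases Int.natAbs_eq n with hn | hn <;> replace hn := congrArg (Int.cast : ℤ → ℂ) hn <;>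
      simp only [Int.cast_neg, Int.cast_natCast] at hn
    · refine ⟨-I, fun θ => ?_⟩
      have e1 : exp (-(I * n * θ)) = conj (circlePt θ ^ n.natAbs) := by
        rw [circlePt_eq_exp, ← Complex.exp_nat_mul, ← exp_conj]
        congr 1
        rw [hn]
        simp
        ring
      rw [e1]
      simp only [Function.comp_apply, reCLM_apply, imCLM_apply, Complex.real_smul]
      have := re_add_im (conj (circlePt θ ^ n.natAbs))
      rw [conj_re, conj_im] at this
      rw [← this]; push_cast; ring
    · refine ⟨I, fun θ => ?_⟩
      have e1 : exp (-(I * n * θ)) = circlePt θ ^ n.natAbs := by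
        rw [circlePt_eq_exp, ← Complex.exp_nat_mul]
        congr 1
        rw [hn]
        ring
      rw [e1]
      simp only [Function.comp_apply, reCLM_apply, imCLM_apply, Complex.real_smul]
      nth_rewrite 1 [← re_add_im (circlePt θ ^ n.natAbs)]
      ring
  obtain ⟨σ, hσ⟩ := e
  simp only [hσ]
  rw [integral_add i1 (i2.const_mul σ), integral_const_mul, h1, h2]
  simp

/-- Subtracting `C` times the Gauss-Green formula of `U` from that of `W` gives `∫ φ (DW - C DU) =
(1 - C) ∫ φ g` with the boundary weight. Test functions supported in the punctured disk show `DW = C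
DU`. If `C ≠ 1`, then all boundary integrals of `g` vanish, so all its Fourier coefficients do,
contradicting `|g| = 1`. -/
theorem eq_one_of_hasCircleTrace {W U g : ℂ → ℂ} {C : ℂ} (hU : HasCircleTrace U g)
    (hW : HasCircleTrace W g) (h : ∀ᵐ z ∂volume.restrict unitDisk, W z = C * U z)
    (hg1 : ∀ᵐ θ ∂angleMeasure, ‖g (circlePt θ)‖ = 1) : C = 1 := by
  obtain ⟨hgi, DU, hUm, hUf⟩ := hU
  obtain ⟨-, DW, hWm, hWf⟩ := hW
  have hdisj : ∀ φ : ℂ → ℝ, (0 : ℂ) ∉ tsupport φ →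
      ∃ δ > 0, ∀ z ∈ Metric.closedBall (0 : ℂ) δ, z ∉ tsupport φ := fun φ h0 => by
    obtain ⟨δ, hδ, hb⟩ := Metric.nhds_basis_closedBall.mem_iff.1
      ((isClosed_tsupport φ).isOpen_compl.mem_nhds h0)
    exact ⟨δ, hδ, fun z hz => hb hz⟩
  have hEm : ∀ e : ℂ, ∀ δ > 0, MemLp (fun z => DW z e - C * DU z e) 2
      (volume.restrict (unitDisk \ Metric.closedBall 0 δ)) := fun e δ hδ =>
    ((ContinuousLinearMap.apply ℝ ℂ e).comp_memLp' (hWm δ hδ).2).sub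
      (((ContinuousLinearMap.apply ℝ ℂ e).comp_memLp' (hUm δ hδ).2).const_mul C)
  have key : ∀ φ : ℂ → ℝ, ContDiff ℝ ∞ φ → HasCompactSupport φ → (0 : ℂ) ∉ tsupport φ → ∀ e : ℂ,
      ∫ z in unitDisk, φ z • (DW z e - C * DU z e) =
        (1 - C) * ∫ θ, (inner ℝ e (circlePt θ) * φ (circlePt θ)) • g (circlePt θ) ∂angleMeasure := by
    intro φ hφ hφc h0 e
    obtain ⟨δ, hδ, hb⟩ := hdisj φ h0
    have hφ0 : ∀ z ∈ Metric.closedBall (0 : ℂ) δ, φ z = 0 := fun z hz =>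
      image_eq_zero_of_notMem_tsupport (hb z hz)
    have hdφ0 : ∀ z ∈ Metric.closedBall (0 : ℂ) δ, fderiv ℝ φ z e = 0 := fun z hz => by
      rw [image_eq_zero_of_notMem_tsupport fun h1 => hb z hz (tsupport_fderiv_subset ℝ h1)]
      rfl
    have hdφ : Continuous fun z => fderiv ℝ φ z e := (contDiff_fderiv_apply hφ e).continuous
    have iU := integrableOn_smul_of_eqOn_zero (hUm δ hδ).1 hdφ hdφ0
    have iW := integrableOn_smul_of_eqOn_zero (hWm δ hδ).1 hdφ hdφ0
    have iDU := integrableOn_smul_of_eqOn_zero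
      ((ContinuousLinearMap.apply ℝ ℂ e).comp_memLp' (hUm δ hδ).2) hφ.continuous hφ0
    have iDW := integrableOn_smul_of_eqOn_zero
      ((ContinuousLinearMap.apply ℝ ℂ e).comp_memLp' (hWm δ hδ).2) hφ.continuous hφ0
    have h1 := hWf φ hφ hφc h0 e
    have h2 := hUf φ hφ hφc h0 e
    erw [integral_add iW iDW] at h1
    erw [integral_add iU iDU] at h2
    have h3 : ∫ z in unitDisk, (fderiv ℝ φ z e) • W z =
        C * ∫ z in unitDisk, (fderiv ℝ φ z e) • U z := by
      rw [← integral_const_mul]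
      refine integral_congr_ae ?_
      filter_upwards [h] with z hz
      rw [hz, mul_smul_comm]
    have h4 : ∫ z in unitDisk, φ z • (DW z e - C * DU z e) =
        (∫ z in unitDisk, φ z • DW z e) - C * ∫ z in unitDisk, φ z • DU z e := by
      rw [← integral_const_mul]
      erw [← integral_sub iDW (iDU.const_mul C)]
      refine integral_congr_ae (ae_of_all _ fun z => ?_)
      simp [mul_sub]
      ring
    rw [h4]
    change _ + (∫ z in unitDisk, φ z • DW z e) = _ at h1
    change _ + (∫ z in unitDisk, φ z • DU z e) = _ at h2
    linear_combination h1 - C * h2 - h3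
  have hO : IsOpen (unitDisk \ {(0 : ℂ)}) := isOpen_unitDisk.sdiff isClosed_singleton
  have hE : ∀ e : ℂ, ∀ᵐ z, z ∈ unitDisk \ {(0 : ℂ)} → DW z e - C * DU z e = 0 := fun e => by
    refine hO.ae_eq_zero_of_integral_contDiff_smul_eq_zero ?_ fun φ hφ hφc hφs => ?_
    · intro z hz
      have h0 : 0 < ‖z‖ := norm_pos_iff.2 hz.2
      refine ⟨unitDisk \ Metric.closedBall 0 (‖z‖ / 2), mem_nhdsWithin_of_mem_nhds
        ((isOpen_unitDisk.sdiff Metric.isClosed_closedBall).mem_nhds ⟨hz.1, ?_⟩), ?_⟩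
      · simp only [mem_closedBall_zero_iff, not_le]; linarith
      · have : IsFiniteMeasure
            (volume.restrict (unitDisk \ Metric.closedBall (0 : ℂ) (‖z‖ / 2))) :=
          isFiniteMeasure_of_le _ (Measure.restrict_mono_set volume sdiff_subset :
            _ ≤ volume.restrict unitDisk)
        exact (hEm e _ (half_pos h0)).integrable (by norm_num)
    · rw [← setIntegral_eq_integral_of_tsupport_subset (hφs.trans sdiff_subset),
        key φ hφ hφc (fun h0 => (hφs h0).2 rfl) e]
      have : ∀ θ, φ (circlePt θ) = 0 := fun θ => image_eq_zero_of_notMem_tsupport fun h1 => by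
        have := mem_ball_zero_iff.1 (hφs h1).1
        rw [norm_circlePt] at this
        exact lt_irrefl _ this
      simp [this]
  by_contra hC
  have hR : ∀ φ : ℂ → ℝ, ContDiff ℝ ∞ φ → HasCompactSupport φ → (0 : ℂ) ∉ tsupport φ → ∀ e : ℂ,
      ∫ θ, (inner ℝ e (circlePt θ) * φ (circlePt θ)) • g (circlePt θ) ∂angleMeasure = 0 := by
    intro φ hφ hφc h0 e
    have h1 := key φ hφ hφc h0 e
    have h2 : ∫ z in unitDisk, φ z • (DW z e - C * DU z e) = 0 := by
      rw [← integral_zero ℂ ℂ (μ := volume.restrict unitDisk)]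
      refine integral_congr_ae ?_
      filter_upwards [ae_restrict_mem isOpen_unitDisk.measurableSet, ae_restrict_of_ae (hE e),
        ae_restrict_of_ae (Measure.ae_ne volume (0 : ℂ))] with z h3 h4 h5
      rw [h4 ⟨h3, h5⟩, smul_zero]
    rw [h2] at h1
    exact (mul_eq_zero.1 h1.symm).resolve_left (sub_ne_zero.2 (Ne.symm hC))
  have hgm : MemLp (fun θ => g (circlePt θ)) 2 angleMeasure :=
    MemLp.of_bound hgi.aestronglyMeasurable 1 (by filter_upwards [hg1] with θ hθ using hθ.le)
  have h1 := integral_sq_eq_zero_of_fourierAngle_eq_zero hgm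
    (fourierAngle_eq_zero_of_integral hgi fun ρ hρ => integral_smul_circle_eq_zero hgi hR hρ)
  have h2 : ∫ θ, ‖g (circlePt θ)‖ ^ 2 ∂angleMeasure = ∫ θ, (1 : ℝ) ∂angleMeasure := by
    refine integral_congr_ae ?_
    filter_upwards [hg1] with θ hθ
    rw [hθ, one_pow]
  rw [h2, integral_const, smul_eq_mul, mul_one, measureReal_restrict_apply_univ,
    Real.volume_real_Ioc, sub_zero, max_eq_left Real.two_pi_pos.le] at h1
  exact Real.two_pi_pos.ne' h1

end uniqueness

/-! ### Uniqueness of the Neumann potential. -/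

section neumannUnique

theorem covectorInner_reForm_reForm (κ l : ℂ) :
    covectorInner (reForm κ) (reForm l) = (l * conj κ).re := by
  rw [covectorInner_reForm, reForm_apply]

theorem integrableOn_covectorInner {D : ℂ → ℂ →L[ℝ] ℝ} (hD : IntegrableOn D unitDisk) {φ : ℂ → ℝ}
    (hφ : ContDiff ℝ ∞ φ) :
    IntegrableOn (fun z => covectorInner (D z) (fderiv ℝ φ z)) unitDisk := by
  have key : ∀ e : ℂ, IntegrableOn (fun z => D z e * fderiv ℝ φ z e) unitDisk := fun e => by
    have hc : Continuous fun z => fderiv ℝ φ z e := (contDiff_fderiv_apply hφ e).continuous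
    obtain ⟨M, hM⟩ := (isCompact_closedBall (0 : ℂ) 1).exists_bound_of_continuousOn hc.continuousOn
    refine ((ContinuousLinearMap.apply ℝ ℝ e).integrable_comp hD).mul_bdd (c := M)
      hc.aestronglyMeasurable ?_
    filter_upwards [ae_restrict_mem isOpen_unitDisk.measurableSet] with z hz
      using hM z (unitDisk_subset_closedBall hz)
  exact (key 1).add (key I)

/-- Orthogonality of the monomials on the disk: `b` is the `m`-th Taylor coefficient of `κ`, read
off on the circle of radius `1/2`, and `2π r^{2m+1}` integrates to `π/(m+1)`. -/
theorem integral_pow_mul_conj {κ : ℂ → ℂ} (hκ : DifferentiableOn ℂ κ unitDisk)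
    (hi : IntegrableOn κ unitDisk) (m : ℕ) : ∃ b : ℂ,
      (∀ r ∈ Ioo (0 : ℝ) 1, fourierAngle (fun θ => κ (circleMap 0 r θ)) m = b * (r : ℂ) ^ m) ∧
      ∫ z in unitDisk, z ^ m * conj (κ z) = Real.pi / (m + 1) * conj b := by
  have h2 : (1 / 2 : ℝ) ∈ Ioo (0 : ℝ) 1 := by norm_num
  set b := fourierAngle (fun θ => κ (circleMap 0 (1 / 2) θ)) m * ((1 / 2 : ℝ) : ℂ) ^ (-(m : ℤ))
    with hb
  have hbr : ∀ r ∈ Ioo (0 : ℝ) 1,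
      fourierAngle (fun θ => κ (circleMap 0 r θ)) m = b * (r : ℂ) ^ m := fun r hr => by
    have hr0 : (r : ℂ) ≠ 0 := by exact_mod_cast hr.1.ne'
    rw [hb, ← fourierAngle_circle_eq_mul_pow hκ hr h2 m, zpow_neg, zpow_natCast,
      inv_mul_cancel_right₀ (pow_ne_zero _ hr0)]
  refine ⟨b, hbr, ?_⟩
  have hi' : IntegrableOn (fun z => z ^ m * conj (κ z)) unitDisk := by
    refine Integrable.bdd_mul (c := 1) ((conjCLE : ℂ →L[ℝ] ℂ).integrable_comp hi)
      (continuous_pow m).aestronglyMeasurable ?_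
    filter_upwards [ae_restrict_mem isOpen_unitDisk.measurableSet] with z hz
    rw [norm_pow]
    exact pow_le_one₀ (norm_nonneg _) (mem_ball_zero_iff.1 hz).le
  rw [setIntegral_unitDisk_eq hi', integral_prod _ (integrable_rectMeasure_of_integrableOn hi')]
  have h3 : ∀ r ∈ Ioo (0 : ℝ) 1, ∫ θ, r • ((circleMap 0 r θ) ^ m * conj (κ (circleMap 0 r θ)))
      ∂angleMeasure = ((r ^ (2 * m + 1) : ℝ) : ℂ) * (2 * Real.pi * conj b) := fun r hr => by
    have hr0 : (r : ℂ) ≠ 0 := by exact_mod_cast hr.1.ne'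
    have hpi : (Real.pi : ℂ) ≠ 0 := by exact_mod_cast Real.pi_ne_zero
    have h4 := congrArg conj (hbr r hr)
    rw [fourierAngle_eq_integral, map_mul, ← integral_conj, map_mul, map_pow, conj_ofReal,
      map_inv₀, map_mul, conj_ofReal, map_ofNat, inv_mul_eq_iff_eq_mul₀ (by simp [hpi])] at h4
    have h5 : ∀ θ : ℝ, r • ((circleMap 0 r θ) ^ m * conj (κ (circleMap 0 r θ))) =
        (r : ℂ) ^ (m + 1) * conj (exp (-(I * (m : ℤ) * θ)) * κ (circleMap 0 r θ)) := fun θ => by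
      rw [map_mul, ← exp_conj, circleMap_eq_mul, circlePt_eq_exp, mul_pow, ← Complex.exp_nat_mul,
        Complex.real_smul, pow_succ]
      have : conj (-(I * (m : ℤ) * θ)) = m * (I * θ) := by simp; ring
      rw [this]; ring
    simp only [h5]
    rw [integral_const_mul, h4]
    push_cast
    ring
  rw [setIntegral_congr_fun measurableSet_Ioo h3, integral_mul_const, integral_complex_ofReal,
    ← integral_Ioc_eq_integral_Ioo, ← intervalIntegral.integral_of_le zero_le_one, integral_pow]
  have : (m : ℂ) + 1 ≠ 0 := by exact_mod_cast Nat.succ_ne_zero m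
  push_cast
  rw [one_pow, zero_pow (by omega), sub_zero, show 2 * (m : ℂ) + 1 + 1 = 2 * (m + 1) by ring]
  field_simp

theorem ae_eq_zero_of_integral_pow_eq_zero {κ : ℂ → ℂ} (hκ : DifferentiableOn ℂ κ unitDisk)
    (hi : IntegrableOn κ unitDisk) (h : ∀ m : ℕ, ∫ z in unitDisk, z ^ m * conj (κ z) = 0) :
    ∀ᵐ z ∂volume.restrict unitDisk, κ z = 0 := by
  have hpi : (Real.pi : ℂ) ≠ 0 := by exact_mod_cast Real.pi_ne_zero
  have hcoef : ∀ r ∈ Ioo (0 : ℝ) 1, ∀ n : ℤ,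
      fourierAngle (fun θ => κ (circleMap 0 r θ)) n = 0 := fun r hr n => by
    rcases lt_or_ge n 0 with hn | hn
    · exact fourierAngle_circle_of_neg hκ hr hn
    · obtain ⟨m, rfl⟩ := Int.eq_ofNat_of_zero_le hn
      obtain ⟨b, hb, hJ⟩ := integral_pow_mul_conj hκ hi m
      rw [h m] at hJ
      have hm : (m : ℂ) + 1 ≠ 0 := by exact_mod_cast Nat.succ_ne_zero m
      have hb0 : b = 0 := by
        simpa using (mul_eq_zero.1 hJ.symm).resolve_left (div_ne_zero hpi hm)
      rw [hb r hr, hb0, zero_mul]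
  have hcirc : ∀ r ∈ Ioo (0 : ℝ) 1, ∫ θ, r • ‖κ (circleMap 0 r θ)‖ ∂angleMeasure = 0 := by
    intro r hr
    have hc : Continuous fun θ => κ (circleMap 0 r θ) :=
      hκ.continuousOn.comp_continuous (continuous_circleMap 0 r) fun θ => circleMap_mem_unitDisk hr θ
    obtain ⟨M, hM⟩ := (isCompact_Icc (a := (0 : ℝ)) (b := 2 * Real.pi)).exists_bound_of_continuousOn
      hc.continuousOn
    have hmem : MemLp (fun θ => κ (circleMap 0 r θ)) 2 angleMeasure := by
      refine MemLp.of_bound hc.aestronglyMeasurable M ?_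
      filter_upwards [ae_restrict_mem measurableSet_Ioc] with θ hθ
        using hM θ (Ioc_subset_Icc_self hθ)
    have h1 := integral_sq_eq_zero_of_fourierAngle_eq_zero hmem (hcoef r hr)
    rw [integral_eq_zero_iff_of_nonneg (fun θ => by positivity) (integrable_sq_norm hmem)] at h1
    refine integral_eq_zero_of_ae ?_
    filter_upwards [h1] with θ hθ
    have : ‖κ (circleMap 0 r θ)‖ = 0 := by simpa using hθ
    rw [this, smul_zero]; rfl
  have h2 : ∫ z in unitDisk, ‖κ z‖ = 0 := by
    rw [setIntegral_unitDisk_eq hi.norm,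
      integral_prod _ (integrable_rectMeasure_of_integrableOn hi.norm),
      setIntegral_congr_fun measurableSet_Ioo hcirc, integral_zero]
  rw [integral_eq_zero_iff_of_nonneg (fun z => norm_nonneg _) hi.norm] at h2
  filter_upwards [h2] with z hz
  simpa using hz

/-- Compactly supported test functions show that the difference is harmonic, so it is the real part
of a holomorphic `F`. The derivatives are only known to be integrable on the disk, so the difference
itself is not used as a test function; polynomial harmonic functions are used to annihilate the
Taylor coefficients of `F'` one by one. -/
theorem IsNeumannPotential.ae_eq_add_const {g : ℂ → ℂ} {Φ Φ' : ℂ → ℝ}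
    (h : IsNeumannPotential g Φ) (h' : IsNeumannPotential g Φ') :
    ∃ C, ∀ᵐ z ∂volume.restrict unitDisk, Φ z = Φ' z + C := by
  obtain ⟨D, hw, -, hD, -, hp⟩ := h
  obtain ⟨D', hw', -, hD', -, hp'⟩ := h'
  have hB : ∀ φ : ℂ → ℝ, ContDiff ℝ ∞ φ →
      ∫ z in unitDisk, covectorInner (D z - D' z) (fderiv ℝ φ z) = 0 := fun φ hφ => by
    have h1 := (hp φ hφ).unique (hp' φ hφ)
    have e : ∀ z, covectorInner (D z - D' z) (fderiv ℝ φ z) =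
        covectorInner (D z) (fderiv ℝ φ z) - covectorInner (D' z) (fderiv ℝ φ z) := fun z => by
      simp only [covectorInner, _root_.sub_apply]; ring
    simp only [e]
    rw [integral_sub (integrableOn_covectorInner hD hφ) (integrableOn_covectorInner hD' hφ)]
    linarith
  have hws := hw.sub hw'
  obtain ⟨p, hpharm, -, -, hpD⟩ := hws.exists_harmonic isOpen_unitDisk fun φ hφ _ hφs => by
    rw [← setIntegral_eq_integral_of_forall_compl_eq_zero (s := unitDisk), hB φ hφ]
    intro z hz
    rw [image_eq_zero_of_notMem_tsupport fun h1 => hz (hφs (tsupport_fderiv_subset ℝ h1))]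
    simp [covectorInner]
  obtain ⟨F, hF, hFp⟩ := hpharm.exists_analyticOnNhd_ball_re_eq
  have hFd : DifferentiableOn ℂ F unitDisk := hF.differentiableOn
  have hκ : DifferentiableOn ℂ (deriv F) unitDisk := hFd.deriv isOpen_unitDisk
  have hBκ : ∀ᵐ z ∂volume.restrict unitDisk, D z - D' z = reForm (deriv F z) := by
    filter_upwards [hpD, ae_restrict_mem isOpen_unitDisk.measurableSet] with z hz hzD
    rw [hz]
    refine (((hFd.differentiableAt (isOpen_unitDisk.mem_nhds hzD)).hasDerivAt.re_hasFDerivAt)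
      |>.congr_of_eventuallyEq ?_).fderiv
    filter_upwards [isOpen_unitDisk.mem_nhds hzD] with w hw using (hFp hw).symm
  have hBi : IntegrableOn (fun z => D z - D' z) unitDisk := hD.sub hD'
  have hκi : IntegrableOn (deriv F) unitDisk := by
    have h1 := ((ofRealCLM.comp (ContinuousLinearMap.apply ℝ ℝ (1 : ℂ))).integrable_comp hBi).sub
      (((ofRealCLM.comp (ContinuousLinearMap.apply ℝ ℝ I)).integrable_comp hBi).const_mul I)
    refine h1.congr ?_
    filter_upwards [hBκ] with z hz
    simp only [Pi.sub_apply, ContinuousLinearMap.comp_apply, ContinuousLinearMap.apply_apply, hz]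
    apply Complex.ext <;> simp
  have hzero := ae_eq_zero_of_integral_pow_eq_zero hκ hκi fun m => by
    set J := ∫ z in unitDisk, z ^ m * conj (deriv F z) with hJ
    have hi' : IntegrableOn (fun z => z ^ m * conj (deriv F z)) unitDisk := by
      refine Integrable.bdd_mul (c := 1) ((conjCLE : ℂ →L[ℝ] ℂ).integrable_comp hκi)
        (continuous_pow m).aestronglyMeasurable ?_
      filter_upwards [ae_restrict_mem isOpen_unitDisk.measurableSet] with z hz
      rw [norm_pow]
      exact pow_le_one₀ (norm_nonneg _) (mem_ball_zero_iff.1 hz).le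
    -- The factor `conj J` makes the pairing equal to `(m + 1) |J|²`, so its vanishing gives `J = 0`
    -- and not merely the vanishing of a real part.
    have hsm : ContDiff ℝ ∞ fun z : ℂ => (conj J * z ^ (m + 1)).re :=
      reCLM.contDiff.comp (contDiff_const.mul (contDiff_id.pow _))
    have h1 := hB _ hsm
    have h2 : ∫ z in unitDisk, covectorInner (D z - D' z)
        (fderiv ℝ (fun z : ℂ => (conj J * z ^ (m + 1)).re) z) =
        ∫ z in unitDisk, (((m + 1) * conj J) * (z ^ m * conj (deriv F z))).re := by
      refine integral_congr_ae ?_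
      filter_upwards [hBκ] with z hz
      have h3 : HasDerivAt (fun z : ℂ => conj J * z ^ (m + 1)) (conj J * ((m + 1) * z ^ m)) z := by
        have := (hasDerivAt_pow (m + 1) z).const_mul (conj J)
        simpa using this
      rw [hz, h3.re_hasFDerivAt.fderiv, covectorInner_reForm_reForm]
      congr 1; ring
    have h4 := integral_re (𝕜 := ℂ) (hi'.const_mul ((m + 1) * conj J))
    rw [h2] at h1
    erw [h1, integral_const_mul, ← hJ] at h4
    have h5 : ((m : ℂ) + 1) * conj J * J = (((m + 1 : ℝ) * ‖J‖ ^ 2 : ℝ) : ℂ) := by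
      rw [mul_assoc, Complex.conj_mul']; push_cast; ring
    rw [h5] at h4
    have h6 : (m + 1 : ℝ) * ‖J‖ ^ 2 = 0 := (Complex.ofReal_re _).symm.trans h4.symm
    have h7 : (m + 1 : ℝ) ≠ 0 := by positivity
    simpa using (mul_eq_zero.1 h6).resolve_left h7
  have hw0 : HasWeakDeriv unitDisk (fun z => Φ z - Φ' z) 0 := hws.congr EventuallyEq.rfl (by
    filter_upwards [hBκ, hzero] with z h1 h2
    rw [h1, h2]; ext e; simp)
  obtain ⟨C, hC⟩ := hw0.ae_const isOpen_unitDisk (convex_ball (0 : ℂ) 1).isPreconnected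
  refine ⟨C, ?_⟩
  filter_upwards [hC] with z hz
  linarith

end neumannUnique

/-! ### Uniqueness of the canonical harmonic map. -/

section canonicalUnique

variable {f : ℂ → ℂ} {Ω : Set ℂ}

/-- Differentiable maps of the plane send null sets to null sets. -/
theorem IsUniformization.ae_comp_discInv (hf : IsUniformization f Ω) {P : ℂ → Prop}
    (h : ∀ᵐ z ∂volume.restrict unitDisk, P z) :
    ∀ᵐ p ∂volume.restrict Ω, P (discInv f p) := by
  rw [ae_restrict_iff' isOpen_unitDisk.measurableSet, ae_iff] at h
  rw [ae_restrict_iff' hf.isOpen.measurableSet, ae_iff]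
  have hd : DifferentiableOn ℝ f {z | ¬(z ∈ unitDisk → P z)} := fun z hz =>
    ((hf.differentiableAt (Classical.not_imp.1 hz).1).restrictScalars ℝ).differentiableWithinAt
  refine measure_mono_null (fun p hp => ?_)
    (addHaar_image_eq_zero_of_differentiableOn_of_addHaar_eq_zero volume hd h)
  have hp' := Classical.not_imp.1 hp
  exact ⟨discInv f p, Classical.not_imp.2 ⟨hf.discInv_mem hp'.1, hp'.2⟩, hf.apply_discInv hp'.1⟩

theorem IsUniformization.ae_comp (hf : IsUniformization f Ω) {P : ℂ → Prop}
    (h : ∀ᵐ p ∂volume.restrict Ω, P p) : ∀ᵐ z ∂volume.restrict unitDisk, P (f z) := by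
  rw [ae_restrict_iff' hf.isOpen.measurableSet, ae_iff] at h
  rw [ae_restrict_iff' isOpen_unitDisk.measurableSet, ae_iff]
  have hd : DifferentiableOn ℝ (discInv f) {p | ¬(p ∈ Ω → P p)} := fun p hp =>
    ((hf.hasDerivAt_discInv (Classical.not_imp.1 hp).1).differentiableAt.restrictScalars
      ℝ).differentiableWithinAt
  refine measure_mono_null (fun z hz => ?_)
    (addHaar_image_eq_zero_of_differentiableOn_of_addHaar_eq_zero volume hd h)
  have hz' := Classical.not_imp.1 hz
  exact ⟨f z, Classical.not_imp.2 ⟨hf.2.mapsTo hz'.1, hz'.2⟩, hf.discInv_apply hz'.1⟩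

/-- Up to a constant rotation the field is the direction of `z f'(z)`; in this form the choice of
the logarithm disappears. -/
theorem phaseMap_eq (ψ : ℂ → ℂ) (c : ℝ) (z : ℂ) :
    phaseMap ψ c z = exp (I * (c : ℂ)) * (z * exp (ψ z) / ‖z * exp (ψ z)‖) := by
  rw [phaseMap, ofReal_add, mul_add, Complex.exp_add, ← exp_div_norm_exp, norm_mul]
  push_cast
  rw [mul_div_mul_comm]
  ring

namespace IsLogDeriv

variable {ψ f₁ ψ₁ u g : ℂ → ℂ} {a : ℂ} {c : ℝ}

/-- The two uniformizations are related by `f₁(z) = f(sz)` with `|s| = 1`, and then `z f₁'(z) = sz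
f'(sz)`. -/
theorem eqOn_phase_of_apply_zero_eq (H : IsLogDeriv f ψ Ω) (H₁ : IsLogDeriv f₁ ψ₁ Ω)
    (h0 : f 0 = f₁ 0) : EqOn (phaseMap ψ c ∘ discInv f) (phaseMap ψ₁ c ∘ discInv f₁) Ω := by
  obtain ⟨s, hs, hrot⟩ := H.unif.exists_rotation H₁.unif h0
  intro p hp
  have hz := H₁.unif.discInv_mem hp
  set z := discInv f₁ p with hzdef
  have hsz : s * z ∈ unitDisk := by
    rw [mem_ball_zero_iff, norm_mul, hs, one_mul]; exact mem_ball_zero_iff.1 hz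
  have e1 : discInv f p = s * z := by
    rw [← H₁.unif.apply_discInv hp, ← hzdef, hrot z hz, H.unif.discInv_apply hsz]
  have e2 : deriv f₁ z = s * deriv f (s * z) := by
    have h1 : f₁ =ᶠ[𝓝 z] fun w => f (s * w) := by
      filter_upwards [isOpen_unitDisk.mem_nhds hz] with w hw using hrot w hw
    have h2 : HasDerivAt (fun w : ℂ => s * w) s z := by simpa using (hasDerivAt_id z).const_mul s
    have h3 : HasDerivAt (fun w => f (s * w)) (deriv f (s * z) * s) z :=
      (H.unif.differentiableAt hsz).hasDerivAt.comp z h2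
    rw [h1.deriv_eq, h3.deriv, mul_comm]
  rw [Function.comp_apply, Function.comp_apply, ← hzdef, e1, phaseMap_eq, phaseMap_eq,
    H.exp_eq _ hsz, H₁.exp_eq _ hz, e2]
  congr 2
  · ring
  · congr 2; ring

/-- A competitor may realize its potential and its trace through different uniformizations, so the
boundary formula for `g` is assumed for all of them; the field `u` has the same form in each. Equal
potentials up to a constant give equal Cartan forms, these give `w = k u`, and the trace gives `k =
1`. -/
theorem isCanonicalHarmonicMap (H : IsLogDeriv f ψ Ω) (hfa : f 0 = a)
    (hu : EqOn u (phaseMap ψ c ∘ discInv f) Ω)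
    (hg : ∀ f ψ, IsLogDeriv f ψ Ω → ∀ᵐ θ ∂angleMeasure, g (boundaryMap f (circlePt θ)) =
      circlePt θ * exp (I * (((radialLimit ψ (circlePt θ)).im + c : ℝ) : ℂ))) :
    IsCanonicalHarmonicMap Ω g a u := by
  have key : ∀ f₁, IsUniformization f₁ Ω → f₁ 0 = a →
      ∃ ψ₁, IsLogDeriv f₁ ψ₁ Ω ∧ EqOn u (phaseMap ψ₁ c ∘ discInv f₁) Ω := fun f₁ h1 h2 => by
    obtain ⟨ψ₁, H₁⟩ := exists_isLogDeriv h1 (HasFiniteEnergy.of_isUniformization H.energy H.unif h1)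
    exact ⟨ψ₁, H₁, hu.trans (H.eqOn_phase_of_apply_zero_eq H₁ (hfa.trans h2.symm))⟩
  refine ⟨H.hasCanonicalProperties hfa hu (hg f ψ H), fun w hw => ?_⟩
  have hO := H.unif.isOpen_diff a
  obtain ⟨Dw, ⟨hDw, -⟩, f₁, hf₁, hf₁a, Φ, hΦ, hΦw⟩ := hw.star_cartan
  obtain ⟨ψ₁, H₁, hu₁⟩ := key f₁ hf₁ hf₁a
  have hN := isNeumannPotential_logPotential H₁.hasDerivAt H₁.continuousOn_logDeriv
    H₁.integrableOn_sq c (H₁.memHHalfCircle_phase c) (g := g ∘ boundaryMap f₁) (hg f₁ ψ₁ H₁)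
  obtain ⟨C, hC⟩ := hΦ.ae_eq_add_const hN
  have hC' : ∀ᵐ p ∂volume.restrict (Ω \ {a}),
      (Φ ∘ discInv f₁) p = (logPotential ψ₁ ∘ discInv f₁) p + C :=
    ae_restrict_of_ae_restrict_of_subset sdiff_subset (hf₁.ae_comp_discInv hC)
  have hW := hasWeakDeriv_of_hasFDerivAt hO
    (fun p hp => (H₁.hasFDerivAt_logPotential hf₁a hp).add_const C)
    (continuous_reForm.comp_continuousOn (hf₁.differentiableOn_logSlope hf₁a).continuousOn)
  have hstar := (hΦw.congr hC' EventuallyEq.rfl).ae_unique hO hW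
  have hpair : pairForm Dw (fun z => -(I * w z)) =ᵐ[volume.restrict (Ω \ {a})]
      pairForm (fderiv ℝ u) (fun z => -(I * u z)) := by
    filter_upwards [hstar, ae_restrict_mem hO.measurableSet] with p hp hpΩ
    have h1 : hodgeStar (pairForm Dw (fun z => -(I * w z))) p =
        hodgeStar (pairForm (fderiv ℝ u) (fun z => -(I * u z))) p := by
      rw [hp]
      exact (pairForm_smulRight _ u (H₁.norm_frame hf₁a hu₁ hpΩ)
        (H₁.hasFDerivAt_frame hf₁a hu₁ hpΩ).fderiv).symm
    ext e
    -- Evaluation at `-ie` undoes the rotation of the argument in the star.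
    have h2 := DFunLike.congr_fun h1 (-(I * e))
    simp only [hodgeStar, _root_.neg_apply, ContinuousLinearMap.comp_apply,
      ContinuousLinearMap.mul_apply', neg_inj] at h2
    rwa [mul_neg, ← mul_assoc, I_mul_I, neg_one_mul, neg_neg] at h2
  obtain ⟨k, hk⟩ := ae_eq_const_mul_of_pairForm_eq hO (H.unif.isPreconnected_diff hfa)
    (H.contDiffOn_frame hfa hu) (fun p hp => H.norm_frame hfa hu hp) hDw hw.norm_eq_one hpair
  obtain ⟨f₂, hf₂, hf₂a, htr⟩ := hw.trace_eq
  obtain ⟨ψ₂, H₂, hu₂⟩ := key f₂ hf₂ hf₂a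
  have htu : HasCircleTrace (u ∘ f₂) (g ∘ boundaryMap f₂) :=
    hasCircleTrace_phaseMap H₂.hasDerivAt H₂.continuousOn_logDeriv H₂.integrableOn_sq c
      (fun z hz => by
        rw [Function.comp_apply, hu₂ (hf₂.2.mapsTo hz), Function.comp_apply,
          hf₂.discInv_apply hz]) (hg f₂ ψ₂ H₂)
  rw [Measure.restrict_congr_set (sdiff_null_ae_eq_self (measure_singleton a))] at hk
  have hk1 : k = 1 := eq_one_of_hasCircleTrace htu htr (hf₂.ae_comp hk) (by
    filter_upwards [hg f₂ ψ₂ H₂] with θ hθ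
    rw [Function.comp_apply, hθ, norm_mul, norm_circlePt, norm_exp_I_mul_ofReal', mul_one])
  refine ae_restrict_of_ae_restrict_of_subset sdiff_subset ?_
  filter_upwards [hk] with p hp
  rw [hp, hk1, one_mul]

end IsLogDeriv

end canonicalUnique

/-! ### The Dirichlet Green function. -/

section green

/-- An integrable function on the unit disk that dominates `1`, `1 / |z|` and `|log |z|| / |z|`. -/
noncomputable def logWeight (z : ℂ) : ℝ := ‖z‖⁻¹ + |‖z‖⁻¹ * Real.log ‖z‖|

theorem integrableOn_logWeight : IntegrableOn logWeight unitDisk :=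
  integrableOn_inv_norm.add integrableOn_inv_norm_mul_log.abs

theorem inv_norm_le_logWeight (z : ℂ) : ‖z‖⁻¹ ≤ logWeight z := le_add_of_nonneg_right (abs_nonneg _)

theorem inv_norm_mul_abs_log_add_le {z : ℂ} (x : ℝ) :
    ‖z‖⁻¹ * |Real.log ‖z‖ + x| ≤ (1 + |x|) * logWeight z := by
  have h0 : 0 ≤ ‖z‖⁻¹ := inv_nonneg.2 (norm_nonneg z)
  have h1 := mul_le_mul_of_nonneg_left (abs_add_le (Real.log ‖z‖) x) h0
  have h2 : 0 ≤ |x| * |‖z‖⁻¹ * Real.log ‖z‖| := by positivity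
  have h3 : |‖z‖⁻¹ * Real.log ‖z‖| = ‖z‖⁻¹ * |Real.log ‖z‖| := by rw [abs_mul, abs_of_nonneg h0]
  simp only [logWeight] at *
  nlinarith

namespace IsUniformization

variable {f : ℂ → ℂ} {Ω : Set ℂ} {a : ℂ}

/-- After the conformal change of variables the area density `|f'|²` appears, and near each point of
the disk the integrand is dominated by a multiple of the integrable weight. -/
theorem locallyIntegrableOn_of_le_logWeight {E : Type*} [NormedAddCommGroup E] [NormedSpace ℝ E]
    [SecondCountableTopology E] (hf : IsUniformization f Ω) (hfa : f 0 = a)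
    {F : ℂ → E} (hF : ContinuousOn F (Ω \ {a})) {M : ℂ → ℝ} (hM : ContinuousOn M unitDisk)
    (h : ∀ z ∈ unitDisk \ {0}, ‖deriv f z‖ ^ 2 * ‖F (f z)‖ ≤ M z * logWeight z) :
    LocallyIntegrableOn F Ω := by
  intro p hp
  obtain ⟨z, hz, rfl⟩ := hf.2.surjOn hp
  obtain ⟨ρ, hρ, hb⟩ := Metric.nhds_basis_closedBall.mem_iff.1 (isOpen_unitDisk.mem_nhds hz)
  have hb' : Metric.ball z ρ ⊆ unitDisk := Metric.ball_subset_closedBall.trans hb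
  refine ⟨f '' Metric.ball z ρ, mem_nhdsWithin_of_mem_nhds (hf.nhds_le_map hz
    (image_mem_map (Metric.ball_mem_nhds z hρ))), ?_⟩
  obtain ⟨C, hC⟩ := (isCompact_closedBall z ρ).exists_bound_of_continuousOn (hM.mono hb)
  refine (integrableOn_image_iff_of_conformal measurableSet_ball
    (fun w hw => (hf.differentiableAt (hb' hw)).hasDerivAt) (hf.2.injOn.mono hb') F).2 ?_
  have hmaps : MapsTo f (unitDisk \ {0}) (Ω \ {a}) := fun w hw =>
    ⟨hf.2.mapsTo hw.1, fun h => hw.2 (hf.2.injOn hw.1 zero_mem_unitDisk (h.trans hfa.symm))⟩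
  have hc : ContinuousOn (fun w => ‖deriv f w‖ ^ 2 • F (f w)) (unitDisk \ {0}) :=
    ((hf.differentiableOn_deriv.continuousOn.mono sdiff_subset).norm.pow 2).smul
      (hF.comp (hf.1.continuousOn.mono sdiff_subset) hmaps)
  refine Integrable.mono' ((integrableOn_logWeight.mono_set hb').const_mul C)
    ((aestronglyMeasurable_unitDisk_of_continuousOn hc).mono_measure
      (Measure.restrict_mono_set _ hb')) ?_
  filter_upwards [ae_restrict_mem measurableSet_ball,
    ae_restrict_of_ae (Measure.ae_ne volume (0 : ℂ))] with w hw hw0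
  rw [norm_smul, norm_pow, norm_norm]
  refine (h w ⟨hb' hw, hw0⟩).trans (mul_le_mul_of_nonneg_right
    ((le_abs_self _).trans (hC w (Metric.ball_subset_closedBall hw))) ?_)
  exact (inv_nonneg.2 (norm_nonneg w)).trans (inv_norm_le_logWeight w)

/-- The formula is classical off `a`, and the singularity there is logarithmic, so the puncture can
be filled. With `χ = 0` this is the Green function, with `χ = ψ` it is `μ + G`. -/
theorem hasWeakDeriv_logPotential_discInv (hf : IsUniformization f Ω) (hfa : f 0 = a) {χ N : ℂ → ℂ}
    (hd : ∀ z ∈ unitDisk, HasDerivAt χ (N z) z) (hN : ContinuousOn N unitDisk)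
    {D : ℂ → ℂ →L[ℝ] ℝ} (hD : ∀ p ∈ Ω \ {a}, D p =
      reForm (((discInv f p)⁻¹ + N (discInv f p)) * (deriv f (discInv f p))⁻¹)) :
    (∀ p ∈ Ω \ {a}, HasFDerivAt (logPotential χ ∘ discInv f) (D p) p) ∧
      HasWeakDeriv Ω (logPotential χ ∘ discInv f) D := by
  have hO := hf.isOpen_diff a
  have h1 : ∀ p ∈ Ω \ {a}, HasFDerivAt (logPotential χ ∘ discInv f) (D p) p := fun p hp => by
    refine ((hasFDerivAt_logPotential (hf.discInv_ne_zero hfa hp)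
      (hd _ (hf.discInv_mem hp.1))).comp p (hf.hasDerivAt_discInv hp.1).hasFDerivAt_mul)
      |>.congr_fderiv ?_
    rw [hD p hp]
    ext e
    simp only [ContinuousLinearMap.comp_apply, reForm_apply, ContinuousLinearMap.mul_apply',
      mul_assoc]
  have hm : MapsTo (discInv f) (Ω \ {a}) unitDisk := fun p hp => hf.discInv_mem hp.1
  have hcd : ContinuousOn (discInv f) (Ω \ {a}) :=
    (hf.differentiableOn_discInv.mono sdiff_subset).continuousOn
  have hcD : ContinuousOn D (Ω \ {a}) := by
    refine ContinuousOn.congr (continuous_reForm.comp_continuousOn ?_) hD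
    exact ((hcd.inv₀ fun p hp => hf.discInv_ne_zero hfa hp).add (hN.comp hcd hm)).mul
      ((hf.differentiableOn_deriv.continuousOn.comp hcd hm).inv₀ fun p hp =>
        hf.deriv_ne_zero (hm hp))
  have hcF : ContinuousOn (logPotential χ ∘ discInv f) (Ω \ {a}) := fun p hp =>
    (h1 p hp).continuousAt.continuousWithinAt
  have hcχ : ContinuousOn χ unitDisk := fun z hz => (hd z hz).continuousAt.continuousWithinAt
  have hcf := hf.differentiableOn_deriv.continuousOn.norm
  have hcb : ContinuousOn (fun z => 1 + |(χ z).re|) unitDisk :=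
    continuousOn_const.add (continuous_re.comp_continuousOn hcχ).abs
  have hone : ∀ z ∈ unitDisk \ {(0 : ℂ)}, 1 ≤ ‖z‖⁻¹ := fun z hz =>
    (one_le_inv₀ (norm_pos_iff.2 hz.2)).2 (mem_ball_zero_iff.1 hz.1).le
  have hval : ∀ z ∈ unitDisk, (logPotential χ ∘ discInv f) (f z) = Real.log ‖z‖ + (χ z).re :=
    fun z hz => by rw [Function.comp_apply, hf.discInv_apply hz, logPotential]
  refine ⟨h1, (hasWeakDeriv_of_hasFDerivAt hO h1 hcD).of_punctured
    (hf.locallyIntegrableOn_of_le_logWeight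
      (M := fun z => ‖deriv f z‖ ^ 2 * (1 + |(χ z).re|)) hfa hcF ((hcf.pow 2).mul hcb)
      fun z hz => ?_)
    (hf.locallyIntegrableOn_of_le_logWeight
      (M := fun z => ‖deriv f z‖ * (1 + ‖N z‖)) hfa hcD
      (hcf.mul (continuousOn_const.add hN.norm : ContinuousOn (fun z => 1 + ‖N z‖) _))
      fun z hz => ?_) ?_⟩
  · rw [hval z hz.1, mul_assoc, Real.norm_eq_abs]
    refine mul_le_mul_of_nonneg_left (le_trans ?_ (inv_norm_mul_abs_log_add_le _)) (by positivity)
    exact le_mul_of_one_le_left (abs_nonneg _) (hone z hz)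
  · have hne : 0 < ‖deriv f z‖ := norm_pos_iff.2 (hf.deriv_ne_zero hz.1)
    have hp : f z ∈ Ω \ {a} :=
      ⟨hf.2.mapsTo hz.1, fun h => hz.2 (hf.2.injOn hz.1 zero_mem_unitDisk (h.trans hfa.symm))⟩
    rw [hD _ hp, hf.discInv_apply hz.1]
    have h2 := norm_reForm_le ((z⁻¹ + N z) * (deriv f z)⁻¹)
    rw [norm_mul, norm_inv] at h2
    have h3 : ‖z⁻¹ + N z‖ ≤ (1 + ‖N z‖) * logWeight z := by
      refine (norm_add_le _ _).trans ?_
      rw [norm_inv]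
      have := inv_norm_le_logWeight z
      nlinarith [norm_nonneg (N z), hone z hz]
    calc _ ≤ ‖deriv f z‖ ^ 2 * (‖z⁻¹ + N z‖ * ‖deriv f z‖⁻¹) := by gcongr
      _ = ‖deriv f z‖ * ‖z⁻¹ + N z‖ := by field_simp
      _ ≤ _ := by rw [mul_assoc]; gcongr
  · set k := dslope f 0 with hk
    have hkc : ContinuousOn k unitDisk :=
      ((Complex.differentiableOn_dslope (isOpen_unitDisk.mem_nhds zero_mem_unitDisk)).2
        hf.1).continuousOn
    have hfk : ∀ z, f z - a = z * k z := fun z => by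
      have := sub_smul_dslope f 0 z
      rw [sub_zero, hfa, smul_eq_mul] at this
      exact this.symm
    have hk0 : ∀ z ∈ unitDisk, k z ≠ 0 := fun z hz => by
      rcases eq_or_ne z 0 with rfl | h0
      · rw [hk, dslope_same]; exact hf.deriv_ne_zero hz
      · intro h
        have h2 := hfk z
        rw [h, mul_zero, sub_eq_zero] at h2
        exact h0 (hf.2.injOn hz zero_mem_unitDisk (h2.trans hfa.symm))
    have hcs : ContinuousOn (fun z => ‖z - a‖⁻¹) (Ω \ {a}) :=
      (continuousOn_id.sub continuousOn_const).norm.inv₀ fun p hp =>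
        norm_ne_zero_iff.2 (sub_ne_zero.2 hp.2)
    refine hf.locallyIntegrableOn_of_le_logWeight
      (M := fun z => ‖deriv f z‖ ^ 2 * ‖k z‖⁻¹ * (1 + |(χ z).re|)) hfa (hcs.smul hcF)
      (((hcf.pow 2).mul (hkc.norm.inv₀ fun z hz => norm_ne_zero_iff.2 (hk0 z hz))).mul hcb)
      fun z hz => ?_
    · rw [hval z hz.1, hfk, norm_smul, norm_inv, norm_norm, norm_mul, mul_inv, Real.norm_eq_abs]
      calc _ = ‖deriv f z‖ ^ 2 * ‖k z‖⁻¹ * (‖z‖⁻¹ * |Real.log ‖z‖ + (χ z).re|) := by ring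
        _ ≤ _ := by
          rw [mul_assoc _ (1 + _)]
          exact mul_le_mul_of_nonneg_left (inv_norm_mul_abs_log_add_le _) (by positivity)

/-- The Dirichlet pairing is conformally invariant, so it can be computed on the disk for `log |z|`
and `φ ∘ f`. The latter vanishes near the circle, and only the value at the origin remains. -/
theorem laplacian_log_norm_discInv (hf : IsUniformization f Ω) (hfa : f 0 = a) {φ : ℂ → ℝ}
    (hφ : ContDiff ℝ ∞ φ) (hφc : HasCompactSupport φ) (hφs : tsupport φ ⊆ Ω)
    {D : ℂ → ℂ →L[ℝ] ℝ}
    (hD : ∀ p ∈ Ω \ {a}, D p = reForm ((discInv f p)⁻¹ * (deriv f (discInv f p))⁻¹)) :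
    ∫ p, covectorInner (D p) (fderiv ℝ φ p) = -(2 * Real.pi * φ a) := by
  -- Extension by zero is smooth because the preimage of the support of `φ` is a compact subset of
  -- the open disk.
  set χ : ℂ → ℝ := unitDisk.indicator (φ ∘ f) with hχ
  have hχD : ∀ z ∈ unitDisk, χ z = φ (f z) := fun z hz => indicator_of_mem hz _
  have hK : IsCompact (discInv f '' tsupport φ) :=
    hφc.isCompact.image_of_continuousOn (hf.differentiableOn_discInv.continuousOn.mono hφs)
  have hχ0 : ∀ z ∉ discInv f '' tsupport φ, χ z = 0 := fun z hz => by
    by_cases h : z ∈ unitDisk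
    · rw [hχD z h]
      by_contra hne
      exact hz ⟨f z, subset_tsupport _ hne, hf.discInv_apply h⟩
    · exact indicator_of_notMem h _
  have hev : ∀ z ∈ unitDisk, χ =ᶠ[𝓝 z] φ ∘ f := fun z hz => by
    filter_upwards [isOpen_unitDisk.mem_nhds hz] with w hw using hχD w hw
  have hχs : ContDiff ℝ ∞ χ := by
    refine contDiff_iff_contDiffAt.2 fun z => ?_
    by_cases h : z ∈ unitDisk
    · exact (hφ.contDiffAt.comp z ((hf.analyticOnNhd z h).contDiffAt.restrict_scalars
        ℝ)).congr_of_eventuallyEq (hev z h)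
    · refine (contDiffAt_const (c := (0 : ℝ))).congr_of_eventuallyEq ?_
      have hz : z ∉ discInv f '' tsupport φ := by
        rintro ⟨p, hp, rfl⟩
        exact h (hf.discInv_mem (hφs hp))
      filter_upwards [hK.isClosed.isOpen_compl.mem_nhds hz] with w hw using hχ0 w hw
  have h1 : ∫ p, covectorInner (D p) (fderiv ℝ φ p) =
      ∫ p in f '' unitDisk, covectorInner (D p) (fderiv ℝ φ p) := by
    rw [hf.2.image_eq]
    refine (setIntegral_eq_integral_of_forall_compl_eq_zero fun p hp => ?_).symm
    rw [image_eq_zero_of_notMem_tsupport fun h1 => hp (hφs (tsupport_fderiv_subset ℝ h1))]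
    simp [covectorInner]
  rw [h1, integral_image_of_conformal isOpen_unitDisk.measurableSet
    (fun w hw => (hf.differentiableAt hw).hasDerivAt) hf.2.injOn]
  have h2 : ∫ z in unitDisk, ‖deriv f z‖ ^ 2 • covectorInner (D (f z)) (fderiv ℝ φ (f z)) =
      ∫ z in unitDisk, covectorInner (reForm z⁻¹) (fderiv ℝ χ z) := by
    refine integral_congr_ae ?_
    filter_upwards [ae_restrict_mem isOpen_unitDisk.measurableSet,
      ae_restrict_of_ae (Measure.ae_ne volume (0 : ℂ))] with z hz hz0
    have hp : f z ∈ Ω \ {a} :=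
      ⟨hf.2.mapsTo hz, fun h => hz0 (hf.2.injOn hz zero_mem_unitDisk (h.trans hfa.symm))⟩
    have h3 : fderiv ℝ χ z = (fderiv ℝ φ (f z)).comp (ContinuousLinearMap.mul ℝ ℂ (deriv f z)) := by
      rw [(hev z hz).fderiv_eq (𝕜 := ℝ)]
      exact ((hφ.differentiable (by simp) _).hasFDerivAt.comp z
        (hf.differentiableAt hz).hasDerivAt.hasFDerivAt_mul).fderiv
    have hne : deriv f z ≠ 0 := hf.deriv_ne_zero hz
    have hcne : conj (deriv f z) ≠ 0 := (map_ne_zero _).2 hne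
    rw [hD _ hp, hf.discInv_apply hz, covectorInner_reForm, covectorInner_reForm, h3,
      ← map_smul, ContinuousLinearMap.comp_apply, ContinuousLinearMap.mul_apply']
    congr 1
    rw [Complex.real_smul, ofReal_pow, ← Complex.mul_conj', map_mul, map_inv₀ _ (deriv f z)]
    field_simp
  have h3 : ∀ θ, χ (circlePt θ) = 0 := fun θ => indicator_of_notMem (fun h => by
    have := mem_ball_zero_iff.1 h
    rw [norm_circlePt] at this
    exact lt_irrefl _ this) _
  rw [h2, (integral_covectorInner_inv hχs).2, hχD 0 zero_mem_unitDisk, hfa]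
  simp [h3]

/-- The image of a smaller closed disk is a compact subset of `Ω`, so points approaching `p ∉ Ω`
eventually leave it. -/
theorem tendsto_norm_discInv (hf : IsUniformization f Ω) {p : ℂ} (hp : p ∉ Ω) :
    Tendsto (fun q => ‖discInv f q‖) (𝓝[Ω] p) (𝓝 1) := by
  refine tendsto_order.2 ⟨fun ρ hρ => ?_, fun ρ hρ => ?_⟩
  · have hsub : Metric.closedBall (0 : ℂ) ρ ⊆ unitDisk := Metric.closedBall_subset_ball hρ
    have hK : IsCompact (f '' Metric.closedBall 0 ρ) :=
      (isCompact_closedBall _ _).image_of_continuousOn (hf.1.continuousOn.mono hsub)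
    have hpK : p ∉ f '' Metric.closedBall 0 ρ := by
      rintro ⟨z, hz, rfl⟩
      exact hp (hf.2.mapsTo (hsub hz))
    filter_upwards [self_mem_nhdsWithin,
      mem_nhdsWithin_of_mem_nhds (hK.isClosed.isOpen_compl.mem_nhds hpK)] with q hq hqK
    by_contra hle
    exact hqK ⟨discInv f q, mem_closedBall_zero_iff.2 (not_lt.1 hle), hf.apply_discInv hq⟩
  · filter_upwards [self_mem_nhdsWithin] with q hq
    exact (mem_ball_zero_iff.1 (hf.discInv_mem hq)).trans hρ

theorem isDirichletGreenFunction (hf : IsUniformization f Ω) (hfa : f 0 = a) :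
    IsDirichletGreenFunction Ω a (fun p => Real.log ‖discInv f p‖) := by
  have e : (fun p => Real.log ‖discInv f p‖) = logPotential 0 ∘ discInv f := by
    funext p; simp [logPotential]
  obtain ⟨h1, h2⟩ := hf.hasWeakDeriv_logPotential_discInv hfa (χ := 0) (N := 0)
    (fun z _ => hasDerivAt_const z 0) continuousOn_const (fun _ _ => rfl)
  rw [e]
  refine ⟨fun p hp => (h1 p hp).continuousAt.continuousWithinAt, h2.1, fun φ hφ hφc hφs => ?_,
    fun p hp => ?_⟩
  · rw [setIntegral_eq_integral_of_forall_compl_eq_zero, h2.integral_mul_laplacian hφ hφc hφs,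
      hf.laplacian_log_norm_discInv hfa hφ hφc hφs fun p hp => by simp, neg_neg]
    intro p hp
    rw [image_eq_zero_of_notMem_tsupport fun h => hp (hφs (tsupport_laplacian_subset φ h)), mul_zero]
  · rw [← e]
    have hpΩ : p ∉ Ω := fun h => by
      rw [frontier, hf.isOpen.interior_eq] at hp
      exact hp.2 h
    have h3 := (Real.continuousAt_log one_ne_zero).tendsto.comp (hf.tendsto_norm_discInv hpΩ)
    rwa [Real.log_one] at h3

end IsUniformization

/-- A positive value would make the maximum attained, because positive superlevel sets are closed in
the plane and bounded. The set where it is attained would then be open and closed in the whole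
plane, yet nonempty and bounded. Connectedness of `Ω` plays no role. -/
theorem HarmonicOnNhd.le_zero_of_tendsto_frontier {Ω : Set ℂ} (hΩ : IsOpen Ω)
    (hb : Bornology.IsBounded Ω) {p : ℂ → ℝ} (hp : InnerProductSpace.HarmonicOnNhd p Ω)
    (hpc : ContinuousOn p Ω) (h : ∀ x ∈ frontier Ω, Tendsto p (𝓝[Ω] x) (𝓝 0)) {y : ℂ}
    (hy : y ∈ Ω) : p y ≤ 0 := by
  by_contra hpos
  push Not at hpos
  have hclosed : ∀ c > 0, IsClosed {x ∈ Ω | c ≤ p x} := fun c hc => by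
    refine isClosed_of_closure_subset fun x hx => ?_
    have hfr : ∃ᶠ y in 𝓝[Ω] x, c ≤ p y := by
      rw [mem_closure_iff_frequently] at hx
      rw [frequently_nhdsWithin_iff]
      exact hx.mono fun y hy => ⟨hy.2, hy.1⟩
    have hxc : x ∈ closure Ω := closure_mono (sep_subset _ _) hx
    by_cases hxΩ : x ∈ Ω
    · exact ⟨hxΩ, ge_of_tendsto_of_frequently (hpc x hxΩ) hfr⟩
    · have h1 := h x ⟨hxc, by rwa [hΩ.interior_eq]⟩
      exact absurd (ge_of_tendsto_of_frequently h1 hfr) (not_le.2 hc)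
  have hK : IsCompact {x ∈ Ω | p y ≤ p x} :=
    Metric.isCompact_of_isClosed_isBounded (hclosed _ hpos) (hb.subset (sep_subset _ _))
  obtain ⟨x, hx, hmax⟩ := hK.exists_isMaxOn ⟨y, hy, le_rfl⟩ (hpc.mono (sep_subset _ _))
  have hle : ∀ z ∈ Ω, p z ≤ p x := fun z hz => by
    rcases le_total (p y) (p z) with h1 | h1
    · exact hmax ⟨hz, h1⟩
    · exact h1.trans hx.2
  -- Locally `p = Re F` with `F` holomorphic; the maximum modulus principle for `exp F` makes `p`
  -- constant near a maximum.
  have hopen : IsOpen {z ∈ Ω | p x ≤ p z} := by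
    refine isOpen_iff_mem_nhds.2 fun z hz => ?_
    obtain ⟨ρ, hρ, hbρ⟩ := Metric.isOpen_iff.1 hΩ z hz.1
    obtain ⟨F, hF, hFp⟩ := (hp.mono hbρ).exists_analyticOnNhd_ball_re_eq
    have hball := Metric.ball_mem_nhds z hρ
    have hnorm : ∀ w ∈ Metric.ball z ρ, ‖exp (F w)‖ = Real.exp (p w) := fun w hw => by
      rw [norm_exp]; exact congrArg _ (hFp hw)
    have hconst := Complex.norm_eventually_eq_of_isLocalMax (f := fun w => exp (F w)) (c := z) (by
        filter_upwards [hball] with w hw using (hF w hw).differentiableAt.cexp) (by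
        filter_upwards [hball] with w hw
        simp only [Function.comp_apply]
        rw [hnorm w hw, hnorm z (Metric.mem_ball_self hρ)]
        exact Real.exp_le_exp.2 ((hle w (hbρ hw)).trans hz.2))
    filter_upwards [hconst, hball] with w hw hwb
    rw [hnorm w hwb, hnorm z (Metric.mem_ball_self hρ), Real.exp_eq_exp] at hw
    exact ⟨hbρ hwb, hw ▸ hz.2⟩
  have huniv := IsClopen.eq_univ (⟨hclosed _ (hpos.trans_le hx.2), hopen⟩ :
    IsClopen {z ∈ Ω | p x ≤ p z}) ⟨x, hx.1, le_rfl⟩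
  have hbu : Bornology.IsBounded (univ : Set ℂ) := huniv ▸ hb.subset (sep_subset _ _)
  exact NormedSpace.unbounded_univ ℝ ℂ hbu

/-- The point masses cancel, so the difference is weakly harmonic across `a`; its harmonic
representative has zero boundary values, and the maximum principle applies to it and to its
negative. -/
theorem IsDirichletGreenFunction.eqOn {Ω : Set ℂ} {a : ℂ} {G G' : ℂ → ℝ} (hΩ : IsOpen Ω)
    (hb : Bornology.IsBounded Ω) (ha : a ∈ Ω) (h : IsDirichletGreenFunction Ω a G)
    (h' : IsDirichletGreenFunction Ω a G') : EqOn G G' (Ω \ {a}) := by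
  have hO : IsOpen (Ω \ {a}) := hΩ.sdiff isClosed_singleton
  have hset : ∀ (u : ℂ → ℝ) (φ : ℂ → ℝ), tsupport φ ⊆ Ω →
      ∫ z in Ω, u z * Laplacian.laplacian φ z = ∫ z, u z * Laplacian.laplacian φ z :=
    fun u φ hφs => setIntegral_eq_integral_of_forall_compl_eq_zero fun z hz => by
      rw [image_eq_zero_of_notMem_tsupport fun h => hz (hφs (tsupport_laplacian_subset φ h)),
        mul_zero]
  have hint : ∀ u : ℂ → ℝ, LocallyIntegrableOn u Ω → ∀ φ : ℂ → ℝ, ContDiff ℝ ∞ φ →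
      HasCompactSupport φ → tsupport φ ⊆ Ω →
      Integrable fun z => u z * Laplacian.laplacian φ z := fun u hu φ hφ hφc hφs => by
    have hs := tsupport_laplacian_subset φ
    refine (integrable_smul_of_tsupport_subset hu (contDiff_laplacian hφ).continuous
      (hφc.isCompact.of_isClosed_subset (isClosed_tsupport _) hs) (hs.trans hφs)).congr
      (ae_of_all _ fun z => ?_)
    simp [mul_comm]
  obtain ⟨p, hp, hps, hpe⟩ := exists_harmonicOnNhd_of_weaklyHarmonic hΩ
    (u := fun z => G z - G' z) (h.locallyIntegrableOn.sub h'.locallyIntegrableOn)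
    fun φ hφ hφc hφs => by
      simp only [sub_mul]
      rw [integral_sub (hint G h.locallyIntegrableOn φ hφ hφc hφs)
        (hint G' h'.locallyIntegrableOn φ hφ hφc hφs), ← hset G φ hφs, ← hset G' φ hφs,
        h.laplacian_eq φ hφ hφc hφs, h'.laplacian_eq φ hφ hφc hφs, sub_self]
  have heq : EqOn (fun z => G z - G' z) p (Ω \ {a}) :=
    Measure.eqOn_open_of_ae_eq (ae_restrict_of_ae_restrict_of_subset sdiff_subset hpe) hO
      (h.continuousOn.sub h'.continuousOn) (hps.continuousOn.mono sdiff_subset)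
  have hbd : ∀ x ∈ frontier Ω, Tendsto p (𝓝[Ω] x) (𝓝 0) := fun x hx => by
    have h1 := (h.boundary x hx).sub (h'.boundary x hx)
    rw [sub_zero] at h1
    refine h1.congr' ?_
    have hxa : x ≠ a := fun hxa => by
      rw [frontier, hΩ.interior_eq, hxa] at hx
      exact hx.2 ha
    filter_upwards [self_mem_nhdsWithin,
      mem_nhdsWithin_of_mem_nhds (isOpen_compl_singleton.mem_nhds hxa)] with z hz hza
      using heq ⟨hz, hza⟩
  intro z hz
  have h1 := HarmonicOnNhd.le_zero_of_tendsto_frontier hΩ hb hp hps.continuousOn hbd hz.1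
  have h2 := HarmonicOnNhd.le_zero_of_tendsto_frontier hΩ hb (p := -p) hp.neg
    hps.continuousOn.neg (fun x hx => by
      have := (hbd x hx).neg
      rwa [neg_zero] at this) hz.1
  have h3 := heq hz
  simp only [Pi.neg_apply] at h2
  simp only at h3
  linarith

end green

/-! ### The proposition. -/

theorem mainTheorem5 (Ω : Set ℂ) (hΩ : IsWeilPeterssonDomain Ω) (a : ℂ)
    (f : ℂ → ℂ) (hf : IsUniformization f Ω) (hfa : f 0 = a) :
    IsCanonicalHarmonicMap Ω (unitTangent Ω) a (frameU f) ∧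
    IsCanonicalHarmonicMap Ω (outwardNormal Ω) a (frameV f) ∧
    IsHarmonicMapToCircle (Ω \ {a}) (frameU f) ∧
    IsHarmonicMapToCircle (Ω \ {a}) (frameV f) ∧
    (∃ G, IsDirichletGreenFunction Ω a G) ∧
    ∀ G, IsDirichletGreenFunction Ω a G →
      (∀ z ∈ Ω \ {a}, HasFDerivAt (fun w => logConformalFactor f w + G w)
        (hodgeStar (cartanForm f) z) z) ∧
      HasWeakDeriv Ω (fun w => logConformalFactor f w + G w) (hodgeStar (cartanForm f)) := by
  obtain ⟨⟨F, -, hF⟩, f₀, hf₀, he₀⟩ := hΩ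
  obtain ⟨ψ, H⟩ := exists_isLogDeriv hf (HasFiniteEnergy.of_isUniformization he₀ hf₀ hf)
  have ha : a ∈ Ω := hfa ▸ hf.2.mapsTo zero_mem_unitDisk
  have hU : EqOn (frameU f) (phaseMap ψ (Real.pi / 2) ∘ discInv f) Ω := fun p hp => H.frameU_eq hp
  have hV : EqOn (frameV f) (phaseMap ψ 0 ∘ discInv f) Ω := fun p hp => H.frameV_eq hp
  have hharm : ∀ {w : ℂ → ℂ} {c : ℝ}, EqOn w (phaseMap ψ c ∘ discInv f) Ω →
      IsHarmonicMapToCircle (Ω \ {a}) w := fun hw =>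
    isHarmonicMapToCircle_of_fderiv_eq (hf.isOpen_diff a) (hf.differentiableOn_logSlope hfa)
      (fun _ hp => H.norm_frame hfa hw hp) (fun _ hp => H.hasFDerivAt_frame hfa hw hp)
      (H.contDiffOn_frame hfa hw)
  refine ⟨H.isCanonicalHarmonicMap hfa hU fun f₁ ψ₁ H₁ => H₁.ae_unitTangent_eq F hF,
    H.isCanonicalHarmonicMap hfa hV fun f₁ ψ₁ H₁ => ?_, hharm hU, hharm hV,
    ⟨_, hf.isDirichletGreenFunction hfa⟩, fun G hG => ?_⟩
  · filter_upwards [H₁.ae_outwardNormal_eq F hF] with θ hθ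
    rw [hθ, add_zero]
  obtain ⟨hd, hw⟩ := hf.hasWeakDeriv_logPotential_discInv hfa H.hasDerivAt
    H.continuousOn_logDeriv (fun p hp => H.hodgeStar_cartanForm hfa hp)
  have heq : EqOn (fun w => logConformalFactor f w + G w) (logPotential ψ ∘ discInv f)
      (Ω \ {a}) := fun p hp => by
    rw [Function.comp_apply, ← H.logConformalFactor_eq hp.1]
    -- Any Green function agrees with `log |f⁻¹|` off `a`; the boundedness needed here comes from
    -- the continuous extension of `f` to the closed disk.
    exact congrArg _ (hG.eqOn hf.isOpen H.isBounded ha (hf.isDirichletGreenFunction hfa) hp)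
  refine ⟨fun p hp => (hd p hp).congr_of_eventuallyEq
    (heq.eventuallyEq_of_mem ((hf.isOpen_diff a).mem_nhds hp)), hw.congr ?_ EventuallyEq.rfl⟩
  filter_upwards [ae_restrict_mem hf.isOpen.measurableSet,
    ae_restrict_of_ae (Measure.ae_ne volume a)] with p hp hpa
  exact (heq ⟨hp, hpa⟩).symm
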